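/- Let $\Omega$ be the category of finite sets and surjections. A right $\Omega$-module is a contravariant functor from $\Omega$ to (non-negatively graded) chain complexes over $\mathbb{Q}$. It is called formal if it is connected, by a finite zigzag of morphisms of right $\Omega$-modules each of which is a quasi-isomorphism on every finite set, to its homology regarded as a right $\Omega$-module with zero differential. For a pointed topological space $X$ let $X^{\wedge\bullet}$ be the contravariant functor on $\Omega$ that sends a finite set $A$ to the smash power $X^{\wedge A}$ (the quotient of $X^{A}$ by the subspace of points having at least one coordinate at the base point; $X^{\wedge\emptyset}=S^0$) and a surjection $A\to B$ to the induced diagonal map $X^{\wedge B}\to X^{\wedge A}$. Let $\widetilde{C}_*(-)=\widetilde{C}_*(-;\mathbb{Q})$ denote reduced singular chains with rational coefficients, so that $\widetilde{C}_*(X^{\wedge\bullet})$ is a right $\Omega$-module. (1) Let $X$ and $Y$ be well-pointed topological spaces, i.e. pointed spaces in which the inclusion of the base point has the homotopy extension property. If the right $\Omega$-modules $\widetilde{C}_*(X^{\wedge\bullet})$ and $\widetilde{C}_*(Y^{\wedge\bullet})$ are formal, then $\widetilde{C}_*((X\vee Y)^{\wedge\bullet})$ is formal. (2) For all integers $r\ge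 1$ and $m_1,\dots,m_r\ge 1$, the right $\Omega$-module $\widetilde{C}_*\big((\bigvee_{i=1}^r S^{m_i})^{\wedge\bullet};\mathbb{Q}\big)$ is formal. -/

import Mathlib

open CategoryTheory

universe u

/-! ### Pointed topological spaces -/

/-- A pointed topological space. -/
structure PtdTop : Type (u + 1) where
  /-- the underlying space -/
  space : TopCat.{u}
  /-- the base point -/
  pt : space

namespace PtdTop

/-- Base-point-preserving continuous maps. -/
@[ext]
structure Hom (X Y : PtdTop.{u}) : Type u where
  /-- the underlying continuous map -/
  map : X.space ⟶ Y.space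
  map_pt : map X.pt = Y.pt

instance : Category PtdTop.{u} where
  Hom X Y := Hom X Y
  id X := ⟨𝟙 X.space, rfl⟩
  comp f g := ⟨f.map ≫ g.map, by rw [TopCat.comp_app, f.map_pt, g.map_pt]⟩

@[ext]
theorem hom_ext {X Y : PtdTop.{u}} {f g : X ⟶ Y} (h : f.map = g.map) : f = g :=
  Hom.ext h

/-- The one-point space. -/
abbrev point : TopCat.{u} := TopCat.of PUnit.{u + 1}

@[simp]
theorem id_map (X : PtdTop.{u}) : Hom.map (𝟙 X) = 𝟙 X.space := rfl

@[simp]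
theorem comp_map {X Y Z : PtdTop.{u}} (f : X ⟶ Y) (g : Y ⟶ Z) :
    Hom.map (f ≫ g) = Hom.map f ≫ Hom.map g := rfl

/-- The inclusion of the base point. -/
def incl (X : PtdTop.{u}) : point.{u} ⟶ X.space :=
  TopCat.ofHom (ContinuousMap.const _ X.pt)

theorem incl_comp {X Y : PtdTop.{u}} (f : X ⟶ Y) : X.incl ≫ f.map = Y.incl := by
  ext x
  exact f.map_pt

/-- A pointed space is well-pointed if the inclusion of the base point has the homotopy
extension property: a map `f` on `X` together with a path starting at `f pt` extends to a homotopy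
of `f` that moves the base point along that path. -/
def WellPointed (X : PtdTop.{u}) : Prop :=
  ∀ (Z : Type u) [TopologicalSpace Z] (f : C(X.space, Z)) (γ : C(unitInterval, Z)),
    γ 0 = f X.pt →
      ∃ H : C(X.space × unitInterval, Z),
        (∀ x, H (x, 0) = f x) ∧ ∀ t, H (X.pt, t) = γ t

/-! ### Quotients, wedges and smash powers -/

/-- For a subset `S` of a space `Z`, the relation on `Z ⊔ {*}` that glues the points of `S`
to `*`. -/
def collapseRel {Z : Type u} (S : Set Z) (a b : Z ⊕ PUnit.{u + 1}) : Prop :=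
  ∃ s ∈ S, a = Sum.inl s ∧ b = Sum.inr PUnit.unit

/-- The pointed quotient space `Z / S`, that is `(Z ⊔ {*}) / (S ⊔ {*})`: the usual quotient, with
base point the class of `S`, when `S` is non-empty, and `Z` with a disjoint base point when `S` is
empty. -/
def collapse (Z : Type u) [TopologicalSpace Z] (S : Set Z) : PtdTop.{u} where
  space := TopCat.of (Quot (collapseRel S))
  pt := Quot.mk _ (Sum.inr PUnit.unit)

/-- The underlying function of the map `Z / S → Z' / S'` induced by a map of pairs. -/
def collapseFun {Z Z' : Type u} {S : Set Z} {S' : Set Z'} (f : Z → Z')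
    (hf : ∀ z ∈ S, f z ∈ S') : Quot (collapseRel S) → Quot (collapseRel S') :=
  Quot.map (Sum.map f id) (by
    rintro _ _ ⟨s, hs, rfl, rfl⟩
    exact ⟨f s, hf s hs, rfl, rfl⟩)

/-- The pointed map `Z / S → Z' / S'` induced by a continuous map of pairs. -/
def collapseMap {Z Z' : Type u} [TopologicalSpace Z] [TopologicalSpace Z'] {S : Set Z}
    {S' : Set Z'} (f : C(Z, Z')) (hf : ∀ z ∈ S, f z ∈ S') : collapse Z S ⟶ collapse Z' S' :=
  Hom.mk (X := collapse Z S) (Y := collapse Z' S')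
    (TopCat.ofHom ⟨collapseFun f hf,
      continuous_quot_lift _ (continuous_quot_mk.comp (f.continuous.sumMap continuous_id))⟩)
    rfl

/-- The wedge `X ∨ Y`. -/
def wedge (X Y : PtdTop.{u}) : PtdTop.{u} :=
  collapse (X.space ⊕ Y.space) {Sum.inl X.pt, Sum.inr Y.pt}

/-- The wedge `⋁ i, X i` of a family of pointed spaces. -/
def bigWedge {ι : Type u} (X : ι → PtdTop.{u}) : PtdTop.{u} :=
  collapse (Σ i, (X i).space) (Set.range fun i => ⟨i, (X i).pt⟩)

/-- The fat wedge: the points of `X ^ A` with at least one coordinate at the base point. -/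
def fatWedge (X : PtdTop.{u}) (A : Type) : Set (A → X.space) :=
  {x | ∃ a, x a = X.pt}

/-- The pointed sphere `S ^ m`, the unit sphere of `ℝ ^ (m + 1)`. -/
noncomputable def sphere (m : ℕ) : PtdTop.{0} where
  space := TopCat.of (Metric.sphere (0 : EuclideanSpace ℝ (Fin (m + 1))) 1)
  pt := ⟨EuclideanSpace.single 0 1, by simp⟩

end PtdTop

/-! ### Right modules over the category of finite sets and surjections -/

/-- The category `Ω` of finite sets and surjections. -/
structure FinSurj : Type 1 where
  /-- the underlying set -/
  carrier : Type
  [finite : Finite carrier]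

instance : Category FinSurj where
  Hom A B := {f : A.carrier → B.carrier // Function.Surjective f}
  id A := ⟨id, Function.surjective_id⟩
  comp f g := ⟨g.1 ∘ f.1, g.2.comp f.2⟩

/-- The right `Ω`-module of pointed spaces `X ^ ∧ •`: a finite set `A` goes to the smash power
`X ^ ∧ A`, the quotient of `X ^ A` by the fat wedge (so `X ^ ∧ ∅ = S ^ 0`), and a surjection
`A → B` goes to the diagonal map `X ^ ∧ B → X ^ ∧ A` induced by precomposition. -/
def PtdTop.smashPowers (X : PtdTop.{u}) : FinSurjᵒᵖ ⥤ PtdTop.{u} where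
  obj A := collapse (A.unop.carrier → X.space) (X.fatWedge A.unop.carrier)
  map {A B} g := collapseMap
    (⟨fun x => x ∘ g.unop.1, by fun_prop⟩ :
      C(A.unop.carrier → X.space, B.unop.carrier → X.space))
    (by
      rintro x ⟨a, ha⟩
      obtain ⟨b, rfl⟩ := g.unop.2 a
      exact ⟨b, ha⟩)
  map_id A := by
    ext x
    obtain ⟨(x | x), rfl⟩ := Quot.exists_rep x <;> rfl
  map_comp f g := by
    ext x
    obtain ⟨(x | x), rfl⟩ := Quot.exists_rep x <;> rfl

/-- Chain complexes over `ℚ`. -/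
abbrev RatChain : Type (u + 1) := ChainComplex (ModuleCat.{u} ℚ) ℕ

/-- Right `Ω`-modules: contravariant functors from `Ω` to chain complexes over `ℚ`. -/
abbrev RightOmegaModule : Type (u + 1) := FinSurjᵒᵖ ⥤ RatChain.{u}

/-- Singular chains with coefficients in `ℚ`. -/
noncomputable abbrev singularChains : TopCat.{u} ⥤ RatChain.{u} :=
  (AlgebraicTopology.singularChainComplexFunctor (ModuleCat.{u} ℚ)).obj
    (ModuleCat.of ℚ (ULift.{u} ℚ))

/-- For a functor `F` on spaces, the functor `X ↦ F(X) / F(pt)` on pointed spaces. -/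
noncomputable def reducedFunctor {C : Type*} [Category C] [Limits.HasZeroMorphisms C]
    [Limits.HasCokernels C] (F : TopCat.{u} ⥤ C) : PtdTop.{u} ⥤ C where
  obj X := Limits.cokernel (F.map X.incl)
  map {X Y} f := Limits.cokernel.map _ _ (𝟙 _) (F.map f.map) (by
    rw [Category.id_comp, ← Functor.map_comp, PtdTop.incl_comp])
  map_id X := by
    apply Limits.coequalizer.hom_ext
    simp [Limits.cokernel.map]
  map_comp f g := by
    apply Limits.coequalizer.hom_ext
    simp [Limits.cokernel.map]

/-- Reduced singular chains of a pointed space, `C_*(X) / C_*(pt)`. -/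
noncomputable def reducedChains : PtdTop.{u} ⥤ RatChain.{u} :=
  reducedFunctor singularChains

/-- The homology of a chain complex, as a chain complex with zero differential. -/
noncomputable def homologyComplex : RatChain.{u} ⥤ RatChain.{u} where
  obj K := { X := fun n => K.homology n, d := fun _ _ => 0 }
  map f := { f := fun n => HomologicalComplex.homologyMap f n }
  map_id K := by
    ext1 n
    exact HomologicalComplex.homologyMap_id K n
  map_comp f g := by
    ext1 n
    exact HomologicalComplex.homologyMap_comp f g n

namespace RightOmegaModule

/-- There is a morphism of right `Ω`-modules `M ⟶ N` that is a quasi-isomorphism for each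
finite set. -/
def HasQuasiIso (M N : RightOmegaModule.{u}) : Prop :=
  ∃ f : M ⟶ N, ∀ A, QuasiIso (f.app A)

/-- The homology of a right `Ω`-module, as a right `Ω`-module with zero differential. -/
noncomputable def homology (M : RightOmegaModule.{u}) : RightOmegaModule.{u} :=
  M ⋙ homologyComplex

/-- A right `Ω`-module is formal if it is connected to its homology by a zigzag of
quasi-isomorphisms of right `Ω`-modules. -/
def Formal (M : RightOmegaModule.{u}) : Prop :=
  Relation.EqvGen HasQuasiIso M M.homology

end RightOmegaModule

/-- The right `Ω`-module of chain complexes `C̃_*(X ^ ∧ •; ℚ)`. -/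
noncomputable def PtdTop.smashChains (X : PtdTop.{u}) : RightOmegaModule.{u} :=
  X.smashPowers ⋙ reducedChains

/-!
All the modules in question are replaced by combinatorial ones. A *simplicial pair* `S` is a
simplicial set with a distinguished simplicial subset, and its powers `S.tensorPowers` form a right
`Ω`-module in simplicial vector spaces: `A` is sent to the free vector space on `S ^ A` modulo the
tuples with a distinguished coordinate. The powers turn weak equivalences into weak equivalences
(`SPair.WeakEquiv.tensorPowersMap`), since levelwise tensor products of simplicial vector spaces do
(`SMod.WeakEquiv.tensor`). If the base point of `X` is closed and is a deformation retract of a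
neighbourhood (`GoodPair`), then small simplices and excision identify the chains on the smash powers
of `X` with the powers of the singular pair of `X`, so that formality of the former can be tested on
the latter (`PtdTop.formal_smashChains_iff`). More generally, the pair `(Z, S)` may be used in place
of the quotient `Z / S` (`PtdTop.isFormal_collapse_iff`).

*Wedges.* A wedge is a quotient of a disjoint union, and the powers of a disjoint union of simplicial
pairs are the convolution product of the powers: a tuple in `(S ⊔ T) ^ A` decomposes `A` into the
coordinates in `S` and those in `T` (`SPair.hasWeakEquiv_coprod`). It remains to see that the
convolution product `M ⊛ N` of formal modules is formal (`OmegaSMod.formal_conv`). Homology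
modules are graded rather than simplicial, so formality of `M` is first brought into a simplicial
form: by the Dold–Kan correspondence, it provides a zigzag of weak equivalences between `M` and a *split* module `⨁ p, E p ⊗ V p`, where the simplicial vector spaces `E p` have
one-dimensional homology in degree `p` and the functors `V p` carry the action of the surjections
(`OmegaSMod.eqvGen_split`). Convolution products of split modules are split, and split modules are
formal, because the differentials of the `E p` have generalized inverses, which are automatically
natural in the finite set (`OmegaSMod.split.formal`).

A well-pointed space need not have a closed base point. It is pointed homotopy equivalent to the
space with a whisker attached at the base point (`PtdTop.WellPointed.pairHomotopyEquiv_whiskerProj`),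
whose base point is good (`PtdTop.goodPair_whisker`), and both the smash powers and the wedge respect
these equivalences.

*Spheres.* The powers of the simplicial circle `(Δ¹, ∂Δ¹)` have homology only in degree `|A|`,
spanned by the fundamental cycle of the cube, and this class is detected by a determinant. The
determinants are functionals compatible with all surjections, and their common kernel is a
submodule whose quotient has zero differential and the same homology; hence the simplicial circle is
formal (`interval.formal`). Restriction along `A ↦ A × B` then shows the same for its powers
(`SPair.IsFormal.pow`), hence for the cubes modulo their boundaries (`PtdTop.isFormal_cube`), which
are homeomorphic to spheres (`PtdTop.exists_homeomorph_cube_sphere`). Finite wedges of spheres follow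
by splitting off one summand at a time (`PtdTop.formal_bigWedge`).
-/

/-! ### Chains of tuples, cones and barycentric subdivision -/

section

/-- Rational linear combinations of `q`-tuples of points, thought of as affine simplices of dimension
`q - 1`. -/
abbrev TupleChain (V : Type*) (q : ℕ) : Type _ := (Fin q → V) →₀ ℚ

namespace TupleChain

variable {V W : Type*}

/-- The tuple `v` as a chain. -/
noncomputable abbrev of {q : ℕ} (v : Fin q → V) : TupleChain V q := Finsupp.single v 1

/-- The linear map with given values on tuples. -/
noncomputable def extend {q : ℕ} {M : Type*} [AddCommGroup M] [Module ℚ M] (f : (Fin q → V) → M) :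
    TupleChain V q →ₗ[ℚ] M := Finsupp.lift M ℚ _ f

theorem extend_of {q : ℕ} {M : Type*} [AddCommGroup M] [Module ℚ M] (f : (Fin q → V) → M)
    (v : Fin q → V) : extend f (of v) = f v := by simp [extend, of]

theorem hom_ext {q : ℕ} {M : Type*} [AddCommGroup M] [Module ℚ M]
    {f g : TupleChain V q →ₗ[ℚ] M} (h : ∀ v, f (of v) = g (of v)) : f = g :=
  Finsupp.lhom_ext' fun v => LinearMap.ext_ring (h v)

/-- The boundary of the augmented chain complex of tuples. -/
noncomputable def bd (q : ℕ) : TupleChain V (q + 1) →ₗ[ℚ] TupleChain V q :=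
  extend fun v => ∑ i : Fin (q + 1), (-1 : ℚ) ^ (i : ℕ) • of (v ∘ i.succAbove)

/-- The cone with apex `b`. -/
noncomputable def cone (b : V) (q : ℕ) : TupleChain V q →ₗ[ℚ] TupleChain V (q + 1) :=
  extend fun v => of (Fin.cons b v : Fin (q + 1) → V)

theorem bd_cone_succ (b : V) (q : ℕ) (c : TupleChain V (q + 1)) :
    bd (q + 1) (cone b (q + 1) c) = c - cone b q (bd q c) := by
  refine LinearMap.congr_fun (f := bd (q + 1) ∘ₗ cone b (q + 1))
    (g := LinearMap.id - cone b q ∘ₗ bd q) (hom_ext fun v => ?_) c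
  simp only [LinearMap.comp_apply, LinearMap.sub_apply, LinearMap.id_apply]
  rw [cone, extend_of, bd, extend_of, bd, extend_of, map_sum, Fin.sum_univ_succ, sub_eq_add_neg,
    ← Finset.sum_neg_distrib]
  refine congr_arg₂ (· + ·) ?_ (Finset.sum_congr rfl fun i _ => ?_)
  · rw [Fin.val_zero, pow_zero, one_smul]
    rfl
  · rw [map_smul, cone, extend_of, Fin.val_succ, pow_succ, mul_neg_one, neg_smul]
    congr 3
    funext j
    refine Fin.cases ?_ (fun j => ?_) j
    · simp
    · simp [Fin.succ_succAbove_succ]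

theorem bd_cone_zero (b : V) (c : TupleChain V 0) : bd 0 (cone b 0 c) = c := by
  refine LinearMap.congr_fun (f := bd 0 ∘ₗ cone b 0) (g := LinearMap.id) (hom_ext fun v => ?_) c
  rw [LinearMap.comp_apply, cone, extend_of, bd, extend_of]
  rw [Fin.sum_univ_succ]
  simp only [Fin.val_zero, pow_zero, one_smul, Finset.univ_eq_empty, Finset.sum_empty, add_zero]
  exact congr_arg of (Subsingleton.elim _ _)

theorem of_eq_cone {q : ℕ} (v : Fin (q + 1) → V) : of v = cone (v 0) q (of (v ∘ Fin.succ)) := by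
  rw [cone, extend_of]
  congr 1
  exact (Fin.cons_self_tail v).symm

theorem bd_bd (q : ℕ) (c : TupleChain V (q + 2)) : bd q (bd (q + 1) c) = 0 := by
  induction q with
  | zero =>
    refine LinearMap.congr_fun (f := bd 0 ∘ₗ bd 1) (g := 0) (hom_ext fun v => ?_) c
    rw [LinearMap.comp_apply, of_eq_cone, bd_cone_succ, map_sub, bd_cone_zero, sub_self]
    rfl
  | succ q ih =>
    refine LinearMap.congr_fun (f := bd (q + 1) ∘ₗ bd (q + 2)) (g := 0) (hom_ext fun v => ?_) c
    rw [LinearMap.comp_apply, of_eq_cone, bd_cone_succ, map_sub, bd_cone_succ, ih, map_zero,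
      sub_zero, sub_self]
    rfl

/-- Barycentric subdivision, with respect to a choice `β` of barycenters. -/
noncomputable def sd (β : ∀ q, (Fin (q + 1) → V) → V) : ∀ q, TupleChain V q →ₗ[ℚ] TupleChain V q
  | 0 => LinearMap.id
  | q + 1 => extend fun v => cone (β q v) q (sd β q (bd q (of v)))

/-- The chain homotopy between the identity and barycentric subdivision. -/
noncomputable def sdHomotopy (β : ∀ q, (Fin (q + 1) → V) → V) :
    ∀ q, TupleChain V q →ₗ[ℚ] TupleChain V (q + 1)
  | 0 => 0
  | q + 1 => extend fun v => cone (β q v) (q + 1) (of v - sdHomotopy β q (bd q (of v)))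

variable (β : ∀ q, (Fin (q + 1) → V) → V)

theorem sd_of {q : ℕ} (v : Fin (q + 1) → V) :
    sd β (q + 1) (of v) = cone (β q v) q (sd β q (bd q (of v))) := extend_of _ _

theorem sdHomotopy_of {q : ℕ} (v : Fin (q + 1) → V) :
    sdHomotopy β (q + 1) (of v) = cone (β q v) (q + 1) (of v - sdHomotopy β q (bd q (of v))) :=
  extend_of _ _

theorem bd_sdHomotopy (q : ℕ) (c : TupleChain V (q + 1)) :
    bd (q + 1) (sdHomotopy β (q + 1) c) = c - sd β (q + 1) c - sdHomotopy β q (bd q c) := by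
  induction q with
  | zero =>
    refine LinearMap.congr_fun (f := bd 1 ∘ₗ sdHomotopy β 1)
      (g := LinearMap.id - sd β 1 - sdHomotopy β 0 ∘ₗ bd 0) (hom_ext fun v => ?_) c
    simp only [LinearMap.comp_apply, LinearMap.sub_apply, LinearMap.id_apply]
    rw [sdHomotopy_of, bd_cone_succ, sd_of, map_sub]
    simp [sdHomotopy, sd]
  | succ q ih =>
    refine LinearMap.congr_fun (f := bd (q + 2) ∘ₗ sdHomotopy β (q + 2))
      (g := LinearMap.id - sd β (q + 2) - sdHomotopy β (q + 1) ∘ₗ bd (q + 1))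
      (hom_ext fun v => ?_) c
    simp only [LinearMap.comp_apply, LinearMap.sub_apply, LinearMap.id_apply]
    rw [sdHomotopy_of, bd_cone_succ, map_sub (bd (q + 1)), ih, bd_bd, map_zero, sub_zero, sd_of,
      sub_sub_cancel]
    abel

/-- The functoriality of chains of tuples. -/
noncomputable def map (φ : V → W) (q : ℕ) : TupleChain V q →ₗ[ℚ] TupleChain W q :=
  extend fun v => of (φ ∘ v)

theorem map_of (φ : V → W) {q : ℕ} (v : Fin q → V) : map φ q (of v) = of (φ ∘ v) := extend_of _ _

theorem map_bd (φ : V → W) (q : ℕ) (c : TupleChain V (q + 1)) :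
    map φ q (bd q c) = bd q (map φ (q + 1) c) := by
  refine LinearMap.congr_fun (f := map φ q ∘ₗ bd q) (g := bd q ∘ₗ map φ (q + 1))
    (hom_ext fun v => ?_) c
  rw [LinearMap.comp_apply, LinearMap.comp_apply, map_of, bd, extend_of, bd, extend_of, map_sum]
  refine Finset.sum_congr rfl fun i _ => ?_
  rw [map_smul, map_of]
  rfl

theorem map_cone (φ : V → W) (b : V) (q : ℕ) (c : TupleChain V q) :
    map φ (q + 1) (cone b q c) = cone (φ b) q (map φ q c) := by
  refine LinearMap.congr_fun (f := map φ (q + 1) ∘ₗ cone b q) (g := cone (φ b) q ∘ₗ map φ q)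
    (hom_ext fun v => ?_) c
  rw [LinearMap.comp_apply, LinearMap.comp_apply, map_of, cone, extend_of, cone, extend_of, map_of]
  congr 1
  exact Fin.comp_cons φ b v

variable {β} {γ : ∀ q, (Fin (q + 1) → W) → W} {φ : V → W}

theorem map_sd (h : ∀ q v, φ (β q v) = γ q (φ ∘ v)) (q : ℕ) (c : TupleChain V q) :
    map φ q (sd β q c) = sd γ q (map φ q c) := by
  induction q with
  | zero => rfl
  | succ q ih =>
    refine LinearMap.congr_fun (f := map φ (q + 1) ∘ₗ sd β (q + 1))
      (g := sd γ (q + 1) ∘ₗ map φ (q + 1)) (hom_ext fun v => ?_) c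
    rw [LinearMap.comp_apply, LinearMap.comp_apply, sd_of, map_cone, ih, map_bd, map_of, sd_of, h]

theorem map_sdHomotopy (h : ∀ q v, φ (β q v) = γ q (φ ∘ v)) (q : ℕ) (c : TupleChain V q) :
    map φ (q + 1) (sdHomotopy β q c) = sdHomotopy γ q (map φ q c) := by
  induction q with
  | zero => exact map_zero _
  | succ q ih =>
    refine LinearMap.congr_fun (f := map φ (q + 2) ∘ₗ sdHomotopy β (q + 1))
      (g := sdHomotopy γ (q + 1) ∘ₗ map φ (q + 1)) (hom_ext fun v => ?_) c
    rw [LinearMap.comp_apply, LinearMap.comp_apply, sdHomotopy_of, map_cone, map_sub, ih, map_bd,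
      map_of, sdHomotopy_of, h]

theorem exists_mem_support {q r : ℕ} (f : TupleChain V q →ₗ[ℚ] TupleChain W r)
    {c : TupleChain V q} {w : Fin r → W} (h : w ∈ (f c).support) :
    ∃ v ∈ c.support, w ∈ (f (of v)).support := by
  by_contra! H
  rw [Finsupp.mem_support_iff] at h
  apply h
  rw [← Finsupp.sum_single c, Finsupp.sum, map_sum, Finsupp.finsetSum_apply]
  refine Finset.sum_eq_zero fun v hv => ?_
  have : Finsupp.single v (c v) = c v • of v := by simp [of]
  rw [this, map_smul, Finsupp.smul_apply, Finsupp.notMem_support_iff.1 (H v hv), smul_zero]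

theorem exists_of_mem_support_cone {b : V} {q : ℕ} {c : TupleChain V q} {w : Fin (q + 1) → V}
    (h : w ∈ (cone b q c).support) : ∃ v ∈ c.support, w = Fin.cons b v := by
  obtain ⟨v, hv, h⟩ := exists_mem_support _ h
  rw [cone, extend_of] at h
  exact ⟨v, hv, Finset.mem_singleton.1 (Finsupp.support_single_subset h)⟩

theorem exists_of_mem_support_bd {q : ℕ} {v : Fin (q + 1) → V} {w : Fin q → V}
    (h : w ∈ (bd q (of v)).support) : ∃ i : Fin (q + 1), w = v ∘ i.succAbove := by
  by_contra! H
  rw [Finsupp.mem_support_iff, bd, extend_of, Finsupp.finsetSum_apply] at h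
  refine h (Finset.sum_eq_zero fun i _ => ?_)
  rw [Finsupp.smul_apply, Finsupp.single_eq_of_ne (H i), smul_zero]

section Metric

variable [PseudoMetricSpace V]

/-- Barycenters satisfy the convexity property of distances in a normed space. -/
def IsConvex (β : ∀ q, (Fin (q + 1) → V) → V) : Prop :=
  ∀ (q : ℕ) (v : Fin (q + 1) → V) (x : V), (q + 1) * dist x (β q v) ≤ ∑ i, dist x (v i)

theorem IsConvex.dist_le (hβ : IsConvex β) {q : ℕ} {v : Fin (q + 1) → V} {x : V} {R : ℝ}
    (h : ∀ i, dist x (v i) ≤ R) : dist x (β q v) ≤ R := by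
  have h1 := (hβ q v x).trans (Finset.sum_le_sum fun i _ => h i)
  simp only [Finset.sum_const, Finset.card_univ, Fintype.card_fin, nsmul_eq_mul] at h1
  push_cast at h1
  exact le_of_mul_le_mul_left h1 (by positivity)

theorem IsConvex.dist_apply_le (hβ : IsConvex β) {q : ℕ} {v : Fin (q + 1) → V} {D : ℝ}
    (h : ∀ i j, dist (v i) (v j) ≤ D) (j : Fin (q + 1)) : (q + 1) * dist (v j) (β q v) ≤ q * D := by
  refine (hβ q v (v j)).trans ?_
  rw [← Finset.add_sum_erase _ _ (Finset.mem_univ j), dist_self, zero_add]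
  refine (Finset.sum_le_sum fun i _ => h j i).trans ?_
  simp [Finset.card_erase_of_mem]

/-- The points of the simplices of the subdivision lie in every closed ball which contains the
vertices. -/
theorem dist_le_of_mem_support_sd (hβ : IsConvex β) {q : ℕ} {v w : Fin q → V}
    (hw : w ∈ (sd β q (of v)).support) {x : V} {R : ℝ} (h : ∀ i, dist x (v i) ≤ R) (i : Fin q) :
    dist x (w i) ≤ R := by
  induction q with
  | zero => exact i.elim0
  | succ q ih =>
    rw [sd_of] at hw
    obtain ⟨w, hw', rfl⟩ := exists_of_mem_support_cone hw
    obtain ⟨v', hv', hw⟩ := exists_mem_support (sd β q) hw'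
    obtain ⟨k, rfl⟩ := exists_of_mem_support_bd hv'
    refine Fin.cases (hβ.dist_le h) (fun i => ?_) i
    exact ih hw (fun j => h _) i

theorem diam_le_of_mem_support_sd (hβ : IsConvex β) {N q : ℕ} (hq : q ≤ N + 1) {v w : Fin q → V}
    (hw : w ∈ (sd β q (of v)).support) {D : ℝ} (hD : 0 ≤ D) (h : ∀ i j, dist (v i) (v j) ≤ D)
    (i j : Fin q) : dist (w i) (w j) ≤ N / (N + 1) * D := by
  induction q with
  | zero => exact i.elim0
  | succ q ih =>
    rw [sd_of] at hw
    obtain ⟨w, hw', rfl⟩ := exists_of_mem_support_cone hw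
    obtain ⟨v', hv', hw⟩ := exists_mem_support (sd β q) hw'
    obtain ⟨k, rfl⟩ := exists_of_mem_support_bd hv'
    have hb : ∀ j, dist (β q v) (v j) ≤ N / (N + 1) * D := fun j => by
      have h1 := hβ.dist_apply_le h j
      rw [dist_comm] at h1
      have hqN : (q : ℝ) ≤ N := by exact_mod_cast Nat.le_of_succ_le_succ hq
      have h2 : dist (β q v) (v j) ≤ q / (q + 1) * D := by
        rw [div_mul_eq_mul_div, le_div_iff₀ (by positivity)]
        linarith
      refine h2.trans (mul_le_mul_of_nonneg_right ?_ hD)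
      rw [div_le_div_iff₀ (by positivity) (by positivity)]
      nlinarith
    have hbw : ∀ i, dist (β q v) (w i) ≤ N / (N + 1) * D :=
      dist_le_of_mem_support_sd hβ hw fun i => hb _
    refine Fin.cases (Fin.cases ?_ (fun j => ?_) j) (fun i => Fin.cases ?_ (fun j => ?_) j) i
    · simp only [Fin.cons_zero, dist_self]
      positivity
    · exact hbw j
    · rw [dist_comm]
      exact hbw i
    · exact ih (by omega) hw (fun _ _ => h _ _) i j

/-- Iterated subdivision makes the simplices arbitrarily small. -/
theorem diam_le_of_mem_support_iterate (hβ : IsConvex β) {q : ℕ} {v : Fin (q + 1) → V} {D : ℝ}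
    (hD : 0 ≤ D) (h : ∀ i j, dist (v i) (v j) ≤ D) (k : ℕ) {w : Fin (q + 1) → V}
    (hw : w ∈ ((sd β (q + 1) ^ k) (of v)).support) (i j : Fin (q + 1)) :
    dist (w i) (w j) ≤ ((q : ℝ) / (q + 1)) ^ k * D := by
  induction k generalizing w i j with
  | zero =>
    obtain rfl := Finset.mem_singleton.1 (Finsupp.support_single_subset hw)
    simpa using h i j
  | succ k ih =>
    rw [pow_succ', Module.End.mul_apply] at hw
    obtain ⟨v', hv', hw⟩ := exists_mem_support (sd β (q + 1)) hw
    rw [pow_succ', mul_assoc]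
    exact diam_le_of_mem_support_sd hβ le_rfl hw (by positivity) (fun i j => ih hv' i j) i j

end Metric

end TupleChain

end

/-! ### Affine maps of standard simplices -/

section

namespace AffineSimplex

variable {ι κ μ : Type*} [Fintype ι] [Fintype κ] [Fintype μ]

/-- The affine map between standard simplices with given values on the vertices. -/
noncomputable def aff (v : ι → stdSimplex ℝ κ) : C(stdSimplex ℝ ι, stdSimplex ℝ κ) where
  toFun t := ⟨fun k => ∑ i, t i * v i k, fun k => Finset.sum_nonneg fun i _ =>
    mul_nonneg (t.2.1 i) ((v i).2.1 k), by
      rw [Finset.sum_comm]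
      simp only [← Finset.mul_sum, stdSimplex.sum_eq_one, mul_one]⟩
  continuous_toFun := by
    refine Continuous.subtype_mk (continuous_pi fun k => continuous_finsetSum _ fun i _ =>
      Continuous.mul ?_ continuous_const) _
    exact (continuous_apply i).comp continuous_subtype_val

theorem aff_apply (v : ι → stdSimplex ℝ κ) (t : stdSimplex ℝ ι) (k : κ) :
    aff v t k = ∑ i, t i * v i k := rfl

theorem aff_vertex [DecidableEq ι] (t : stdSimplex ℝ ι) : aff (fun i => stdSimplex.vertex i) t = t := by
  ext k
  change ∑ i, t i * (Pi.single i (1 : ℝ) : ι → ℝ) k = t k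
  simp [Pi.single_apply]

theorem aff_map (v : κ → stdSimplex ℝ μ) (f : ι → κ) (t : stdSimplex ℝ ι) :
    aff v (stdSimplex.map f t) = aff (v ∘ f) t := by
  classical
  ext m
  rw [aff_apply, aff_apply]
  simp only [stdSimplex.map_coe, FunOnFinite.linearMap_apply_apply, Finset.sum_mul]
  rw [← Finset.sum_fiberwise Finset.univ f]
  refine Finset.sum_congr rfl fun k _ => Finset.sum_congr (by ext; simp) fun i hi => ?_
  rw [Function.comp_apply, (Finset.mem_filter.1 hi).2]

theorem aff_aff (v : κ → stdSimplex ℝ μ) (w : ι → stdSimplex ℝ κ) (t : stdSimplex ℝ ι) :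
    aff v (aff w t) = aff (aff v ∘ w) t := by
  ext m
  simp only [aff_apply, Function.comp_apply, Finset.sum_mul, Finset.mul_sum]
  rw [Finset.sum_comm]
  exact Finset.sum_congr rfl fun i _ => Finset.sum_congr rfl fun j _ => by ring

theorem aff_comp_vertex [DecidableEq ι] (v : ι → stdSimplex ℝ κ) :
    aff v ∘ (fun i => stdSimplex.vertex i) = v := by
  funext i
  ext k
  change ∑ j, (Pi.single i (1 : ℝ) : ι → ℝ) j * v j k = v i k
  simp [Pi.single_apply]

/-- The barycenter of a tuple of points. -/
noncomputable def bary (q : ℕ) (v : Fin (q + 1) → stdSimplex ℝ κ) : stdSimplex ℝ κ :=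
  aff v stdSimplex.barycenter

theorem aff_bary (v : κ → stdSimplex ℝ μ) (q : ℕ) (w : Fin (q + 1) → stdSimplex ℝ κ) :
    aff v (bary q w) = bary q (aff v ∘ w) := aff_aff _ _ _

theorem dist_aff_le (v : ι → stdSimplex ℝ κ) (t : stdSimplex ℝ ι) (x : stdSimplex ℝ κ) :
    dist x (aff v t) ≤ ∑ i, t i * dist x (v i) := by
  rw [Subtype.dist_eq, dist_pi_le_iff (Finset.sum_nonneg fun i _ =>
    mul_nonneg (stdSimplex.zero_le t i) dist_nonneg)]
  intro k
  have h1 : x k - aff v t k = ∑ i, t i * (x k - v i k) := by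
    simp only [mul_sub, Finset.sum_sub_distrib, ← Finset.sum_mul, stdSimplex.sum_eq_one, one_mul]
    rfl
  rw [Real.dist_eq]
  change |x k - aff v t k| ≤ _
  rw [h1]
  refine (Finset.abs_sum_le_sum_abs _ _).trans (Finset.sum_le_sum fun i _ => ?_)
  rw [abs_mul, abs_of_nonneg (stdSimplex.zero_le t i)]
  refine mul_le_mul_of_nonneg_left ?_ (stdSimplex.zero_le t i)
  exact (Real.dist_eq _ _).symm.le.trans (dist_le_pi_dist (x : κ → ℝ) (v i : κ → ℝ) k)

theorem dist_aff_le_of_forall {v : ι → stdSimplex ℝ κ} {x : stdSimplex ℝ κ} {R : ℝ}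
    (h : ∀ i, dist x (v i) ≤ R) (t : stdSimplex ℝ ι) : dist x (aff v t) ≤ R := by
  refine (dist_aff_le v t x).trans ((Finset.sum_le_sum fun i _ =>
    mul_le_mul_of_nonneg_left (h i) (stdSimplex.zero_le t i)).trans ?_)
  rw [← Finset.sum_mul, stdSimplex.sum_eq_one, one_mul]

theorem dist_aff_aff_le {v : ι → stdSimplex ℝ κ} {D : ℝ} (h : ∀ i j, dist (v i) (v j) ≤ D)
    (s t : stdSimplex ℝ ι) : dist (aff v s) (aff v t) ≤ D := by
  refine dist_aff_le_of_forall (fun i => ?_) t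
  rw [dist_comm]
  exact dist_aff_le_of_forall (h i) s

theorem isConvex_bary : TupleChain.IsConvex (bary (κ := κ)) := fun q v x => by
  refine (mul_le_mul_of_nonneg_left (dist_aff_le v _ x) (by positivity)).trans_eq ?_
  rw [Finset.mul_sum]
  refine Finset.sum_congr rfl fun i _ => ?_
  change ((q : ℝ) + 1) * ((Fintype.card (Fin (q + 1)) : ℝ)⁻¹ * _) = _
  rw [Fintype.card_fin, ← mul_assoc, Nat.cast_add_one, mul_inv_cancel₀ (by positivity), one_mul]

end AffineSimplex

end

/-! ### Cycles, quasi-isomorphisms and formality -/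

section

open Limits HomologicalComplex

namespace RatChain

/-- A chain is a cycle. -/
def IsCycle (K : RatChain.{u}) (n : ℕ) (x : K.X n) : Prop := ∀ m, K.d n m x = 0

theorem isCycle_zero (K : RatChain.{u}) (x : K.X 0) : IsCycle K 0 x := fun m => by
  rw [K.shape 0 m (by simp)]; rfl

theorem isCycle_succ_iff (K : RatChain.{u}) (n : ℕ) (x : K.X (n + 1)) :
    IsCycle K (n + 1) x ↔ K.d (n + 1) n x = 0 := by
  refine ⟨fun h => h n, fun h m => ?_⟩
  by_cases hm : m = n
  · subst hm; exact h
  · rw [K.shape _ m (by simp; omega)]; rfl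

theorem d_d_apply (K : RatChain.{u}) (i j k : ℕ) (x : K.X i) : K.d j k (K.d i j x) = 0 := by
  rw [← ModuleCat.comp_apply, K.d_comp_d]; rfl

theorem isCycle_d (K : RatChain.{u}) (i n : ℕ) (x : K.X i) : IsCycle K n (K.d i n x) :=
  fun _ => d_d_apply K _ _ _ x

theorem comm_apply {K L : RatChain.{u}} (f : K ⟶ L) (i j : ℕ) (x : K.X i) :
    L.d i j (f.f i x) = f.f j (K.d i j x) := by
  rw [← ModuleCat.comp_apply, ← ModuleCat.comp_apply, f.comm]

theorem IsCycle.map {K L : RatChain.{u}} (f : K ⟶ L) {n : ℕ} {x : K.X n} (h : IsCycle K n x) :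
    IsCycle L n (f.f n x) := fun m => by rw [comm_apply, h m, map_zero]

theorem exists_iCycles (K : RatChain.{u}) (n : ℕ) (x : K.X n) (h : IsCycle K n x) :
    ∃ z : K.cycles n, K.iCycles n z = x := by
  have hex : (ShortComplex.mk (K.iCycles n) (K.d n ((ComplexShape.down ℕ).next n))
      (K.iCycles_d _ _)).Exact :=
    ShortComplex.exact_of_f_is_kernel _ (K.cyclesIsKernel n _ rfl)
  rw [ShortComplex.moduleCat_exact_iff] at hex
  exact hex x (h _)

theorem homologyπ_eq_zero_iff (K : RatChain.{u}) (n : ℕ) (z : K.cycles n) :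
    K.homologyπ n z = 0 ↔ ∃ y : K.X (n + 1), K.d (n + 1) n y = K.iCycles n z := by
  have hex : (ShortComplex.mk (K.toCycles (n + 1) n) (K.homologyπ n)
      (K.toCycles_comp_homologyπ _ _)).Exact :=
    ShortComplex.exact_of_g_is_cokernel _ (K.homologyIsCokernel (n + 1) n (by simp))
  rw [ShortComplex.moduleCat_exact_iff] at hex
  constructor
  · intro h
    obtain ⟨y, hy⟩ := hex z h
    refine ⟨y, ?_⟩
    rw [← hy]
    change _ = (K.toCycles (n + 1) n ≫ K.iCycles n) y
    rw [K.toCycles_i]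
  · rintro ⟨y, hy⟩
    have : K.toCycles (n + 1) n y = z := by
      apply (ModuleCat.mono_iff_injective (K.iCycles n)).1 inferInstance
      rw [← hy]
      change (K.toCycles (n + 1) n ≫ K.iCycles n) y = _
      rw [K.toCycles_i]
    rw [← this]
    change (K.toCycles (n + 1) n ≫ K.homologyπ n) y = _
    rw [K.toCycles_comp_homologyπ]; rfl

theorem homologyπ_surjective (K : RatChain.{u}) (n : ℕ) :
    Function.Surjective (K.homologyπ n) :=
  (ModuleCat.epi_iff_surjective _).1 inferInstance

theorem homologyMap_π {K L : RatChain.{u}} (f : K ⟶ L) (n : ℕ) (z : K.cycles n) :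
    homologyMap f n (K.homologyπ n z) = L.homologyπ n (cyclesMap f n z) := by
  change (K.homologyπ n ≫ homologyMap f n) z = (cyclesMap f n ≫ L.homologyπ n) z
  rw [homologyπ_naturality]

theorem iCycles_map {K L : RatChain.{u}} (f : K ⟶ L) (n : ℕ) (z : K.cycles n) :
    L.iCycles n (cyclesMap f n z) = f.f n (K.iCycles n z) := by
  change (cyclesMap f n ≫ L.iCycles n) z = (K.iCycles n ≫ f.f n) z
  rw [cyclesMap_i]

theorem isCycle_iCycles (K : RatChain.{u}) (n : ℕ) (z : K.cycles n) :
    IsCycle K n (K.iCycles n z) := fun m => by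
  change (K.iCycles n ≫ K.d n m) z = 0
  rw [K.iCycles_d]; rfl

/-- Quasi-isomorphisms in terms of cycles and boundaries. -/
theorem quasiIso_iff_cycles {K L : RatChain.{u}} (f : K ⟶ L) :
    QuasiIso f ↔ ∀ n,
      (∀ x, IsCycle K n x → (∃ y, L.d (n + 1) n y = f.f n x) → ∃ y, K.d (n + 1) n y = x) ∧
      (∀ x, IsCycle L n x → ∃ z y, IsCycle K n z ∧ x = f.f n z + L.d (n + 1) n y) := by
  rw [_root_.quasiIso_iff]
  refine forall_congr' fun n => ?_
  rw [quasiIsoAt_iff_isIso_homologyMap, ConcreteCategory.isIso_iff_bijective]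
  refine and_congr ?_ ?_
  · rw [injective_iff_map_eq_zero (homologyMap f n).hom]
    constructor
    · intro h x hx hy
      obtain ⟨z, rfl⟩ := exists_iCycles K n x hx
      rw [← homologyπ_eq_zero_iff]
      apply h
      erw [homologyMap_π]
      rw [homologyπ_eq_zero_iff]
      rw [iCycles_map]
      exact hy
    · intro h a ha
      obtain ⟨z, rfl⟩ := homologyπ_surjective K n a
      erw [homologyMap_π] at ha
      rw [homologyπ_eq_zero_iff] at ha
      rw [homologyπ_eq_zero_iff]
      rw [iCycles_map] at ha
      exact h _ (isCycle_iCycles _ _ _) ha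
  · constructor
    · intro h x hx
      obtain ⟨z, rfl⟩ := exists_iCycles L n x hx
      obtain ⟨b, hb⟩ := h (L.homologyπ n z)
      obtain ⟨w, rfl⟩ := homologyπ_surjective K n b
      erw [homologyMap_π] at hb
      have : L.homologyπ n (z - cyclesMap f n w) = 0 := by
        rw [map_sub, sub_eq_zero]; exact hb.symm
      rw [homologyπ_eq_zero_iff] at this
      obtain ⟨y, hy⟩ := this
      refine ⟨K.iCycles n w, y, isCycle_iCycles _ _ _, ?_⟩
      rw [hy, map_sub, iCycles_map]; abel
    · intro h a
      obtain ⟨z, rfl⟩ := homologyπ_surjective L n a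
      obtain ⟨w, y, hw, e⟩ := h _ (isCycle_iCycles _ _ z)
      obtain ⟨w, rfl⟩ := exists_iCycles K n w hw
      refine ⟨K.homologyπ n w, ?_⟩
      erw [homologyMap_π]
      rw [← sub_eq_zero, ← map_sub, homologyπ_eq_zero_iff]
      refine ⟨-y, ?_⟩
      rw [map_neg, map_sub, iCycles_map, e]; abel

/-- Exactness in every degree, in terms of elements. -/
def Acyclic (K : RatChain.{u}) : Prop := ∀ n x, IsCycle K n x → ∃ y, K.d (n + 1) n y = x

end RatChain

end

section

open Limits HomologicalComplex

namespace RatChain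

/-- Exactness in one degree. -/
def AcyclicAt (K : RatChain.{u}) (n : ℕ) : Prop :=
  ∀ x, IsCycle K n x → ∃ y, K.d (n + 1) n y = x

/-- A degreewise short exact sequence of complexes. -/
structure IsShortExact {K L M : RatChain.{u}} (f : K ⟶ L) (g : L ⟶ M) : Prop where
  inj : ∀ n, Function.Injective (f.f n)
  surj : ∀ n, Function.Surjective (g.f n)
  comp : ∀ n x, g.f n (f.f n x) = 0
  exact : ∀ n y, g.f n y = 0 → ∃ x, f.f n x = y

namespace IsShortExact

variable {K L M : RatChain.{u}} {f : K ⟶ L} {g : L ⟶ M}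

theorem isCycle_of_map (h : IsShortExact f g) {n : ℕ} {x : K.X n} (hx : IsCycle L n (f.f n x)) :
    IsCycle K n x := fun m => by
  apply h.inj
  rw [← comm_apply, hx, map_zero]

theorem quasiIso_right (h : IsShortExact f g) (hK : Acyclic K) : QuasiIso g := by
  rw [quasiIso_iff_cycles]
  refine fun n => ⟨?_, ?_⟩
  · rintro x hx ⟨y, hy⟩
    obtain ⟨y, rfl⟩ := h.surj _ y
    rw [comm_apply, ← sub_eq_zero, ← map_sub] at hy
    obtain ⟨z, hz⟩ := h.exact _ _ hy
    have hzc : IsCycle K n z := h.isCycle_of_map fun m => by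
      rw [hz, map_sub, d_d_apply, hx, sub_zero]
    obtain ⟨w, rfl⟩ := hK n z hzc
    refine ⟨y - f.f _ w, ?_⟩
    rw [map_sub, comm_apply, hz]; abel
  · intro x hx
    obtain ⟨y, rfl⟩ := h.surj _ x
    cases n with
    | zero => exact ⟨y, 0, isCycle_zero _ _, by simp⟩
    | succ n =>
      rw [isCycle_succ_iff, comm_apply] at hx
      obtain ⟨z, hz⟩ := h.exact _ _ hx
      have hzc : IsCycle K n z := h.isCycle_of_map fun m => by rw [hz, d_d_apply]
      obtain ⟨w, rfl⟩ := hK n z hzc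
      refine ⟨y - f.f _ w, 0, ?_, ?_⟩
      · rw [isCycle_succ_iff, map_sub, comm_apply, hz, sub_self]
      · rw [map_sub, h.comp, map_zero]; abel

theorem quasiIso_left (h : IsShortExact f g) (hM : Acyclic M) : QuasiIso f := by
  rw [quasiIso_iff_cycles]
  refine fun n => ⟨?_, ?_⟩
  · rintro x hx ⟨y, hy⟩
    have hyc : IsCycle M (n + 1) (g.f _ y) := by
      rw [isCycle_succ_iff, comm_apply, hy, h.comp]
    obtain ⟨w, hw⟩ := hM _ _ hyc
    obtain ⟨w, rfl⟩ := h.surj _ w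
    rw [comm_apply, ← sub_eq_zero, ← map_sub] at hw
    obtain ⟨z, hz⟩ := h.exact _ _ hw
    refine ⟨-z, h.inj _ ?_⟩
    rw [← hy, ← comm_apply, map_neg, hz, map_neg, map_sub, d_d_apply]; abel
  · intro x hx
    obtain ⟨w, hw⟩ := hM _ _ (hx.map g)
    obtain ⟨w, rfl⟩ := h.surj _ w
    rw [comm_apply, eq_comm, ← sub_eq_zero, ← map_sub] at hw
    obtain ⟨z, hz⟩ := h.exact _ _ hw
    refine ⟨z, w, h.isCycle_of_map fun m => ?_, ?_⟩
    · rw [hz, map_sub, hx, d_d_apply, sub_zero]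
    · rw [hz]; abel

theorem acyclic_right (h : IsShortExact f g) (hf : QuasiIso f) : Acyclic M := by
  rw [quasiIso_iff_cycles] at hf
  intro n x hx
  obtain ⟨y, rfl⟩ := h.surj _ x
  suffices ∃ (k : K.X n) (_ : IsCycle L n (y - f.f n k)), True by
    obtain ⟨k, hk, -⟩ := this
    obtain ⟨z, w, hz, e⟩ := (hf n).2 _ hk
    refine ⟨g.f _ w, ?_⟩
    have e' : y = f.f n (k + z) + L.d (n + 1) n w := by
      rw [map_add, add_assoc, ← e]; abel
    rw [e', map_add, h.comp, comm_apply, zero_add]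
  cases n with
  | zero => exact ⟨0, isCycle_zero _ _, trivial⟩
  | succ n =>
    rw [isCycle_succ_iff, comm_apply] at hx
    obtain ⟨z, hz⟩ := h.exact _ _ hx
    have hzc : IsCycle K n z := h.isCycle_of_map fun m => by rw [hz, d_d_apply]
    obtain ⟨w, rfl⟩ := (hf n).1 z hzc ⟨y, hz.symm⟩
    refine ⟨w, ?_, trivial⟩
    rw [isCycle_succ_iff, map_sub, comm_apply, hz, sub_self]

theorem acyclicAt_zero (h : IsShortExact f g) (hL : AcyclicAt L 0) : AcyclicAt M 0 := by
  intro x _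
  obtain ⟨y, rfl⟩ := h.surj _ x
  obtain ⟨z, rfl⟩ := hL y (isCycle_zero _ _)
  exact ⟨g.f _ z, comm_apply _ _ _ _⟩

theorem acyclicAt_succ (h : IsShortExact f g) {n : ℕ} (hL : AcyclicAt L (n + 1))
    (hK : AcyclicAt K n) : AcyclicAt M (n + 1) := by
  intro x hx
  obtain ⟨y, rfl⟩ := h.surj _ x
  rw [isCycle_succ_iff, comm_apply] at hx
  obtain ⟨z, hz⟩ := h.exact _ _ hx
  have hzc : IsCycle K n z := h.isCycle_of_map fun m => by rw [hz, d_d_apply]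
  obtain ⟨w, rfl⟩ := hK z hzc
  obtain ⟨v, hv⟩ := hL (y - f.f _ w) (by
    rw [isCycle_succ_iff, map_sub, comm_apply, hz, sub_self])
  refine ⟨g.f _ v, ?_⟩
  rw [comm_apply, hv, map_sub, h.comp, sub_zero]

theorem acyclic_left (h : IsShortExact f g) (hL : Acyclic L) (hM : Acyclic M) : Acyclic K := by
  intro n x hx
  obtain ⟨y, hy⟩ := hL n _ (hx.map f)
  obtain ⟨z, hz⟩ := hM (n + 1) (g.f _ y) (by
    rw [isCycle_succ_iff, comm_apply, hy, h.comp])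
  obtain ⟨z, rfl⟩ := h.surj _ z
  rw [comm_apply, ← sub_eq_zero, ← map_sub] at hz
  obtain ⟨w, hw⟩ := h.exact _ _ hz
  refine ⟨-w, h.inj _ ?_⟩
  rw [← comm_apply, map_neg, hw, map_neg, map_sub, d_d_apply, hy]; abel

end IsShortExact

/-- A degreewise surjective map is a quasi-isomorphism as soon as its kernel is acyclic. -/
theorem quasiIso_of_surjective {K L : RatChain.{u}} (g : K ⟶ L)
    (hs : ∀ n, Function.Surjective (g.f n))
    (hk : ∀ n x, IsCycle K n x → g.f n x = 0 → ∃ y, g.f (n + 1) y = 0 ∧ K.d (n + 1) n y = x) :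
    QuasiIso g := by
  rw [quasiIso_iff_cycles]
  refine fun n => ⟨?_, ?_⟩
  · rintro x hx ⟨y, hy⟩
    obtain ⟨y, rfl⟩ := hs _ y
    rw [comm_apply] at hy
    obtain ⟨w, -, hw⟩ := hk n (x - K.d (n + 1) n y)
      (fun m => by rw [map_sub, hx, d_d_apply, sub_zero]) (by rw [map_sub, hy, sub_self])
    exact ⟨w + y, by rw [map_add, hw]; abel⟩
  · intro x hx
    obtain ⟨y, rfl⟩ := hs _ x
    cases n with
    | zero => exact ⟨y, 0, isCycle_zero _ _, by simp⟩
    | succ n =>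
      rw [isCycle_succ_iff, comm_apply] at hx
      obtain ⟨w, hw, e⟩ := hk n _ (isCycle_d K (n + 1) n y) hx
      refine ⟨y - w, 0, ?_, ?_⟩
      · rw [isCycle_succ_iff, map_sub, e, sub_self]
      · rw [map_sub, hw, map_zero]; abel

theorem quasiIso_of_bijective {K L : RatChain.{u}} (g : K ⟶ L)
    (hs : ∀ n, Function.Bijective (g.f n)) : QuasiIso g := by
  refine quasiIso_of_surjective g (fun n => (hs n).2) fun n x _ hx => ⟨0, map_zero _, ?_⟩
  rw [map_zero]
  exact ((hs n).1 (hx.trans (map_zero _).symm)).symm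

theorem Acyclic.of_quasiIso {K L : RatChain.{u}} (f : K ⟶ L) (hf : QuasiIso f)
    (hL : Acyclic L) : Acyclic K := fun n x hx =>
  (((quasiIso_iff_cycles f).1 hf n).1 x hx (hL n _ (hx.map f)))

end RatChain

namespace RightOmegaModule

open RatChain

theorem HasQuasiIso.comp_functor {M N : RightOmegaModule.{u}} (h : HasQuasiIso M N)
    (F : FinSurj ⥤ FinSurj) : HasQuasiIso (F.op ⋙ M) (F.op ⋙ N) := by
  obtain ⟨f, hf⟩ := h
  exact ⟨Functor.whiskerLeft F.op f, fun A => hf _⟩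

theorem HasQuasiIso.homology {M N : RightOmegaModule.{u}} (h : HasQuasiIso M N) :
    HasQuasiIso M.homology N.homology := by
  obtain ⟨f, hf⟩ := h
  refine ⟨Functor.whiskerRight f homologyComplex, fun A => ?_⟩
  refine quasiIso_of_bijective _ fun n => ?_
  have : IsIso (homologyMap (f.app A) n) := by
    have := hf A
    infer_instance
  exact (ConcreteCategory.isIso_iff_bijective _).1 this

theorem eqvGen_homology {M N : RightOmegaModule.{u}} (h : Relation.EqvGen HasQuasiIso M N) :
    Relation.EqvGen HasQuasiIso M.homology N.homology := by
  induction h with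
  | rel _ _ h => exact .rel _ _ h.homology
  | refl => exact .refl _
  | symm _ _ _ ih => exact .symm _ _ ih
  | trans _ _ _ _ _ ih ih' => exact .trans _ _ _ ih ih'

/-- Formality is invariant under zigzags of quasi-isomorphisms. -/
theorem Formal.of_eqvGen {M N : RightOmegaModule.{u}} (hM : Formal M)
    (h : Relation.EqvGen HasQuasiIso M N) : Formal N :=
  (h.symm.trans _ _ _ hM).trans _ _ _ (eqvGen_homology h)

theorem Formal.of_hasQuasiIso {M N : RightOmegaModule.{u}} (hM : Formal M)
    (h : HasQuasiIso M N) : Formal N := hM.of_eqvGen (.rel _ _ h)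

theorem Formal.of_hasQuasiIso' {M N : RightOmegaModule.{u}} (hN : Formal N)
    (h : HasQuasiIso M N) : Formal M := hN.of_eqvGen ((Relation.EqvGen.rel _ _ h).symm)

/-- A right `Ω`-module with zero differentials maps isomorphically to its homology. -/
theorem formal_of_zero_differential (Z : RightOmegaModule.{u})
    (hZ : ∀ A i j, (Z.obj A).d i j = 0) : Formal Z := by
  refine .rel _ _ ⟨{
    app := fun A =>
      { f := fun n => (Z.obj A).liftCycles (𝟙 _) _ rfl (by rw [hZ]; simp) ≫
          (Z.obj A).homologyπ n
        comm' := fun i j _ => by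
          exact comp_zero.trans (zero_comp.symm.trans (congr_arg (· ≫ _) (hZ A i j).symm)) }
    naturality := fun A B f => by
      ext1 n
      change (Z.map f).f n ≫ _ ≫ _ = (_ ≫ _) ≫ homologyMap (Z.map f) n
      rw [Category.assoc, homologyπ_naturality, ← Category.assoc, ← Category.assoc]
      congr 1
      rw [← cancel_mono ((Z.obj B).iCycles n)]
      simp }, fun A => ?_⟩
  have key : ∀ n x, (Z.obj A).iCycles n ((Z.obj A).liftCycles (𝟙 ((Z.obj A).X n)) _ rfl
      (by rw [hZ]; simp) x) = x := fun n x => by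
    rw [← ModuleCat.comp_apply, liftCycles_i]; rfl
  refine quasiIso_of_bijective _ fun n => ⟨?_, ?_⟩
  · refine (injective_iff_map_eq_zero (((Z.obj A).liftCycles (𝟙 _) _ rfl (by rw [hZ]; simp) ≫
      (Z.obj A).homologyπ n).hom)).2 fun x hx => ?_
    have hx' : (Z.obj A).homologyπ n ((Z.obj A).liftCycles (𝟙 ((Z.obj A).X n)) _ rfl
      (by rw [hZ]; simp) x) = 0 := hx
    rw [homologyπ_eq_zero_iff] at hx'
    obtain ⟨y, hy⟩ := hx'
    rw [key, hZ] at hy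
    exact hy.symm
  · intro a
    obtain ⟨z, rfl⟩ := homologyπ_surjective (Z.obj A) n a
    refine ⟨(Z.obj A).iCycles n z, ?_⟩
    change (Z.obj A).homologyπ n ((Z.obj A).liftCycles (𝟙 ((Z.obj A).X n)) _ rfl
      (by rw [hZ]; simp) _) = _
    congr 1
    apply (ModuleCat.mono_iff_injective ((Z.obj A).iCycles n)).1 inferInstance
    exact key _ _

/-- A right `Ω`-module is formal if it carries a natural idempotent endomorphism which is
homologous to the identity and annihilates, and is annihilated by, the differentials: its image is
then a quasi-isomorphic quotient with zero differentials. -/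
theorem formal_of_idempotent (Q : RightOmegaModule.{u}) (D : Q ⟶ Q)
    (hD : ∀ A n x, (D.app A).f n ((D.app A).f n x) = (D.app A).f n x)
    (hd : ∀ A i j x, (Q.obj A).d i j ((D.app A).f i x) = 0)
    (hh : ∀ A n x, IsCycle (Q.obj A) n x → ∃ y, (Q.obj A).d (n + 1) n y = x - (D.app A).f n x) :
    Formal Q := by
  have nat : ∀ {A B} (f : A ⟶ B) n x,
      (Q.map f).f n ((D.app A).f n x) = (D.app B).f n ((Q.map f).f n x) := fun f n x => by
    have := congr_arg (fun t => HomologicalComplex.Hom.f t n) (D.naturality f)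
    exact (ConcreteCategory.congr_hom this x).symm
  let Z : RightOmegaModule.{u} :=
    { obj := fun A =>
        { X := fun n => ModuleCat.of ℚ (LinearMap.range ((D.app A).f n).hom)
          d := fun _ _ => 0 }
      map := fun {A B} f =>
        { f := fun n => ModuleCat.ofHom
            (((Q.map f).f n).hom.restrict (by
              rintro _ ⟨x, rfl⟩
              exact ⟨(Q.map f).f n x, (nat f n x).symm⟩)) }
      map_id := fun A => by
        ext n x
        change (Q.map (𝟙 A)).f n x.1 = x.1
        rw [Q.map_id]; rfl
      map_comp := fun f g => by
        ext n x
        change (Q.map (f ≫ g)).f n x.1 = (Q.map g).f n ((Q.map f).f n x.1)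
        rw [Q.map_comp]; rfl }
  refine (formal_of_zero_differential Z fun _ _ _ => rfl).of_hasQuasiIso' ⟨
    { app := fun A =>
        { f := fun n => ModuleCat.ofHom (LinearMap.rangeRestrict ((D.app A).f n).hom)
          comm' := fun i j _ => by
            ext x
            change 0 = (D.app A).f j ((Q.obj A).d i j x)
            rw [← comm_apply, hd] }
      naturality := fun A B f => by
        ext n x
        exact (nat f n x).symm }, fun A => ?_⟩
  rw [quasiIso_iff_cycles]
  refine fun n => ⟨?_, ?_⟩
  · rintro x hx ⟨y, hy⟩
    obtain ⟨z, hz⟩ := hh A n x hx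
    refine ⟨z, ?_⟩
    have : (D.app A).f n x = 0 := (congr_arg Subtype.val hy).symm
    rw [hz, this, sub_zero]
  · rintro ⟨_, x, rfl⟩ -
    refine ⟨(D.app A).f n x, 0, fun m => hd _ _ _ _, ?_⟩
    rw [map_zero, add_zero]
    exact Subtype.ext (hD A n x).symm

end RightOmegaModule

end

/-! ### Simplicial pairs and their powers -/

section

open Limits HomologicalComplex Opposite Simplicial

/-- A set with a distinguished subset. -/
structure PairType : Type (u + 1) where
  /-- the underlying type -/
  carrier : Type u
  /-- the distinguished subset -/
  sub : Set carrier

namespace PairType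

/-- Maps of pairs. -/
@[ext]
structure Hom (P Q : PairType.{u}) : Type u where
  /-- the underlying function -/
  map : P.carrier → Q.carrier
  mem : ∀ x ∈ P.sub, map x ∈ Q.sub

instance : Category PairType.{u} where
  Hom P Q := Hom P Q
  id P := ⟨id, fun _ h => h⟩
  comp f g := ⟨g.map ∘ f.map, fun x h => g.mem _ (f.mem x h)⟩

@[ext]
theorem hom_ext {P Q : PairType.{u}} {f g : P ⟶ Q} (h : ∀ x, Hom.map f x = Hom.map g x) : f = g :=
  Hom.ext (funext h)

@[simp] theorem id_map (P : PairType.{u}) (x : P.carrier) : Hom.map (𝟙 P) x = x := rfl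

@[simp] theorem comp_map {P Q R : PairType.{u}} (f : P ⟶ Q) (g : Q ⟶ R) (x : P.carrier) :
    Hom.map (f ≫ g) x = Hom.map g (Hom.map f x) := rfl

/-- The underlying set. -/
def forget : PairType.{u} ⥤ Type u where
  obj P := P.carrier
  map f := ↾(Hom.map f)

/-- The vector space `ℚ[P] / ℚ[F]` of a pair `(P, F)`. -/
abbrev Free (P : PairType.{u}) : Type u := (P.carrier →₀ ℚ) ⧸ Finsupp.supported ℚ ℚ P.sub

/-- The class of an element in `ℚ[P] / ℚ[F]`. -/
noncomputable def cls (P : PairType.{u}) (x : P.carrier) : P.Free :=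
  Submodule.Quotient.mk (Finsupp.single x 1)

theorem cls_eq_zero (P : PairType.{u}) {x : P.carrier} (h : x ∈ P.sub) : P.cls x = 0 :=
  (Submodule.Quotient.mk_eq_zero _).2 (Finsupp.single_mem_supported ℚ _ h)

theorem mk_eq_zero_iff (P : PairType.{u}) (c : P.carrier →₀ ℚ) :
    (Submodule.Quotient.mk c : P.Free) = 0 ↔ ∀ x ∈ c.support, x ∈ P.sub := by
  rw [Submodule.Quotient.mk_eq_zero, Finsupp.mem_supported]
  rfl

theorem free_hom_ext {P : PairType.{u}} {M : Type*} [AddCommGroup M] [Module ℚ M]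
    {f g : P.Free →ₗ[ℚ] M} (h : ∀ x, f (P.cls x) = g (P.cls x)) : f = g := by
  apply Submodule.linearMap_qext
  apply Finsupp.lhom_ext'
  intro x
  apply LinearMap.ext_ring
  exact h x

/-- The linear map on `ℚ[P] / ℚ[F]` with given values on `P`. -/
noncomputable def lift (P : PairType.{u}) {M : Type*} [AddCommGroup M] [Module ℚ M]
    (f : P.carrier → M) (hf : ∀ x ∈ P.sub, f x = 0) : P.Free →ₗ[ℚ] M :=
  Submodule.liftQ _ (Finsupp.lift M ℚ P.carrier f) (by
    rw [Finsupp.supported_eq_span_single, Submodule.span_le]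
    rintro _ ⟨x, hx, rfl⟩
    simp [hf x hx])

@[simp]
theorem lift_cls (P : PairType.{u}) {M : Type*} [AddCommGroup M] [Module ℚ M]
    (f : P.carrier → M) (hf : ∀ x ∈ P.sub, f x = 0) (x : P.carrier) :
    P.lift f hf (P.cls x) = f x := by
  change Submodule.liftQ _ _ _ (Submodule.Quotient.mk _) = _
  rw [Submodule.liftQ_apply]
  simp

/-- The linear map induced by a map of pairs. -/
noncomputable def freeMap {P Q : PairType.{u}} (f : P ⟶ Q) : P.Free →ₗ[ℚ] Q.Free :=
  P.lift (fun x => Q.cls (Hom.map f x)) fun x hx => Q.cls_eq_zero (f.mem x hx)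

@[simp]
theorem freeMap_cls {P Q : PairType.{u}} (f : P ⟶ Q) (x : P.carrier) :
    freeMap f (P.cls x) = Q.cls (Hom.map f x) := lift_cls _ _ _ _

theorem freeMap_mk {P Q : PairType.{u}} (f : P ⟶ Q) (c : P.carrier →₀ ℚ) :
    freeMap f (Submodule.Quotient.mk c) =
      (Submodule.Quotient.mk (Finsupp.mapDomain (Hom.map f) c) : Q.Free) := by
  induction c using Finsupp.induction_linear with
  | zero => simp
  | add c d hc hd => simp [Finsupp.mapDomain_add, hc, hd]
  | single x a =>
    have : ∀ (R : PairType.{u}) (y : R.carrier),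
        (Submodule.Quotient.mk (Finsupp.single y a) : R.Free) = a • R.cls y := fun R y => by
      rw [cls, ← Submodule.Quotient.mk_smul]; simp
    rw [Finsupp.mapDomain_single, this, this, map_smul, freeMap_cls]

theorem free_induction {P : PairType.{u}} {p : P.Free → Prop} (x : P.Free) (zero : p 0)
    (add : ∀ x y, p x → p y → p (x + y)) (smul : ∀ (a : ℚ) x, p (a • P.cls x)) : p x := by
  obtain ⟨c, rfl⟩ := Submodule.Quotient.mk_surjective _ x
  induction c using Finsupp.induction_linear with
  | zero => exact zero
  | add c d hc hd => exact add _ _ hc hd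
  | single x a =>
    convert smul a x
    rw [cls, ← Submodule.Quotient.mk_smul]; simp

/-- The functor `(P, F) ↦ ℚ[P] / ℚ[F]`. -/
noncomputable def free : PairType.{u} ⥤ ModuleCat.{u} ℚ where
  obj P := ModuleCat.of ℚ P.Free
  map f := ModuleCat.ofHom (freeMap f)
  map_id P := by
    ext1
    exact free_hom_ext fun x => by simp
  map_comp f g := by
    ext1
    exact free_hom_ext fun x => by simp

/-- The `A`-th power of `(P, F)`: all functions `A → P`, with the functions having at least one
value in `F` as distinguished subset. -/
def pow (A : Type) : PairType.{u} ⥤ PairType.{u} where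
  obj P := ⟨A → P.carrier, {x | ∃ a, x a ∈ P.sub}⟩
  map f := ⟨fun x a => Hom.map f (x a), fun _ ⟨a, ha⟩ => ⟨a, f.mem _ ha⟩⟩

/-- The powers of a pair, contravariant in the exponent. -/
def powers : FinSurjᵒᵖ ⥤ PairType.{u} ⥤ PairType.{u} where
  obj A := pow A.unop.carrier
  map {A B} g :=
    { app := fun P => Hom.mk (P := (pow _).obj P) (Q := (pow _).obj P) (fun x => x ∘ g.unop.1) (by
        rintro x ⟨a, ha⟩
        obtain ⟨b, rfl⟩ := g.unop.2 a
        exact ⟨b, ha⟩) }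

end PairType

/-- Simplicial rational vector spaces. -/
abbrev SMod : Type (u + 1) := SimplicialObject (ModuleCat.{u} ℚ)

/-- Simplicial pairs of sets. -/
abbrev SPair : Type (u + 1) := SimplicialObject PairType.{u}

/-- The alternating face map complex of a simplicial vector space. -/
noncomputable abbrev chains : SMod.{u} ⥤ RatChain.{u} :=
  AlgebraicTopology.alternatingFaceMapComplex (ModuleCat.{u} ℚ)

/-- Weak equivalences of simplicial vector spaces. -/
def SMod.WeakEquiv {U V : SMod.{u}} (f : U ⟶ V) : Prop := QuasiIso (chains.map f)

/-- The simplicial vector space of a simplicial pair. -/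
noncomputable abbrev SPair.free : SPair.{u} ⥤ SMod.{u} :=
  (SimplicialObject.whiskering _ _).obj PairType.free

/-- Maps of simplicial pairs inducing isomorphisms in relative homology. -/
def SPair.WeakEquiv {S T : SPair.{u}} (f : S ⟶ T) : Prop := SMod.WeakEquiv (SPair.free.map f)

theorem SMod.WeakEquiv.comp {U V W : SMod.{u}} {f : U ⟶ V} {g : V ⟶ W} (hf : WeakEquiv f)
    (hg : WeakEquiv g) : WeakEquiv (f ≫ g) := by
  unfold WeakEquiv at *
  rw [Functor.map_comp]
  infer_instance

theorem SMod.WeakEquiv.of_comp_left {U V W : SMod.{u}} {f : U ⟶ V} {g : V ⟶ W} (hf : WeakEquiv f)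
    (h : WeakEquiv (f ≫ g)) : WeakEquiv g := by
  unfold WeakEquiv at *
  rw [Functor.map_comp] at h
  exact quasiIso_of_comp_left (chains.map f) _

theorem SMod.WeakEquiv.of_comp_right {U V W : SMod.{u}} {f : U ⟶ V} {g : V ⟶ W}
    (hg : WeakEquiv g) (h : WeakEquiv (f ≫ g)) : WeakEquiv f := by
  unfold WeakEquiv at *
  rw [Functor.map_comp] at h
  exact quasiIso_of_comp_right (chains.map f) (chains.map g)

theorem SMod.WeakEquiv.of_bijective {U V : SMod.{u}} {f : U ⟶ V}
    (h : ∀ n : ℕ, Function.Bijective (f.app (op ⦋n⦌))) : WeakEquiv f :=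
  RatChain.quasiIso_of_bijective _ h

theorem SMod.WeakEquiv.of_isIso {U V : SMod.{u}} (f : U ⟶ V) [IsIso f] : WeakEquiv f := by
  unfold WeakEquiv
  infer_instance

namespace SPair

theorem WeakEquiv.comp {U V W : SPair.{u}} {f : U ⟶ V} {g : V ⟶ W} (hf : WeakEquiv f)
    (hg : WeakEquiv g) : WeakEquiv (f ≫ g) := by
  unfold WeakEquiv at *
  rw [Functor.map_comp]
  exact SMod.WeakEquiv.comp hf hg

theorem WeakEquiv.of_comp_left {U V W : SPair.{u}} {f : U ⟶ V} {g : V ⟶ W} (hf : WeakEquiv f)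
    (h : WeakEquiv (f ≫ g)) : WeakEquiv g := by
  unfold WeakEquiv at *
  rw [Functor.map_comp] at h
  exact SMod.WeakEquiv.of_comp_left hf h

theorem WeakEquiv.of_comp_right {U V W : SPair.{u}} {f : U ⟶ V} {g : V ⟶ W}
    (hg : WeakEquiv g) (h : WeakEquiv (f ≫ g)) : WeakEquiv f := by
  unfold WeakEquiv at *
  rw [Functor.map_comp] at h
  exact SMod.WeakEquiv.of_comp_right hg h

/-- A map of simplicial pairs `(P, F) ⟶ (P', F')` which restricts to bijections from the simplices
outside `F` to the simplices outside `F'` is a weak equivalence. -/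
theorem WeakEquiv.of_bijOn {S T : SPair.{u}} (f : S ⟶ T)
    (h : ∀ n : ℕ, Set.BijOn (PairType.Hom.map (f.app (op ⦋n⦌))) (S.obj (op ⦋n⦌)).subᶜ
      (T.obj (op ⦋n⦌)).subᶜ) : WeakEquiv f := by
  refine SMod.WeakEquiv.of_bijective fun n => ?_
  classical
  let g : (T.obj (op ⦋n⦌)).Free →ₗ[ℚ] (S.obj (op ⦋n⦌)).Free := (T.obj (op ⦋n⦌)).lift
    (fun y => if hy : y ∈ (T.obj (op ⦋n⦌)).subᶜ then (S.obj (op ⦋n⦌)).cls ((h n).surjOn hy).choose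
      else 0) (fun y hy => dif_neg (fun h => h hy))
  have hg : ∀ y (hy : y ∈ (T.obj (op ⦋n⦌)).subᶜ), g ((T.obj (op ⦋n⦌)).cls y) =
      (S.obj (op ⦋n⦌)).cls ((h n).surjOn hy).choose := fun y hy => by
    simp only [g, PairType.lift_cls, dif_pos hy]
  have h1 : g ∘ₗ PairType.freeMap (f.app (op ⦋n⦌)) = LinearMap.id :=
    PairType.free_hom_ext fun x => by
      by_cases hx : x ∈ (S.obj (op ⦋n⦌)).sub
      · rw [PairType.cls_eq_zero _ hx, map_zero, map_zero]
      · rw [LinearMap.comp_apply, PairType.freeMap_cls, hg _ ((h n).mapsTo hx)]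
        have hs := ((h n).surjOn ((h n).mapsTo hx)).choose_spec
        rw [(h n).injOn hs.1 hx hs.2]; rfl
  have h2 : PairType.freeMap (f.app (op ⦋n⦌)) ∘ₗ g = LinearMap.id :=
    PairType.free_hom_ext fun y => by
      by_cases hy : y ∈ (T.obj (op ⦋n⦌)).sub
      · rw [PairType.cls_eq_zero _ hy, map_zero, map_zero]
      · rw [LinearMap.comp_apply, hg y hy, PairType.freeMap_cls,
          ((h n).surjOn hy).choose_spec.2]; rfl
  exact ⟨Function.LeftInverse.injective (g := g) fun x => LinearMap.congr_fun h1 x,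
    Function.RightInverse.surjective (g := g) fun x => LinearMap.congr_fun h2 x⟩

end SPair

/-- Maps of simplicial vector spaces which are inverse to each other up to simplicial homotopy are
weak equivalences. -/
theorem SMod.WeakEquiv.of_homotopies {U V : SMod.{u}} {f : U ⟶ V} {g : V ⟶ U}
    (h : SimplicialObject.Homotopy (f ≫ g) (𝟙 U))
    (h' : SimplicialObject.Homotopy (g ≫ f) (𝟙 V)) : WeakEquiv f := by
  let e : HomotopyEquiv (chains.obj U) (chains.obj V) :=
    { hom := chains.map f
      inv := chains.map g
      homotopyHomInvId := (Homotopy.ofEq (chains.map_comp f g).symm).trans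
        (h.toChainHomotopy.trans (Homotopy.ofEq (chains.map_id U)))
      homotopyInvHomId := (Homotopy.ofEq (chains.map_comp g f).symm).trans
        (h'.toChainHomotopy.trans (Homotopy.ofEq (chains.map_id V))) }
  exact e.quasiIso_hom

theorem SPair.WeakEquiv.of_homotopies {U V : SPair.{u}} {f : U ⟶ V} {g : V ⟶ U}
    (h : SimplicialObject.Homotopy (f ≫ g) (𝟙 U))
    (h' : SimplicialObject.Homotopy (g ≫ f) (𝟙 V)) : WeakEquiv f :=
  SMod.WeakEquiv.of_homotopies (g := SPair.free.map g)
    (by have := h.whiskerRight PairType.free; rwa [Functor.map_comp, CategoryTheory.Functor.map_id] at this)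
    (by have := h'.whiskerRight PairType.free; rwa [Functor.map_comp, CategoryTheory.Functor.map_id] at this)

namespace SPair

/-- The underlying simplicial set of a simplicial pair. -/
abbrev toSSet (S : SPair.{u}) : SSet.{u} := S ⋙ PairType.forget

/-- The map of simplicial sets underlying a map of simplicial pairs. -/
abbrev mapSSet {S T : SPair.{u}} (f : S ⟶ T) : S.toSSet ⟶ T.toSSet :=
  Functor.whiskerRight f PairType.forget

/-- A combinatorial homotopy of simplicial sets which preserves the distinguished subsets is a homotopy of
simplicial pairs. -/
noncomputable def homotopyOfForget {S T : SPair.{u}} {f g : S ⟶ T}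
    (H : SimplicialObject.Homotopy (mapSSet f) (mapSSet g))
    (hH : ∀ (n : ℕ) (i : Fin (n + 1)) (x : S.toSSet _⦋n⦌), x ∈ (S.obj (op ⦋n⦌)).sub →
      H.h i x ∈ (T.obj (op ⦋n + 1⦌)).sub) :
    SimplicialObject.Homotopy f g where
  h {n} i := PairType.Hom.mk (P := S.obj (op ⦋n⦌)) (Q := T.obj (op ⦋n + 1⦌))
    (fun x => H.h i x) (fun x hx => hH n i x hx)
  h_zero_comp_δ_zero n := by
    ext x
    exact ConcreteCategory.congr_hom (H.h_zero_comp_δ_zero n) x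
  h_last_comp_δ_last n := by
    ext x
    exact ConcreteCategory.congr_hom (H.h_last_comp_δ_last n) x
  h_succ_comp_δ_castSucc_of_lt i j hij := by
    ext x
    exact ConcreteCategory.congr_hom
      (H.h_succ_comp_δ_castSucc_of_lt i j hij) x
  h_succ_comp_δ_castSucc_succ j := by
    ext x
    exact ConcreteCategory.congr_hom
      (H.h_succ_comp_δ_castSucc_succ j) x
  h_castSucc_comp_δ_succ_of_lt i j hij := by
    ext x
    exact ConcreteCategory.congr_hom
      (H.h_castSucc_comp_δ_succ_of_lt i j hij) x
  h_comp_σ_castSucc_of_le i j hij := by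
    ext x
    exact ConcreteCategory.congr_hom
      (H.h_comp_σ_castSucc_of_le i j hij) x
  h_comp_σ_succ_of_lt i j hij := by
    ext x
    exact ConcreteCategory.congr_hom
      (H.h_comp_σ_succ_of_lt i j hij) x

/-- A homotopy of simplicial sets which preserves the distinguished subsets is a homotopy of
simplicial pairs. -/
noncomputable def homotopyOfSSet {S T : SPair.{u}} {f g : S ⟶ T}
    (H : SSet.Homotopy (mapSSet f) (mapSSet g))
    (hH : ∀ (n : ℕ) (x : S.toSSet _⦋n⦌) (t : Δ[1] _⦋n⦌), x ∈ (S.obj (op ⦋n⦌)).sub →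
      H.h.app (op ⦋n⦌) (x, t) ∈ (T.obj (op ⦋n⦌)).sub) :
    SimplicialObject.Homotopy f g :=
  homotopyOfForget H.toSimplicialObjectHomotopy fun n i x hx =>
    hH (n + 1) ((S.map (SimplexCategory.σ i).op).map x)
      (SSet.stdSimplex.objMk₁ i.succ.castSucc) ((S.map (SimplexCategory.σ i).op).mem x hx)

/-- The simplicial pair of a simplicial set and a subcomplex. -/
def ofSubcomplex (X : SSet.{u}) (A : X.Subcomplex) : SPair.{u} where
  obj n := ⟨X.obj n, A.obj n⟩
  map f := ⟨fun x => X.map f x, fun x hx => A.map f hx⟩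
  map_id n := by ext x; exact ConcreteCategory.congr_hom (X.map_id n) x
  map_comp f g := by ext x; exact ConcreteCategory.congr_hom (X.map_comp f g) x

/-- The map of simplicial pairs given by a map of simplicial sets. -/
def ofSubcomplexMap {X Y : SSet.{u}} (f : X ⟶ Y) {A : X.Subcomplex} {B : Y.Subcomplex}
    (h : ∀ n, ∀ x ∈ A.obj n, f.app n x ∈ B.obj n) : ofSubcomplex X A ⟶ ofSubcomplex Y B where
  app n := PairType.Hom.mk (P := (ofSubcomplex X A).obj n) (Q := (ofSubcomplex Y B).obj n)
    (fun x => f.app n x) (h n)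
  naturality _ _ g := by ext x; exact ConcreteCategory.congr_hom (f.naturality g) x

/-- The right `Ω`-module of simplicial vector spaces `A ↦ ℚ[S ^ A] / ℚ[fat]` of a simplicial
pair `S`; for `S = (X, pt)` these are the reduced chains on the smash powers of `X`. -/
noncomputable def tensorPowers (S : SPair.{u}) : FinSurjᵒᵖ ⥤ SMod.{u} where
  obj A := S ⋙ PairType.powers.obj A ⋙ PairType.free
  map g := Functor.whiskerLeft S (Functor.whiskerRight (PairType.powers.map g) PairType.free)
  map_id A := by
    rw [PairType.powers.map_id]
    refine NatTrans.ext (funext fun n => ?_)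
    exact PairType.free.map_id _
  map_comp f g := by
    rw [PairType.powers.map_comp]
    refine NatTrans.ext (funext fun n => ?_)
    exact PairType.free.map_comp _ _

/-- The functoriality of `tensorPowers` in the simplicial pair. -/
noncomputable def tensorPowersMap {S T : SPair.{u}} (f : S ⟶ T) :
    S.tensorPowers ⟶ T.tensorPowers where
  app A := Functor.whiskerRight f (PairType.powers.obj A ⋙ PairType.free)
  naturality A B g := by
    refine NatTrans.ext (funext fun n => ?_)
    exact ((PairType.free.map_comp _ _).symm.trans (congr_arg PairType.free.map
      ((PairType.powers.map g).naturality (f.app n)).symm)).trans (PairType.free.map_comp _ _)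

end SPair

end

/-! ### Tensor products of simplicial vector spaces -/

section

open Limits HomologicalComplex Opposite Simplicial TensorProduct

namespace SMod

theorem map_id_apply (U : SMod.{u}) (n : SimplexCategoryᵒᵖ) (x : U.obj n) : U.map (𝟙 n) x = x := by
  rw [U.map_id]; rfl

theorem map_comp_apply (U : SMod.{u}) {a b c : SimplexCategoryᵒᵖ} (f : a ⟶ b) (g : b ⟶ c)
    (x : U.obj a) : U.map (f ≫ g) x = U.map g (U.map f x) := by
  rw [U.map_comp]; rfl

theorem naturality_apply {U V : SMod.{u}} (f : U ⟶ V) {a b : SimplexCategoryᵒᵖ} (g : a ⟶ b)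
    (x : U.obj a) : f.app b (U.map g x) = V.map g (f.app a x) :=
  ConcreteCategory.congr_hom (f.naturality g) x

/-- The levelwise tensor product of simplicial vector spaces. -/
noncomputable def tensor (U V : SMod.{u}) : SMod.{u} where
  obj n := ModuleCat.of ℚ (U.obj n ⊗[ℚ] V.obj n)
  map f := ModuleCat.ofHom (TensorProduct.map (U.map f).hom (V.map f).hom)
  map_id n := by
    ext1
    apply TensorProduct.ext'
    intro x y
    change U.map (𝟙 n) x ⊗ₜ V.map (𝟙 n) y = x ⊗ₜ y
    rw [map_id_apply, map_id_apply]
  map_comp f g := by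
    ext1
    apply TensorProduct.ext'
    intro x y
    change U.map (f ≫ g) x ⊗ₜ V.map (f ≫ g) y = U.map g (U.map f x) ⊗ₜ V.map g (V.map f y)
    rw [map_comp_apply, map_comp_apply]

/-- The functoriality of the levelwise tensor product. -/
noncomputable def tensorMap {U U' V V' : SMod.{u}} (f : U ⟶ U') (g : V ⟶ V') :
    tensor U V ⟶ tensor U' V' where
  app n := ModuleCat.ofHom (TensorProduct.map (f.app n).hom (g.app n).hom)
  naturality a b h := by
    ext1
    apply TensorProduct.ext'
    intro x y
    change f.app b (U.map h x) ⊗ₜ g.app b (V.map h y) =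
      U'.map h (f.app a x) ⊗ₜ V'.map h (g.app a y)
    rw [naturality_apply, naturality_apply]

theorem tensorMap_comp {U U' U'' V V' V'' : SMod.{u}} (f : U ⟶ U') (f' : U' ⟶ U'') (g : V ⟶ V')
    (g' : V' ⟶ V'') : tensorMap (f ≫ f') (g ≫ g') = tensorMap f g ≫ tensorMap f' g' := by
  refine NatTrans.ext (funext fun n => ?_)
  ext1
  apply TensorProduct.ext'
  intro x y
  rfl

/-- The tensor product of two simplicial homotopies. -/
noncomputable def tensorHomotopy {U U' V V' : SMod.{u}} {f f' : U ⟶ U'} {g g' : V ⟶ V'}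
    (H : SimplicialObject.Homotopy f f') (H' : SimplicialObject.Homotopy g g') :
    SimplicialObject.Homotopy (tensorMap f g) (tensorMap f' g') := by
  have aux : ∀ {A B C A' B' C' : ModuleCat.{u} ℚ} {D D' : ModuleCat.{u} ℚ} {p : A ⟶ B} {q : B ⟶ C}
      {r : A ⟶ D} {s : D ⟶ C} {p' : A' ⟶ B'} {q' : B' ⟶ C'} {r' : A' ⟶ D'} {s' : D' ⟶ C'},
      p ≫ q = r ≫ s → p' ≫ q' = r' ≫ s' →
      ModuleCat.ofHom (TensorProduct.map p.hom p'.hom) ≫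
        ModuleCat.ofHom (TensorProduct.map q.hom q'.hom) =
      ModuleCat.ofHom (TensorProduct.map r.hom r'.hom) ≫
        ModuleCat.ofHom (TensorProduct.map s.hom s'.hom) := by
    intro A B C A' B' C' D D' p q r s p' q' r' s' h h'
    ext1
    apply TensorProduct.ext'
    intro x y
    exact congr_arg₂ (fun a b => a ⊗ₜ[ℚ] b) (ConcreteCategory.congr_hom h x)
      (ConcreteCategory.congr_hom h' y)
  have aux' : ∀ {A B C A' B' C' : ModuleCat.{u} ℚ} {p : A ⟶ B} {q : B ⟶ C}
      {r : A ⟶ C} {p' : A' ⟶ B'} {q' : B' ⟶ C'} {r' : A' ⟶ C'},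
      p ≫ q = r → p' ≫ q' = r' →
      ModuleCat.ofHom (TensorProduct.map p.hom p'.hom) ≫
        ModuleCat.ofHom (TensorProduct.map q.hom q'.hom) =
      ModuleCat.ofHom (TensorProduct.map r.hom r'.hom) := by
    intro A B C A' B' C' p q r p' q' r' h h'
    ext1
    apply TensorProduct.ext'
    intro x y
    exact congr_arg₂ (fun a b => a ⊗ₜ[ℚ] b) (ConcreteCategory.congr_hom h x)
      (ConcreteCategory.congr_hom h' y)
  exact
    { h := fun i => ModuleCat.ofHom (TensorProduct.map (H.h i).hom (H'.h i).hom)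
      h_zero_comp_δ_zero := fun n => aux' (H.h_zero_comp_δ_zero n) (H'.h_zero_comp_δ_zero n)
      h_last_comp_δ_last := fun n => aux' (H.h_last_comp_δ_last n) (H'.h_last_comp_δ_last n)
      h_succ_comp_δ_castSucc_of_lt := fun i j h =>
        aux (H.h_succ_comp_δ_castSucc_of_lt i j h) (H'.h_succ_comp_δ_castSucc_of_lt i j h)
      h_succ_comp_δ_castSucc_succ := fun j =>
        aux (H.h_succ_comp_δ_castSucc_succ j) (H'.h_succ_comp_δ_castSucc_succ j)
      h_castSucc_comp_δ_succ_of_lt := fun i j h =>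
        aux (H.h_castSucc_comp_δ_succ_of_lt i j h) (H'.h_castSucc_comp_δ_succ_of_lt i j h)
      h_comp_σ_castSucc_of_le := fun i j h =>
        aux (H.h_comp_σ_castSucc_of_le i j h) (H'.h_comp_σ_castSucc_of_le i j h)
      h_comp_σ_succ_of_lt := fun i j h =>
        aux (H.h_comp_σ_succ_of_lt i j h) (H'.h_comp_σ_succ_of_lt i j h) }

/-- The levelwise kernel. -/
noncomputable def ker {U V : SMod.{u}} (f : U ⟶ V) : SMod.{u} where
  obj n := ModuleCat.of ℚ (LinearMap.ker (f.app n).hom)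
  map g := ModuleCat.ofHom ((U.map g).hom.restrict fun x hx => by
    change f.app _ (U.map g x) = 0
    rw [naturality_apply, show f.app _ x = 0 from hx, map_zero])
  map_id n := by
    ext x
    exact map_id_apply U n x.1
  map_comp g h := by
    ext x
    exact map_comp_apply U g h x.1

/-- The inclusion of the levelwise kernel. -/
noncomputable def kerι {U V : SMod.{u}} (f : U ⟶ V) : ker f ⟶ U where
  app n := ModuleCat.ofHom (LinearMap.ker (f.app n).hom).subtype

/-- The levelwise cokernel. -/
noncomputable def coker {U V : SMod.{u}} (f : U ⟶ V) : SMod.{u} where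
  obj n := ModuleCat.of ℚ (V.obj n ⧸ LinearMap.range (f.app n).hom)
  map {a b} g := ModuleCat.ofHom (Submodule.mapQ _ _ (V.map g).hom (by
    rintro _ ⟨x, rfl⟩
    exact ⟨U.map g x, naturality_apply f g x⟩))
  map_id n := by
    ext x
    exact congr_arg Submodule.Quotient.mk (map_id_apply V n x)
  map_comp g h := by
    ext x
    exact congr_arg Submodule.Quotient.mk (map_comp_apply V g h x)

/-- The projection onto the levelwise cokernel. -/
noncomputable def cokerπ {U V : SMod.{u}} (f : U ⟶ V) : V ⟶ coker f where
  app n := ModuleCat.ofHom (LinearMap.range (f.app n).hom).mkQ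

/-- The levelwise product. -/
noncomputable def prod (U V : SMod.{u}) : SMod.{u} where
  obj n := ModuleCat.of ℚ (U.obj n × V.obj n)
  map g := ModuleCat.ofHom (LinearMap.prodMap (U.map g).hom (V.map g).hom)
  map_id n := by
    ext1
    exact LinearMap.ext fun x => Prod.ext (map_id_apply U n x.1) (map_id_apply V n x.2)
  map_comp g h := by
    ext1
    exact LinearMap.ext fun x => Prod.ext (map_comp_apply U g h x.1) (map_comp_apply V g h x.2)

/-- The first projection. -/
noncomputable def fst (U V : SMod.{u}) : prod U V ⟶ U where
  app n := ModuleCat.ofHom (LinearMap.fst ℚ _ _)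

/-- The map to a product with given components. -/
noncomputable def pair {U V W : SMod.{u}} (f : W ⟶ U) (g : W ⟶ V) : W ⟶ prod U V where
  app n := ModuleCat.ofHom (LinearMap.prod (f.app n).hom (g.app n).hom)
  naturality a b h := by
    ext1
    exact LinearMap.ext fun x => Prod.ext (naturality_apply f h x) (naturality_apply g h x)

open RatChain

/-- Acyclicity of simplicial vector spaces. -/
def Acyclic (U : SMod.{u}) : Prop := RatChain.Acyclic (chains.obj U)

/-- The identity of an acyclic simplicial vector space may be detected by a null-homotopy. -/
theorem Acyclic.of_homotopy {U : SMod.{u}} {z : U ⟶ U} (H : SimplicialObject.Homotopy z (𝟙 U))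
    (hz : ∀ (n : ℕ) x, z.app (op ⦋n⦌) x = 0) : Acyclic U := by
  intro n x hx
  have e := H.toChainHomotopy
  have hq : homologyMap (chains.map z) n = homologyMap (chains.map (𝟙 U)) n :=
    e.homologyMap_eq n
  obtain ⟨c, rfl⟩ := exists_iCycles _ n x hx
  rw [← homologyπ_eq_zero_iff]
  have h1 := homologyMap_π (chains.map z) n c
  have h2 := homologyMap_π (chains.map (𝟙 U)) n c
  have h3 : cyclesMap (chains.map z) n c = 0 := by
    apply (ModuleCat.mono_iff_injective ((chains.obj U).iCycles n)).1 inferInstance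
    rw [iCycles_map, map_zero]
    exact hz n _
  have h4 : cyclesMap (chains.map (𝟙 U)) n c = c := by
    rw [CategoryTheory.Functor.map_id, cyclesMap_id]; rfl
  rw [h3, map_zero] at h1
  rw [h4] at h2
  rw [← h2, ← hq, h1]

section exactness

variable {U V X : SMod.{u}} {f : U ⟶ V} {g : V ⟶ X}

/-- Levelwise short exact sequences. -/
structure IsShortExact (f : U ⟶ V) (g : V ⟶ X) : Prop where
  inj : ∀ n, Function.Injective (f.app n)
  surj : ∀ n, Function.Surjective (g.app n)
  exact : ∀ n, Function.Exact (f.app n) (g.app n)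

theorem IsShortExact.chains (h : IsShortExact f g) :
    RatChain.IsShortExact (chains.map f) (chains.map g) where
  inj _ := h.inj _
  surj _ := h.surj _
  comp _ x := (h.exact _).apply_apply_eq_zero x
  exact n y hy := (h.exact (op ⦋n⦌) y).1 hy

theorem IsShortExact.tensor (h : IsShortExact f g) (W : SMod.{u}) :
    IsShortExact (tensorMap f (𝟙 W)) (tensorMap g (𝟙 W)) where
  inj n := Module.Flat.rTensor_preserves_injective_linearMap (M := W.obj n) (f.app n).hom (h.inj n)
  surj n := LinearMap.rTensor_surjective (W.obj n) (h.surj n)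
  exact n := rTensor_exact (W.obj n) (h.exact n) (h.surj n)

theorem isShortExact_ker (h : ∀ n, Function.Surjective (g.app n)) : IsShortExact (kerι g) g where
  inj _ := Subtype.val_injective
  surj := h
  exact _ x := ⟨fun hx => ⟨⟨x, hx⟩, rfl⟩, fun ⟨y, hy⟩ => hy ▸ y.2⟩

theorem isShortExact_coker (h : ∀ n, Function.Injective (f.app n)) :
    IsShortExact f (cokerπ f) where
  inj := h
  surj _ := Submodule.mkQ_surjective _
  exact _ _ := Submodule.Quotient.mk_eq_zero _

end exactness

end SMod

end

/-! ### Cones over simplices -/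

section

open Limits HomologicalComplex Opposite Simplicial TensorProduct

namespace SPair

/-- The disjoint union of a family of standard simplices, relative to their initial vertices. -/
def cones {J : Type u} (n : J → ℕ) : SPair.{u} where
  obj k := ⟨Σ j, (k.unop ⟶ ⦋n j⦌), {x | ∀ i, x.2.toOrderHom i = 0}⟩
  map f := ⟨fun x => ⟨x.1, f.unop ≫ x.2⟩, fun x hx i => hx _⟩

namespace cones

variable {J : Type u} (n : J → ℕ)

theorem val_succAbove {k : ℕ} (i : Fin (k + 1)) (a : Fin k) :
    (i.succAbove a : ℕ) = if (a : ℕ) < i then (a : ℕ) else a + 1 := by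
  simp only [Fin.succAbove, Fin.lt_def, Fin.val_castSucc]
  split_ifs <;> rfl

theorem val_predAbove {k : ℕ} (i : Fin k) (a : Fin (k + 1)) :
    (i.predAbove a : ℕ) = if (i : ℕ) < a then (a : ℕ) - 1 else a := by
  simp only [Fin.predAbove, Fin.lt_def, Fin.val_castSucc]
  split_ifs <;> rfl

theorem ite_zero_congr {k m : ℕ} (f : Fin k → Fin (m + 1)) {p q : Prop} [Decidable p] [Decidable q]
    {x y : Fin k} (h : p ↔ q) (h' : ¬ p → (x : ℕ) = y) :
    (if p then 0 else f x) = if q then 0 else f y := by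
  by_cases hp : p
  · rw [if_pos hp, if_pos (h.1 hp)]
  · rw [if_neg hp, if_neg (fun hq => hp (h.2 hq)), Fin.ext (h' hp)]

/-- Extend a simplex of `Δ[m]` by the initial vertex: the first `i + 1` vertices are sent to the
initial vertex of `Δ[m]`, and the others are shifted. -/
def extend {k m : ℕ} (i : Fin (k + 1)) (θ : ⦋k⦌ ⟶ ⦋m⦌) : ⦋k + 1⦌ ⟶ ⦋m⦌ :=
  SimplexCategory.mkHom ⟨fun a => if a ≤ i.castSucc then 0 else θ.toOrderHom (i.predAbove a),
    fun a b hab => by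
      dsimp only
      split_ifs with h1 h2
      · exact le_rfl
      · exact Fin.zero_le _
      · exact absurd (hab.trans ‹_›) h1
      · exact θ.toOrderHom.monotone (Fin.predAbove_right_monotone _ hab)⟩

theorem extend_apply {k m : ℕ} (i : Fin (k + 1)) (θ : ⦋k⦌ ⟶ ⦋m⦌) (a : Fin (k + 2)) :
    (extend i θ).toOrderHom a = if a ≤ i.castSucc then 0 else θ.toOrderHom (i.predAbove a) := rfl

/-- The constant map to the initial vertices. -/
def const : cones n ⟶ cones n where
  app k := ⟨fun x => ⟨x.1, SimplexCategory.mkHom ⟨fun _ => 0, fun _ _ _ => le_rfl⟩⟩,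
    fun _ _ _ => rfl⟩

theorem mk_eq_mk_of_forall {k : ℕ} {j : J} {θ θ' : ⦋k⦌ ⟶ ⦋n j⦌}
    (h : ∀ a : Fin (k + 1), θ.toOrderHom a = θ'.toOrderHom a) :
    (⟨j, θ⟩ : ((cones n).obj (op ⦋k⦌)).carrier) = ⟨j, θ'⟩ := by
  congr 1
  ext a : 3
  exact h a

/-- The contraction of the simplices to their initial vertices. -/
def contraction : SimplicialObject.Homotopy (const n) (𝟙 (cones n)) where
  h {k} i := PairType.Hom.mk (P := (cones n).obj (op ⦋k⦌)) (Q := (cones n).obj (op ⦋k + 1⦌))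
    (fun x => ⟨x.1, extend i x.2⟩) (fun x hx a => by
      change (extend i x.2).toOrderHom a = 0
      rw [extend_apply]
      split_ifs
      · rfl
      · exact hx _)
  h_zero_comp_δ_zero k := by
    ext ⟨j, θ⟩
    refine mk_eq_mk_of_forall n fun a => ?_
    change (extend 0 θ).toOrderHom (Fin.succAbove 0 a) = _
    rw [extend_apply, if_neg (by simp)]
    exact congr_arg _ (Fin.ext (by simp))
  h_last_comp_δ_last k := by
    ext ⟨j, θ⟩
    refine mk_eq_mk_of_forall n fun a => ?_
    change (extend (Fin.last k) θ).toOrderHom (Fin.succAbove (Fin.last (k + 1)) a) = 0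
    rw [extend_apply, if_pos]
    have := a.2
    simp only [Fin.le_def, val_succAbove, Fin.val_castSucc, Fin.val_last]
    split_ifs <;> omega
  h_succ_comp_δ_castSucc_of_lt {k} i l hij := by
    ext ⟨j, θ⟩
    refine mk_eq_mk_of_forall n fun a => ?_
    change (extend l.succ θ).toOrderHom (Fin.succAbove i.castSucc a) =
      (extend l (SimplexCategory.δ i ≫ θ)).toOrderHom a
    rw [extend_apply, extend_apply]
    change _ = ite _ _ (θ.toOrderHom (Fin.succAbove i (l.predAbove a)))
    refine ite_zero_congr _ ?_ fun h => ?_ <;>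
      simp only [Fin.le_def, val_succAbove, val_predAbove, Fin.val_castSucc, Fin.val_succ] at * <;>
      split_ifs at * <;> omega
  h_succ_comp_δ_castSucc_succ {k} l := by
    ext ⟨j, θ⟩
    refine mk_eq_mk_of_forall n fun a => ?_
    change (extend l.succ θ).toOrderHom (Fin.succAbove l.castSucc.succ a) =
      (extend l.castSucc θ).toOrderHom (Fin.succAbove l.castSucc.succ a)
    rw [extend_apply, extend_apply]
    refine ite_zero_congr _ ?_ fun h => ?_ <;>
      simp only [Fin.le_def, val_succAbove, val_predAbove, Fin.val_castSucc, Fin.val_succ] at * <;>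
      split_ifs at * <;> omega
  h_castSucc_comp_δ_succ_of_lt {k} i l hji := by
    ext ⟨j, θ⟩
    refine mk_eq_mk_of_forall n fun a => ?_
    change (extend l.castSucc θ).toOrderHom (Fin.succAbove i.succ a) =
      (extend l (SimplexCategory.δ i ≫ θ)).toOrderHom a
    rw [extend_apply, extend_apply]
    change _ = ite _ _ (θ.toOrderHom (Fin.succAbove i (l.predAbove a)))
    refine ite_zero_congr _ ?_ fun h => ?_ <;>
      simp only [Fin.le_def, Fin.lt_def, val_succAbove, val_predAbove, Fin.val_castSucc, Fin.val_succ] at * <;>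
      split_ifs at * <;> omega
  h_comp_σ_castSucc_of_le {k} i l hij := by
    ext ⟨j, θ⟩
    refine mk_eq_mk_of_forall n fun a => ?_
    change (extend l θ).toOrderHom (Fin.predAbove i.castSucc a) =
      (extend l.succ (SimplexCategory.σ i ≫ θ)).toOrderHom a
    rw [extend_apply, extend_apply]
    change _ = ite _ _ (θ.toOrderHom (Fin.predAbove i (l.succ.predAbove a)))
    refine ite_zero_congr _ ?_ fun h => ?_ <;>
      simp only [Fin.le_def, val_predAbove, Fin.val_castSucc, Fin.val_succ] at * <;>
      split_ifs at * <;> omega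
  h_comp_σ_succ_of_lt {k} i l hji := by
    ext ⟨j, θ⟩
    refine mk_eq_mk_of_forall n fun a => ?_
    change (extend l θ).toOrderHom (Fin.predAbove i.succ a) =
      (extend l.castSucc (SimplexCategory.σ i ≫ θ)).toOrderHom a
    rw [extend_apply, extend_apply]
    change _ = ite _ _ (θ.toOrderHom (Fin.predAbove i (l.castSucc.predAbove a)))
    refine ite_zero_congr _ ?_ fun h => ?_ <;>
      simp only [Fin.le_def, val_predAbove, Fin.val_castSucc, Fin.val_succ] at * <;>
      split_ifs at * <;> omega

end cones

end SPair

end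

/-! ### Tensor products preserve weak equivalences -/

section

open Limits HomologicalComplex Opposite Simplicial TensorProduct

namespace SMod

open RatChain

/-- Cones remain acyclic after tensoring with any simplicial vector space. -/
theorem acyclic_cones_tensor {J : Type u} (n : J → ℕ) (W : SMod.{u}) :
    Acyclic (tensor (SPair.free.obj (SPair.cones n)) W) := by
  have H := tensorHomotopy ((SPair.cones.contraction n).whiskerRight PairType.free)
    (SimplicialObject.Homotopy.refl (𝟙 W))
  have hid : tensorMap (((SimplicialObject.whiskering PairType (ModuleCat ℚ)).obj
      PairType.free).map (𝟙 (SPair.cones n))) (𝟙 W) = 𝟙 _ := by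
    rw [CategoryTheory.Functor.map_id]
    refine NatTrans.ext (funext fun n => ?_)
    ext1
    apply TensorProduct.ext'
    intro x y
    rfl
  rw [hid] at H
  refine Acyclic.of_homotopy H fun k x => ?_
  have : PairType.freeMap ((SPair.cones.const n).app (op ⦋k⦌)) = 0 :=
    PairType.free_hom_ext fun x => by
      rw [PairType.freeMap_cls]
      exact PairType.cls_eq_zero _ fun _ => rfl
  change TensorProduct.map (PairType.freeMap ((SPair.cones.const n).app (op ⦋k⦌))) _ x = 0
  rw [this, TensorProduct.map_zero_left]
  rfl

section epi

variable (K : SMod.{u})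

/-- The map `⦋0⦌ ⟶ ⦋n⦌` selecting the initial vertex. -/
def initialVertex (n : ℕ) : (⦋0⦌ : SimplexCategory) ⟶ ⦋n⦌ :=
  SimplexCategory.mkHom ⟨fun _ => 0, fun _ _ _ => le_rfl⟩

/-- The simplices of `K` whose initial vertex vanishes. -/
def BasedSimplex : Type u :=
  Σ n : ℕ, {x : K.obj (op ⦋n⦌) // K.map (initialVertex n).op x = 0}

/-- The tautological linear map from the sum of cones, in one simplicial degree. -/
noncomputable def fromConesApp (k : SimplexCategoryᵒᵖ) :
    ((SPair.cones fun j : BasedSimplex K => j.1).obj k).Free →ₗ[ℚ] K.obj k :=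
  PairType.lift _ (fun x => K.map x.2.op x.1.2.1) (by
    rintro ⟨⟨n, x, hx⟩, θ⟩ hθ
    dsimp only
    have : θ = SimplexCategory.mkHom ⟨fun _ => 0, fun _ _ _ => le_rfl⟩ ≫ initialVertex n := by
      ext i : 3
      exact hθ i
    rw [this, op_comp, map_comp_apply, hx, map_zero])

theorem fromConesApp_cls {k : SimplexCategoryᵒᵖ} (j : BasedSimplex K) (θ : k.unop ⟶ ⦋j.1⦌) :
    fromConesApp K k (PairType.cls _ ⟨j, θ⟩) = K.map θ.op j.2.1 := PairType.lift_cls _ _ _ _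

/-- The tautological map from a sum of cones to a simplicial vector space. -/
noncomputable def fromCones :
    SPair.free.obj (SPair.cones fun j : BasedSimplex K => j.1) ⟶ K where
  app k := ModuleCat.ofHom (fromConesApp K k)
  naturality a b f := by
    ext1
    refine PairType.free_hom_ext fun x => ?_
    change fromConesApp K b (PairType.freeMap _ _) = K.map f (fromConesApp K a (PairType.cls _ _))
    rw [PairType.freeMap_cls]
    refine (fromConesApp_cls K _ _).trans (Eq.trans ?_
      (congr_arg (K.map f) (fromConesApp_cls K _ _).symm))
    rw [← map_comp_apply]
    rfl

theorem based_mem_range {n : ℕ} (x : K.obj (op ⦋n⦌)) (hx : K.map (initialVertex n).op x = 0)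
    {k : SimplexCategory} (θ : k ⟶ ⦋n⦌) : ∃ y, (fromCones K).app (op k) y = K.map θ.op x :=
  ⟨PairType.cls _ ⟨⟨n, x, hx⟩, θ⟩, fromConesApp_cls K _ _⟩

/-- If `H₀(K) = 0`, then `K` is generated by simplices with vanishing initial vertex: a vertex
`v = d₀ w - d₁ w` is a face of the based simplex `w - s₀ d₁ w`. -/
theorem fromCones_surjective (hK : AcyclicAt (chains.obj K) 0) (k) :
    Function.Surjective ((fromCones K).app k) := by
  intro x
  obtain ⟨n, hn⟩ : ∃ n, k.unop = ⦋n⦌ := ⟨_, rfl⟩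
  obtain rfl : k = op ⦋n⦌ := by rw [← hn]
  let c : (⦋n⦌ : SimplexCategory) ⟶ ⦋0⦌ := SimplexCategory.mkHom ⟨fun _ => 0, fun _ _ _ => le_rfl⟩
  have hc : initialVertex n ≫ c = 𝟙 _ := by
    ext i : 3
    exact Subsingleton.elim (α := Fin 1) _ _
  obtain ⟨w, hw⟩ : ∃ w : K.obj (op ⦋1⦌), (chains.obj K).d 1 0 w = K.map (initialVertex n).op x :=
    hK (K.map (initialVertex n).op x) (isCycle_zero _ _)
  have hw' : K.map (SimplexCategory.δ (0 : Fin 2)).op w -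
      K.map (SimplexCategory.δ (1 : Fin 2)).op w = K.map (initialVertex n).op x := by
    rw [← hw]
    have e : (chains.obj K).d 1 0 = K.δ (0 : Fin 2) - K.δ (1 : Fin 2) := by
      rw [AlgebraicTopology.alternatingFaceMapComplex_obj_d]
      simp [AlgebraicTopology.AlternatingFaceMapComplex.objD, Fin.sum_univ_two, sub_eq_add_neg]
    erw [e]
    rfl
  obtain ⟨y₁, hy₁⟩ := based_mem_range K (x - K.map c.op (K.map (initialVertex n).op x)) (by
    rw [map_sub, ← map_comp_apply (f := c.op), ← op_comp, hc, op_id, map_id_apply, sub_self]) (𝟙 _)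
  rw [op_id, map_id_apply] at hy₁
  let s : (⦋1⦌ : SimplexCategory) ⟶ ⦋0⦌ := SimplexCategory.σ 0
  have h1 : initialVertex 1 = SimplexCategory.δ (1 : Fin 2) := by
    ext i : 3
    obtain rfl : i = 0 := Subsingleton.elim (α := Fin 1) _ _
    rfl
  obtain ⟨y₂, hy₂⟩ := based_mem_range K
    (w - K.map s.op (K.map (SimplexCategory.δ (1 : Fin 2)).op w)) (by
      rw [map_sub, ← map_comp_apply (f := s.op), ← op_comp, h1]
      have : SimplexCategory.δ (1 : Fin 2) ≫ s = 𝟙 _ := by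
        ext i : 3
        exact Subsingleton.elim (α := Fin 1) _ _
      rw [this, op_id, map_id_apply, sub_self]) (c ≫ SimplexCategory.δ (0 : Fin 2))
  refine ⟨y₁ + y₂, ?_⟩
  rw [map_add, hy₁, hy₂, map_sub, ← hw', map_sub]
  have e1 : K.map (c ≫ SimplexCategory.δ (0 : Fin 2)).op w =
      K.map c.op (K.map (SimplexCategory.δ (0 : Fin 2)).op w) := by
    rw [op_comp, map_comp_apply]
  have e2 : K.map (c ≫ SimplexCategory.δ (0 : Fin 2)).op
      (K.map s.op (K.map (SimplexCategory.δ (1 : Fin 2)).op w)) =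
      K.map c.op (K.map (SimplexCategory.δ (1 : Fin 2)).op w) := by
    rw [← map_comp_apply, ← op_comp]
    congr 3
  rw [e1, e2]
  abel

end epi

theorem acyclic_cones {J : Type u} (n : J → ℕ) : Acyclic (SPair.free.obj (SPair.cones n)) := by
  refine Acyclic.of_homotopy (z := SPair.free.map (SPair.cones.const n)) (by
    have := (SPair.cones.contraction n).whiskerRight PairType.free
    rwa [CategoryTheory.Functor.map_id] at this) fun k x => ?_
  have : PairType.freeMap ((SPair.cones.const n).app (op ⦋k⦌)) = 0 :=
    PairType.free_hom_ext fun x => by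
      rw [PairType.freeMap_cls]
      exact PairType.cls_eq_zero _ fun _ => rfl
  exact LinearMap.congr_fun this x

/-- Tensoring with any simplicial vector space preserves acyclicity: by dimension shifting along
the resolutions by cones, every homology group of `K ⊗ W` vanishes. -/
theorem Acyclic.tensor {K : SMod.{u}} (hK : Acyclic K) (W : SMod.{u}) :
    Acyclic (tensor K W) := by
  intro n
  induction n generalizing K with
  | zero =>
    exact ((isShortExact_ker (fromCones_surjective K (hK 0))).tensor W).chains.acyclicAt_zero
      (acyclic_cones_tensor _ W 0)
  | succ n ih =>
    have h := isShortExact_ker (fromCones_surjective K (hK 0))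
    exact (h.tensor W).chains.acyclicAt_succ (acyclic_cones_tensor _ W (n + 1))
      (ih (h.chains.acyclic_left (acyclic_cones _) hK))

theorem WeakEquiv.tensor_of_injective {U V : SMod.{u}} {f : U ⟶ V} (hf : WeakEquiv f)
    (h : ∀ n, Function.Injective (f.app n)) (W : SMod.{u}) : WeakEquiv (tensorMap f (𝟙 W)) :=
  ((isShortExact_coker h).tensor W).chains.quasiIso_left
    (Acyclic.tensor ((isShortExact_coker h).chains.acyclic_right hf) W)

theorem WeakEquiv.tensor_of_surjective {U V : SMod.{u}} {f : U ⟶ V}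
    (hf : Acyclic (ker f)) (h : ∀ n, Function.Surjective (f.app n)) (W : SMod.{u}) :
    WeakEquiv (tensorMap f (𝟙 W)) :=
  ((isShortExact_ker h).tensor W).chains.quasiIso_right (Acyclic.tensor hf W)

/-- The cone `ℚ[Δ¹, 0] ⊗ U` on a simplicial vector space. -/
noncomputable abbrev cone (U : SMod.{u}) : SMod.{u} :=
  tensor (SPair.free.obj (SPair.cones fun _ : PUnit.{u + 1} => 1)) U

/-- The class of the vertex `1` of `Δ¹`, as a degenerate simplex. -/
noncomputable def coneBase (k : SimplexCategoryᵒᵖ) :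
    ((SPair.cones fun _ : PUnit.{u + 1} => 1).obj k).Free :=
  PairType.cls ((SPair.cones fun _ : PUnit.{u + 1} => 1).obj k)
    ⟨PUnit.unit, SimplexCategory.mkHom ⟨fun _ => 1, fun _ _ _ => le_rfl⟩⟩

theorem freeMap_coneBase {a b : SimplexCategoryᵒᵖ} (f : a ⟶ b) :
    PairType.freeMap ((SPair.cones fun _ : PUnit.{u + 1} => 1).map f) (coneBase a) =
      coneBase b :=
  PairType.freeMap_cls _ _

/-- The inclusion of a simplicial vector space as the base of its cone. -/
noncomputable def toCone (U : SMod.{u}) : U ⟶ cone U where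
  app k := ModuleCat.ofHom (TensorProduct.mk ℚ _ _ (coneBase k))
  naturality a b f := by
    ext x
    exact congr_arg (fun t => t ⊗ₜ[ℚ] U.map f x) (freeMap_coneBase f).symm

theorem toCone_injective (U : SMod.{u}) (k) : Function.Injective ((toCone U).app k) := by
  classical
  let φ := PairType.lift ((SPair.cones fun _ : PUnit.{u + 1} => 1).obj k)
    (fun x => if ∀ i, x.2.toOrderHom i = 0 then (0 : ℚ) else 1) (fun x hx => if_pos hx)
  let r : cone U |>.obj k →ₗ[ℚ] U.obj k :=
    (TensorProduct.lid ℚ _).toLinearMap ∘ₗ TensorProduct.map φ LinearMap.id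
  refine Function.LeftInverse.injective (g := r) fun x => ?_
  change φ (coneBase k) • x = x
  have hφ : φ (coneBase k) = 1 :=
    (PairType.lift_cls _ _ _ _).trans
      (if_neg fun h => absurd (show (1 : Fin 2) = 0 from h 0) (by decide))
  exact (congr_arg (· • x) hφ).trans (one_smul _ _)

/-- Künneth: tensoring with any simplicial vector space preserves weak equivalences. -/
theorem WeakEquiv.tensor {U V : SMod.{u}} {f : U ⟶ V} (hf : WeakEquiv f) (W : SMod.{u}) :
    WeakEquiv (tensorMap f (𝟙 W)) := by
  have hs : ∀ n, Function.Surjective ((fst V (cone U)).app n) := fun n x => ⟨(x, 0), rfl⟩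
  have hk : Acyclic (ker (fst V (cone U))) := by
    let g : ker (fst V (cone U)) ⟶ cone U :=
      { app := fun n => ModuleCat.ofHom (LinearMap.snd ℚ _ _ ∘ₗ (LinearMap.ker _).subtype) }
    refine RatChain.Acyclic.of_quasiIso (chains.map g) ?_ (acyclic_cones_tensor _ U)
    refine WeakEquiv.of_bijective fun n => ⟨?_, fun x => ⟨⟨(0, x), rfl⟩, rfl⟩⟩
    rintro ⟨⟨x, y⟩, hx⟩ ⟨⟨x', y'⟩, hx'⟩ h
    obtain rfl : x = 0 := hx
    obtain rfl : x' = 0 := hx'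
    obtain rfl : y = y' := h
    rfl
  have e : pair f (toCone U) ≫ fst V (cone U) = f := rfl
  have h1 : WeakEquiv (fst V (cone U)) := (isShortExact_ker hs).chains.quasiIso_right hk
  have h2 : WeakEquiv (pair f (toCone U)) := WeakEquiv.of_comp_right h1 (by rwa [e])
  have e' : tensorMap f (𝟙 W) =
      tensorMap (pair f (toCone U)) (𝟙 W) ≫ tensorMap (fst V (cone U)) (𝟙 W) := by
    rw [← tensorMap_comp, e, Category.comp_id]
  rw [e']
  exact (h2.tensor_of_injective (fun n x y h => toCone_injective U n (congr_arg Prod.snd h)) W).comp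
    (WeakEquiv.tensor_of_surjective hk hs W)

/-- The symmetry of the levelwise tensor product. -/
noncomputable def tensorComm (U V : SMod.{u}) : tensor U V ⟶ tensor V U where
  app n := ModuleCat.ofHom (TensorProduct.comm ℚ (U.obj n) (V.obj n)).toLinearMap
  naturality a b f := by
    ext1
    apply TensorProduct.ext'
    intro x y
    rfl

theorem tensorComm_weakEquiv (U V : SMod.{u}) : WeakEquiv (tensorComm U V) :=
  WeakEquiv.of_bijective fun n => (TensorProduct.comm ℚ (U.obj (op ⦋n⦌)) (V.obj (op ⦋n⦌))).bijective

theorem WeakEquiv.tensor' {U V : SMod.{u}} {f : U ⟶ V} (hf : WeakEquiv f) (W : SMod.{u}) :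
    WeakEquiv (tensorMap (𝟙 W) f) := by
  refine WeakEquiv.of_comp_right (tensorComm_weakEquiv W V) ?_
  have : tensorMap (𝟙 W) f ≫ tensorComm W V = tensorComm W U ≫ tensorMap f (𝟙 W) := by
    refine NatTrans.ext (funext fun n => ?_)
    ext1
    apply TensorProduct.ext'
    intro x y
    rfl
  rw [this]
  exact (tensorComm_weakEquiv _ _).comp (hf.tensor W)

end SMod

end

/-! ### Homotopy invariance of the powers -/

section

open Limits HomologicalComplex Opposite Simplicial TensorProduct

namespace PairType

/-- The coordinate at `none`. -/
def powHead (A : Type) {P : PairType.{u}} (x : ((pow (Option A)).obj P).carrier) : P.carrier :=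
  x none

/-- The remaining coordinates. -/
def powTail (A : Type) {P : PairType.{u}} (x : ((pow (Option A)).obj P).carrier) :
    ((pow A).obj P).carrier :=
  fun a => x (some a)

/-- Adding a coordinate. -/
def powCons (A : Type) {P : PairType.{u}} (p : P.carrier) (x : ((pow A).obj P).carrier) :
    ((pow (Option A)).obj P).carrier :=
  fun o => o.elim p x

/-- The isomorphism `ℚ[P ^ (A ⊔ *)] / fat = ℚ[P] / ℚ[F] ⊗ ℚ[P ^ A] / fat`. -/
noncomputable def powOption (A : Type) (P : PairType.{u}) :
    ((pow (Option A)).obj P).Free →ₗ[ℚ] P.Free ⊗[ℚ] ((pow A).obj P).Free :=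
  lift _ (fun x => P.cls (powHead A x) ⊗ₜ ((pow A).obj P).cls (powTail A x)) (by
    rintro x ⟨(_ | a), ha⟩
    · rw [cls_eq_zero _ (x := powHead A x) ha, zero_tmul]
    · rw [cls_eq_zero _ (x := powTail A x) ⟨a, ha⟩, tmul_zero])

theorem powOption_cls (A : Type) (P : PairType.{u}) (x : ((pow (Option A)).obj P).carrier) :
    powOption A P (((pow (Option A)).obj P).cls x) =
      P.cls (powHead A x) ⊗ₜ ((pow A).obj P).cls (powTail A x) := lift_cls _ _ _ _

theorem powOption_bijective (A : Type) (P : PairType.{u}) :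
    Function.Bijective (powOption A P) := by
  let g : P.Free ⊗[ℚ] ((pow A).obj P).Free →ₗ[ℚ] ((pow (Option A)).obj P).Free :=
    TensorProduct.lift (P.lift (fun p => ((pow A).obj P).lift
      (fun x => ((pow (Option A)).obj P).cls (powCons A p x))
        fun x ⟨a, ha⟩ => cls_eq_zero _ ⟨some a, ha⟩)
      fun p hp => free_hom_ext fun x => by
        rw [lift_cls]
        exact cls_eq_zero _ ⟨none, hp⟩)
  have hg : ∀ p x, g (P.cls p ⊗ₜ ((pow A).obj P).cls x) =
      ((pow (Option A)).obj P).cls (powCons A p x) := fun p x => by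
    simp only [g, lift.tmul, lift_cls]
  have h1 : g ∘ₗ powOption A P = LinearMap.id := free_hom_ext fun x => by
    rw [LinearMap.comp_apply, powOption_cls, hg]
    refine congr_arg _ (funext fun o => ?_)
    cases o <;> rfl
  have h2 : powOption A P ∘ₗ g = LinearMap.id := by
    apply TensorProduct.ext
    refine free_hom_ext fun p => free_hom_ext fun x => ?_
    change powOption A P (g (P.cls p ⊗ₜ ((pow A).obj P).cls x)) = _
    rw [hg, powOption_cls]
    rfl
  exact ⟨Function.LeftInverse.injective (g := g) fun x => LinearMap.congr_fun h1 x,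
    Function.RightInverse.surjective (g := g) fun x => LinearMap.congr_fun h2 x⟩

end PairType

namespace SPair

/-- The simplicial vector space `ℚ[S ^ A] / ℚ[fat]`. -/
noncomputable abbrev tensorPower (A : Type) : SPair.{u} ⥤ SMod.{u} :=
  (SimplicialObject.whiskering _ _).obj (PairType.pow A ⋙ PairType.free)

/-- A bijection of exponents induces a transformation of powers. -/
def powReindex {A B : Type} (e : A ≃ B) : PairType.pow.{u} B ⟶ PairType.pow A where
  app P := PairType.Hom.mk (P := (PairType.pow B).obj P) (Q := (PairType.pow A).obj P)
    (fun x => x ∘ e) (fun x ⟨b, hb⟩ => ⟨e.symm b, by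
      change x (e (e.symm b)) ∈ P.sub
      rwa [e.apply_symm_apply]⟩)

theorem powReindex_weakEquiv {A B : Type} (e : A ≃ B) (S : SPair.{u}) :
    WeakEquiv (Functor.whiskerLeft S (powReindex e)) := by
  refine WeakEquiv.of_bijOn _ fun n => ⟨fun x hx ⟨a, ha⟩ => hx ⟨e a, ha⟩, fun x _ y _ h => ?_,
    fun x hx => ⟨x ∘ e.symm, fun ⟨a, ha⟩ => hx ⟨e.symm a, ha⟩, ?_⟩⟩
  · exact (Function.Surjective.injective_comp_right e.surjective) h
  · funext a
    exact congr_arg x (e.symm_apply_apply a)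

theorem tensorPower_reindex {A B : Type} (e : A ≃ B) {S T : SPair.{u}} {f : S ⟶ T}
    (h : SMod.WeakEquiv ((tensorPower A).map f)) : SMod.WeakEquiv ((tensorPower B).map f) := by
  refine SMod.WeakEquiv.of_comp_right (powReindex_weakEquiv e T) ?_
  have : (tensorPower B).map f ≫ SPair.free.map (Functor.whiskerLeft T (powReindex e)) =
      SPair.free.map (Functor.whiskerLeft S (powReindex e)) ≫ (tensorPower A).map f := by
    refine NatTrans.ext (funext fun n => ?_)
    ext1
    refine PairType.free_hom_ext fun x => ?_
    change PairType.freeMap ((powReindex e).app (T.obj n)) (PairType.freeMap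
        ((PairType.pow B).map (f.app n)) (PairType.cls _ x)) =
      PairType.freeMap ((PairType.pow A).map (f.app n)) (PairType.freeMap
        ((powReindex e).app (S.obj n)) (PairType.cls _ x))
    simp only [PairType.freeMap_cls]
    rfl
  rw [this]
  exact SMod.WeakEquiv.comp (powReindex_weakEquiv e S) h

theorem tensorPower_empty {S T : SPair.{u}} (f : S ⟶ T) :
    SMod.WeakEquiv ((tensorPower PEmpty).map f) := by
  refine SMod.WeakEquiv.of_bijective fun n => ?_
  have hsub : ∀ U : SPair.{u}, Subsingleton ((PairType.pow PEmpty).obj (U.obj (op ⦋n⦌))).carrier :=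
    fun U => inferInstanceAs (Subsingleton (PEmpty → _))
  let g := PairType.freeMap (PairType.Hom.mk (P := (PairType.pow PEmpty).obj (T.obj (op ⦋n⦌)))
    (Q := (PairType.pow PEmpty).obj (S.obj (op ⦋n⦌))) (fun _ a => a.elim)
    (fun x ⟨a, _⟩ => a.elim))
  let h := PairType.freeMap ((PairType.pow PEmpty).map (f.app (op ⦋n⦌)))
  have h1 : g ∘ₗ h = LinearMap.id := PairType.free_hom_ext fun x => by
    rw [LinearMap.comp_apply, PairType.freeMap_cls, PairType.freeMap_cls]
    exact congr_arg _ (@Subsingleton.elim _ (hsub S) _ _)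
  have h2 : h ∘ₗ g = LinearMap.id := PairType.free_hom_ext fun x => by
    rw [LinearMap.comp_apply, PairType.freeMap_cls, PairType.freeMap_cls]
    exact congr_arg _ (@Subsingleton.elim _ (hsub T) _ _)
  exact ⟨Function.LeftInverse.injective (g := g) fun x => LinearMap.congr_fun h1 x,
    Function.RightInverse.surjective (g := g) fun x => LinearMap.congr_fun h2 x⟩

/-- The isomorphism `ℚ[S ^ (A ⊔ *)] / fat = ℚ[S] ⊗ ℚ[S ^ A] / fat`. -/
noncomputable def tensorPowerOption (A : Type) (S : SPair.{u}) :
    (tensorPower (Option A)).obj S ⟶ SMod.tensor (SPair.free.obj S) ((tensorPower A).obj S) where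
  app n := ModuleCat.ofHom (PairType.powOption A (S.obj n))
  naturality a b g := by
    ext1
    refine PairType.free_hom_ext fun x => ?_
    change PairType.powOption A (S.obj b) (PairType.freeMap ((PairType.pow (Option A)).map (S.map g))
        (PairType.cls _ x)) =
      TensorProduct.map (PairType.freeMap (S.map g))
        (PairType.freeMap ((PairType.pow A).map (S.map g)))
        (PairType.powOption A (S.obj a) (PairType.cls _ x))
    rw [PairType.freeMap_cls, PairType.powOption_cls, PairType.powOption_cls,
      TensorProduct.map_tmul, PairType.freeMap_cls, PairType.freeMap_cls]
    rfl

theorem tensorPower_option {S T : SPair.{u}} {f : S ⟶ T} (hf : WeakEquiv f) {A : Type}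
    (h : SMod.WeakEquiv ((tensorPower A).map f)) :
    SMod.WeakEquiv ((tensorPower (Option A)).map f) := by
  have hφ (S : SPair.{u}) : SMod.WeakEquiv (tensorPowerOption A S) :=
    SMod.WeakEquiv.of_bijective fun n => PairType.powOption_bijective A _
  refine SMod.WeakEquiv.of_comp_right (hφ T) ?_
  have : (tensorPower (Option A)).map f ≫ tensorPowerOption A T = tensorPowerOption A S ≫
      SMod.tensorMap (SPair.free.map f) (𝟙 _) ≫ SMod.tensorMap (𝟙 _) ((tensorPower A).map f) := by
    refine NatTrans.ext (funext fun n => ?_)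
    ext1
    refine PairType.free_hom_ext fun x => ?_
    change PairType.powOption A (T.obj n) (PairType.freeMap ((PairType.pow (Option A)).map (f.app n))
        (PairType.cls _ x)) =
      TensorProduct.map LinearMap.id (PairType.freeMap ((PairType.pow A).map (f.app n)))
        (TensorProduct.map (PairType.freeMap (f.app n)) LinearMap.id
          (PairType.powOption A (S.obj n) (PairType.cls _ x)))
    rw [PairType.freeMap_cls, PairType.powOption_cls, PairType.powOption_cls,
      TensorProduct.map_tmul, TensorProduct.map_tmul, PairType.freeMap_cls, LinearMap.id_apply,
      LinearMap.id_apply, PairType.freeMap_cls]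
    rfl
  rw [this]
  exact (hφ S).comp ((SMod.WeakEquiv.tensor hf _).comp (SMod.WeakEquiv.tensor' h _))

theorem WeakEquiv.tensorPower {S T : SPair.{u}} {f : S ⟶ T} (hf : WeakEquiv f) (A : Type)
    [Finite A] : SMod.WeakEquiv ((tensorPower A).map f) := by
  induction A using Finite.induction_empty_option with
  | of_equiv e ih => exact tensorPower_reindex e ih
  | h_empty => exact tensorPower_empty f
  | h_option ih => exact tensorPower_option hf ih

/-- A weak equivalence of simplicial pairs induces weak equivalences of tensor powers. -/
theorem WeakEquiv.tensorPowersMap {S T : SPair.{u}} {f : S ⟶ T} (hf : WeakEquiv f)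
    (A : FinSurjᵒᵖ) : SMod.WeakEquiv ((SPair.tensorPowersMap f).app A) :=
  haveI := A.unop.finite
  hf.tensorPower A.unop.carrier

end SPair

end

/-! ### Zigzags of simplicial right modules -/

section

open Limits HomologicalComplex Opposite Simplicial TensorProduct

/-- Right `Ω`-modules in simplicial vector spaces. -/
abbrev OmegaSMod : Type (u + 1) := FinSurjᵒᵖ ⥤ SMod.{u}

namespace OmegaSMod

/-- There is a morphism `M ⟶ N` that is a weak equivalence for each finite set. -/
def HasWeakEquiv (M N : OmegaSMod.{u}) : Prop :=
  ∃ f : M ⟶ N, ∀ A, SMod.WeakEquiv (f.app A)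

theorem HasWeakEquiv.of_iso {M N : OmegaSMod.{u}} (e : M ≅ N) : HasWeakEquiv M N :=
  ⟨e.hom, fun _ => SMod.WeakEquiv.of_isIso _⟩

open AlgebraicTopology AlgebraicTopology.DoldKan CategoryTheory.Abelian

/-- The projection of the alternating face map complex onto the normalized complex. -/
noncomputable def toNormalized : chains.{u} ⟶ Abelian.DoldKan.N where
  app U := PInftyToNormalizedMooreComplex U
  naturality _ _ f := PInftyToNormalizedMooreComplex_naturality f

theorem quasiIso_toNormalized (U : SMod.{u}) : QuasiIso (toNormalized.app U) :=
  (homotopyEquivNormalizedMooreComplexAlternatingFaceMapComplex (Y := U)).quasiIso_inv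

theorem quasiIso_N_map_iff {U V : SMod.{u}} (f : U ⟶ V) :
    QuasiIso (Abelian.DoldKan.N.map f) ↔ SMod.WeakEquiv f := by
  have := quasiIso_toNormalized U
  have := quasiIso_toNormalized V
  rw [SMod.WeakEquiv, ← quasiIso_iff_comp_right _ (toNormalized.app V), toNormalized.naturality,
    quasiIso_iff_comp_left]

theorem weakEquiv_Γ_map {K L : RatChain.{u}} (f : K ⟶ L) [QuasiIso f] :
    SMod.WeakEquiv (Abelian.DoldKan.Γ.map f) := by
  rw [← quasiIso_N_map_iff]
  have := (Abelian.DoldKan.equivalence (A := ModuleCat.{u} ℚ)).counitIso.hom.naturality f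
  refine quasiIso_of_arrow_mk_iso f _ ?_
  exact (Arrow.isoMk ((Abelian.DoldKan.equivalence (A := ModuleCat.{u} ℚ)).counitIso.app K)
    ((Abelian.DoldKan.equivalence (A := ModuleCat.{u} ℚ)).counitIso.app L) this.symm).symm

/-- By the Dold–Kan correspondence, zigzags of quasi-isomorphisms of chain complexes lift to zigzags
of weak equivalences of simplicial vector spaces. -/
theorem eqvGen_of_chains {M N : OmegaSMod.{u}}
    (h : Relation.EqvGen RightOmegaModule.HasQuasiIso (M ⋙ chains) (N ⋙ chains)) :
    Relation.EqvGen HasWeakEquiv M N := by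
  have hΓ : ∀ P Q : RightOmegaModule.{u}, Relation.EqvGen RightOmegaModule.HasQuasiIso P Q →
      Relation.EqvGen HasWeakEquiv (P ⋙ Abelian.DoldKan.Γ) (Q ⋙ Abelian.DoldKan.Γ) := by
    intro P Q h
    induction h with
    | rel _ _ h =>
      obtain ⟨f, hf⟩ := h
      exact .rel _ _ ⟨Functor.whiskerRight f _, fun A => by
        have := hf A
        exact weakEquiv_Γ_map (f.app A)⟩
    | refl => exact .refl _
    | symm _ _ _ ih => exact .symm _ _ ih
    | trans _ _ _ _ _ ih ih' => exact .trans _ _ _ ih ih'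
  have hN : ∀ P : OmegaSMod.{u}, RightOmegaModule.HasQuasiIso (P ⋙ chains)
      (P ⋙ Abelian.DoldKan.N) := fun P =>
    ⟨Functor.whiskerLeft P toNormalized, fun A => quasiIso_toNormalized _⟩
  have hu : ∀ P : OmegaSMod.{u}, HasWeakEquiv P
      ((P ⋙ Abelian.DoldKan.N) ⋙ Abelian.DoldKan.Γ) := fun P =>
    .of_iso (Functor.isoWhiskerLeft P
      (Abelian.DoldKan.equivalence (A := ModuleCat.{u} ℚ)).unitIso)
  refine (Relation.EqvGen.rel _ _ (hu M)).trans _ _ _ (.trans _ _ _ (hΓ _ _ ?_)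
    (.symm _ _ (.rel _ _ (hu N))))
  exact (Relation.EqvGen.symm _ _ (.rel _ _ (hN M))).trans _ _ _
    (h.trans _ _ _ (.rel _ _ (hN N)))

theorem eqvGen_chains {M N : OmegaSMod.{u}} (h : Relation.EqvGen HasWeakEquiv M N) :
    Relation.EqvGen RightOmegaModule.HasQuasiIso (M ⋙ chains) (N ⋙ chains) := by
  induction h with
  | rel _ _ h =>
    obtain ⟨f, hf⟩ := h
    exact .rel _ _ ⟨Functor.whiskerRight f _, hf⟩
  | refl => exact .refl _
  | symm _ _ _ ih => exact .symm _ _ ih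
  | trans _ _ _ _ _ ih ih' => exact .trans _ _ _ ih ih'

end OmegaSMod

end

/-! ### Convolution products -/

section

open Limits HomologicalComplex Opposite Simplicial TensorProduct

namespace SMod

open scoped Classical in
/-- The levelwise direct sum. -/
noncomputable def directSum {I : Type} (W : I → SMod.{u}) : SMod.{u} where
  obj n := ModuleCat.of ℚ (DirectSum I fun i => (W i).obj n)
  map f := ModuleCat.ofHom (DirectSum.lmap fun i => ((W i).map f).hom)
  map_id n := by
    ext1
    refine DirectSum.linearMap_ext _ fun i => LinearMap.ext fun x => ?_
    change DirectSum.lmap _ (DirectSum.lof ℚ I (fun i => (W i).obj n) i x) = _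
    rw [DirectSum.lmap_lof]
    exact congr_arg _ (map_id_apply (W i) n x)
  map_comp {a b c} f g := by
    ext1
    refine DirectSum.linearMap_ext _ fun i => LinearMap.ext fun x => ?_
    change DirectSum.lmap _ (DirectSum.lof ℚ I (fun i => (W i).obj a) i x) = DirectSum.lmap _
      (DirectSum.lmap _ (DirectSum.lof ℚ I (fun i => (W i).obj a) i x))
    rw [DirectSum.lmap_lof, DirectSum.lmap_lof, DirectSum.lmap_lof]
    exact congr_arg _ (map_comp_apply (W i) f g x)

open scoped Classical in
/-- The inclusion of a summand. -/
noncomputable def ι {I : Type} (W : I → SMod.{u}) (i : I) : W i ⟶ directSum W where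
  app n := ModuleCat.ofHom (DirectSum.lof ℚ I (fun i => (W i).obj n) i)
  naturality a b f := by
    ext x
    exact (DirectSum.lmap_lof (fun i => ((W i).map f).hom) i x).symm

/-- The projection onto a summand. -/
noncomputable def π {I : Type} (W : I → SMod.{u}) (i : I) : directSum W ⟶ W i where
  app n := ModuleCat.ofHom (DirectSum.component ℚ I (fun i => (W i).obj n) i)

open scoped Classical in
theorem linearMap_ext_ι {I : Type} {W : I → SMod.{u}} {n : SimplexCategoryᵒᵖ} {M : Type*}
    [AddCommGroup M] [Module ℚ M] {f g : (directSum W).obj n →ₗ[ℚ] M}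
    (h : ∀ i x, f ((ι W i).app n x) = g ((ι W i).app n x)) : f = g :=
  DirectSum.linearMap_ext (M := fun i => (W i).obj n) ℚ fun i => LinearMap.ext (h i)

theorem directSum_hom_ext {I : Type} {W : I → SMod.{u}} {V : SMod.{u}} {f g : directSum W ⟶ V}
    (h : ∀ i, ι W i ≫ f = ι W i ≫ g) : f = g := by
  refine NatTrans.ext (funext fun n => ?_)
  ext1
  exact linearMap_ext_ι fun i x =>
    ConcreteCategory.congr_hom (congr_arg (fun t => NatTrans.app t n) (h i)) x

open scoped Classical in
/-- The map out of a direct sum with given restrictions to the summands. -/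
noncomputable def desc {I : Type} {W : I → SMod.{u}} {V : SMod.{u}} (f : ∀ i, W i ⟶ V) :
    directSum W ⟶ V where
  app n := ModuleCat.ofHom (DirectSum.toModule ℚ I (V.obj n) fun i => ((f i).app n).hom)
  naturality a b g := by
    ext1
    refine linearMap_ext_ι fun i x => ?_
    have h : ∀ c (z : (W i).obj c), DirectSum.toModule ℚ I (V.obj c)
        (fun i => ((f i).app c).hom) ((ι W i).app c z) = (f i).app c z := fun c z =>
      DirectSum.toModule_lof (M := fun i => (W i).obj c) ℚ i z
    change DirectSum.toModule ℚ I (V.obj b) (fun i => ((f i).app b).hom)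
        ((directSum W).map g ((ι W i).app a x)) =
      V.map g (DirectSum.toModule ℚ I (V.obj a) (fun i => ((f i).app a).hom) ((ι W i).app a x))
    rw [← naturality_apply, h, h]
    exact naturality_apply (f i) g x

open scoped Classical in
theorem ι_desc {I : Type} {W : I → SMod.{u}} {V : SMod.{u}} (f : ∀ i, W i ⟶ V) (i : I) :
    ι W i ≫ desc f = f i := by
  refine NatTrans.ext (funext fun n => ?_)
  ext x
  exact DirectSum.toModule_lof (M := fun i => (W i).obj n) (φ := fun i => ((f i).app n).hom) ℚ i x

theorem desc_app_ι {I : Type} {W : I → SMod.{u}} {V : SMod.{u}} (f : ∀ i, W i ⟶ V) (i : I)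
    (n : SimplexCategoryᵒᵖ) (x : (W i).obj n) :
    (desc f).app n ((ι W i).app n x) = (f i).app n x :=
  ConcreteCategory.congr_hom (congr_arg (fun t => NatTrans.app t n) (ι_desc f i)) x

theorem ι_desc_assoc {I : Type} {W : I → SMod.{u}} {V V' : SMod.{u}} (f : ∀ i, W i ⟶ V) (i : I)
    (h : V ⟶ V') : ι W i ≫ desc f ≫ h = f i ≫ h := by
  rw [← Category.assoc, ι_desc]

theorem π_injective {I : Type} {W : I → SMod.{u}} {n : SimplexCategoryᵒᵖ}
    {x y : (directSum W).obj n} (h : ∀ i, (π W i).app n x = (π W i).app n y) : x = y :=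
  DFinsupp.ext h

open scoped Classical in
theorem exists_π_eq {I : Type} {W W' : I → SMod.{u}} {n m : SimplexCategoryᵒᵖ}
    (x : (directSum W').obj n) (y : ∀ i, (W i).obj m) (h : ∀ i, (π W' i).app n x = 0 → y i = 0) :
    ∃ z : (directSum W).obj m, ∀ i, (π W i).app m z = y i := by
  refine ⟨DFinsupp.mk (DFinsupp.support (β := fun i => (W' i).obj n) x) fun i => y i, fun i => ?_⟩
  change (DFinsupp.mk (DFinsupp.support (β := fun i => (W' i).obj n) x) fun i => y i :
    Π₀ i, (W i).obj m) i = _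
  by_cases hi : i ∈ DFinsupp.support (β := fun i => (W' i).obj n) x
  · rw [DFinsupp.mk_of_mem hi]
  · rw [DFinsupp.mk_of_notMem hi]
    exact (h i (DFinsupp.notMem_support_iff.1 hi)).symm

/-- The map of direct sums given by maps of the summands. -/
noncomputable def directSumMap {I : Type} {W W' : I → SMod.{u}} (f : ∀ i, W i ⟶ W' i) :
    directSum W ⟶ directSum W' :=
  desc fun i => f i ≫ ι W' i

open scoped Classical in
theorem directSumMap_π {I : Type} {W W' : I → SMod.{u}} (f : ∀ i, W i ⟶ W' i) (i : I) :
    directSumMap f ≫ π W' i = π W i ≫ f i := by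
  refine directSum_hom_ext fun j => ?_
  rw [directSumMap, ι_desc_assoc]
  refine NatTrans.ext (funext fun n => ?_)
  ext x
  change DirectSum.component ℚ I (fun i => (W' i).obj n) i (DirectSum.lof ℚ I
      (fun i => (W' i).obj n) j ((f j).app n x)) =
    (f i).app n (DirectSum.component ℚ I (fun i => (W i).obj n) i (DirectSum.lof ℚ I
      (fun i => (W i).obj n) j x))
  rw [DirectSum.component.of, DirectSum.component.of]
  split_ifs with h
  · subst h; rfl
  · rw [map_zero]

open RatChain in
theorem WeakEquiv.directSum {I : Type} {W W' : I → SMod.{u}} {f : ∀ i, W i ⟶ W' i}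
    (hf : ∀ i, WeakEquiv (f i)) : WeakEquiv (directSumMap f) := by
  have hf' := fun i => (quasiIso_iff_cycles (chains.map (f i))).1 (hf i)
  have hπ : ∀ i n (x : (SMod.directSum W).obj (op ⦋n⦌)),
      (π W' i).app _ ((directSumMap f).app _ x) = (f i).app _ ((π W i).app _ x) := fun i n x =>
    ConcreteCategory.congr_hom (congr_arg (fun t => NatTrans.app t (op ⦋n⦌))
      (directSumMap_π f i)) x
  have hd : ∀ (V : I → SMod.{u}) i n (x : (chains.obj (SMod.directSum V)).X (n + 1)),
      (chains.obj (V i)).d (n + 1) n ((chains.map (π V i)).f (n + 1) x) =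
        (chains.map (π V i)).f n ((chains.obj (SMod.directSum V)).d (n + 1) n x) := fun V i n x =>
    comm_apply (chains.map (π V i)) _ _ x
  refine (quasiIso_iff_cycles _).2 fun n => ⟨?_, ?_⟩
  · rintro x hx ⟨y, hy⟩
    have : ∀ i, ∃ z, (chains.obj (W i)).d (n + 1) n z = (chains.map (π W i)).f n x ∧
        ((chains.map (π W i)).f n x = 0 → z = 0) := by
      intro i
      by_cases h : (chains.map (π W i)).f n x = 0
      · exact ⟨0, by rw [h, map_zero], fun _ => rfl⟩
      · obtain ⟨z, hz⟩ := (hf' i n).1 _ (hx.map (chains.map (π W i)))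
          ⟨(chains.map (π W' i)).f _ y, by rw [hd, hy]; exact hπ i n x⟩
        exact ⟨z, hz, fun h' => absurd h' h⟩
    choose z hz hz' using this
    obtain ⟨Z, hZ⟩ := exists_π_eq (m := op ⦋n + 1⦌) x z hz'
    refine ⟨Z, π_injective fun i => ?_⟩
    refine (hd W i n Z).symm.trans ((congr_arg _ (hZ i)).trans (hz i))
  · intro x hx
    have : ∀ i, ∃ z y, IsCycle (chains.obj (W i)) n z ∧ (chains.map (π W' i)).f n x =
        (chains.map (f i)).f n z + (chains.obj (W' i)).d (n + 1) n y ∧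
        ((chains.map (π W' i)).f n x = 0 → z = 0 ∧ y = 0) := by
      intro i
      by_cases h : (chains.map (π W' i)).f n x = 0
      · exact ⟨0, 0, fun m => map_zero _, by rw [h, map_zero, map_zero, add_zero], fun _ => ⟨rfl, rfl⟩⟩
      · obtain ⟨z, y, hz, e⟩ := (hf' i n).2 _ (hx.map (chains.map (π W' i)))
        exact ⟨z, y, hz, e, fun h' => absurd h' h⟩
    choose z y hz e h0 using this
    obtain ⟨Z, hZ⟩ := exists_π_eq (m := op ⦋n⦌) x z fun i h => (h0 i h).1
    obtain ⟨Y, hY⟩ := exists_π_eq (m := op ⦋n + 1⦌) x y fun i h => (h0 i h).2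
    refine ⟨Z, Y, ?_, π_injective fun i => ?_⟩
    · cases n with
      | zero => exact isCycle_zero _ _
      | succ n =>
        rw [isCycle_succ_iff]
        refine π_injective fun i => ?_
        rw [map_zero]
        refine (hd W i n Z).symm.trans ?_
        have h2 : (chains.map (π W i)).f (n + 1) Z = z i := hZ i
        rw [h2]
        exact hz i n
    · refine (e i).trans ?_
      rw [map_add]
      refine congr_arg₂ (· + ·) ?_ ?_
      · rw [← hZ i]; exact (hπ i n Z).symm
      · rw [← hY i]; exact hd W' i n Y

theorem tensorMap_id (U V : SMod.{u}) : tensorMap (𝟙 U) (𝟙 V) = 𝟙 (tensor U V) := by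
  refine NatTrans.ext (funext fun n => ?_)
  ext1
  apply TensorProduct.ext'
  intro x y
  rfl

end SMod

/-- The fibre over `b` of a map to `Bool`. -/
def FinSurj.fib (A : FinSurj) (χ : A.carrier → Bool) (b : Bool) : FinSurj :=
  haveI := A.finite
  ⟨{a // χ a = b}⟩

/-- The restriction of a surjection to fibres. -/
def FinSurj.fibMap {A B : FinSurj} (g : A ⟶ B) (χ : B.carrier → Bool) (b : Bool) :
    A.fib (χ ∘ g.1) b ⟶ B.fib χ b :=
  ⟨fun a => ⟨g.1 a.1, a.2⟩, fun c => by
    obtain ⟨a, ha⟩ := g.2 c.1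
    exact ⟨⟨a, (congr_arg χ ha).trans c.2⟩, Subtype.ext ha⟩⟩

namespace OmegaSMod

/-- The convolution product: `(M ⊛ N)(A)` is the direct sum over the decompositions `A = A₀ ⊔ A₁`
of `M(A₀) ⊗ N(A₁)`; the decompositions are encoded by maps to `Bool`. -/
noncomputable def conv (M N : OmegaSMod.{u}) : OmegaSMod.{u} where
  obj A := SMod.directSum fun χ : A.unop.carrier → Bool =>
    SMod.tensor (M.obj (op (A.unop.fib χ false))) (N.obj (op (A.unop.fib χ true)))
  map {A B} f := SMod.desc fun χ => SMod.tensorMap (M.map (FinSurj.fibMap f.unop χ false).op)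
    (N.map (FinSurj.fibMap f.unop χ true).op) ≫ SMod.ι (fun χ : B.unop.carrier → Bool =>
      SMod.tensor (M.obj (op (B.unop.fib χ false))) (N.obj (op (B.unop.fib χ true))))
        (χ ∘ f.unop.1)
  map_id A := by
    refine SMod.directSum_hom_ext fun χ => ?_
    rw [SMod.ι_desc, Category.comp_id]
    have h : ∀ (P : OmegaSMod.{u}) b, P.map (FinSurj.fibMap (𝟙 A : A ⟶ A).unop χ b).op =
        𝟙 (P.obj (op (A.unop.fib χ b))) := fun P b => P.map_id _
    exact (congr_arg (· ≫ SMod.ι (fun χ : A.unop.carrier → Bool => SMod.tensor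
      (M.obj (op (A.unop.fib χ false))) (N.obj (op (A.unop.fib χ true)))) χ)
        ((congr_arg₂ SMod.tensorMap (h M false) (h N true)).trans (SMod.tensorMap_id _ _))).trans
          (Category.id_comp _)
  map_comp {A B C} f g := by
    refine SMod.directSum_hom_ext fun χ => ?_
    rw [SMod.ι_desc, SMod.ι_desc_assoc, Category.assoc, SMod.ι_desc]
    have h : ∀ (P : OmegaSMod.{u}) b, P.map (FinSurj.fibMap (f ≫ g).unop χ b).op =
        P.map (FinSurj.fibMap f.unop χ b).op ≫
          P.map (FinSurj.fibMap g.unop (χ ∘ f.unop.1) b).op := fun P b =>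
      P.map_comp (FinSurj.fibMap f.unop χ b).op (FinSurj.fibMap g.unop (χ ∘ f.unop.1) b).op
    rw [h, h, SMod.tensorMap_comp, Category.assoc]
    rfl

/-- The functoriality of the convolution product. -/
noncomputable def convMap {M M' N N' : OmegaSMod.{u}} (f : M ⟶ M') (g : N ⟶ N') :
    conv M N ⟶ conv M' N' where
  app A := SMod.directSumMap fun χ =>
    SMod.tensorMap (f.app (op (A.unop.fib χ false))) (g.app (op (A.unop.fib χ true)))
  naturality A B h := by
    refine SMod.directSum_hom_ext fun χ => ?_
    dsimp only [conv, SMod.directSumMap]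
    rw [SMod.ι_desc_assoc, SMod.ι_desc_assoc, Category.assoc, Category.assoc, SMod.ι_desc,
      SMod.ι_desc, ← Category.assoc, ← Category.assoc, ← SMod.tensorMap_comp,
      ← SMod.tensorMap_comp, f.naturality, g.naturality]

/-- By the Künneth property `SMod.WeakEquiv.tensor`, weak equivalences are compatible with convolution. -/
theorem HasWeakEquiv.conv {M M' N N' : OmegaSMod.{u}} (h : HasWeakEquiv M M')
    (h' : HasWeakEquiv N N') : HasWeakEquiv (conv M N) (conv M' N') := by
  obtain ⟨f, hf⟩ := h
  obtain ⟨g, hg⟩ := h'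
  refine ⟨convMap f g, fun A => SMod.WeakEquiv.directSum fun χ => ?_⟩
  have : SMod.tensorMap (f.app (op (A.unop.fib χ false))) (g.app (op (A.unop.fib χ true))) =
      SMod.tensorMap (f.app _) (𝟙 _) ≫ SMod.tensorMap (𝟙 _) (g.app _) := by
    rw [← SMod.tensorMap_comp, Category.id_comp, Category.comp_id]
  rw [this]
  exact ((hf _).tensor _).comp ((hg _).tensor' _)

theorem eqvGen_conv {M M' N N' : OmegaSMod.{u}} (h : Relation.EqvGen HasWeakEquiv M M')
    (h' : Relation.EqvGen HasWeakEquiv N N') :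
    Relation.EqvGen HasWeakEquiv (conv M N) (conv M' N') := by
  refine Relation.EqvGen.trans _ (conv M' N) _ ?_ ?_
  · induction h with
    | rel _ _ h => exact .rel _ _ (h.conv (.of_iso (Iso.refl _)))
    | refl => exact .refl _
    | symm _ _ _ ih => exact .symm _ _ ih
    | trans _ _ _ _ _ ih ih' => exact .trans _ _ _ ih ih'
  · clear h
    induction h' with
    | rel _ _ h => exact .rel _ _ (HasWeakEquiv.conv (.of_iso (Iso.refl _)) h)
    | refl => exact .refl _
    | symm _ _ _ ih => exact .symm _ _ ih
    | trans _ _ _ _ _ ih ih' => exact .trans _ _ _ ih ih'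

end OmegaSMod

end

/-! ### Split modules are formal -/

section

open Limits HomologicalComplex Opposite Simplicial TensorProduct

/-- Over a field every linear map has a generalized inverse. -/
theorem LinearMap.exists_generalizedInverse {V W : Type*} [AddCommGroup V] [Module ℚ V]
    [AddCommGroup W] [Module ℚ W] (d : V →ₗ[ℚ] W) : ∃ g : W →ₗ[ℚ] V, ∀ x, d (g (d x)) = d x := by
  obtain ⟨s, hs⟩ := LinearMap.exists_rightInverse_of_surjective d.rangeRestrict d.range_rangeRestrict
  obtain ⟨p, hp⟩ := LinearMap.exists_leftInverse_of_injective (LinearMap.range d).subtype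
    (Submodule.ker_subtype _)
  refine ⟨s ∘ₗ p, fun x => ?_⟩
  have h1 : p (d x) = d.rangeRestrict x := LinearMap.congr_fun hp (d.rangeRestrict x)
  have h2 := LinearMap.congr_fun hs (d.rangeRestrict x)
  rw [LinearMap.comp_apply, h1]
  exact congr_arg Subtype.val h2

namespace RightOmegaModule

open RatChain

/-- A right `Ω`-module with natural generalized inverses `g` of its differentials is formal:
`(1 - d g) (1 - g d)` is a natural idempotent onto a complement of the boundaries in the cycles. -/
theorem formal_of_generalizedInverse (Q : RightOmegaModule.{u})
    (g : ∀ A n, (Q.obj A).X n →ₗ[ℚ] (Q.obj A).X (n + 1))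
    (nat : ∀ {A B} (f : A ⟶ B) n x, (Q.map f).f (n + 1) (g A n x) = g B n ((Q.map f).f n x))
    (hg : ∀ A n x, (Q.obj A).d (n + 1) n (g A n ((Q.obj A).d (n + 1) n x)) =
      (Q.obj A).d (n + 1) n x) : Formal Q := by
  let e (A) : ∀ n, (Q.obj A).X n →ₗ[ℚ] (Q.obj A).X n := fun n => match n with
    | 0 => 0
    | n + 1 => g A n ∘ₗ ((Q.obj A).d (n + 1) n).hom
  let b (A) (n) : (Q.obj A).X n →ₗ[ℚ] (Q.obj A).X n := ((Q.obj A).d (n + 1) n).hom ∘ₗ g A n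
  let D (A) (n) : (Q.obj A).X n →ₗ[ℚ] (Q.obj A).X n :=
    (LinearMap.id - b A n) ∘ₗ (LinearMap.id - e A n)
  have hD : ∀ A n x, D A n x = x - e A n x - (Q.obj A).d (n + 1) n (g A n (x - e A n x)) :=
    fun A n x => rfl
  have e_d : ∀ A n x, e A n ((Q.obj A).d (n + 1) n x) = 0 := fun A n x => by
    cases n with
    | zero => rfl
    | succ n => exact (congr_arg (g A n) (d_d_apply (Q.obj A) _ _ _ x)).trans (map_zero (g A n))
  have d_e : ∀ A n x, (Q.obj A).d (n + 1) n (e A (n + 1) x) = (Q.obj A).d (n + 1) n x :=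
    fun A n x => hg A n x
  have D_d : ∀ A n x, D A n ((Q.obj A).d (n + 1) n x) = 0 := fun A n x => by
    rw [hD, e_d, sub_zero, hg, sub_self]
  have d_D : ∀ A n x, (Q.obj A).d (n + 1) n (D A (n + 1) x) = 0 := fun A n x => by
    rw [hD, map_sub, map_sub, d_e, d_d_apply, sub_self, sub_zero]
  have e_D : ∀ A n x, e A n (D A n x) = 0 := fun A n x => by
    cases n with
    | zero => rfl
    | succ n => exact (congr_arg (g A n) (d_D A n x)).trans (map_zero _)
  have D_nat : ∀ {A B} (f : A ⟶ B) n x, (Q.map f).f n (D A n x) = D B n ((Q.map f).f n x) := by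
    intro A B f n x
    have he : ∀ x, (Q.map f).f n (e A n x) = e B n ((Q.map f).f n x) := fun x => by
      cases n with
      | zero => exact map_zero _
      | succ n =>
        refine (nat f n _).trans (congr_arg (g B n) ?_)
        exact (comm_apply (Q.map f) _ _ x).symm
    rw [hD, hD, map_sub, map_sub, he, ← comm_apply, nat, map_sub, he]
  refine formal_of_idempotent Q
    { app := fun A =>
        { f := fun n => ModuleCat.ofHom (D A n)
          comm' := fun i j h => by
            obtain rfl : j + 1 = i := h
            ext x
            exact (d_D A j x).trans (D_d A j x).symm }
      naturality := fun A B f => by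
        ext n x
        exact (D_nat f n x).symm } ?_ ?_ ?_
  · intro A n x
    change D A n (D A n x) = D A n x
    rw [hD A n (D A n x), e_D, sub_zero]
    have : b A n (D A n x) = 0 := by
      have h1 : ∀ y, b A n (b A n y) = b A n y := fun y => hg A n (g A n y)
      change b A n ((x - e A n x) - b A n (x - e A n x)) = 0
      rw [map_sub, h1, sub_self]
    exact (congr_arg _ this).trans (sub_zero _)
  · intro A i j x
    change (Q.obj A).d i j (D A i x) = 0
    by_cases h : j + 1 = i
    · subst h
      exact d_D A j x
    · rw [(Q.obj A).shape i j h]; rfl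
  · intro A n x hx
    refine ⟨g A n x, ?_⟩
    change _ = x - D A n x
    have : e A n x = 0 := by
      cases n with
      | zero => rfl
      | succ n => exact (congr_arg (g A n) (hx n)).trans (map_zero _)
    rw [hD, this, sub_zero, sub_sub_cancel]

end RightOmegaModule

namespace OmegaSMod

/-- The right `Ω`-module `A ↦ ⨁ i, E i ⊗ V i A`, where the simplicial structure comes from the
simplicial vector spaces `E i`, and the functoriality in `A` from the functors `V i`. -/
noncomputable def split {I : Type} (E : I → SMod.{u}) (V : I → FinSurjᵒᵖ ⥤ ModuleCat.{u} ℚ) :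
    OmegaSMod.{u} where
  obj A := SMod.directSum fun i => SMod.tensor (E i) ((Functor.const _).obj ((V i).obj A))
  map f := SMod.directSumMap fun i => SMod.tensorMap (𝟙 (E i)) ((Functor.const _).map ((V i).map f))
  map_id A := by
    refine SMod.directSum_hom_ext fun i => ?_
    rw [SMod.directSumMap, SMod.ι_desc, (V i).map_id, CategoryTheory.Functor.map_id, SMod.tensorMap_id,
      Category.id_comp, Category.comp_id]
  map_comp f g := by
    refine SMod.directSum_hom_ext fun i => ?_
    simp only [SMod.directSumMap]
    rw [SMod.ι_desc, SMod.ι_desc_assoc, Category.assoc, SMod.ι_desc, ← Category.assoc,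
      ← SMod.tensorMap_comp, (V i).map_comp, Functor.map_comp, Category.comp_id]

namespace split

variable {I : Type} (E : I → SMod.{u}) (V : I → FinSurjᵒᵖ ⥤ ModuleCat.{u} ℚ)

/-- The inclusion of a summand into `split E V`. -/
noncomputable def ι (A : FinSurjᵒᵖ) (i : I) :
    SMod.tensor (E i) ((Functor.const _).obj ((V i).obj A)) ⟶ (split E V).obj A :=
  SMod.ι (fun i => SMod.tensor (E i) ((Functor.const _).obj ((V i).obj A))) i

/-- Elementary tensors in `split E V`. -/
noncomputable def tmul (A : FinSurjᵒᵖ) (i : I) {n : SimplexCategoryᵒᵖ} (x : (E i).obj n)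
    (v : (V i).obj A) : ((split E V).obj A).obj n :=
  (ι E V A i).app n (x ⊗ₜ[ℚ] v)

variable {E V}

theorem linearMap_ext {A : FinSurjᵒᵖ} {n : SimplexCategoryᵒᵖ} {M : Type*} [AddCommGroup M]
    [Module ℚ M] {p q : ((split E V).obj A).obj n →ₗ[ℚ] M}
    (h : ∀ i x v, p (tmul E V A i x v) = q (tmul E V A i x v)) : p = q := by
  refine SMod.linearMap_ext_ι fun i y => ?_
  exact LinearMap.congr_fun (TensorProduct.ext' (g := p ∘ₗ ((ι E V A i).app n).hom)
    (h := q ∘ₗ ((ι E V A i).app n).hom) (h i)) y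

theorem map_tmul {A B : FinSurjᵒᵖ} (f : A ⟶ B) (i : I) {n : SimplexCategoryᵒᵖ} (x : (E i).obj n)
    (v : (V i).obj A) :
    ((split E V).map f).app n (tmul E V A i x v) = tmul E V B i x ((V i).map f v) :=
  ConcreteCategory.congr_hom (congr_arg (fun t => NatTrans.app t n) (SMod.ι_desc
    (fun i => SMod.tensorMap (𝟙 (E i)) ((Functor.const _).map ((V i).map f)) ≫
      SMod.ι (fun i => SMod.tensor (E i) ((Functor.const _).obj ((V i).obj B))) i) i)) (x ⊗ₜ v)

/-- The map `E i ⟶ E i ⊗ V i A` given by an element of `V i A`. -/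
noncomputable def right (A : FinSurjᵒᵖ) (i : I) (v : (V i).obj A) :
    E i ⟶ SMod.tensor (E i) ((Functor.const _).obj ((V i).obj A)) where
  app n := ModuleCat.ofHom ((TensorProduct.mk ℚ ((E i).obj n) ((V i).obj A)).flip v)
  naturality a b h := by ext x; rfl

theorem d_tmul (A : FinSurjᵒᵖ) (i : I) (n : ℕ) (x : (E i).obj (op ⦋n + 1⦌)) (v : (V i).obj A) :
    (chains.obj ((split E V).obj A)).d (n + 1) n (tmul E V A i x v) =
      tmul E V A i ((chains.obj (E i)).d (n + 1) n x) v :=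
  RatChain.comm_apply (chains.map (right A i v ≫ ι E V A i)) (n + 1) n x

open scoped Classical in
/-- The operator on `split E V` given by operators on the `E i`. -/
noncomputable def operator {m n : SimplexCategoryᵒᵖ} (g : ∀ i, (E i).obj m →ₗ[ℚ] (E i).obj n)
    (A : FinSurjᵒᵖ) : ((split E V).obj A).obj m →ₗ[ℚ] ((split E V).obj A).obj n :=
  DirectSum.lmap (M := fun i => (E i).obj m ⊗[ℚ] (V i).obj A)
    (N := fun i => (E i).obj n ⊗[ℚ] (V i).obj A) fun i => TensorProduct.map (g i) LinearMap.id

open scoped Classical in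
theorem operator_tmul {m n : SimplexCategoryᵒᵖ} (g : ∀ i, (E i).obj m →ₗ[ℚ] (E i).obj n)
    (A : FinSurjᵒᵖ) (i : I) (x : (E i).obj m) (v : (V i).obj A) :
    operator g A (tmul E V A i x v) = tmul E V A i (g i x) v :=
  DirectSum.lmap_lof (M := fun i => (E i).obj m ⊗[ℚ] (V i).obj A)
    (N := fun i => (E i).obj n ⊗[ℚ] (V i).obj A)
    (fun i => TensorProduct.map (g i) LinearMap.id) i (x ⊗ₜ v)

variable (E V) in
/-- The differentials of a split module only involve the `E i`, so generalized inverses of the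
differentials of the `E i` provide natural ones. -/
theorem formal : RightOmegaModule.Formal (split E V ⋙ chains) := by
  choose g hg using fun (i : I) (n : ℕ) =>
    LinearMap.exists_generalizedInverse ((chains.obj (E i)).d (n + 1) n).hom
  refine RightOmegaModule.formal_of_generalizedInverse _ (fun A n => operator (m := op ⦋n⦌)
    (n := op ⦋n + 1⦌) (fun i => g i n) A) ?_ ?_
  · intro A B f n
    refine LinearMap.congr_fun (f := (((split E V).map f).app (op ⦋n + 1⦌)).hom ∘ₗ
      operator (m := op ⦋n⦌) (n := op ⦋n + 1⦌) (fun i => g i n) A)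
      (g := operator (m := op ⦋n⦌) (n := op ⦋n + 1⦌) (fun i => g i n) B ∘ₗ
        (((split E V).map f).app (op ⦋n⦌)).hom) (linearMap_ext fun i x v => ?_)
    change ((split E V).map f).app _ (operator _ A (tmul E V A i x v)) =
      operator _ B (((split E V).map f).app _ (tmul E V A i x v))
    rw [operator_tmul, map_tmul, map_tmul, operator_tmul]
  · intro A n
    refine LinearMap.congr_fun (f := ((chains.obj ((split E V).obj A)).d (n + 1) n).hom ∘ₗ
        operator (m := op ⦋n⦌) (n := op ⦋n + 1⦌) (fun i => g i n) A ∘ₗ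
        ((chains.obj ((split E V).obj A)).d (n + 1) n).hom)
      (g := ((chains.obj ((split E V).obj A)).d (n + 1) n).hom) (linearMap_ext fun i x v => ?_)
    change (chains.obj ((split E V).obj A)).d (n + 1) n (operator _ A
      ((chains.obj ((split E V).obj A)).d (n + 1) n (tmul E V A i x v))) =
      (chains.obj ((split E V).obj A)).d (n + 1) n (tmul E V A i x v)
    rw [d_tmul, operator_tmul, d_tmul]
    exact congr_arg (fun y => tmul E V A i y v) (hg i n x)

end split

end OmegaSMod

end

/-! ### Convolution products of split modules -/

section

open Limits HomologicalComplex Opposite Simplicial TensorProduct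

namespace DirectSum

variable {I : Type} (M : I → Type u) [∀ i, AddCommMonoid (M i)] [∀ i, Module ℚ (M i)]

open scoped Classical in
/-- The inclusion of a summand, for an arbitrary index type. -/
noncomputable def inc (i : I) : M i →ₗ[ℚ] DirectSum I M := lof ℚ I M i

open scoped Classical in
/-- The map out of a direct sum with given components, for an arbitrary index type. -/
noncomputable def descend {N : Type*} [AddCommMonoid N] [Module ℚ N] (f : ∀ i, M i →ₗ[ℚ] N) :
    DirectSum I M →ₗ[ℚ] N := toModule ℚ I N f

open scoped Classical in
theorem descend_inc {N : Type*} [AddCommMonoid N] [Module ℚ N] (f : ∀ i, M i →ₗ[ℚ] N) (i : I)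
    (x : M i) : descend M f (inc M i x) = f i x := toModule_lof ℚ i x

open scoped Classical in
theorem lmap_inc {N : I → Type u} [∀ i, AddCommMonoid (N i)] [∀ i, Module ℚ (N i)]
    (f : ∀ i, M i →ₗ[ℚ] N i) (i : I) (x : M i) : lmap f (inc M i x) = inc N i (f i x) :=
  lmap_lof f i x

variable {M} in
open scoped Classical in
theorem linearMap_ext_inc {N : Type*} [AddCommMonoid N] [Module ℚ N] {f g : DirectSum I M →ₗ[ℚ] N}
    (h : ∀ i, f ∘ₗ inc M i = g ∘ₗ inc M i) : f = g := linearMap_ext ℚ h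

end DirectSum

namespace TensorProduct

section rearrange

open scoped DirectSum

variable {I J K : Type} (X : I → Type u) (Y : J → Type u) (C : K → I → Type u)
  (D : K → J → Type u) [∀ i, AddCommGroup (X i)] [∀ i, Module ℚ (X i)] [∀ i, AddCommGroup (Y i)]
  [∀ i, Module ℚ (Y i)] [∀ k i, AddCommGroup (C k i)] [∀ k i, Module ℚ (C k i)]
  [∀ k i, AddCommGroup (D k i)] [∀ k i, Module ℚ (D k i)]

/-- The source of `rearrange`. -/
abbrev RearrangeSource : Type u :=
  ⨁ p : I × J, (X p.1 ⊗[ℚ] Y p.2) ⊗[ℚ] ⨁ k, C k p.1 ⊗[ℚ] D k p.2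

/-- The target of `rearrange`. -/
abbrev RearrangeTarget : Type u :=
  ⨁ k, (⨁ i, X i ⊗[ℚ] C k i) ⊗[ℚ] (⨁ j, Y j ⊗[ℚ] D k j)

/-- Elementary tensors in the source of `rearrange`. -/
noncomputable def rearrangeLeft (i : I) (j : J) (k : K) (x : X i) (y : Y j) (c : C k i) (d : D k j) :
    RearrangeSource X Y C D :=
  DirectSum.inc (fun p : I × J => (X p.1 ⊗[ℚ] Y p.2) ⊗[ℚ] ⨁ k, C k p.1 ⊗[ℚ] D k p.2) (i, j)
    ((x ⊗ₜ y) ⊗ₜ DirectSum.inc (fun k => C k i ⊗[ℚ] D k j) k (c ⊗ₜ d))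

/-- Elementary tensors in the target of `rearrange`. -/
noncomputable def rearrangeRight (i : I) (j : J) (k : K) (x : X i) (y : Y j) (c : C k i)
    (d : D k j) : RearrangeTarget X Y C D :=
  DirectSum.inc (fun k => (⨁ i, X i ⊗[ℚ] C k i) ⊗[ℚ] (⨁ j, Y j ⊗[ℚ] D k j)) k
    (DirectSum.inc (fun i => X i ⊗[ℚ] C k i) i (x ⊗ₜ c) ⊗ₜ
      DirectSum.inc (fun j => Y j ⊗[ℚ] D k j) j (y ⊗ₜ d))

open scoped Classical in
/-- The canonical map
`⨁ (i, j), (X i ⊗ Y j) ⊗ ⨁ k, C k i ⊗ D k j → ⨁ k, (⨁ i, X i ⊗ C k i) ⊗ (⨁ j, Y j ⊗ D k j)`. -/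
noncomputable def rearrange : RearrangeSource X Y C D →ₗ[ℚ] RearrangeTarget X Y C D :=
  DirectSum.descend (fun p : I × J => (X p.1 ⊗[ℚ] Y p.2) ⊗[ℚ] ⨁ k, C k p.1 ⊗[ℚ] D k p.2) fun p =>
    DirectSum.lmap (fun k =>
      TensorProduct.map (DirectSum.inc (fun i => X i ⊗[ℚ] C k i) p.1)
        (DirectSum.inc (fun j => Y j ⊗[ℚ] D k j) p.2) ∘ₗ
      (tensorTensorTensorComm ℚ (X p.1) (Y p.2) (C k p.1) (D k p.2)).toLinearMap) ∘ₗ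
    (directSumRight ℚ ℚ (X p.1 ⊗[ℚ] Y p.2) (fun k => C k p.1 ⊗[ℚ] D k p.2)).toLinearMap

open scoped Classical in
theorem rearrange_apply (i : I) (j : J) (k : K) (x : X i) (y : Y j) (c : C k i) (d : D k j) :
    rearrange X Y C D (rearrangeLeft X Y C D i j k x y c d) =
      rearrangeRight X Y C D i j k x y c d := by
  have h : directSumRight ℚ ℚ (X i ⊗[ℚ] Y j) (fun k => C k i ⊗[ℚ] D k j)
      ((x ⊗ₜ y) ⊗ₜ DirectSum.inc (fun k => C k i ⊗[ℚ] D k j) k (c ⊗ₜ d)) =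
      DirectSum.inc (fun k => (X i ⊗[ℚ] Y j) ⊗[ℚ] (C k i ⊗[ℚ] D k j)) k
        ((x ⊗ₜ y) ⊗ₜ (c ⊗ₜ d)) := directSumRight_tmul_lof ℚ _ _ _ _
  rw [rearrange, rearrangeLeft, DirectSum.descend_inc, LinearMap.comp_apply, LinearEquiv.coe_coe,
    h, DirectSum.lmap_inc, LinearMap.comp_apply, LinearEquiv.coe_coe,
    tensorTensorTensorComm_tmul, TensorProduct.map_tmul, rearrangeRight]

variable {X Y C D}

theorem rearrange_ext {M : Type*} [AddCommMonoid M] [Module ℚ M]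
    {p q : RearrangeSource X Y C D →ₗ[ℚ] M}
    (h : ∀ i j k x y c d, p (rearrangeLeft X Y C D i j k x y c d) =
      q (rearrangeLeft X Y C D i j k x y c d)) : p = q :=
  DirectSum.linearMap_ext_inc
    (M := fun p : I × J => (X p.1 ⊗[ℚ] Y p.2) ⊗[ℚ] ⨁ k, C k p.1 ⊗[ℚ] D k p.2) fun ⟨i, j⟩ => TensorProduct.ext (TensorProduct.ext'
    fun x y => DirectSum.linearMap_ext_inc fun k => TensorProduct.ext' fun c d => h i j k x y c d)

variable (X Y C D)

open scoped Classical in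
/-- The inverse of `rearrange`. -/
noncomputable def rearrangeInv : RearrangeTarget X Y C D →ₗ[ℚ] RearrangeSource X Y C D :=
  DirectSum.descend (fun k => (⨁ i, X i ⊗[ℚ] C k i) ⊗[ℚ] (⨁ j, Y j ⊗[ℚ] D k j)) fun k =>
    DirectSum.lmap (fun p : I × J =>
      TensorProduct.map LinearMap.id (DirectSum.inc (fun k => C k p.1 ⊗[ℚ] D k p.2) k) ∘ₗ
      (tensorTensorTensorComm ℚ (X p.1) (C k p.1) (Y p.2) (D k p.2)).toLinearMap) ∘ₗ
    (TensorProduct.directSum ℚ ℚ (fun i => X i ⊗[ℚ] C k i)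
      (fun j => Y j ⊗[ℚ] D k j)).toLinearMap

open scoped Classical in
theorem rearrangeInv_apply (i : I) (j : J) (k : K) (x : X i) (y : Y j) (c : C k i) (d : D k j) :
    rearrangeInv X Y C D (rearrangeRight X Y C D i j k x y c d) =
      rearrangeLeft X Y C D i j k x y c d := by
  have h : TensorProduct.directSum ℚ ℚ (fun i => X i ⊗[ℚ] C k i) (fun j => Y j ⊗[ℚ] D k j)
      (DirectSum.inc (fun i => X i ⊗[ℚ] C k i) i (x ⊗ₜ c) ⊗ₜ
        DirectSum.inc (fun j => Y j ⊗[ℚ] D k j) j (y ⊗ₜ d)) =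
      DirectSum.inc (fun p : I × J => (X p.1 ⊗[ℚ] C k p.1) ⊗[ℚ] (Y p.2 ⊗[ℚ] D k p.2)) (i, j)
        ((x ⊗ₜ c) ⊗ₜ (y ⊗ₜ d)) := by
    refine (directSum_lof_tmul_lof ℚ ℚ _ _ _ _).trans ?_
    unfold DirectSum.inc
    congr!
  rw [rearrangeInv, rearrangeRight, DirectSum.descend_inc, LinearMap.comp_apply,
    LinearEquiv.coe_coe, h, DirectSum.lmap_inc, LinearMap.comp_apply, LinearEquiv.coe_coe,
    tensorTensorTensorComm_tmul, TensorProduct.map_tmul, LinearMap.id_apply, rearrangeLeft]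

theorem rearrange_bijective : Function.Bijective (rearrange X Y C D) := by
  have h1 : rearrangeInv X Y C D ∘ₗ rearrange X Y C D = LinearMap.id := by
    refine rearrange_ext fun i j k x y c d => ?_
    rw [LinearMap.comp_apply, rearrange_apply, rearrangeInv_apply]; rfl
  have h2 : rearrange X Y C D ∘ₗ rearrangeInv X Y C D = LinearMap.id := by
    refine DirectSum.linearMap_ext_inc (M := fun k =>
      (⨁ i, X i ⊗[ℚ] C k i) ⊗[ℚ] (⨁ j, Y j ⊗[ℚ] D k j)) fun k => TensorProduct.ext (DirectSum.linearMap_ext_inc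
      fun i => TensorProduct.ext' fun x c => DirectSum.linearMap_ext_inc fun j =>
        TensorProduct.ext' fun y d => ?_)
    change rearrange X Y C D (rearrangeInv X Y C D (rearrangeRight X Y C D i j k x y c d)) = _
    rw [rearrangeInv_apply, rearrange_apply]
    rfl
  exact ⟨Function.LeftInverse.injective (g := rearrangeInv X Y C D) fun x => LinearMap.congr_fun h1 x,
    Function.RightInverse.surjective (g := rearrangeInv X Y C D) fun x => LinearMap.congr_fun h2 x⟩

end rearrange

end TensorProduct

namespace OmegaSMod

section

variable {I J : Type} (E : I → SMod.{u}) (V : I → FinSurjᵒᵖ ⥤ ModuleCat.{u} ℚ)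
  (E' : J → SMod.{u}) (V' : J → FinSurjᵒᵖ ⥤ ModuleCat.{u} ℚ)

/-- The convolution product of two functors to vector spaces. -/
noncomputable def convModule (F G : FinSurjᵒᵖ ⥤ ModuleCat.{u} ℚ) : FinSurjᵒᵖ ⥤ ModuleCat.{u} ℚ :=
  conv (F ⋙ Functor.const _) (G ⋙ Functor.const _) ⋙ (evaluation _ _).obj (op ⦋0⦌)

/-- Elementary tensors in `convModule F G`. -/
noncomputable def convModule.tmul {F G : FinSurjᵒᵖ ⥤ ModuleCat.{u} ℚ} (A : FinSurjᵒᵖ)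
    (χ : A.unop.carrier → Bool) (x : F.obj (op (A.unop.fib χ false)))
    (y : G.obj (op (A.unop.fib χ true))) : (convModule F G).obj A :=
  DirectSum.inc (fun χ : A.unop.carrier → Bool => F.obj (op (A.unop.fib χ false)) ⊗[ℚ]
    G.obj (op (A.unop.fib χ true))) χ (x ⊗ₜ y)

/-- Elementary tensors in `conv M N`. -/
noncomputable def conv.tmul {M N : OmegaSMod.{u}} (A : FinSurjᵒᵖ) (χ : A.unop.carrier → Bool)
    {n : SimplexCategoryᵒᵖ} (x : (M.obj (op (A.unop.fib χ false))).obj n)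
    (y : (N.obj (op (A.unop.fib χ true))).obj n) : ((conv M N).obj A).obj n :=
  (SMod.ι (fun χ : A.unop.carrier → Bool => SMod.tensor (M.obj (op (A.unop.fib χ false)))
    (N.obj (op (A.unop.fib χ true)))) χ).app n (x ⊗ₜ[ℚ] y)

theorem conv.map_tmul {M N : OmegaSMod.{u}} {A B : FinSurjᵒᵖ} (f : A ⟶ B)
    (χ : A.unop.carrier → Bool) {n : SimplexCategoryᵒᵖ}
    (x : (M.obj (op (A.unop.fib χ false))).obj n) (y : (N.obj (op (A.unop.fib χ true))).obj n) :
    ((conv M N).map f).app n (conv.tmul A χ x y) = conv.tmul B (χ ∘ f.unop.1)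
      ((M.map (FinSurj.fibMap f.unop χ false).op).app n x)
      ((N.map (FinSurj.fibMap f.unop χ true).op).app n y) :=
  SMod.desc_app_ι (W := fun χ : A.unop.carrier → Bool =>
    SMod.tensor (M.obj (op (A.unop.fib χ false))) (N.obj (op (A.unop.fib χ true))))
    (fun χ => SMod.tensorMap (M.map (FinSurj.fibMap f.unop χ false).op)
    (N.map (FinSurj.fibMap f.unop χ true).op) ≫ SMod.ι (fun χ : B.unop.carrier → Bool =>
      SMod.tensor (M.obj (op (B.unop.fib χ false))) (N.obj (op (B.unop.fib χ true))))
        (χ ∘ f.unop.1)) χ n (x ⊗ₜ[ℚ] y)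

theorem conv.level_tmul {M N : OmegaSMod.{u}} (A : FinSurjᵒᵖ)
    (χ : A.unop.carrier → Bool) {m n : SimplexCategoryᵒᵖ} (g : m ⟶ n)
    (x : (M.obj (op (A.unop.fib χ false))).obj m) (y : (N.obj (op (A.unop.fib χ true))).obj m) :
    ((conv M N).obj A).map g (conv.tmul A χ x y) = conv.tmul A χ ((M.obj _).map g x)
      ((N.obj _).map g y) :=
  (SMod.naturality_apply (SMod.ι (fun χ : A.unop.carrier → Bool => SMod.tensor
    (M.obj (op (A.unop.fib χ false))) (N.obj (op (A.unop.fib χ true)))) χ) g (x ⊗ₜ[ℚ] y)).symm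

theorem convModule.map_tmul {F G : FinSurjᵒᵖ ⥤ ModuleCat.{u} ℚ} {A B : FinSurjᵒᵖ} (f : A ⟶ B)
    (χ : A.unop.carrier → Bool) (x : F.obj (op (A.unop.fib χ false)))
    (y : G.obj (op (A.unop.fib χ true))) :
    (convModule F G).map f (tmul A χ x y) = tmul B (χ ∘ f.unop.1)
      (F.map (FinSurj.fibMap f.unop χ false).op x) (G.map (FinSurj.fibMap f.unop χ true).op y) :=
  conv.map_tmul (M := F ⋙ Functor.const _) (N := G ⋙ Functor.const _) f χ x y

theorem split.level_tmul {K : Type} {F : K → SMod.{u}} {U : K → FinSurjᵒᵖ ⥤ ModuleCat.{u} ℚ}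
    (B : FinSurjᵒᵖ) (k : K) {m n : SimplexCategoryᵒᵖ} (g : m ⟶ n) (z : (F k).obj m)
    (u : (U k).obj B) : ((split F U).obj B).map g (split.tmul F U B k z u) =
      split.tmul F U B k ((F k).map g z) u :=
  (SMod.naturality_apply (split.ι _ _ B k) g (z ⊗ₜ u)).symm

/-- The product of two split modules, as a split module. -/
noncomputable abbrev splitProd : OmegaSMod.{u} :=
  split (fun p : I × J => SMod.tensor (E p.1) (E' p.2)) fun p => convModule (V p.1) (V' p.2)

/-- The components of the isomorphism from `splitProd` to the convolution product. -/
noncomputable def splitProdToConvApp (A : FinSurjᵒᵖ) (n : SimplexCategoryᵒᵖ) :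
    ((splitProd E V E' V').obj A).obj n →ₗ[ℚ] ((conv (split E V) (split E' V')).obj A).obj n :=
  TensorProduct.rearrange (fun i => (E i).obj n) (fun j => (E' j).obj n)
    (fun (χ : A.unop.carrier → Bool) i => (V i).obj (op (A.unop.fib χ false)))
    (fun (χ : A.unop.carrier → Bool) j => (V' j).obj (op (A.unop.fib χ true)))

theorem splitProdToConvApp_tmul (A : FinSurjᵒᵖ) (n : SimplexCategoryᵒᵖ) (i : I) (j : J)
    (χ : A.unop.carrier → Bool) (x : (E i).obj n) (y : (E' j).obj n)
    (v : (V i).obj (op (A.unop.fib χ false))) (w : (V' j).obj (op (A.unop.fib χ true))) :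
    splitProdToConvApp E V E' V' A n (split.tmul _ _ A (i, j) (x ⊗ₜ y) (convModule.tmul A χ v w)) =
      conv.tmul A χ (split.tmul E V _ i x v) (split.tmul E' V' _ j y w) :=
  TensorProduct.rearrange_apply (fun i => (E i).obj n) (fun j => (E' j).obj n)
    (fun (χ : A.unop.carrier → Bool) i => (V i).obj (op (A.unop.fib χ false)))
    (fun (χ : A.unop.carrier → Bool) j => (V' j).obj (op (A.unop.fib χ true))) i j χ x y v w

theorem splitProd_ext {A : FinSurjᵒᵖ} {n : SimplexCategoryᵒᵖ} {M : Type*} [AddCommGroup M]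
    [Module ℚ M] {p q : ((splitProd E V E' V').obj A).obj n →ₗ[ℚ] M}
    (h : ∀ (i : I) (j : J) (χ : A.unop.carrier → Bool) (x : (E i).obj n) (y : (E' j).obj n)
      (v : (V i).obj (op (A.unop.fib χ false))) (w : (V' j).obj (op (A.unop.fib χ true))),
      p (split.tmul _ _ A (i, j) (x ⊗ₜ y) (convModule.tmul A χ v w)) =
        q (split.tmul _ _ A (i, j) (x ⊗ₜ y) (convModule.tmul A χ v w))) : p = q :=
  TensorProduct.rearrange_ext (X := fun i => (E i).obj n) (Y := fun j => (E' j).obj n)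
    (C := fun (χ : A.unop.carrier → Bool) i => (V i).obj (op (A.unop.fib χ false)))
    (D := fun (χ : A.unop.carrier → Bool) j => (V' j).obj (op (A.unop.fib χ true))) h

/-- The isomorphism from `splitProd` to the convolution product. -/
noncomputable def splitProdToConv : splitProd E V E' V' ⟶ conv (split E V) (split E' V') where
  app A :=
    { app := fun n => ModuleCat.ofHom (splitProdToConvApp E V E' V' A n)
      naturality := fun m n g => by
        ext1
        refine splitProd_ext E V E' V' fun i j χ x y v w => ?_
        have h1 : splitProdToConvApp E V E' V' A n (((splitProd E V E' V').obj A).map g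
            (split.tmul _ _ A (i, j) (x ⊗ₜ[ℚ] y) (convModule.tmul A χ v w))) =
            conv.tmul A χ (split.tmul E V _ i ((E i).map g x) v)
              (split.tmul E' V' _ j ((E' j).map g y) w) :=
          (congr_arg (splitProdToConvApp E V E' V' A n) (split.level_tmul
            (F := fun p : I × J => SMod.tensor (E p.1) (E' p.2)) A (i, j) g (x ⊗ₜ[ℚ] y) _)).trans
            (splitProdToConvApp_tmul E V E' V' A n i j χ _ _ v w)
        have h2 : ((conv (split E V) (split E' V')).obj A).map g (splitProdToConvApp E V E' V' A m
            (split.tmul _ _ A (i, j) (x ⊗ₜ[ℚ] y) (convModule.tmul A χ v w))) =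
            conv.tmul A χ (split.tmul E V _ i ((E i).map g x) v)
              (split.tmul E' V' _ j ((E' j).map g y) w) := by
          rw [splitProdToConvApp_tmul, conv.level_tmul, split.level_tmul, split.level_tmul]
        exact h1.trans h2.symm }
  naturality A B f := by
    refine NatTrans.ext (funext fun n => ?_)
    ext1
    refine splitProd_ext E V E' V' fun i j χ x y v w => ?_
    have h1 : splitProdToConvApp E V E' V' B n (((splitProd E V E' V').map f).app n
        (split.tmul _ _ A (i, j) (x ⊗ₜ[ℚ] y) (convModule.tmul A χ v w))) =
        conv.tmul B (χ ∘ f.unop.1)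
          (split.tmul E V _ i x ((V i).map (FinSurj.fibMap f.unop χ false).op v))
          (split.tmul E' V' _ j y ((V' j).map (FinSurj.fibMap f.unop χ true).op w)) :=
      (congr_arg (splitProdToConvApp E V E' V' B n) ((split.map_tmul
        (E := fun p : I × J => SMod.tensor (E p.1) (E' p.2)) f (i, j) (x ⊗ₜ[ℚ] y) _).trans
          (congr_arg _ (convModule.map_tmul f χ v w)))).trans
        (splitProdToConvApp_tmul E V E' V' B n i j _ _ _ _ _)
    have h2 : ((conv (split E V) (split E' V')).map f).app n (splitProdToConvApp E V E' V' A n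
        (split.tmul _ _ A (i, j) (x ⊗ₜ[ℚ] y) (convModule.tmul A χ v w))) =
        conv.tmul B (χ ∘ f.unop.1)
          (split.tmul E V _ i x ((V i).map (FinSurj.fibMap f.unop χ false).op v))
          (split.tmul E' V' _ j y ((V' j).map (FinSurj.fibMap f.unop χ true).op w)) := by
      rw [splitProdToConvApp_tmul, conv.map_tmul, split.map_tmul, split.map_tmul]
    exact h1.trans h2.symm

theorem hasWeakEquiv_splitProd_conv :
    HasWeakEquiv (splitProd E V E' V') (conv (split E V) (split E' V')) := by
  classical
  exact ⟨splitProdToConv E V E' V', fun A => SMod.WeakEquiv.of_bijective fun n =>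
    TensorProduct.rearrange_bijective (fun i => (E i).obj (op ⦋n⦌)) (fun j => (E' j).obj (op ⦋n⦌))
    (fun (χ : A.unop.carrier → Bool) i => (V i).obj (op (A.unop.fib χ false)))
    (fun (χ : A.unop.carrier → Bool) j => (V' j).obj (op (A.unop.fib χ true)))⟩

end

end OmegaSMod

end

/-! ### The simplicial circle -/

section

open Limits HomologicalComplex Opposite Simplicial TensorProduct

namespace RatChain

/-- The homology vanishes outside degree `p`, and is at most one-dimensional in degree `p`. -/
def IsLine (K : RatChain.{u}) (p : ℕ) : Prop :=
  (∃ z, IsCycle K p z ∧ ∀ x, IsCycle K p x → ∃ (q : ℚ) (y : _), x = q • z + K.d (p + 1) p y) ∧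
    ∀ n, n ≠ p → AcyclicAt K n

/-- The connecting homomorphism of an extension with acyclic middle term shifts the degree by one. -/
theorem IsShortExact.isLine_succ {K L M : RatChain.{u}} {f : K ⟶ L} {g : L ⟶ M}
    (h : IsShortExact f g) (hL : Acyclic L) {p : ℕ} (hK : IsLine K p) : IsLine M (p + 1) := by
  obtain ⟨⟨z, hz, hz'⟩, h'⟩ := hK
  refine ⟨?_, fun n hn => ?_⟩
  · obtain ⟨w, hw⟩ := hL p _ (hz.map f)
    refine ⟨g.f _ w, ?_, fun x hx => ?_⟩
    · rw [isCycle_succ_iff, comm_apply, hw, h.comp]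
    · obtain ⟨y, rfl⟩ := h.surj _ x
      rw [isCycle_succ_iff, comm_apply] at hx
      obtain ⟨k, hk⟩ := h.exact _ _ hx
      obtain ⟨q, v, rfl⟩ := hz' k (h.isCycle_of_map fun m => by rw [hk, d_d_apply])
      obtain ⟨u, hu⟩ := hL (p + 1) (y - q • w - f.f _ v) (by
        rw [isCycle_succ_iff, map_sub, map_sub, map_smul, hw, ← hk, map_add, map_smul, comm_apply]
        abel)
      refine ⟨q, g.f _ u, ?_⟩
      rw [comm_apply, hu, map_sub, map_sub, map_smul, h.comp]
      abel
  · cases n with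
    | zero => exact h.acyclicAt_zero (hL 0)
    | succ n => exact h.acyclicAt_succ (hL (n + 1)) (h' n fun e => hn (e ▸ rfl))

theorem IsLine.of_quasiIso {K L : RatChain.{u}} (f : K ⟶ L) (hf : QuasiIso f) {p : ℕ}
    (hL : IsLine L p) : IsLine K p := by
  rw [quasiIso_iff_cycles] at hf
  obtain ⟨⟨z, hz, hz'⟩, h'⟩ := hL
  refine ⟨?_, fun n hn x hx => (hf n).1 x hx (h' n hn _ (hx.map f))⟩
  obtain ⟨w, y, hw, rfl⟩ := (hf p).2 z hz
  refine ⟨w, hw, fun x hx => ?_⟩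
  obtain ⟨q, v, e⟩ := hz' _ (hx.map f)
  obtain ⟨u, hu⟩ := (hf p).1 (x - q • w) (fun m => by rw [map_sub, map_smul, hx, hw]; simp)
    ⟨q • y + v, by rw [map_sub, e, map_smul, map_add, map_smul, smul_add]; abel⟩
  exact ⟨q, u, by rw [hu]; abel⟩

end RatChain

theorem PairType.mk_eq_sum (P : PairType.{u}) (c : P.carrier →₀ ℚ) :
    (Submodule.Quotient.mk c : P.Free) = ∑ x ∈ c.support, c x • P.cls x := by
  conv_lhs => rw [← c.sum_single, Finsupp.sum]
  change Submodule.mkQ _ _ = _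
  rw [map_sum]
  refine Finset.sum_congr rfl fun x _ => ?_
  rw [PairType.cls, ← Submodule.Quotient.mk_smul]
  simp

/-- The simplicial pair `(Δ¹, ∂Δ¹)`. -/
def interval : SPair.{u} where
  obj k := ⟨Δ[1].obj k, {x | ∀ i j, (SSet.stdSimplex.objEquiv x).toOrderHom i =
    (SSet.stdSimplex.objEquiv x).toOrderHom j}⟩
  map f := ⟨fun x => Δ[1].map f x, fun x hx i j => hx _ _⟩
  map_id n := by ext x; exact ConcreteCategory.congr_hom (Δ[1].map_id n) x
  map_comp f g := by ext x; exact ConcreteCategory.congr_hom (Δ[1].map_comp f g) x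

namespace interval

/-- The projection `(Δ¹, 0) ⟶ (Δ¹, ∂Δ¹)`. -/
def ofCones : SPair.cones (fun _ : PUnit.{u + 1} => 1) ⟶ interval.{u} where
  app k := PairType.Hom.mk (P := (SPair.cones fun _ : PUnit.{u + 1} => 1).obj k)
    (Q := interval.{u}.obj k) (fun x => SSet.stdSimplex.objEquiv.symm x.2)
    (fun x hx i j => by
      rw [Equiv.apply_symm_apply]
      exact (hx i).trans (hx j).symm)

theorem freeMap_ofCones_surjective (n : SimplexCategoryᵒᵖ) :
    Function.Surjective (PairType.freeMap (ofCones.{u}.app n)) := fun x => by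
  refine PairType.free_induction (p := fun x => ∃ y, PairType.freeMap (ofCones.app n) y = x) x
    ⟨0, map_zero _⟩ ?_ fun q x => ?_
  · rintro _ _ ⟨y, rfl⟩ ⟨y', rfl⟩
    exact ⟨y + y', map_add _ _ _⟩
  · refine ⟨q • PairType.cls ((SPair.cones fun _ : PUnit.{u + 1} => 1).obj n)
      ⟨PUnit.unit, SSet.stdSimplex.objEquiv x⟩, ?_⟩
    rw [map_smul]
    exact congr_arg (q • ·) ((PairType.freeMap_cls (ofCones.app n) _).trans
      (congr_arg (PairType.cls _) (Equiv.symm_apply_apply _ _)))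

/-- The simplicial circle is the quotient of the cone `(Δ¹, 0)` by the class of the vertex `1`; after
tensoring with `U`, this is the short exact sequence of the cone on `U`. -/
theorem shortExact (U : SMod.{u}) :
    SMod.IsShortExact (SMod.toCone U) (SMod.tensorMap (SPair.free.map ofCones) (𝟙 U)) where
  inj := SMod.toCone_injective U
  surj n := LinearMap.rTensor_surjective (U.obj n) (freeMap_ofCones_surjective n)
  exact n := by
    let b : ℚ →ₗ[ℚ] ((SPair.cones fun _ : PUnit.{u + 1} => 1).obj n).Free :=
      LinearMap.toSpanSingleton ℚ _ (SMod.coneBase n)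
    have hb : Function.Exact b (PairType.freeMap (ofCones.app n)) := by
      intro x
      constructor
      · intro hx
        suffices x ∈ Submodule.span ℚ {SMod.coneBase n} by
          obtain ⟨q, rfl⟩ := Submodule.mem_span_singleton.1 this
          exact ⟨q, rfl⟩
        obtain ⟨c, rfl⟩ := Submodule.Quotient.mk_surjective _ x
        rw [PairType.freeMap_mk, PairType.mk_eq_zero_iff] at hx
        have hinj : Function.Injective (PairType.Hom.map (ofCones.{u}.app n)) := by
          rintro ⟨⟨⟩, x⟩ ⟨⟨⟩, y⟩ h
          exact congr_arg _ (SSet.stdSimplex.objEquiv.symm.injective h)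
        rw [PairType.mk_eq_sum]
        refine Submodule.sum_mem _ fun s hs => Submodule.smul_mem _ _ ?_
        have h0 := hx (PairType.Hom.map (ofCones.{u}.app n) s) (by
          rw [Finsupp.mem_support_iff, Finsupp.mapDomain_apply hinj]
          exact Finsupp.mem_support_iff.1 hs)
        obtain ⟨⟨⟩, θ⟩ := s
        have h1 : ∀ i j, θ.toOrderHom i = θ.toOrderHom j := fun i j => h0 i j
        by_cases h2 : θ.toOrderHom 0 = 0
        · have h3 := PairType.cls_eq_zero ((SPair.cones fun _ : PUnit.{u + 1} => 1).obj n)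
            (x := ⟨PUnit.unit, θ⟩) fun i => (h1 i 0).trans h2
          exact h3.symm ▸ Submodule.zero_mem _
        · refine Submodule.subset_span ?_
          change PairType.cls _ _ = PairType.cls _ _
          congr 2
          ext i : 3
          refine (h1 i 0).trans ?_
          exact (show ∀ a : Fin 2, a ≠ 0 → a = 1 by decide) _ h2
      · rintro ⟨q, rfl⟩
        have : PairType.freeMap (ofCones.{u}.app n) (SMod.coneBase n) = 0 := by
          refine (PairType.freeMap_cls (ofCones.app n) _).trans
            (PairType.cls_eq_zero _ fun i j => rfl)
        change PairType.freeMap (ofCones.{u}.app n) (q • SMod.coneBase n) = 0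
        rw [map_smul, this, smul_zero]
    have hs : Function.Surjective (PairType.freeMap (ofCones.{u}.app n)) := fun x => freeMap_ofCones_surjective n x
    have key : ∀ t : ℚ ⊗[ℚ] U.obj n, LinearMap.rTensor (U.obj n) b t =
        SMod.coneBase n ⊗ₜ (TensorProduct.lid ℚ (U.obj n) t) := by
      refine LinearMap.congr_fun (f := LinearMap.rTensor (U.obj n) b)
        (g := TensorProduct.mk ℚ _ _ (SMod.coneBase n) ∘ₗ
          (TensorProduct.lid ℚ (U.obj n)).toLinearMap) (TensorProduct.ext' fun q u => ?_)
      change (q • SMod.coneBase n) ⊗ₜ u = SMod.coneBase n ⊗ₜ (TensorProduct.lid ℚ (U.obj n) (q ⊗ₜ u))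
      rw [TensorProduct.lid_tmul, TensorProduct.smul_tmul]
    intro x
    refine (rTensor_exact (U.obj n) hb hs x).trans ⟨?_, ?_⟩
    · rintro ⟨t, rfl⟩
      exact ⟨TensorProduct.lid ℚ (U.obj n) t, (key t).symm⟩
    · rintro ⟨y, rfl⟩
      refine ⟨(1 : ℚ) ⊗ₜ y, ?_⟩
      rw [key, TensorProduct.lid_tmul, one_smul]
      rfl

end interval

end

section

open Limits HomologicalComplex Opposite Simplicial TensorProduct

theorem SMod.d_apply (U : SMod.{u}) (n : ℕ) (x : U.obj (op ⦋n + 1⦌)) :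
    (chains.obj U).d (n + 1) n x =
      ∑ i : Fin (n + 2), (-1 : ℚ) ^ (i : ℕ) • U.map (SimplexCategory.δ i).op x := by
  rw [AlgebraicTopology.alternatingFaceMapComplex_obj_d]
  change ((AlgebraicTopology.AlternatingFaceMapComplex.objD U n).hom : _ →ₗ[ℚ] _) x = _
  rw [AlgebraicTopology.AlternatingFaceMapComplex.objD, ModuleCat.hom_sum, LinearMap.sum_apply]
  refine Finset.sum_congr rfl fun i _ => ?_
  rw [ModuleCat.hom_zsmul, LinearMap.smul_apply, ← Int.cast_smul_eq_zsmul ℚ]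
  push_cast
  rfl

namespace interval

open RatChain

theorem isLine_empty : IsLine (chains.obj ((SPair.tensorPower PEmpty).obj interval.{u})) 0 := by
  let x (n : ℕ) : ((SPair.tensorPower PEmpty).obj interval.{u}).obj (op ⦋n⦌) :=
    PairType.cls _ fun a => a.elim
  have hx : ∀ n (y : ((SPair.tensorPower PEmpty).obj interval.{u}).obj (op ⦋n⦌)),
      ∃ q : ℚ, y = q • x n := fun n y => by
    refine PairType.free_induction (p := fun y => ∃ q : ℚ, y = q • x n) y ⟨0, (zero_smul _ _).symm⟩
      ?_ fun q z => ⟨q, ?_⟩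
    · rintro _ _ ⟨q, rfl⟩ ⟨q', rfl⟩
      exact ⟨q + q', (add_smul _ _ _).symm⟩
    · exact congr_arg (fun z => q • PairType.cls _ z) (funext fun a => a.elim)
  have hd : ∀ n, (chains.obj ((SPair.tensorPower PEmpty).obj interval.{u})).d (n + 1) n (x (n + 1)) =
      if Even n then 0 else x n := fun n => by
    rw [SMod.d_apply]
    have : ∀ i : Fin (n + 2), ((SPair.tensorPower PEmpty).obj interval.{u}).map
        (SimplexCategory.δ i).op (x (n + 1)) = x n := fun i =>
      (PairType.freeMap_cls _ _).trans (congr_arg (PairType.cls _) (funext fun a => a.elim))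
    simp only [this]
    rw [← Finset.sum_smul, Fin.sum_univ_eq_sum_range (fun i => (-1 : ℚ) ^ i) (n + 2),
      neg_one_geom_sum]
    by_cases h : Even n
    · rw [if_pos h, if_pos (by simpa [Nat.even_add] using h), zero_smul]
    · rw [if_neg h, if_neg (by simpa [Nat.even_add] using h), one_smul]
  refine ⟨⟨x 0, isCycle_zero _ _, fun y _ => ?_⟩, fun n hn y hy => ?_⟩
  · obtain ⟨q, rfl⟩ := hx 0 y
    exact ⟨q, 0, by rw [map_zero, add_zero]⟩
  · obtain ⟨q, rfl⟩ := hx n y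
    by_cases h : Even n
    · obtain ⟨m, rfl⟩ := Nat.exists_eq_succ_of_ne_zero hn
      rw [isCycle_succ_iff, map_smul, hd, if_neg (by
        rw [Nat.succ_eq_add_one, Nat.even_add_one] at h; exact h)] at hy
      have hσ : ((SPair.tensorPower PEmpty).obj interval.{u}).map
          (SimplexCategory.σ (0 : Fin (m + 1))).op (x m) = x (m + 1) :=
        (PairType.freeMap_cls _ _).trans (congr_arg (PairType.cls _) (funext fun a => a.elim))
      refine ⟨0, ?_⟩
      rw [map_zero, Nat.succ_eq_add_one, ← hσ, ← map_smul]
      exact ((congr_arg _ hy).trans (map_zero _)).symm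
    · exact ⟨q • x (n + 1), by rw [map_smul, hd, if_neg h]⟩

/-- The homology of `ℚ[(Δ¹, ∂Δ¹) ^ A]` is at most one-dimensional and concentrated in degree `|A|`.
By induction on `A`: the cone on a simplicial vector space `U` is an acyclic extension of
`ℚ[Δ¹, ∂Δ¹] ⊗ U` by `U`. -/
theorem isLine_tensorPower (A : Type) [Finite A] :
    IsLine (chains.obj ((SPair.tensorPower A).obj interval.{u})) (Nat.card A) := by
  induction A using Finite.induction_empty_option with
  | of_equiv e ih =>
    rw [← Nat.card_congr e]
    exact IsLine.of_quasiIso _ (SPair.powReindex_weakEquiv e interval) ih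
  | h_empty =>
    rw [Nat.card_of_isEmpty]
    exact isLine_empty
  | h_option ih =>
    rw [Finite.card_option]
    refine IsLine.of_quasiIso (chains.map (SPair.tensorPowerOption _ interval))
      (SMod.WeakEquiv.of_bijective fun n => PairType.powOption_bijective _ _) ?_
    exact (shortExact _).chains.isLine_succ (SMod.acyclic_cones_tensor _ _) ih

end interval

end

section

open Limits HomologicalComplex Opposite Simplicial TensorProduct

namespace interval

open RatChain SSet.stdSimplex

/-- The non-constant simplices of `Δ¹`, numbered by the position of their jump. -/
def jump {n : ℕ} (j : Fin n) : (interval.{u}.obj (op ⦋n⦌)).carrier :=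
  objMk₁ j.succ.castSucc

theorem jump_injective {n : ℕ} : Function.Injective (jump.{u} (n := n)) := fun i j h => by
  have := objMk₁_injective h
  exact Fin.succ_injective _ (Fin.castSucc_injective _ this)

theorem objMk₁_zero_mem (n : ℕ) : objMk₁.{u} (0 : Fin (n + 2)) ∈ (interval.{u}.obj (op ⦋n⦌)).sub :=
  fun i j => (objMk₁_of_le_castSucc.{u} 0 i (Fin.zero_le _)).trans
    (objMk₁_of_le_castSucc.{u} 0 j (Fin.zero_le _)).symm

theorem objMk₁_last_mem (n : ℕ) :
    objMk₁.{u} (Fin.last (n + 1)) ∈ (interval.{u}.obj (op ⦋n⦌)).sub :=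
  fun i j => (objMk₁_of_castSucc_lt.{u} _ i (Fin.castSucc_lt_last i)).trans
    (objMk₁_of_castSucc_lt.{u} _ j (Fin.castSucc_lt_last j)).symm

theorem exists_jump {n : ℕ} (x : (interval.{u}.obj (op ⦋n⦌)).carrier)
    (hx : x ∉ (interval.{u}.obj (op ⦋n⦌)).sub) : ∃ j, x = jump j := by
  obtain ⟨i, rfl⟩ := objMk₁_surjective x
  have h0 : i ≠ 0 := fun h => hx (h ▸ objMk₁_zero_mem.{u} n)
  have h1 : i ≠ Fin.last _ := fun h => hx (h ▸ objMk₁_last_mem.{u} n)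
  refine ⟨⟨i - 1, ?_⟩, ?_⟩
  · have := Fin.val_lt_last h1
    have := Fin.val_ne_zero_iff.2 h0
    omega
  · refine congr_arg objMk₁ (Fin.ext ?_)
    have := Fin.val_ne_zero_iff.2 h0
    simp
    omega

theorem jump_notMem {n : ℕ} (j : Fin n) : jump.{u} j ∉ (interval.{u}.obj (op ⦋n⦌)).sub := by
  intro h
  have h1 := h (0 : Fin (n + 1)) (Fin.last n)
  have e1 : objMk₁.{u} j.succ.castSucc (0 : Fin (n + 1)) = 0 :=
    objMk₁_of_castSucc_lt.{u} _ _ (by simp [Fin.lt_def])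
  have e2 : objMk₁.{u} j.succ.castSucc (Fin.last n) = 1 :=
    objMk₁_of_le_castSucc.{u} _ _ (by simp only [Fin.le_def, Fin.val_castSucc, Fin.val_succ, Fin.val_last]; omega)
  exact absurd ((e1.symm.trans h1).trans e2) (show (0 : Fin 2) ≠ 1 by decide)

open scoped Classical in
/-- The coordinates of a simplex in the basis of `ℚ[Δ¹, ∂Δ¹]` given by the non-constant
simplices. -/
noncomputable def row {n : ℕ} (x : (interval.{u}.obj (op ⦋n⦌)).carrier) (j : Fin n) : ℚ :=
  if x = jump j then 1 else 0

theorem row_eq_zero {n : ℕ} {x : (interval.{u}.obj (op ⦋n⦌)).carrier}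
    (hx : x ∈ (interval.{u}.obj (op ⦋n⦌)).sub) : row x = 0 :=
  funext fun j => if_neg fun h : x = jump j => jump_notMem j (h ▸ hx)

theorem row_jump {n : ℕ} (i j : Fin n) : row (jump.{u} i) j = if i = j then 1 else 0 := by
  simp only [row, jump_injective.eq_iff]

theorem face_jump {n : ℕ} (i : Fin (n + 2)) (y : Fin (n + 1)) :
    (interval.{u}.map (SimplexCategory.δ i).op).map (jump y) =
      objMk₁ (if (y : ℕ) < i then y.succ else y.castSucc) := by
  by_cases h : (y : ℕ) < i
  · rw [if_pos h]
    exact δ_objMk₁_of_le.{u} _ i (by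
      simp only [Fin.le_def, Fin.val_castSucc, Fin.val_succ]; omega)
  · rw [if_neg h]
    exact δ_objMk₁_of_lt.{u} _ i (by
      simp only [Fin.lt_def, Fin.val_castSucc, Fin.val_succ]; omega)

/-- The effect of a face map on the number of a non-constant simplex. -/
theorem row_face_jump {n : ℕ} (i : Fin (n + 2)) (y : Fin (n + 1)) (j : Fin n) :
    row ((interval.{u}.map (SimplexCategory.δ i).op).map (jump y)) j =
      if (if (y : ℕ) < i then (y : ℕ) + 1 else y) = j + 1 then 1 else 0 := by
  have key : ∀ k : Fin (n + 2), row (objMk₁.{u} k) j = if (k : ℕ) = j + 1 then 1 else 0 :=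
    fun k => by
      have : objMk₁.{u} k = jump j ↔ (k : ℕ) = j + 1 := by
        rw [jump, objMk₁_injective.eq_iff]
        simp [Fin.ext_iff]
      by_cases h : (k : ℕ) = j + 1
      · exact (if_pos (this.2 h)).trans (if_pos h).symm
      · exact (if_neg (mt this.1 h)).trans (if_neg h).symm
  rw [face_jump]
  refine (key _).trans ?_
  split_ifs <;> simp_all

/-- The determinant of a family of simplices. -/
noncomputable def rowDet {n : ℕ} (c : Fin n → (interval.{u}.obj (op ⦋n⦌)).carrier) : ℚ :=
  Matrix.det (Matrix.of fun k => row (c k))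

theorem rowDet_eq_zero_of_row {n : ℕ} {c : Fin n → (interval.{u}.obj (op ⦋n⦌)).carrier} (k : Fin n)
    (h : row (c k) = 0) : rowDet c = 0 :=
  Matrix.det_eq_zero_of_row_eq_zero k fun j => congr_fun h j

theorem rowDet_eq_zero_of_eq {n : ℕ} {c : Fin n → (interval.{u}.obj (op ⦋n⦌)).carrier} {k l : Fin n}
    (hkl : k ≠ l) (h : row (c k) = row (c l)) : rowDet c = 0 :=
  Matrix.det_zero_of_row_eq hkl h

/-- The determinant is compatible with the differential: only the two faces which omit the one jump
that does not occur contribute, and they cancel. -/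
theorem sum_rowDet_face {n : ℕ} (c : Fin n → (interval.{u}.obj (op ⦋n + 1⦌)).carrier) :
    ∑ i : Fin (n + 2), (-1 : ℚ) ^ (i : ℕ) *
      rowDet (fun k => (interval.{u}.map (SimplexCategory.δ i).op).map (c k)) = 0 := by
  by_cases h1 : ∃ k, c k ∈ (interval.{u}.obj (op ⦋n + 1⦌)).sub
  · obtain ⟨k, hk⟩ := h1
    refine Finset.sum_eq_zero fun i _ => ?_
    rw [rowDet_eq_zero_of_row k (row_eq_zero ((interval.map (SimplexCategory.δ i).op).mem _ hk)),
      mul_zero]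
  push Not at h1
  choose y hy using fun k => exists_jump (c k) (h1 k)
  by_cases h2 : Function.Injective y
  swap
  · rw [Function.Injective] at h2
    push Not at h2
    obtain ⟨k, l, e, hkl⟩ := h2
    refine Finset.sum_eq_zero fun i _ => ?_
    rw [rowDet_eq_zero_of_eq hkl (by rw [hy, hy, e]), mul_zero]
  have hr : ∀ i k j, row ((interval.{u}.map (SimplexCategory.δ i).op).map (c k)) j =
      if (if (y k : ℕ) < (i : Fin (n + 2)) then (y k : ℕ) + 1 else y k) = j + 1 then 1 else 0 :=
    fun i k j => by rw [hy, row_face_jump]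
  obtain ⟨m, hm⟩ : ∃ m, m ∉ Set.range y := by
    by_contra! h
    have := Fintype.card_le_of_surjective y h
    simp at this
  have hm' : ∀ a, a ≠ m → ∃ k, y k = a := by
    have hc : Finset.univ.image y = Finset.univ.erase m := by
      apply Finset.eq_of_subset_of_card_le
      · intro a ha
        obtain ⟨k, -, rfl⟩ := Finset.mem_image.1 ha
        exact Finset.mem_erase.2 ⟨fun e => hm ⟨k, e⟩, Finset.mem_univ _⟩
      · rw [Finset.card_image_of_injective _ h2, Finset.card_erase_of_mem (Finset.mem_univ _)]
        simp
    intro a ha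
    have : a ∈ Finset.univ.image y := hc ▸ Finset.mem_erase.2 ⟨ha, Finset.mem_univ _⟩
    obtain ⟨k, -, e⟩ := Finset.mem_image.1 this
    exact ⟨k, e⟩
  have hne : ∀ k, (y k : ℕ) ≠ m := fun k e => hm ⟨k, Fin.ext e⟩
  rw [Finset.sum_eq_add m.castSucc m.succ (by simp [Fin.ext_iff])]
  · have : (fun k => row ((interval.{u}.map (SimplexCategory.δ m.castSucc).op).map (c k))) =
        fun k => row ((interval.{u}.map (SimplexCategory.δ m.succ).op).map (c k)) := by
      funext k j
      rw [hr, hr]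
      have := hne k
      simp only [Fin.val_castSucc, Fin.val_succ]
      have : (y k : ℕ) < m ↔ (y k : ℕ) < m + 1 := by omega
      simp only [this]
    rw [rowDet, rowDet, this]
    simp only [Fin.val_castSucc, Fin.val_succ]
    ring
  · intro i _ hi
    have hi1 : (i : ℕ) ≠ m := fun e => hi.1 (Fin.ext e)
    have hi2 : (i : ℕ) ≠ m + 1 := fun e => hi.2 (Fin.ext e)
    have hlt := i.2
    by_cases i0 : (i : ℕ) = 0
    · obtain ⟨k, hk⟩ := hm' 0 (fun e => hi1 (by rw [i0, ← e]; rfl))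
      rw [rowDet_eq_zero_of_row k, mul_zero]
      funext j
      rw [hr, hk, if_neg]; · rfl
      simp [i0]
    by_cases i1 : (i : ℕ) = n + 1
    · obtain ⟨k, hk⟩ := hm' (Fin.last n) (fun e => hi2 (by rw [i1, ← e]; rfl))
      rw [rowDet_eq_zero_of_row k, mul_zero]
      funext j
      rw [hr, hk, if_neg]; · rfl
      have := j.2
      simp only [Fin.val_last, i1]
      rw [if_pos (by omega)]
      omega
    obtain ⟨k, hk⟩ := hm' ⟨i, by omega⟩ (fun e => hi1 (by rw [← e]))
    obtain ⟨l, hl⟩ := hm' ⟨i - 1, by omega⟩ (fun e => hi2 (by rw [← e]; simp only; omega))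
    rw [rowDet_eq_zero_of_eq (k := k) (l := l), mul_zero]
    · rintro rfl
      have := hk.symm.trans hl
      simp only [Fin.ext_iff] at this
      omega
    · funext j
      rw [hr, hr, hk, hl]
      simp only
      rw [if_neg (show ¬ (i : ℕ) < i by omega), if_pos (show (i : ℕ) - 1 < i by omega),
        Nat.sub_add_cancel (by omega)]
  · simp
  · simp

end interval

end

/-! ### The fundamental class -/

section

open Limits HomologicalComplex Opposite Simplicial TensorProduct

namespace interval

open RatChain SSet.stdSimplex

/-- The class in `ℚ[(Δ¹, ∂Δ¹) ^ A]` of a family of simplices. -/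
noncomputable def simplex {A : Type} {n : ℕ} (c : A → (interval.{u}.obj (op ⦋n⦌)).carrier) :
    ((SPair.tensorPower A).obj interval.{u}).obj (op ⦋n⦌) :=
  PairType.cls ((PairType.pow A).obj (interval.{u}.obj (op ⦋n⦌))) c

theorem simplex_eq_zero {A : Type} {n : ℕ} {c : A → (interval.{u}.obj (op ⦋n⦌)).carrier} {a : A}
    (h : c a ∈ (interval.{u}.obj (op ⦋n⦌)).sub) : simplex c = 0 :=
  PairType.cls_eq_zero _ ⟨a, h⟩

theorem map_simplex {A : Type} {n m : ℕ} (f : op ⦋n⦌ ⟶ op ⦋m⦌)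
    (c : A → (interval.{u}.obj (op ⦋n⦌)).carrier) :
    ((SPair.tensorPower A).obj interval.{u}).map f (simplex c) =
      simplex fun a => (interval.{u}.map f).map (c a) := PairType.freeMap_cls _ _

theorem linearMap_ext_simplex {A : Type} {n : ℕ} {M : Type*} [AddCommGroup M] [Module ℚ M]
    {f g : ((SPair.tensorPower A).obj interval.{u}).obj (op ⦋n⦌) →ₗ[ℚ] M}
    (h : ∀ c, f (simplex c) = g (simplex c)) : f = g :=
  PairType.free_hom_ext h

/-- The determinant functional on `ℚ[(Δ¹, ∂Δ¹) ^ A]` in degree `n` given by `e : Fin n → A`. -/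
noncomputable def sgn {A : Type} {n : ℕ} (e : Fin n → A) (he : Function.Surjective e) :
    ((SPair.tensorPower A).obj interval.{u}).obj (op ⦋n⦌) →ₗ[ℚ] ℚ :=
  PairType.lift ((PairType.pow A).obj (interval.{u}.obj (op ⦋n⦌)))
    (fun c => rowDet fun k => c (e k)) fun c ⟨a, ha⟩ => by
      obtain ⟨k, rfl⟩ := he a
      exact rowDet_eq_zero_of_row k (row_eq_zero ha)

theorem sgn_simplex {A : Type} {n : ℕ} (e : Fin n → A) (he : Function.Surjective e)
    (c : A → (interval.{u}.obj (op ⦋n⦌)).carrier) :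
    sgn e he (simplex c) = rowDet fun k => c (e k) := PairType.lift_cls _ _ _ _

theorem sgn_d {A : Type} {n : ℕ} (e : Fin n → A) (he : Function.Surjective e)
    (x : ((SPair.tensorPower A).obj interval.{u}).obj (op ⦋n + 1⦌)) :
    sgn e he ((chains.obj ((SPair.tensorPower A).obj interval.{u})).d (n + 1) n x) = 0 := by
  rw [SMod.d_apply]
  have : sgn e he ∘ₗ ∑ i : Fin (n + 2), (-1 : ℚ) ^ (i : ℕ) •
      (((SPair.tensorPower A).obj interval.{u}).map (SimplexCategory.δ i).op).hom = 0 := by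
    refine linearMap_ext_simplex fun c => ?_
    rw [LinearMap.comp_apply, LinearMap.sum_apply, map_sum, LinearMap.zero_apply,
      ← sum_rowDet_face fun k => c (e k)]
    refine Finset.sum_congr rfl fun i _ => ?_
    rw [LinearMap.smul_apply, map_smul, smul_eq_mul]
    exact congr_arg _ ((congr_arg _ (map_simplex _ c)).trans (sgn_simplex _ _ _))
  have h := LinearMap.congr_fun this x
  rw [LinearMap.comp_apply, LinearMap.sum_apply] at h
  exact h

theorem powers_map_simplex {A B : FinSurj} (f : A ⟶ B) {n : ℕ}
    (c : B.carrier → (interval.{u}.obj (op ⦋n⦌)).carrier) :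
    ((interval.{u}.tensorPowers.map f.op).app (op ⦋n⦌)).hom (simplex c) =
      simplex fun a => c (f.1 a) := PairType.freeMap_cls _ _

/-- The determinant functionals are natural in the index set. Since `f` need not be injective, this is
the reason for admitting all surjective `e`, and not only bijections. -/
theorem sgn_map {A B : FinSurj} (f : A ⟶ B) {n : ℕ} (e : Fin n → A.carrier)
    (he : Function.Surjective e) (x : (interval.{u}.tensorPowers.obj (op B)).obj (op ⦋n⦌)) :
    sgn e he ((interval.{u}.tensorPowers.map f.op).app (op ⦋n⦌) x) =
      sgn (f.1 ∘ e) (f.2.comp he) x := by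
  let L : ((SPair.tensorPower B.carrier).obj interval.{u}).obj (op ⦋n⦌) →ₗ[ℚ]
      ((SPair.tensorPower A.carrier).obj interval.{u}).obj (op ⦋n⦌) :=
    ((interval.{u}.tensorPowers.map f.op).app (op ⦋n⦌)).hom
  have : sgn e he ∘ₗ L = sgn (f.1 ∘ e) (f.2.comp he) := linearMap_ext_simplex fun c => by
    rw [LinearMap.comp_apply]
    refine (congr_arg (sgn e he) (powers_map_simplex f c)).trans ?_
    rw [sgn_simplex, sgn_simplex]
    rfl
  exact LinearMap.congr_fun this x

/-- If `e` takes a value twice, then two rows of the determinants agree. -/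
theorem sgn_eq_zero {A : Type} {n : ℕ} (e : Fin n → A) (he : Function.Surjective e)
    (hi : ¬ Function.Injective e) : sgn.{u} e he = 0 := linearMap_ext_simplex fun c => by
  rw [Function.Injective] at hi
  push Not at hi
  obtain ⟨k, l, h, hkl⟩ := hi
  refine (sgn_simplex _ _ _).trans ?_
  rw [rowDet_eq_zero_of_eq hkl (by rw [h])]
  rfl

theorem sgn_comp_perm {A : Type} {n : ℕ} (e : Fin n ≃ A) (σ : Equiv.Perm (Fin n))
    (x : ((SPair.tensorPower A).obj interval.{u}).obj (op ⦋n⦌)) :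
    sgn (e ∘ σ) (e.surjective.comp σ.surjective) x =
      (Equiv.Perm.sign σ : ℚ) * sgn e e.surjective x :=
  LinearMap.congr_fun (g := (Equiv.Perm.sign σ : ℚ) • sgn e e.surjective)
    (linearMap_ext_simplex fun c => by
      refine (sgn_simplex _ _ _).trans (Eq.trans ?_ (congr_arg ((Equiv.Perm.sign σ : ℚ) * ·) (sgn_simplex e e.surjective c).symm))
      exact Matrix.det_permute σ (Matrix.of fun k => row (c (e k)))) x

theorem sgn_eq_zero_of_equiv {A : Type} {n : ℕ} (e : Fin n ≃ A)
    {x : ((SPair.tensorPower A).obj interval.{u}).obj (op ⦋n⦌)} (hx : sgn e e.surjective x = 0)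
    (e' : Fin n → A) (he' : Function.Surjective e') : sgn e' he' x = 0 := by
  have hb : Function.Bijective (e.symm ∘ e') :=
    Finite.surjective_iff_bijective.1 (e.symm.surjective.comp he')
  obtain ⟨σ, hσ⟩ : ∃ σ : Equiv.Perm (Fin n), e' = e ∘ σ :=
    ⟨Equiv.ofBijective _ hb, funext fun k => (e.apply_symm_apply _).symm⟩
  subst hσ
  rw [sgn_comp_perm, hx, mul_zero]

/-- The fundamental cycle of `(Δ¹, ∂Δ¹) ^ A`, the signed sum of the simplices of the standard
triangulation of the cube. -/
noncomputable def fundamental {A : Type} {n : ℕ} (e : Fin n ≃ A) :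
    ((SPair.tensorPower A).obj interval.{u}).obj (op ⦋n⦌) :=
  ∑ σ : Equiv.Perm (Fin n), (Equiv.Perm.sign σ : ℚ) •
    simplex fun a => jump (σ (e.symm a))

theorem sgn_fundamental {A : Type} {n : ℕ} (e : Fin n ≃ A) :
    sgn e e.surjective (fundamental.{u} e) = n.factorial := by
  have : ∀ σ : Equiv.Perm (Fin n), sgn e e.surjective ((Equiv.Perm.sign σ : ℚ) •
      simplex fun a => jump (σ (e.symm a))) = 1 :=
    fun σ => by
      refine (map_smul (sgn e e.surjective) _ _).trans ?_
      rw [sgn_simplex]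
      have h : rowDet (fun k => jump.{u} (σ (e.symm (e k)))) = (Equiv.Perm.sign σ : ℚ) := by
        have h1 : (Matrix.of fun k => row (jump.{u} (σ (e.symm (e k))))) =
            (1 : Matrix (Fin n) (Fin n) ℚ).submatrix σ id := by
          ext k j
          rw [Matrix.of_apply, e.symm_apply_apply, row_jump]
          rfl
        rw [rowDet, h1, Matrix.det_permute, Matrix.det_one, mul_one]
      rw [h]
      rcases Int.units_eq_one_or (Equiv.Perm.sign σ) with h | h <;> simp [h]
  rw [fundamental, map_sum, Finset.sum_congr rfl fun σ _ => this σ]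
  simp [Fintype.card_perm]

/-- The outer faces lie in the boundary of the cube, and the inner ones cancel in pairs. -/
theorem isCycle_fundamental {A : Type} {n : ℕ} (e : Fin n ≃ A) :
    IsCycle (chains.obj ((SPair.tensorPower A).obj interval.{u})) n (fundamental.{u} e) := by
  obtain _ | n := n
  · exact isCycle_zero _ _
  rw [isCycle_succ_iff, SMod.d_apply]
  refine Finset.sum_eq_zero fun i _ => ?_
  refine smul_eq_zero_of_right _ ?_
  rw [fundamental, map_sum]
  let F (y : Fin (n + 1)) : (interval.{u}.obj (op ⦋n⦌)).carrier :=
    (interval.{u}.map (SimplexCategory.δ i).op).map (jump y)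
  have hmap : ∀ σ : Equiv.Perm (Fin (n + 1)),
      ((SPair.tensorPower A).obj interval.{u}).map (SimplexCategory.δ i).op
        ((Equiv.Perm.sign σ : ℚ) • simplex fun a => jump (σ (e.symm a))) =
      (Equiv.Perm.sign σ : ℚ) • simplex fun a => F (σ (e.symm a)) := fun σ =>
    (map_smul _ _ _).trans (congr_arg _ (map_simplex _ _))
  rw [Finset.sum_congr rfl fun σ _ => hmap σ]
  have fat : ∀ (σ : Equiv.Perm (Fin (n + 1))) (k : Fin (n + 1)),
      F (σ k) ∈ (interval.{u}.obj (op ⦋n⦌)).sub → (simplex fun a => F (σ (e.symm a))) = 0 :=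
    fun σ k h => simplex_eq_zero (a := e k) (by rwa [← e.symm_apply_apply k] at h)
  by_cases i0 : (i : ℕ) = 0
  · refine Finset.sum_eq_zero fun σ _ => ?_
    rw [fat σ (σ.symm 0), smul_zero]
    rw [σ.apply_symm_apply, show F 0 = _ from face_jump i 0, if_neg (by omega)]
    exact objMk₁_zero_mem.{u} n
  by_cases i1 : (i : ℕ) = n + 1
  · refine Finset.sum_eq_zero fun σ _ => ?_
    rw [fat σ (σ.symm (Fin.last n)), smul_zero]
    rw [σ.apply_symm_apply, show F (Fin.last n) = _ from face_jump i _, if_pos (by simp [i1])]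
    exact objMk₁_last_mem.{u} n
  -- two permutations which differ by the transposition of `i - 1` and `i` have the same face
  have hi := i.2
  let p : Fin (n + 1) := ⟨i - 1, by omega⟩
  let q : Fin (n + 1) := ⟨i, by omega⟩
  have hp : (p : ℕ) = i - 1 := rfl
  have hq : (q : ℕ) = i := rfl
  have hpq : p ≠ q := fun h => by
    have : (i : ℕ) - 1 = i := congr_arg Fin.val h
    omega
  have hFpq : F p = F q := by
    refine (face_jump i p).trans (Eq.trans ?_ (face_jump i q).symm)
    rw [if_pos (by omega), if_neg (by omega)]
    refine congr_arg objMk₁ (Fin.ext ?_)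
    simp only [Fin.val_succ, Fin.val_castSucc]
    omega
  have hs : ∀ y, F (Equiv.swap p q y) = F y := fun y => by
    rw [Equiv.swap_apply_def]
    split_ifs with h1 h2
    · rw [h1, hFpq]
    · rw [h2, hFpq]
    · rfl
  refine Finset.sum_involution (fun σ _ => Equiv.swap p q * σ) (fun σ _ => ?_) (fun σ _ _ h => ?_)
    (fun σ _ => Finset.mem_univ _) (fun σ _ => ?_)
  · simp only [Equiv.Perm.mul_apply, hs, Equiv.Perm.sign_mul, Equiv.Perm.sign_swap hpq]
    rw [← add_smul]
    simp
  · have := congr_arg (fun τ : Equiv.Perm _ => τ (σ.symm p)) h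
    simp only [Equiv.Perm.mul_apply, Equiv.apply_symm_apply, Equiv.swap_apply_left] at this
    exact hpq this.symm
  · rw [← mul_assoc, Equiv.swap_mul_self, one_mul]

/-- The functional `sgn` detects the homology in degree `|A|`: it does not vanish on the fundamental
cycle, and that homology is at most one-dimensional. -/
theorem exists_boundary {A : Type} [Finite A] {n : ℕ} (e : Fin n ≃ A)
    (x : ((SPair.tensorPower A).obj interval.{u}).obj (op ⦋n⦌))
    (hx : IsCycle (chains.obj ((SPair.tensorPower A).obj interval.{u})) n x)
    (h : sgn e e.surjective x = 0) :
    ∃ y, (chains.obj ((SPair.tensorPower A).obj interval.{u})).d (n + 1) n y = x := by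
  have hn : Nat.card A = n := by simp [← Nat.card_congr e]
  obtain ⟨⟨z, hz, hz'⟩, -⟩ := isLine_tensorPower.{u} A
  subst hn
  obtain ⟨q, y, hq⟩ := hz' _ (isCycle_fundamental e)
  obtain ⟨q', y', rfl⟩ := hz' _ hx
  have h1 := sgn_fundamental.{u} e
  rw [hq] at h1
  have h1' : q * sgn e e.surjective z = (Nat.card A).factorial := by
    rw [← h1, map_add, sgn_d, add_zero, map_smul, smul_eq_mul]
  have h2 : q' * sgn e e.surjective z = 0 := by
    rw [← h, map_add, sgn_d, add_zero, map_smul, smul_eq_mul]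
  have h3 : sgn e e.surjective z ≠ 0 := fun h0 => by
    rw [h0, mul_zero] at h1'
    exact absurd h1'.symm (by positivity)
  rw [(mul_eq_zero.1 h2).resolve_right h3]
  exact ⟨y', by rw [zero_smul, zero_add]⟩

end interval

end

/-! ### Formality of the simplicial circle -/

section

open Limits HomologicalComplex Opposite Simplicial TensorProduct

namespace RightOmegaModule

open RatChain

/-- A right `Ω`-module is formal if it has a natural system of subspaces `R` which contains the
boundaries, meets the cycles in the boundaries, and spans everything together with the cycles: the
quotient by `R` has zero differential and the right homology. -/
theorem formal_of_submodule (M : RightOmegaModule.{u})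
    (R : ∀ A n, Submodule ℚ ((M.obj A).X n))
    (hmap : ∀ {A B} (f : A ⟶ B) n, ∀ x ∈ R A n, (M.map f).f n x ∈ R B n)
    (hd : ∀ A n x, (M.obj A).d (n + 1) n x ∈ R A n)
    (hcyc : ∀ A n, ∀ x ∈ R A n, IsCycle (M.obj A) n x → ∃ y, (M.obj A).d (n + 1) n y = x)
    (hspan : ∀ A n x, ∃ w, IsCycle (M.obj A) n w ∧ x - w ∈ R A n) : Formal M := by
  let Z : RightOmegaModule.{u} :=
    { obj := fun A =>
        { X := fun n => ModuleCat.of ℚ ((M.obj A).X n ⧸ R A n)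
          d := fun _ _ => 0 }
      map := fun {A B} f =>
        { f := fun n => ModuleCat.ofHom ((R A n).mapQ (R B n) ((M.map f).f n).hom (hmap f n)) }
      map_id := fun A => by
        ext n x
        exact congr_arg (Submodule.Quotient.mk (p := R A n))
          (ConcreteCategory.congr_hom (congr_arg (fun t => Hom.f t n) (M.map_id A)) x)
      map_comp := fun {A B C} f g => by
        ext n x
        exact congr_arg (Submodule.Quotient.mk (p := R C n))
          (ConcreteCategory.congr_hom (congr_arg (fun t => Hom.f t n) (M.map_comp f g)) x) }
  refine (formal_of_zero_differential Z fun _ _ _ => rfl).of_hasQuasiIso' ⟨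
    { app := fun A =>
        { f := fun n => ModuleCat.ofHom (R A n).mkQ
          comm' := fun i j h => by
            obtain rfl : j + 1 = i := h
            ext x
            exact ((Submodule.Quotient.mk_eq_zero _).2 (hd A j x)).symm } }, fun A => ?_⟩
  rw [quasiIso_iff_cycles]
  refine fun n => ⟨?_, ?_⟩
  · rintro x hx ⟨y, hy⟩
    exact hcyc A n x ((Submodule.Quotient.mk_eq_zero _).1 hy.symm) hx
  · intro z _
    obtain ⟨x, rfl⟩ := Submodule.Quotient.mk_surjective _ z
    obtain ⟨w, hw, h⟩ := hspan A n x
    exact ⟨w, 0, hw, ((Submodule.Quotient.eq _).2 h).trans (add_zero _).symm⟩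

end RightOmegaModule

namespace interval

open RatChain

/-- The right `Ω`-module of chains on the smash powers of the simplicial circle `Δ¹ / ∂Δ¹`, relative
to the base point, is formal. -/
theorem formal : RightOmegaModule.Formal (interval.{u}.tensorPowers ⋙ chains) := by
  have main : ∀ (A : FinSurjᵒᵖ) (n : ℕ), (∃ e : Fin n ≃ A.unop.carrier, True) ∨
      n ≠ Nat.card A.unop.carrier ∧ ∀ (e : Fin n → A.unop.carrier) (he : Function.Surjective e),
        sgn.{u} e he = 0 := fun A n => by
    have := A.unop.finite
    by_cases h : n = Nat.card A.unop.carrier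
    · exact .inl ⟨(finCongr h).trans (Finite.equivFin _).symm, trivial⟩
    · refine .inr ⟨h, fun e he => sgn_eq_zero e he fun hi => h ?_⟩
      rw [← Nat.card_congr (Equiv.ofBijective e ⟨hi, he⟩), Nat.card_fin]
  refine RightOmegaModule.formal_of_submodule _ (fun A n => ⨅ (e : Fin n → A.unop.carrier)
    (he : Function.Surjective e), LinearMap.ker (sgn.{u} e he)) ?_ ?_ ?_ ?_
  · intro A B f n x hx
    simp only [Submodule.mem_iInf] at hx ⊢
    exact fun e he => (sgn_map f.unop e he x).trans (hx _ _)
  · intro A n x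
    simp only [Submodule.mem_iInf]
    exact fun e he => sgn_d e he x
  · intro A n x hx hc
    simp only [Submodule.mem_iInf] at hx
    have := A.unop.finite
    obtain ⟨e, -⟩ | ⟨h, -⟩ := main A n
    · exact exists_boundary e x hc (hx _ e.surjective)
    · exact (isLine_tensorPower A.unop.carrier).2 n h x hc
  · intro A n x
    simp only [Submodule.mem_iInf]
    obtain ⟨e, -⟩ | ⟨-, h⟩ := main A n
    · refine ⟨(sgn e e.surjective x / n.factorial) • fundamental e, ?_, fun e' he' => ?_⟩
      · exact fun m => (map_smul _ _ _).trans (smul_eq_zero_of_right _ (isCycle_fundamental e m))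
      · refine sgn_eq_zero_of_equiv e ?_ e' he'
        have : (n.factorial : ℚ) ≠ 0 := by positivity
        refine (map_sub (sgn e e.surjective) _ _).trans ?_
        rw [map_smul, sgn_fundamental, smul_eq_mul, div_mul_cancel₀ _ this]
        exact sub_self _
    · exact ⟨0, fun m => map_zero _, fun e he => by rw [h e he]; rfl⟩

end interval

end

/-! ### Formal modules are split -/

section

open Limits HomologicalComplex Opposite Simplicial TensorProduct

namespace OmegaSMod

open RatChain

/-- The right `Ω`-module with zero differential and components `V n`. -/
noncomputable def zeroDifferential (V : ℕ → FinSurjᵒᵖ ⥤ ModuleCat.{u} ℚ) : RightOmegaModule.{u} where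
  obj A := { X := fun n => (V n).obj A, d := fun _ _ => 0 }
  map f := { f := fun n => (V n).map f }
  map_id A := by
    ext1 n
    exact (V n).map_id A
  map_comp f g := by
    ext1 n
    exact (V n).map_comp f g

namespace split

variable {E : ℕ → SMod.{u}} {V : ℕ → FinSurjᵒᵖ ⥤ ModuleCat.{u} ℚ}

/-- The map `(⨁ p, E p ⊗ V p A)_n → V n A` given by functionals on the degree `p` parts of the
`E p`. -/
noncomputable def functional (ε : ∀ p, (E p).obj (op ⦋p⦌) →ₗ[ℚ] ℚ) (A : FinSurjᵒᵖ) (n : ℕ) :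
    ((split E V).obj A).obj (op ⦋n⦌) →ₗ[ℚ] (V n).obj A :=
  (TensorProduct.lid ℚ ((V n).obj A)).toLinearMap ∘ₗ
    TensorProduct.map (ε n) (LinearMap.id (M := (V n).obj A)) ∘ₗ
      DirectSum.component ℚ ℕ (fun i => (E i).obj (op ⦋n⦌) ⊗[ℚ] (V i).obj A) n

open scoped Classical in
theorem component_tmul_self {I : Type} {E : I → SMod.{u}} {V : I → FinSurjᵒᵖ ⥤ ModuleCat.{u} ℚ}
    (A : FinSurjᵒᵖ) (i : I) {n : SimplexCategoryᵒᵖ} (x : (E i).obj n) (v : (V i).obj A) :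
    DirectSum.component ℚ I (fun i => (E i).obj n ⊗[ℚ] (V i).obj A) i (tmul E V A i x v) =
      x ⊗ₜ v :=
  DirectSum.component.lof_self (M := fun i => (E i).obj n ⊗[ℚ] (V i).obj A) ℚ i _

open scoped Classical in
theorem component_tmul_of_ne {I : Type} {E : I → SMod.{u}} {V : I → FinSurjᵒᵖ ⥤ ModuleCat.{u} ℚ}
    (A : FinSurjᵒᵖ) {i j : I} (h : j ≠ i) {n : SimplexCategoryᵒᵖ} (x : (E i).obj n)
    (v : (V i).obj A) :
    DirectSum.component ℚ I (fun i => (E i).obj n ⊗[ℚ] (V i).obj A) j (tmul E V A i x v) = 0 :=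
  (DirectSum.component.of (M := fun i => (E i).obj n ⊗[ℚ] (V i).obj A) ℚ j i _).trans
    (dif_neg h.symm)

theorem functional_tmul_self (ε : ∀ p, (E p).obj (op ⦋p⦌) →ₗ[ℚ] ℚ) (A : FinSurjᵒᵖ) (n : ℕ)
    (x : (E n).obj (op ⦋n⦌)) (v : (V n).obj A) :
    functional ε A n (tmul E V A n x v) = ε n x • v :=
  congr_arg ((TensorProduct.lid ℚ ((V n).obj A)).toLinearMap ∘ₗ
    TensorProduct.map (ε n) (LinearMap.id (M := (V n).obj A))) (component_tmul_self A n x v)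

theorem functional_tmul_of_ne (ε : ∀ p, (E p).obj (op ⦋p⦌) →ₗ[ℚ] ℚ) (A : FinSurjᵒᵖ) {n p : ℕ}
    (h : n ≠ p) (x : (E p).obj (op ⦋n⦌)) (v : (V p).obj A) :
    functional ε A n (tmul E V A p x v) = 0 :=
  (congr_arg ((TensorProduct.lid ℚ ((V n).obj A)).toLinearMap ∘ₗ
    TensorProduct.map (ε n) (LinearMap.id (M := (V n).obj A)))
      (component_tmul_of_ne A h x v)).trans (map_zero _)

theorem tmul_zero (A : FinSurjᵒᵖ) (i : ℕ) {n : SimplexCategoryᵒᵖ} (v : (V i).obj A) :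
    tmul E V A i (0 : (E i).obj n) v = 0 :=
  (congr_arg _ (TensorProduct.zero_tmul _ v)).trans (map_zero _)

/-- If `E p` has one-dimensional homology, concentrated in degree `p` and detected by a functional,
then `⨁ p, E p ⊗ V p` is quasi-isomorphic to the module with components `V p` and zero
differential. -/
theorem hasQuasiIso_zeroDifferential (V : ℕ → FinSurjᵒᵖ ⥤ ModuleCat.{u} ℚ)
    (ε : ∀ p, (E p).obj (op ⦋p⦌) →ₗ[ℚ] ℚ) (z : ∀ p, (E p).obj (op ⦋p⦌))
    (hz : ∀ p, IsCycle (chains.obj (E p)) p (z p)) (hεz : ∀ p, ε p (z p) = 1)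
    (hεd : ∀ p x, ε p ((chains.obj (E p)).d (p + 1) p x) = 0)
    (hε : ∀ p x, IsCycle (chains.obj (E p)) p x → ε p x = 0 →
      ∃ y, (chains.obj (E p)).d (p + 1) p y = x)
    (hE : ∀ p n, n ≠ p → AcyclicAt (chains.obj (E p)) n) :
    RightOmegaModule.HasQuasiIso (split E V ⋙ chains) (zeroDifferential V) := by
  let dE (p n : ℕ) : (E p).obj (op ⦋n + 1⦌) →ₗ[ℚ] (E p).obj (op ⦋n⦌) :=
    ((chains.obj (E p)).d (n + 1) n).hom
  let d (A : FinSurjᵒᵖ) (n : ℕ) : ((split E V).obj A).obj (op ⦋n + 1⦌) →ₗ[ℚ]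
      ((split E V).obj A).obj (op ⦋n⦌) := ((chains.obj ((split E V).obj A)).d (n + 1) n).hom
  have φd : ∀ A n x, functional ε A n ((chains.obj ((split E V).obj A)).d (n + 1) n x) = 0 := by
    intro A n
    refine LinearMap.congr_fun (f := functional ε A n ∘ₗ
      ((chains.obj ((split E V).obj A)).d (n + 1) n).hom) (g := 0) (linearMap_ext fun p x v => ?_)
    refine (congr_arg (functional ε A n) (d_tmul A p n x v)).trans ?_
    by_cases h : n = p
    · subst h
      rw [functional_tmul_self, hεd, zero_smul]
      rfl
    · exact functional_tmul_of_ne ε A h _ v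
  choose g hg using fun (p n : ℕ) =>
    LinearMap.exists_generalizedInverse (dE p n)
  let G (A : FinSurjᵒᵖ) (n : ℕ) : ((split E V).obj A).obj (op ⦋n⦌) →ₗ[ℚ]
      ((split E V).obj A).obj (op ⦋n + 1⦌) := operator (fun p => g p n) A
  -- the identity `x = d g (x - z ε x) + z ε x` for cycles of `E p` holds for cycles of the sum
  let π (n p : ℕ) : (E p).obj (op ⦋n⦌) →ₗ[ℚ] (E p).obj (op ⦋n⦌) :=
    if h : n = p then h ▸ (LinearMap.toSpanSingleton ℚ _ (z n) ∘ₗ ε n) else 0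
  let P (A : FinSurjᵒᵖ) (n : ℕ) : ((split E V).obj A).obj (op ⦋n⦌) →ₗ[ℚ]
      ((split E V).obj A).obj (op ⦋n⦌) := operator (π n) A
  have π_self : ∀ n x, π n n x = ε n x • z n := fun n x => by simp only [π, dif_pos rfl]; rfl
  have π_ne : ∀ n p, n ≠ p → π n p = 0 := fun n p h => dif_neg h
  have key : ∀ p n (x : (E p).obj (op ⦋n⦌)), IsCycle (chains.obj (E p)) n x →
      dE p n (g p n (x - π n p x)) = x - π n p x := fun p n x hx => by
    obtain ⟨y, hy⟩ : ∃ y, dE p n y = x - π n p x := by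
      by_cases h : n = p
      · subst h
        refine hε n _ (fun m => ?_) ?_
        · rw [π_self, map_sub, hx, map_smul, hz, smul_zero, sub_zero]
        · rw [π_self, map_sub, map_smul, hεz, smul_eq_mul, mul_one, sub_self]
      · rw [π_ne n p h]
        exact hE p n h _ (by rwa [LinearMap.zero_apply, sub_zero])
    rw [← hy]
    exact hg p n y
  let e (p : ℕ) : ∀ n, (E p).obj (op ⦋n⦌) →ₗ[ℚ] (E p).obj (op ⦋n⦌) := fun n => match n with
    | 0 => 0
    | n + 1 => g p n ∘ₗ dE p n
  have key' : ∀ p n (x : (E p).obj (op ⦋n⦌)), x - e p n x =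
      dE p n (g p n (x - e p n x - π n p (x - e p n x))) +
        π n p (x - e p n x) := fun p n x => by
    rw [key, sub_add_cancel]
    cases n with
    | zero => exact isCycle_zero _ _
    | succ n =>
      rw [isCycle_succ_iff, map_sub, sub_eq_zero]
      exact (hg p n x).symm
  let Q (A : FinSurjᵒᵖ) (n : ℕ) : ((split E V).obj A).obj (op ⦋n⦌) →ₗ[ℚ]
      ((split E V).obj A).obj (op ⦋n⦌) := operator (fun p => e p n) A
  have hsub : ∀ A p n (x y : (E p).obj (op ⦋n⦌)) (v : (V p).obj A),
      tmul E V A p (x - y) v = tmul E V A p x v - tmul E V A p y v := fun A p n x y v =>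
    (congr_arg _ (TensorProduct.sub_tmul x y v)).trans (map_sub _ _ _)
  have hadd : ∀ A p n (x y : (E p).obj (op ⦋n⦌)) (v : (V p).obj A),
      tmul E V A p (x + y) v = tmul E V A p x v + tmul E V A p y v := fun A p n x y v =>
    (congr_arg _ (TensorProduct.add_tmul x y v)).trans (map_add _ _ _)
  have key2 : ∀ A n (x : ((split E V).obj A).obj (op ⦋n⦌)), x - Q A n x =
      d A n (G A n (x - Q A n x - P A n (x - Q A n x))) + P A n (x - Q A n x) := fun A n => by
    have : LinearMap.id - Q A n = d A n ∘ₗ G A n ∘ₗ (LinearMap.id - Q A n - P A n ∘ₗ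
        (LinearMap.id - Q A n)) + P A n ∘ₗ (LinearMap.id - Q A n) := by
      refine linearMap_ext fun p x v => ?_
      simp only [LinearMap.add_apply, LinearMap.sub_apply, LinearMap.comp_apply, LinearMap.id_apply]
      simp only [Q, operator_tmul, ← hsub, P, G]
      have hd : ∀ y, d A n (tmul E V A p y v) = tmul E V A p (dE p n y) v :=
        fun y => d_tmul A p n y v
      rw [hd, ← hadd, ← key']
    exact fun x => LinearMap.congr_fun this x
  have hQ : ∀ A n x, IsCycle (chains.obj ((split E V).obj A)) n x → Q A n x = 0 := by
    intro A n x hx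
    cases n with
    | zero => 
      exact LinearMap.congr_fun (f := Q A 0) (g := 0) (linearMap_ext fun p x v => by
        refine (operator_tmul _ A p x v).trans ?_
        exact tmul_zero _ _ _) x
    | succ n =>
      rw [isCycle_succ_iff] at hx
      have : Q A (n + 1) = G A n ∘ₗ d A n := by
        refine linearMap_ext fun p x v => ?_
        refine (operator_tmul _ A p x v).trans ?_
        exact ((congr_arg (G A n) (d_tmul A p n x v)).trans (operator_tmul _ A p _ v)).symm
      rw [this]
      exact (congr_arg (G A n) hx).trans (map_zero _)
  have hP : ∀ A n x, P A n x = tmul E V A n (z n) (functional ε A n x) := by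
    intro A n
    refine LinearMap.congr_fun (f := P A n) (g := (LinearMap.comp
      ((ι E V A n).app (op ⦋n⦌)).hom (TensorProduct.mk ℚ ((E n).obj (op ⦋n⦌)) ((V n).obj A) (z n)))
        ∘ₗ functional ε A n) (linearMap_ext fun p x v => ?_)
    change operator (π n) A (tmul E V A p x v) = tmul E V A n (z n) (functional ε A n _)
    rw [operator_tmul]
    by_cases h : n = p
    · subst h
      rw [π_self, functional_tmul_self]
      exact congr_arg _ (TensorProduct.smul_tmul _ _ _)
    · rw [functional_tmul_of_ne ε A h, π_ne n p h, LinearMap.zero_apply, tmul_zero]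
      exact ((congr_arg _ (TensorProduct.tmul_zero _ _)).trans (map_zero _)).symm
  refine ⟨
    { app := fun A =>
        { f := fun n => ModuleCat.ofHom (functional ε A n)
          comm' := fun i j h => by
            obtain rfl : j + 1 = i := h
            ext x
            exact (φd A j x).symm }
      naturality := fun A B f => by
        refine HomologicalComplex.hom_ext _ _ fun n => ?_
        ext1
        refine linearMap_ext fun p x v => ?_
        change functional ε B n (((split E V).map f).app _ (tmul E V A p x v)) =
          (V n).map f (functional ε A n (tmul E V A p x v))
        rw [map_tmul]
        by_cases h : n = p
        · subst h
          rw [functional_tmul_self, functional_tmul_self, map_smul]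
        · rw [functional_tmul_of_ne ε A h, functional_tmul_of_ne ε B h, map_zero] }, fun A => ?_⟩
  rw [quasiIso_iff_cycles]
  refine fun n => ⟨?_, ?_⟩
  · rintro x hx ⟨y, hy⟩
    have h0 : functional ε A n x = 0 := hy.symm
    have h1 := key2 A n x
    rw [hQ A n x hx, sub_zero, hP, h0] at h1
    have h2 : tmul E V A n (z n) (0 : (V n).obj A) = 0 :=
      (congr_arg _ (TensorProduct.tmul_zero _ _)).trans (map_zero _)
    rw [h2, sub_zero, add_zero] at h1
    exact ⟨_, h1.symm⟩
  · intro (v : (V n).obj A) _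
    refine ⟨tmul E V A n (z n) v, 0, ?_, ?_⟩
    · intro m
      by_cases h : m + 1 = n
      · subst h
        refine (d_tmul A (m + 1) m _ v).trans ?_
        rw [hz]
        exact tmul_zero _ _ _
      · have := ((split E V ⋙ chains).obj A).shape n m h
        rw [this]
        rfl
    · refine (?_ : v = functional ε A n (tmul E V A n (z n) v)).trans (add_zero _).symm
      exact ((functional_tmul_self ε A n _ v).trans (by rw [hεz, one_smul])).symm

end split

/-- The formal right `Ω`-modules in simplicial vector spaces are split up to weak equivalence:
the powers of the simplicial circle provide simplicial vector spaces `E p` with one-dimensional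
homology in degree `p`, and `⨁ p, E p ⊗ H_p(M)` is connected to `M` through the homology of `M`. -/
theorem eqvGen_split {M : OmegaSMod.{u}} (hM : RightOmegaModule.Formal (M ⋙ chains)) :
    ∃ (E : ℕ → SMod.{u}) (V : ℕ → FinSurjᵒᵖ ⥤ ModuleCat.{u} ℚ),
      Relation.EqvGen HasWeakEquiv M (split E V) := by
  let V (n : ℕ) : FinSurjᵒᵖ ⥤ ModuleCat.{u} ℚ := (M ⋙ chains) ⋙ homologyFunctor _ _ n
  let E (p : ℕ) : SMod.{u} := (SPair.tensorPower (Fin p)).obj interval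
  have hq : RightOmegaModule.HasQuasiIso (split E V ⋙ chains) (zeroDifferential V) := by
    refine split.hasQuasiIso_zeroDifferential V
      (fun p => (p.factorial : ℚ)⁻¹ • interval.sgn (Equiv.refl (Fin p)) Function.surjective_id)
      (fun p => interval.fundamental (Equiv.refl (Fin p)))
      (fun p => interval.isCycle_fundamental _) (fun p => ?_) (fun p x => ?_) (fun p x hx h => ?_)
      (fun p n hn => (interval.isLine_tensorPower (Fin p)).2 n (by rwa [Nat.card_fin]))
    · have : (p.factorial : ℚ) ≠ 0 := by positivity
      refine (congr_arg ((p.factorial : ℚ)⁻¹ * ·) (interval.sgn_fundamental _)).trans ?_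
      exact inv_mul_cancel₀ this
    · exact (congr_arg ((p.factorial : ℚ)⁻¹ * ·) (interval.sgn_d _ _ _)).trans (mul_zero _)
    · have : (p.factorial : ℚ)⁻¹ ≠ 0 := by positivity
      exact interval.exists_boundary (Equiv.refl (Fin p)) x hx
        ((mul_eq_zero.1 (show (p.factorial : ℚ)⁻¹ * _ = 0 from h)).resolve_left this)
  exact ⟨E, V, eqvGen_of_chains (hM.trans _ _ _ (Relation.EqvGen.rel _ _ hq).symm)⟩

/-- The convolution product of formal right `Ω`-modules is formal. -/
theorem formal_conv {M N : OmegaSMod.{u}} (hM : RightOmegaModule.Formal (M ⋙ chains))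
    (hN : RightOmegaModule.Formal (N ⋙ chains)) :
    RightOmegaModule.Formal (conv M N ⋙ chains) := by
  obtain ⟨E, V, h⟩ := eqvGen_split hM
  obtain ⟨E', V', h'⟩ := eqvGen_split hN
  refine RightOmegaModule.Formal.of_eqvGen (split.formal _ _) (eqvGen_chains
    ((Relation.EqvGen.rel _ _ (hasWeakEquiv_splitProd_conv E V E' V')).trans _ _ _
      (eqvGen_conv h h').symm))

end OmegaSMod

end

/-! ### Disjoint unions of simplicial pairs -/

section

open Limits HomologicalComplex Opposite Simplicial TensorProduct

namespace SPair

/-- The class in `S.tensorPowers` of a family of simplices. -/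
noncomputable def powCls (S : SPair.{u}) (A : FinSurjᵒᵖ) {n : SimplexCategoryᵒᵖ}
    (c : A.unop.carrier → (S.obj n).carrier) : (S.tensorPowers.obj A).obj n :=
  PairType.cls ((PairType.pow A.unop.carrier).obj (S.obj n)) c

theorem powCls_eq_zero {S : SPair.{u}} {A : FinSurjᵒᵖ} {n : SimplexCategoryᵒᵖ}
    {c : A.unop.carrier → (S.obj n).carrier} {a : A.unop.carrier} (h : c a ∈ (S.obj n).sub) :
    S.powCls A c = 0 := PairType.cls_eq_zero _ ⟨a, h⟩

theorem level_powCls {S : SPair.{u}} {A : FinSurjᵒᵖ} {m n : SimplexCategoryᵒᵖ} (g : m ⟶ n)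
    (c : A.unop.carrier → (S.obj m).carrier) :
    (S.tensorPowers.obj A).map g (S.powCls A c) = S.powCls A fun a => (S.map g).map (c a) :=
  PairType.freeMap_cls _ _

theorem map_powCls {S : SPair.{u}} {A B : FinSurjᵒᵖ} (f : A ⟶ B) {n : SimplexCategoryᵒᵖ}
    (c : A.unop.carrier → (S.obj n).carrier) :
    (S.tensorPowers.map f).app n (S.powCls A c) = S.powCls B fun b => c (f.unop.1 b) :=
  PairType.freeMap_cls _ _

theorem powCls_ext {S : SPair.{u}} {A : FinSurjᵒᵖ} {n : SimplexCategoryᵒᵖ} {M : Type*}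
    [AddCommGroup M] [Module ℚ M] {f g : (S.tensorPowers.obj A).obj n →ₗ[ℚ] M}
    (h : ∀ c, f (S.powCls A c) = g (S.powCls A c)) : f = g := PairType.free_hom_ext h

/-- The linear map on `S.tensorPowers` with given values on families of simplices. -/
noncomputable def powLift (S : SPair.{u}) (A : FinSurjᵒᵖ) {n : SimplexCategoryᵒᵖ} {M : Type*}
    [AddCommGroup M] [Module ℚ M] (f : (A.unop.carrier → (S.obj n).carrier) → M)
    (hf : ∀ c a, c a ∈ (S.obj n).sub → f c = 0) : (S.tensorPowers.obj A).obj n →ₗ[ℚ] M :=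
  PairType.lift ((PairType.pow A.unop.carrier).obj (S.obj n)) f fun c ⟨a, ha⟩ => hf c a ha

theorem powLift_powCls (S : SPair.{u}) (A : FinSurjᵒᵖ) {n : SimplexCategoryᵒᵖ} {M : Type*}
    [AddCommGroup M] [Module ℚ M] (f : (A.unop.carrier → (S.obj n).carrier) → M)
    (hf : ∀ c a, c a ∈ (S.obj n).sub → f c = 0) (c : A.unop.carrier → (S.obj n).carrier) :
    S.powLift A f hf (S.powCls A c) = f c := PairType.lift_cls _ _ _ _

/-- The disjoint union of two simplicial pairs. -/
def coprod (S T : SPair.{u}) : SPair.{u} where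
  obj n := ⟨(S.obj n).carrier ⊕ (T.obj n).carrier, Sum.elim (S.obj n).sub (T.obj n).sub⟩
  map f := ⟨Sum.map (S.map f).map (T.map f).map, fun x hx => by
    cases x with
    | inl x => exact (S.map f).mem x hx
    | inr x => exact (T.map f).mem x hx⟩
  map_id n := by
    ext (x | x)
    · exact congr_arg Sum.inl (congr_fun (congr_arg PairType.Hom.map (S.map_id n)) x)
    · exact congr_arg Sum.inr (congr_fun (congr_arg PairType.Hom.map (T.map_id n)) x)
  map_comp f g := by
    ext (x | x)
    · exact congr_arg Sum.inl (congr_fun (congr_arg PairType.Hom.map (S.map_comp f g)) x)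
    · exact congr_arg Sum.inr (congr_fun (congr_arg PairType.Hom.map (T.map_comp f g)) x)

namespace coprod

variable {S T : SPair.{u}}

/-- The elements of `S` in a family of elements of `S ⊔ T`. -/
def left {A : FinSurjᵒᵖ} {n : SimplexCategoryᵒᵖ} (c : A.unop.carrier → ((coprod S T).obj n).carrier)
    (χ : A.unop.carrier → Bool) (h : ∀ a, Sum.isRight (c a) = χ a)
    (a : (A.unop.fib χ false).carrier) : (S.obj n).carrier :=
  Sum.getLeft (c a.1) (Sum.isRight_eq_false.1 ((h _).trans a.2))

/-- The elements of `T` in a family of elements of `S ⊔ T`. -/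
def right {A : FinSurjᵒᵖ} {n : SimplexCategoryᵒᵖ}
    (c : A.unop.carrier → ((coprod S T).obj n).carrier)
    (χ : A.unop.carrier → Bool) (h : ∀ a, Sum.isRight (c a) = χ a)
    (a : (A.unop.fib χ true).carrier) : (T.obj n).carrier :=
  Sum.getRight (c a.1) ((h _).trans a.2)

/-- The tensor corresponding to a family of elements of `S ⊔ T`. -/
noncomputable def toConvFun (A : FinSurjᵒᵖ) {n : SimplexCategoryᵒᵖ}
    (c : A.unop.carrier → ((coprod S T).obj n).carrier)
    (χ : A.unop.carrier → Bool) (h : ∀ a, Sum.isRight (c a) = χ a) :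
    ((OmegaSMod.conv S.tensorPowers T.tensorPowers).obj A).obj n :=
  OmegaSMod.conv.tmul A χ (S.powCls (op (A.unop.fib χ false)) (left c χ h))
    (T.powCls (op (A.unop.fib χ true)) (right c χ h))

theorem toConvFun_congr (A : FinSurjᵒᵖ) {n : SimplexCategoryᵒᵖ}
    {c c' : A.unop.carrier → ((coprod S T).obj n).carrier} (hc : c = c')
    {χ χ' : A.unop.carrier → Bool} (h : ∀ a, Sum.isRight (c a) = χ a)
    (h' : ∀ a, Sum.isRight (c' a) = χ' a) : toConvFun A c χ h = toConvFun A c' χ' h' := by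
  subst hc
  obtain rfl : χ = χ' := funext fun a => (h a).symm.trans (h' a)
  rfl

theorem toConvFun_eq_zero (A : FinSurjᵒᵖ) {n : SimplexCategoryᵒᵖ}
    (c : A.unop.carrier → ((coprod S T).obj n).carrier)
    (χ : A.unop.carrier → Bool) (h : ∀ a, Sum.isRight (c a) = χ a) (a : A.unop.carrier)
    (ha : c a ∈ ((coprod S T).obj n).sub) : toConvFun A c χ h = 0 := by
  obtain ⟨b, hb⟩ : ∃ b, χ a = b := ⟨_, rfl⟩
  cases b with
  | false =>
    have : S.powCls (op (A.unop.fib χ false)) (left c χ h) = 0 := by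
      refine powCls_eq_zero (A := op (A.unop.fib χ false)) (a := ⟨a, hb⟩) ?_
      have h1 : c a = Sum.inl (left c χ h ⟨a, hb⟩) := (Sum.inl_getLeft _ _).symm
      rw [h1] at ha
      exact ha
    rw [toConvFun, this]
    exact (congr_arg _ (TensorProduct.zero_tmul _ _)).trans (map_zero _)
  | true =>
    have : T.powCls (op (A.unop.fib χ true)) (right c χ h) = 0 := by
      refine powCls_eq_zero (A := op (A.unop.fib χ true)) (a := ⟨a, hb⟩) ?_
      have h1 : c a = Sum.inr (right c χ h ⟨a, hb⟩) := (Sum.inr_getRight _ _).symm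
      rw [h1] at ha
      exact ha
    rw [toConvFun, this]
    exact (congr_arg _ (TensorProduct.tmul_zero _ _)).trans (map_zero _)

/-- The decomposition of `ℚ[(S ⊔ T) ^ A]`. -/
noncomputable def toConvApp (A : FinSurjᵒᵖ) (n : SimplexCategoryᵒᵖ) :
    ((coprod S T).tensorPowers.obj A).obj n →ₗ[ℚ]
      ((OmegaSMod.conv S.tensorPowers T.tensorPowers).obj A).obj n :=
  powLift _ A (fun c => toConvFun A c (fun a => Sum.isRight (c a)) fun _ => rfl)
    fun c a ha => toConvFun_eq_zero A c _ _ a ha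

theorem toConvApp_powCls {A : FinSurjᵒᵖ} {n : SimplexCategoryᵒᵖ}
    (c : A.unop.carrier → ((coprod S T).obj n).carrier)
    (χ : A.unop.carrier → Bool) (h : ∀ a, Sum.isRight (c a) = χ a) :
    toConvApp A n (powCls _ A c) = toConvFun A c χ h :=
  (powLift_powCls _ _ _ _ _).trans (toConvFun_congr A rfl _ _)

theorem isRight_map {m n : SimplexCategoryᵒᵖ} (g : m ⟶ n) (x : ((coprod S T).obj m).carrier) :
    Sum.isRight (((coprod S T).map g).map x : (S.obj n).carrier ⊕ (T.obj n).carrier) =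
      Sum.isRight x := by
  cases x <;> rfl

/-- The map `ℚ[(S ⊔ T) ^ A] → ⨁ ℚ[S ^ A₀] ⊗ ℚ[T ^ A₁]`. -/
noncomputable def toConv :
    (coprod S T).tensorPowers ⟶ OmegaSMod.conv S.tensorPowers T.tensorPowers where
  app A :=
    { app := fun n => ModuleCat.ofHom (toConvApp A n)
      naturality := fun m n g => by
        ext1
        refine powCls_ext (A := A) fun c => ?_
        change toConvApp A n (((coprod S T).tensorPowers.obj A).map g (powCls _ A c)) =
          ((OmegaSMod.conv S.tensorPowers T.tensorPowers).obj A).map g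
            (toConvApp A m (powCls _ A c))
        rw [level_powCls, toConvApp_powCls _ (fun a => Sum.isRight (c a)) fun a => isRight_map g _,
          toConvApp_powCls _ (fun a => Sum.isRight (c a)) fun a => rfl, toConvFun, toConvFun,
          OmegaSMod.conv.level_tmul, level_powCls, level_powCls]
        refine congr_arg₂ (fun x y => OmegaSMod.conv.tmul A _ (powCls _ _ x) (powCls _ _ y))
          (funext fun a => ?_) (funext fun a => ?_)
        · refine Sum.inl_injective (β := (T.obj n).carrier) ((Sum.inl_getLeft _ _).trans ?_)
          exact congr_arg ((coprod S T).map g).map (Sum.inl_getLeft (c a.1) _).symm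
        · refine Sum.inr_injective (α := (S.obj n).carrier) ((Sum.inr_getRight _ _).trans ?_)
          exact congr_arg ((coprod S T).map g).map (Sum.inr_getRight (c a.1) _).symm }
  naturality A B f := by
    refine NatTrans.ext (funext fun n => ?_)
    ext1
    refine powCls_ext (A := A) fun c => ?_
    change toConvApp B n (((coprod S T).tensorPowers.map f).app n (powCls _ A c)) =
      ((OmegaSMod.conv S.tensorPowers T.tensorPowers).map f).app n (toConvApp A n (powCls _ A c))
    rw [map_powCls, toConvApp_powCls _ (fun a => Sum.isRight (c (f.unop.1 a))) fun a => rfl,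
      toConvApp_powCls _ (fun a => Sum.isRight (c a)) fun a => rfl, toConvFun, toConvFun,
      OmegaSMod.conv.map_tmul]
    exact congr_arg₂ (OmegaSMod.conv.tmul B _)
      (map_powCls (S := S) (FinSurj.fibMap f.unop (fun a => Sum.isRight (c a)) false).op
        (left c _ fun _ => rfl)).symm
      (map_powCls (S := T) (FinSurj.fibMap f.unop (fun a => Sum.isRight (c a)) true).op
        (right c _ fun _ => rfl)).symm

open scoped Classical in
/-- The family of elements of `S ⊔ T` with given elements of `S` and of `T`. -/
noncomputable def glue {A : FinSurjᵒᵖ} {n : SimplexCategoryᵒᵖ} (χ : A.unop.carrier → Bool)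
    (x : (A.unop.fib χ false).carrier → (S.obj n).carrier)
    (y : (A.unop.fib χ true).carrier → (T.obj n).carrier) (a : A.unop.carrier) :
    ((coprod S T).obj n).carrier :=
  if h : χ a = false then Sum.inl (x ⟨a, h⟩) else Sum.inr (y ⟨a, by simpa using h⟩)

theorem glue_left {A : FinSurjᵒᵖ} {n : SimplexCategoryᵒᵖ} (χ : A.unop.carrier → Bool)
    (x : (A.unop.fib χ false).carrier → (S.obj n).carrier)
    (y : (A.unop.fib χ true).carrier → (T.obj n).carrier) (a : (A.unop.fib χ false).carrier) :
    glue χ x y a.1 = Sum.inl (x a) := dif_pos a.2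

theorem glue_right {A : FinSurjᵒᵖ} {n : SimplexCategoryᵒᵖ} (χ : A.unop.carrier → Bool)
    (x : (A.unop.fib χ false).carrier → (S.obj n).carrier)
    (y : (A.unop.fib χ true).carrier → (T.obj n).carrier) (a : (A.unop.fib χ true).carrier) :
    glue χ x y a.1 = Sum.inr (y a) := dif_neg (by rw [a.2]; simp)

theorem isRight_glue {A : FinSurjᵒᵖ} {n : SimplexCategoryᵒᵖ} (χ : A.unop.carrier → Bool)
    (x : (A.unop.fib χ false).carrier → (S.obj n).carrier)
    (y : (A.unop.fib χ true).carrier → (T.obj n).carrier) (a : A.unop.carrier) :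
    Sum.isRight (glue χ x y a) = χ a := by
  obtain ⟨b, hb⟩ : ∃ b, χ a = b := ⟨_, rfl⟩
  cases b with
  | false => exact (congr_arg Sum.isRight (glue_left χ x y ⟨a, hb⟩)).trans hb.symm
  | true => exact (congr_arg Sum.isRight (glue_right χ x y ⟨a, hb⟩)).trans hb.symm

/-- The inverse of `toConv`. -/
noncomputable def ofConvApp (A : FinSurjᵒᵖ) (n : SimplexCategoryᵒᵖ) :
    ((OmegaSMod.conv S.tensorPowers T.tensorPowers).obj A).obj n →ₗ[ℚ]
      ((coprod S T).tensorPowers.obj A).obj n :=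
  DirectSum.descend (fun χ : A.unop.carrier → Bool =>
    (S.tensorPowers.obj (op (A.unop.fib χ false))).obj n ⊗[ℚ]
      (T.tensorPowers.obj (op (A.unop.fib χ true))).obj n) fun χ =>
    TensorProduct.lift (powLift S (op (A.unop.fib χ false)) (fun x =>
      powLift T (op (A.unop.fib χ true)) (fun y => powCls (coprod S T) A (glue χ x y))
        fun y a ha => powCls_eq_zero (a := a.1) (by rw [glue_right]; exact ha))
      fun x a ha => powCls_ext (A := op (A.unop.fib χ true)) fun y => by
        rw [powLift_powCls]
        exact powCls_eq_zero (a := a.1) (by rw [glue_left]; exact ha))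

theorem ofConvApp_tmul (A : FinSurjᵒᵖ) (n : SimplexCategoryᵒᵖ) (χ : A.unop.carrier → Bool)
    (x : (A.unop.fib χ false).carrier → (S.obj n).carrier)
    (y : (A.unop.fib χ true).carrier → (T.obj n).carrier) :
    ofConvApp A n (OmegaSMod.conv.tmul A χ (S.powCls (op (A.unop.fib χ false)) x)
      (T.powCls (op (A.unop.fib χ true)) y)) = powCls (coprod S T) A (glue χ x y) := by
  refine (DirectSum.descend_inc _ _ _ _).trans ?_
  refine (TensorProduct.lift.tmul _ _).trans ?_
  rw [powLift_powCls, powLift_powCls]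

theorem toConvApp_bijective (A : FinSurjᵒᵖ) (n : SimplexCategoryᵒᵖ) :
    Function.Bijective (toConvApp (S := S) (T := T) A n) := by
  have h1 : ofConvApp A n ∘ₗ toConvApp (S := S) (T := T) A n = LinearMap.id :=
    powCls_ext (A := A) fun c => by
      rw [LinearMap.comp_apply, toConvApp_powCls _ (fun a => Sum.isRight (c a)) fun a => rfl,
        toConvFun, ofConvApp_tmul]
      refine congr_arg (powCls _ A) (funext fun a => ?_)
      obtain ⟨b, hb⟩ : ∃ b, Sum.isRight (c a) = b := ⟨_, rfl⟩
      cases b with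
      | false => exact (glue_left _ _ _ ⟨a, hb⟩).trans (Sum.inl_getLeft _ _)
      | true => exact (glue_right _ _ _ ⟨a, hb⟩).trans (Sum.inr_getRight _ _)
  have h2 : toConvApp (S := S) (T := T) A n ∘ₗ ofConvApp A n = LinearMap.id := by
    refine DirectSum.linearMap_ext_inc fun χ => ?_
    refine TensorProduct.ext (powCls_ext (A := op (A.unop.fib χ false)) fun x =>
      powCls_ext (A := op (A.unop.fib χ true)) fun y => ?_)
    change toConvApp A n (ofConvApp A n (OmegaSMod.conv.tmul A χ
      (S.powCls (op (A.unop.fib χ false)) x) (T.powCls (op (A.unop.fib χ true)) y))) =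
      OmegaSMod.conv.tmul A χ
      (S.powCls (op (A.unop.fib χ false)) x) (T.powCls (op (A.unop.fib χ true)) y)
    rw [ofConvApp_tmul, toConvApp_powCls _ χ (isRight_glue χ x y), toConvFun]
    refine congr_arg₂ (fun x y => OmegaSMod.conv.tmul A _ (powCls _ _ x) (powCls _ _ y))
      (funext fun a => ?_) (funext fun a => ?_)
    · exact Sum.inl_injective (β := (T.obj n).carrier)
        ((Sum.inl_getLeft _ _).trans (glue_left _ _ _ a))
    · exact Sum.inr_injective (α := (S.obj n).carrier)
        ((Sum.inr_getRight _ _).trans (glue_right _ _ _ a))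
  exact ⟨Function.LeftInverse.injective (g := ofConvApp A n) fun x => LinearMap.congr_fun h1 x,
    Function.RightInverse.surjective (g := ofConvApp A n) fun x => LinearMap.congr_fun h2 x⟩

end coprod

/-- The tensor powers of a disjoint union are the convolution product of the tensor powers. -/
theorem hasWeakEquiv_coprod (S T : SPair.{u}) : OmegaSMod.HasWeakEquiv (coprod S T).tensorPowers
    (OmegaSMod.conv S.tensorPowers T.tensorPowers) :=
  ⟨coprod.toConv, fun A => SMod.WeakEquiv.of_bijective fun n =>
    coprod.toConvApp_bijective A (op ⦋n⦌)⟩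

theorem formal_coprod {S T : SPair.{u}} (hS : RightOmegaModule.Formal (S.tensorPowers ⋙ chains))
    (hT : RightOmegaModule.Formal (T.tensorPowers ⋙ chains)) :
    RightOmegaModule.Formal ((coprod S T).tensorPowers ⋙ chains) :=
  (OmegaSMod.formal_conv hS hT).of_eqvGen
    (OmegaSMod.eqvGen_chains (.rel _ _ (hasWeakEquiv_coprod S T))).symm

end SPair

end

/-! ### Singular simplices -/

section

open Limits HomologicalComplex Opposite Simplicial TensorProduct

namespace TopCat

/-- The evaluation of a singular simplex at a point of the standard simplex. -/
noncomputable def simplexEval {Z : TopCat.{u}} {n : SimplexCategoryᵒᵖ} (σ : (toSSet.obj Z).obj n)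
    (p : stdSimplex ℝ (Fin (n.unop.len + 1))) : Z := toSSetObjEquiv Z n σ p

theorem simplex_ext {Z : TopCat.{u}} {n : SimplexCategoryᵒᵖ} {σ τ : (toSSet.obj Z).obj n}
    (h : ∀ p, simplexEval σ p = simplexEval τ p) : σ = τ :=
  (toSSetObjEquiv Z n).injective (ContinuousMap.ext h)

/-- The singular simplex given by a continuous map. -/
noncomputable def simplexMk {Z : TopCat.{u}} (n : SimplexCategoryᵒᵖ)
    (f : C(stdSimplex ℝ (Fin (n.unop.len + 1)), Z)) : (toSSet.obj Z).obj n :=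
  (toSSetObjEquiv Z n).symm f

theorem simplexEval_mk {Z : TopCat.{u}} {n : SimplexCategoryᵒᵖ}
    (f : C(stdSimplex ℝ (Fin (n.unop.len + 1)), Z)) (p : stdSimplex ℝ (Fin (n.unop.len + 1))) :
    simplexEval (simplexMk n f) p = f p := by
  rw [simplexEval, simplexMk, Equiv.apply_symm_apply]

theorem continuous_simplexEval {Z : TopCat.{u}} {n : SimplexCategoryᵒᵖ} (σ : (toSSet.obj Z).obj n) :
    Continuous (simplexEval σ) := (toSSetObjEquiv Z n σ).continuous

theorem simplexEval_level {Z : TopCat.{u}} {n m : SimplexCategoryᵒᵖ} (f : n ⟶ m)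
    (σ : (toSSet.obj Z).obj n) (p : stdSimplex ℝ (Fin (m.unop.len + 1))) :
    simplexEval ((toSSet.obj Z).map f σ) p = simplexEval σ (stdSimplex.map f.unop p) := rfl

theorem simplexEval_map {Z W : TopCat.{u}} (f : Z ⟶ W) {n : SimplexCategoryᵒᵖ}
    (σ : (toSSet.obj Z).obj n) (p : stdSimplex ℝ (Fin (n.unop.len + 1))) :
    simplexEval ((toSSet.map f).app n σ) p = f (simplexEval σ p) := rfl

end TopCat

open TopCat

/-- The subcomplex of the singular simplices which lie in one member of a family of subsets. -/
noncomputable def singSub (Z : TopCat.{u}) (𝒰 : Set (Set Z)) : (toSSet.obj Z).Subcomplex where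
  obj n := {σ | ∃ U ∈ 𝒰, ∀ p, simplexEval σ p ∈ U}
  map f := by
    rintro σ ⟨U, hU, h⟩
    exact ⟨U, hU, fun p => h _⟩

/-- The simplicial pair of the singular simplices of `Z` and those lying in one member of `𝒰`. -/
noncomputable def sing (Z : TopCat.{u}) (𝒰 : Set (Set Z)) : SPair.{u} :=
  SPair.ofSubcomplex _ (singSub Z 𝒰)

/-- A map from `Z` to `W` sends every member of `𝒰` into a member of `𝒱`. -/
def Subordinate {Z W : Type*} (𝒰 : Set (Set Z)) (𝒱 : Set (Set W)) (f : Z → W) : Prop :=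
  ∀ U ∈ 𝒰, ∃ V ∈ 𝒱, Set.MapsTo f U V

theorem Subordinate.singleton {Z W : Type*} {U : Set Z} {V : Set W} {f : Z → W}
    (h : Set.MapsTo f U V) : Subordinate {U} {V} f := by
  rintro _ rfl
  exact ⟨V, rfl, h⟩

/-- The functoriality of `sing`. -/
noncomputable def singMap {Z W : TopCat.{u}} {𝒰 : Set (Set Z)} {𝒱 : Set (Set W)} (f : Z ⟶ W)
    (hf : Subordinate 𝒰 𝒱 f) : sing Z 𝒰 ⟶ sing W 𝒱 :=
  SPair.ofSubcomplexMap (toSSet.map f) fun n σ ⟨U, hU, h⟩ => by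
    obtain ⟨V, hV, h'⟩ := hf U hU
    exact ⟨V, hV, fun p => h' (h p)⟩

open MonoidalCategory in
theorem exists_simplexEval_homotopy {Z W : TopCat.{u}} {f g : Z ⟶ W} (H : TopCat.Homotopy f g)
    {n : SimplexCategoryᵒᵖ} (σ : (toSSet.obj Z).obj n) (τ : Δ[1].obj n)
    (p : stdSimplex ℝ (Fin (n.unop.len + 1))) :
    ∃ t, simplexEval ((TopCat.Homotopy.toSSet H).h.app n (σ, τ)) p = H (t, simplexEval σ p) := by
  let c : toSSet.obj Z ⊗ toSSet.obj TopCat.I.{u} ⟶ toSSet.obj (Z ⊗ TopCat.I.{u}) :=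
    Functor.LaxMonoidal.μ TopCat.toSSet Z TopCat.I.{u}
  let π : (toSSet.obj Z ⊗ toSSet.obj TopCat.I.{u} : SSet.{u}).obj n :=
    (σ, SSet.stdSimplex.toSSetObjI.{u}.app n τ)
  let ρ : (toSSet.obj (Z ⊗ TopCat.I.{u})).obj n := c.app n π
  have hc : c ≫ toSSet.map (CartesianMonoidalCategory.fst Z TopCat.I.{u}) =
      CartesianMonoidalCategory.fst _ _ := Functor.Monoidal.μ_fst TopCat.toSSet Z TopCat.I.{u}
  have h1 : (toSSet.map (CartesianMonoidalCategory.fst Z TopCat.I.{u})).app n ρ = σ :=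
    ConcreteCategory.congr_hom (congr_arg (fun t => NatTrans.app t n) hc) π
  refine ⟨TopCat.I.homeomorph (simplexEval ρ p).2, ?_⟩
  conv_rhs => rw [← h1]
  rfl

/-- A homotopy which is compatible with the distinguished families of subsets. -/
noncomputable def singHomotopy {Z W : TopCat.{u}} {𝒰 : Set (Set Z)} {𝒱 : Set (Set W)} {f g : Z ⟶ W}
    (hf : Subordinate 𝒰 𝒱 f) (hg : Subordinate 𝒰 𝒱 g) (H : TopCat.Homotopy f g)
    (hH : ∀ U ∈ 𝒰, ∃ V ∈ 𝒱, ∀ t, Set.MapsTo (fun z => H (t, z)) U V) :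
    SimplicialObject.Homotopy (singMap f hf) (singMap g hg) :=
  SPair.homotopyOfSSet (S := sing Z 𝒰) (T := sing W 𝒱) (TopCat.Homotopy.toSSet H) fun n σ τ ⟨U, hU, h⟩ => by
    obtain ⟨V, hV, h'⟩ := hH U hU
    refine ⟨V, hV, fun p => ?_⟩
    obtain ⟨t, ht⟩ := exists_simplexEval_homotopy H σ τ p
    exact Set.mem_of_eq_of_mem ht (h' t (h p))

/-- Homotopy equivalences which are compatible with distinguished families of subsets are weak
equivalences. -/
theorem weakEquiv_singMap {Z W : TopCat.{u}} {𝒰 : Set (Set Z)} {𝒱 : Set (Set W)} (f : Z ⟶ W)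
    (hf : Subordinate 𝒰 𝒱 f) (g : W ⟶ Z) (hg : Subordinate 𝒱 𝒰 g)
    (H : TopCat.Homotopy (f ≫ g) (𝟙 Z)) (H' : TopCat.Homotopy (g ≫ f) (𝟙 W))
    (hH : ∀ U ∈ 𝒰, ∃ V ∈ 𝒰, ∀ t, Set.MapsTo (fun z => H (t, z)) U V)
    (hH' : ∀ U ∈ 𝒱, ∃ V ∈ 𝒱, ∀ t, Set.MapsTo (fun z => H' (t, z)) U V) :
    SPair.WeakEquiv (singMap f hf) := by
  have hid : ∀ (T : TopCat.{u}) (𝒲 : Set (Set T)), Subordinate 𝒲 𝒲 (𝟙 T) := fun T 𝒲 U hU =>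
    ⟨U, hU, fun _ h => h⟩
  have hfg : ∀ {A B C : TopCat.{u}} {𝒰 : Set (Set A)} {𝒱 : Set (Set B)} {𝒲 : Set (Set C)}
      {a : A ⟶ B} {b : B ⟶ C}, Subordinate 𝒰 𝒱 a → Subordinate 𝒱 𝒲 b →
        Subordinate 𝒰 𝒲 (a ≫ b) := fun ha hb U hU => by
    obtain ⟨V, hV, h⟩ := ha U hU
    obtain ⟨W, hW, h'⟩ := hb V hV
    exact ⟨W, hW, fun _ hx => h' (h hx)⟩
  exact SPair.WeakEquiv.of_homotopies (g := singMap g hg)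
    (singHomotopy (hfg hf hg) (hid _ _) H hH) (singHomotopy (hfg hg hf) (hid _ _) H' hH')

end

/-! ### Subdivision of singular simplices -/

section

open Limits HomologicalComplex Opposite Simplicial TensorProduct

open TopCat

/-- The class of a singular simplex modulo those lying in one member of `𝒰`. -/
noncomputable def singCls {Z : TopCat.{u}} (𝒰 : Set (Set Z)) {n : SimplexCategoryᵒᵖ}
    (σ : (toSSet.obj Z).obj n) : (SPair.free.obj (sing Z 𝒰)).obj n :=
  PairType.cls ((sing Z 𝒰).obj n) σ

section

variable {Z : TopCat.{u}} {𝒰 : Set (Set Z)}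

theorem singCls_eq_zero {n : SimplexCategoryᵒᵖ} {σ : (toSSet.obj Z).obj n} {U : Set Z} (hU : U ∈ 𝒰)
    (h : ∀ p, simplexEval σ p ∈ U) : singCls 𝒰 σ = 0 := PairType.cls_eq_zero _ ⟨U, hU, h⟩

theorem sing_hom_ext {n : SimplexCategoryᵒᵖ} {M : Type*} [AddCommGroup M] [Module ℚ M]
    {f g : (SPair.free.obj (sing Z 𝒰)).obj n →ₗ[ℚ] M}
    (h : ∀ σ, f (singCls 𝒰 σ) = g (singCls 𝒰 σ)) : f = g := PairType.free_hom_ext h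

theorem level_singCls {n m : SimplexCategoryᵒᵖ} (f : n ⟶ m) (σ : (toSSet.obj Z).obj n) :
    (SPair.free.obj (sing Z 𝒰)).map f (singCls 𝒰 σ) = singCls 𝒰 ((toSSet.obj Z).map f σ) :=
  PairType.freeMap_cls _ _

/-- The linear map with given values on singular simplices. -/
noncomputable def singLift {n : SimplexCategoryᵒᵖ} {M : Type*} [AddCommGroup M] [Module ℚ M]
    (f : (toSSet.obj Z).obj n → M) (hf : ∀ σ, ∀ U ∈ 𝒰, (∀ p, simplexEval σ p ∈ U) → f σ = 0) :
    (SPair.free.obj (sing Z 𝒰)).obj n →ₗ[ℚ] M :=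
  PairType.lift ((sing Z 𝒰).obj n) f fun σ ⟨U, hU, h⟩ => hf σ U hU h

theorem singLift_singCls {n : SimplexCategoryᵒᵖ} {M : Type*} [AddCommGroup M] [Module ℚ M]
    (f : (toSSet.obj Z).obj n → M) (hf : ∀ σ, ∀ U ∈ 𝒰, (∀ p, simplexEval σ p ∈ U) → f σ = 0)
    (σ : (toSSet.obj Z).obj n) : singLift f hf (singCls 𝒰 σ) = f σ := PairType.lift_cls _ _ _ _

open AffineSimplex

/-- The singular simplex `σ ∘ aff v`, for an affine simplex `v` in the domain of `σ`. -/
noncomputable def affineRestrict {n q : ℕ} (σ : (toSSet.obj Z).obj (op ⦋n⦌))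
    (v : Fin (q + 1) → stdSimplex ℝ (Fin (n + 1))) : (toSSet.obj Z).obj (op ⦋q⦌) :=
  simplexMk (op ⦋q⦌) ((toSSetObjEquiv Z (op ⦋n⦌) σ).comp (aff v))

theorem simplexEval_affineRestrict {n q : ℕ} (σ : (toSSet.obj Z).obj (op ⦋n⦌))
    (v : Fin (q + 1) → stdSimplex ℝ (Fin (n + 1))) (p : stdSimplex ℝ (Fin (q + 1))) :
    simplexEval (affineRestrict σ v) p = simplexEval (n := op ⦋n⦌) σ (aff v p) :=
  simplexEval_mk _ _

/-- The standard tuple of vertices. -/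
noncomputable def vertices (n : ℕ) : Fin (n + 1) → stdSimplex ℝ (Fin (n + 1)) :=
  fun i => stdSimplex.vertex i

theorem affineRestrict_vertices {n : ℕ} (σ : (toSSet.obj Z).obj (op ⦋n⦌)) :
    affineRestrict σ (vertices n) = σ :=
  simplex_ext fun _ => (simplexEval_affineRestrict _ _ _).trans (congr_arg _ (aff_vertex _))

theorem affineRestrict_affineRestrict {n q r : ℕ} (σ : (toSSet.obj Z).obj (op ⦋n⦌))
    (v : Fin (q + 1) → stdSimplex ℝ (Fin (n + 1))) (w : Fin (r + 1) → stdSimplex ℝ (Fin (q + 1))) :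
    affineRestrict (affineRestrict σ v) w = affineRestrict σ (aff v ∘ w) :=
  simplex_ext fun p => by
    refine (simplexEval_affineRestrict _ _ _).trans ((simplexEval_affineRestrict _ _ _).trans
      (Eq.trans ?_ (simplexEval_affineRestrict _ _ _).symm))
    rw [aff_aff]

theorem face_affineRestrict {n q : ℕ} (σ : (toSSet.obj Z).obj (op ⦋n⦌))
    (v : Fin (q + 2) → stdSimplex ℝ (Fin (n + 1))) (i : Fin (q + 2)) :
    (toSSet.obj Z).map (SimplexCategory.δ i).op (affineRestrict σ v) =
      affineRestrict σ (v ∘ i.succAbove) := simplex_ext fun p => by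
  refine (simplexEval_level _ _ _).trans ((simplexEval_affineRestrict _ _ _).trans
    (Eq.trans ?_ (simplexEval_affineRestrict _ _ _).symm))
  exact congr_arg _ (aff_map v _ p)

variable (𝒰) in
/-- The singular chain given by a chain of affine simplices in the domain of `σ`. -/
noncomputable def realize {n : ℕ} (σ : (toSSet.obj Z).obj (op ⦋n⦌)) (q : ℕ) :
    TupleChain (stdSimplex ℝ (Fin (n + 1))) (q + 1) →ₗ[ℚ]
      (SPair.free.obj (sing Z 𝒰)).obj (op ⦋q⦌) :=
  TupleChain.extend fun v => singCls 𝒰 (affineRestrict σ v)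

theorem realize_of {n : ℕ} (σ : (toSSet.obj Z).obj (op ⦋n⦌)) (q : ℕ)
    (v : Fin (q + 1) → stdSimplex ℝ (Fin (n + 1))) :
    realize 𝒰 σ q (TupleChain.of v) = singCls 𝒰 (affineRestrict σ v) := TupleChain.extend_of _ _

theorem d_realize {n : ℕ} (σ : (toSSet.obj Z).obj (op ⦋n⦌)) (q : ℕ)
    (c : TupleChain (stdSimplex ℝ (Fin (n + 1))) (q + 2)) :
    (chains.obj (SPair.free.obj (sing Z 𝒰))).d (q + 1) q (realize 𝒰 σ (q + 1) c) =
      realize 𝒰 σ q (TupleChain.bd (q + 1) c) := by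
  refine LinearMap.congr_fun (f := ((chains.obj (SPair.free.obj (sing Z 𝒰))).d (q + 1) q).hom ∘ₗ
    realize 𝒰 σ (q + 1)) (g := realize 𝒰 σ q ∘ₗ TupleChain.bd (q + 1))
    (TupleChain.hom_ext fun v => ?_) c
  refine (SMod.d_apply _ _ _).trans ?_
  rw [LinearMap.comp_apply, TupleChain.bd, TupleChain.extend_of, map_sum]
  refine Finset.sum_congr rfl fun i _ => ?_
  rw [map_smul, realize_of, realize_of, ← face_affineRestrict]
  exact congr_arg _ (level_singCls _ _)

theorem realize_affineRestrict {n q : ℕ} (σ : (toSSet.obj Z).obj (op ⦋n⦌))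
    (v : Fin (q + 1) → stdSimplex ℝ (Fin (n + 1))) (r : ℕ)
    (c : TupleChain (stdSimplex ℝ (Fin (q + 1))) (r + 1)) :
    realize 𝒰 (affineRestrict σ v) r c = realize 𝒰 σ r (TupleChain.map (aff v) (r + 1) c) := by
  refine LinearMap.congr_fun (f := realize 𝒰 (affineRestrict σ v) r)
    (g := realize 𝒰 σ r ∘ₗ TupleChain.map (aff v) (r + 1)) (TupleChain.hom_ext fun w => ?_) c
  rw [LinearMap.comp_apply, TupleChain.map_of, realize_of, realize_of,
    affineRestrict_affineRestrict]

theorem realize_eq_zero {n : ℕ} {σ : (toSSet.obj Z).obj (op ⦋n⦌)} {q : ℕ}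
    {c : TupleChain (stdSimplex ℝ (Fin (n + 1))) (q + 1)}
    (h : ∀ v ∈ c.support, ∃ U ∈ 𝒰, ∀ p, simplexEval (n := op ⦋n⦌) σ (aff v p) ∈ U) :
    realize 𝒰 σ q c = 0 := by
  rw [← Finsupp.sum_single c, Finsupp.sum, map_sum]
  refine Finset.sum_eq_zero fun v hv => ?_
  have : Finsupp.single v (c v) = c v • TupleChain.of v := by simp [TupleChain.of]
  obtain ⟨U, hU, h⟩ := h v hv
  rw [this, map_smul, realize_of, singCls_eq_zero hU, smul_zero]
  intro p
  exact Set.mem_of_eq_of_mem (simplexEval_affineRestrict _ _ _) (h p)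

variable (𝒰) in
/-- Barycentric subdivision of singular chains. -/
noncomputable def singSd (n : ℕ) : (SPair.free.obj (sing Z 𝒰)).obj (op ⦋n⦌) →ₗ[ℚ]
    (SPair.free.obj (sing Z 𝒰)).obj (op ⦋n⦌) :=
  singLift (fun σ => realize 𝒰 σ n (TupleChain.sd bary (n + 1) (TupleChain.of (vertices n))))
    fun _ U hU h => realize_eq_zero fun _ _ => ⟨U, hU, fun _ => h _⟩

variable (𝒰) in
/-- The homotopy between the identity and barycentric subdivision of singular chains. -/
noncomputable def singSdHomotopy (n : ℕ) : (SPair.free.obj (sing Z 𝒰)).obj (op ⦋n⦌) →ₗ[ℚ]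
    (SPair.free.obj (sing Z 𝒰)).obj (op ⦋n + 1⦌) :=
  singLift (fun σ => realize 𝒰 σ (n + 1)
    (TupleChain.sdHomotopy bary (n + 1) (TupleChain.of (vertices n))))
    fun _ U hU h => realize_eq_zero fun _ _ => ⟨U, hU, fun _ => h _⟩

theorem singSd_realize {n : ℕ} (σ : (toSSet.obj Z).obj (op ⦋n⦌)) (q : ℕ)
    (c : TupleChain (stdSimplex ℝ (Fin (n + 1))) (q + 1)) :
    singSd 𝒰 q (realize 𝒰 σ q c) = realize 𝒰 σ q (TupleChain.sd bary (q + 1) c) := by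
  refine LinearMap.congr_fun (f := singSd 𝒰 q ∘ₗ realize 𝒰 σ q)
    (g := realize 𝒰 σ q ∘ₗ TupleChain.sd bary (q + 1)) (TupleChain.hom_ext fun v => ?_) c
  rw [LinearMap.comp_apply, LinearMap.comp_apply, realize_of, singSd, singLift_singCls,
    realize_affineRestrict, TupleChain.map_sd (γ := bary) (aff_bary v), TupleChain.map_of]
  exact congr_arg (fun w => realize 𝒰 σ q (TupleChain.sd bary (q + 1) (TupleChain.of w)))
    (aff_comp_vertex v)

theorem singSdHomotopy_realize {n : ℕ} (σ : (toSSet.obj Z).obj (op ⦋n⦌)) (q : ℕ)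
    (c : TupleChain (stdSimplex ℝ (Fin (n + 1))) (q + 1)) :
    singSdHomotopy 𝒰 q (realize 𝒰 σ q c) =
      realize 𝒰 σ (q + 1) (TupleChain.sdHomotopy bary (q + 1) c) := by
  refine LinearMap.congr_fun (f := singSdHomotopy 𝒰 q ∘ₗ realize 𝒰 σ q)
    (g := realize 𝒰 σ (q + 1) ∘ₗ TupleChain.sdHomotopy bary (q + 1))
    (TupleChain.hom_ext fun v => ?_) c
  rw [LinearMap.comp_apply, LinearMap.comp_apply, realize_of, singSdHomotopy, singLift_singCls,
    realize_affineRestrict, TupleChain.map_sdHomotopy (γ := bary) (aff_bary v), TupleChain.map_of]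
  exact congr_arg (fun w => realize 𝒰 σ (q + 1) (TupleChain.sdHomotopy bary (q + 1)
    (TupleChain.of w))) (aff_comp_vertex v)

theorem realize_vertices {n : ℕ} (σ : (toSSet.obj Z).obj (op ⦋n⦌)) :
    realize 𝒰 σ n (TupleChain.of (vertices n)) = singCls 𝒰 σ := by
  rw [realize_of, affineRestrict_vertices]

theorem singSd_pow_singCls (n k : ℕ) (σ : (toSSet.obj Z).obj (op ⦋n⦌)) :
    (singSd 𝒰 n ^ k) (singCls 𝒰 σ) =
      realize 𝒰 σ n ((TupleChain.sd bary (n + 1) ^ k) (TupleChain.of (vertices n))) := by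
  induction k with
  | zero => exact (realize_vertices σ).symm
  | succ k ih =>
    rw [pow_succ', Module.End.mul_apply, ih, singSd_realize, pow_succ', Module.End.mul_apply]

theorem d_singSdHomotopy_zero (x : (SPair.free.obj (sing Z 𝒰)).obj (op ⦋0⦌)) :
    (chains.obj (SPair.free.obj (sing Z 𝒰))).d 1 0 (singSdHomotopy 𝒰 0 x) = x - singSd 𝒰 0 x := by
  refine LinearMap.congr_fun (f := ((chains.obj (SPair.free.obj (sing Z 𝒰))).d 1 0).hom ∘ₗ
    singSdHomotopy 𝒰 0) (g := LinearMap.id - singSd 𝒰 0) (sing_hom_ext fun σ => ?_) x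
  change (chains.obj (SPair.free.obj (sing Z 𝒰))).d 1 0 (singSdHomotopy 𝒰 0 (singCls 𝒰 σ)) =
    singCls 𝒰 σ - singSd 𝒰 0 (singCls 𝒰 σ)
  rw [← realize_vertices, singSdHomotopy_realize, d_realize, TupleChain.bd_sdHomotopy, map_sub,
    map_sub, singSd_realize]
  exact (congr_arg _ (map_zero _)).trans (sub_zero _)

theorem d_singSdHomotopy_succ (n : ℕ) (x : (SPair.free.obj (sing Z 𝒰)).obj (op ⦋n + 1⦌)) :
    (chains.obj (SPair.free.obj (sing Z 𝒰))).d (n + 2) (n + 1) (singSdHomotopy 𝒰 (n + 1) x) =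
      x - singSd 𝒰 (n + 1) x -
        singSdHomotopy 𝒰 n ((chains.obj (SPair.free.obj (sing Z 𝒰))).d (n + 1) n x) := by
  let d : (SPair.free.obj (sing Z 𝒰)).obj (op ⦋n + 1⦌) →ₗ[ℚ] (SPair.free.obj (sing Z 𝒰)).obj (op ⦋n⦌) :=
    ((chains.obj (SPair.free.obj (sing Z 𝒰))).d (n + 1) n).hom
  refine LinearMap.congr_fun (f := ((chains.obj (SPair.free.obj (sing Z 𝒰))).d (n + 2)
      (n + 1)).hom ∘ₗ singSdHomotopy 𝒰 (n + 1))
    (g := LinearMap.id - singSd 𝒰 (n + 1) - singSdHomotopy 𝒰 n ∘ₗ d) (sing_hom_ext fun σ => ?_) x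
  change (chains.obj (SPair.free.obj (sing Z 𝒰))).d (n + 2) (n + 1)
      (singSdHomotopy 𝒰 (n + 1) (singCls 𝒰 σ)) = singCls 𝒰 σ - singSd 𝒰 (n + 1) (singCls 𝒰 σ) -
        singSdHomotopy 𝒰 n ((chains.obj (SPair.free.obj (sing Z 𝒰))).d (n + 1) n (singCls 𝒰 σ))
  rw [← realize_vertices, singSdHomotopy_realize, d_realize, TupleChain.bd_sdHomotopy, map_sub,
    map_sub, singSd_realize, d_realize, singSdHomotopy_realize]

/-- Sufficiently fine iterated subdivisions of a simplex lying in the union of the open sets of `𝒰`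
vanish modulo `𝒰`. -/
theorem exists_singSd_pow_eq_zero (h𝒰 : ∀ U ∈ 𝒰, IsOpen U) {n : ℕ} (σ : (toSSet.obj Z).obj (op ⦋n⦌))
    (hσ : ∀ p, simplexEval σ p ∈ ⋃₀ 𝒰) : ∃ k₀, ∀ k, k₀ ≤ k → (singSd 𝒰 n ^ k) (singCls 𝒰 σ) = 0 := by
  obtain ⟨δ, hδ, h⟩ := lebesgue_number_lemma_of_metric_sUnion
    (c := (fun U => (simplexEval (n := op ⦋n⦌) σ) ⁻¹' U) '' 𝒰)
    (isCompact_univ (X := stdSimplex ℝ (Fin (n + 1))))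
    (by
      rintro _ ⟨U, hU, rfl⟩
      exact (h𝒰 U hU).preimage (continuous_simplexEval σ))
    (fun p _ => by
      obtain ⟨U, hU, hp⟩ := hσ p
      exact ⟨_, ⟨U, hU, rfl⟩, hp⟩)
  have hlim : Filter.Tendsto (fun k => ((n : ℝ) / (n + 1)) ^ k) Filter.atTop (nhds 0) :=
    tendsto_pow_atTop_nhds_zero_of_lt_one (by positivity)
      ((div_lt_one (by positivity)).2 (lt_add_one _))
  obtain ⟨k₀, hk₀⟩ := (Filter.eventually_atTop.1 (hlim.eventually (gt_mem_nhds hδ)))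
  refine ⟨k₀, fun k hk => ?_⟩
  rw [singSd_pow_singCls]
  refine realize_eq_zero fun v hv => ?_
  have hdiam : ∀ i j, dist (vertices n i) (vertices n j) ≤ 1 := fun i j =>
    (Metric.dist_le_diam_of_mem (bounded_stdSimplex _) (vertices n i).2 (vertices n j).2).trans
      diam_stdSimplex_le
  have hv' := dist_aff_aff_le (fun i j => TupleChain.diam_le_of_mem_support_iterate isConvex_bary
    zero_le_one hdiam k hv i j)
  obtain ⟨_, ⟨U, hU, rfl⟩, hsub⟩ := h (aff v (stdSimplex.vertex 0)) (Set.mem_univ _)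
  refine ⟨U, hU, fun p => hsub ?_⟩
  rw [Metric.mem_ball]
  refine (hv' p _).trans_lt ?_
  rw [mul_one]
  exact hk₀ k hk

end

end

/-! ### Small simplices -/

section

open Limits HomologicalComplex Opposite Simplicial TensorProduct

open TopCat RatChain

theorem PairType.mem_span_of_freeMap_eq_zero {P Q : PairType.{u}} (f : P ⟶ Q)
    (hf : Function.Injective (Hom.map f)) {x : P.Free} (hx : freeMap f x = 0) :
    x ∈ Submodule.span ℚ (P.cls '' (Hom.map f ⁻¹' Q.sub)) := by
  obtain ⟨c, rfl⟩ := Submodule.Quotient.mk_surjective _ x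
  rw [freeMap_mk, mk_eq_zero_iff] at hx
  rw [mk_eq_sum]
  refine Submodule.sum_mem _ fun s hs => Submodule.smul_mem _ _ (Submodule.subset_span ⟨s, ?_, rfl⟩)
  refine hx _ ?_
  rw [Finsupp.mem_support_iff, Finsupp.mapDomain_apply hf]
  exact Finsupp.mem_support_iff.1 hs

/-- Small simplices: singular simplices in the union of a family of open sets can be replaced by
simplices which lie in one of the open sets. -/
theorem weakEquiv_sing_sUnion {Z : TopCat.{u}} (𝒰 : Set (Set Z)) (h𝒰 : ∀ U ∈ 𝒰, IsOpen U)
    (h : Subordinate 𝒰 {⋃₀ 𝒰} (𝟙 Z)) : SPair.WeakEquiv (singMap (𝟙 Z) h) := by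
  have hone : ∀ n, Function.Surjective ((SPair.free.map (singMap (𝟙 Z) h)).app (op ⦋n⦌)) := by
    intro n y
    let f : (SPair.free.obj (sing Z 𝒰)).obj (op ⦋n⦌) →ₗ[ℚ]
      (SPair.free.obj (sing Z {⋃₀ 𝒰})).obj (op ⦋n⦌) :=
      ((SPair.free.map (singMap (𝟙 Z) h)).app (op ⦋n⦌)).hom
    suffices LinearMap.range f = ⊤ from LinearMap.range_eq_top.1 this y
    rw [eq_top_iff]
    rintro y -
    refine PairType.free_induction (p := (· ∈ LinearMap.range f)) y (Submodule.zero_mem _)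
      (fun x y hx hy => Submodule.add_mem _ hx hy) fun a σ => Submodule.smul_mem _ _ ?_
    exact ⟨singCls 𝒰 σ, PairType.freeMap_cls _ _⟩
  -- the kernel of the map consists of the chains which lie in the union
  let K (n : ℕ) : Submodule ℚ ((SPair.free.obj (sing Z 𝒰)).obj (op ⦋n⦌)) :=
    Submodule.span ℚ (singCls 𝒰 '' {σ | ∀ p, simplexEval σ p ∈ ⋃₀ 𝒰})
  have hK : ∀ n x, (SPair.free.map (singMap (𝟙 Z) h)).app (op ⦋n⦌) x = 0 → x ∈ K n := fun n x hx => by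
    refine Submodule.span_mono ?_ (PairType.mem_span_of_freeMap_eq_zero
      ((singMap (𝟙 Z) h).app (op ⦋n⦌)) (fun _ _ h => h) hx)
    rintro _ ⟨σ, ⟨_, rfl, hσ⟩, rfl⟩
    exact ⟨σ, hσ, rfl⟩
  have hK' : ∀ n, ∀ x ∈ K n, (SPair.free.map (singMap (𝟙 Z) h)).app (op ⦋n⦌) x = 0 := by
    intro n x hx
    refine Submodule.span_induction (p := fun x _ =>
      (SPair.free.map (singMap (𝟙 Z) h)).app (op ⦋n⦌) x = 0) ?_ (map_zero _) ?_ ?_ hx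
    · rintro _ ⟨σ, hσ, rfl⟩
      exact (PairType.freeMap_cls _ _).trans (PairType.cls_eq_zero _ ⟨_, rfl, hσ⟩)
    · intro x y _ _ hx hy
      rw [map_add, hx, hy, add_zero]
    · intro a x _ hx
      rw [map_smul, hx, smul_zero]
  have hrealize : ∀ {n} (σ : (toSSet.obj Z).obj (op ⦋n⦌)), (∀ p, simplexEval σ p ∈ ⋃₀ 𝒰) →
      ∀ q c, realize 𝒰 σ q c ∈ K q := fun σ hσ q c => by
    rw [← Finsupp.sum_single c, Finsupp.sum, map_sum]
    refine Submodule.sum_mem _ fun v hv => ?_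
    have : Finsupp.single v (c v) = c v • TupleChain.of v := by simp [TupleChain.of]
    rw [this, map_smul, realize_of]
    refine Submodule.smul_mem _ _ (Submodule.subset_span ⟨_, fun p => ?_, rfl⟩)
    exact Set.mem_of_eq_of_mem (simplexEval_affineRestrict _ _ _) (hσ _)
  have hT : ∀ n, ∀ x ∈ K n, singSdHomotopy 𝒰 n x ∈ K (n + 1) := fun n x hx => by
    have : K n ≤ (K (n + 1)).comap (singSdHomotopy 𝒰 n) := by
      rw [Submodule.span_le]
      rintro _ ⟨σ, hσ, rfl⟩
      change singSdHomotopy 𝒰 n (singCls 𝒰 σ) ∈ K (n + 1)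
      rw [singSdHomotopy, singLift_singCls]
      exact hrealize σ hσ _ _
    exact this hx
  have hS : ∀ n, ∀ x ∈ K n, singSd 𝒰 n x ∈ K n := fun n x hx => by
    have : K n ≤ (K n).comap (singSd 𝒰 n) := by
      rw [Submodule.span_le]
      rintro _ ⟨σ, hσ, rfl⟩
      change singSd 𝒰 n (singCls 𝒰 σ) ∈ K n
      rw [singSd, singLift_singCls]
      exact hrealize σ hσ _ _
    exact this hx
  have hnil : ∀ n, ∀ x ∈ K n, ∃ k₀, ∀ k, k₀ ≤ k → (singSd 𝒰 n ^ k) x = 0 := fun n x hx => by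
    refine Submodule.span_induction (p := fun x _ => ∃ k₀, ∀ k, k₀ ≤ k → (singSd 𝒰 n ^ k) x = 0)
      ?_ ⟨0, fun k _ => map_zero _⟩ ?_ ?_ hx
    · rintro _ ⟨σ, hσ, rfl⟩
      exact exists_singSd_pow_eq_zero h𝒰 σ hσ
    · rintro x y _ _ ⟨k, hk⟩ ⟨l, hl⟩
      exact ⟨max k l, fun m hm => by
        rw [map_add, hk m (le_trans (le_max_left _ _) hm), hl m (le_trans (le_max_right _ _) hm),
          add_zero]⟩
    · rintro a x _ ⟨k, hk⟩
      exact ⟨k, fun m hm => by rw [map_smul, hk m hm, smul_zero]⟩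
  have main : ∀ (k n : ℕ) (x : (SPair.free.obj (sing Z 𝒰)).obj (op ⦋n⦌)), x ∈ K n →
      IsCycle (chains.obj (SPair.free.obj (sing Z 𝒰))) n x → (singSd 𝒰 n ^ k) x = 0 →
      ∃ y ∈ K (n + 1), (chains.obj (SPair.free.obj (sing Z 𝒰))).d (n + 1) n y = x := by
    intro k
    induction k with
    | zero =>
      intro n x _ _ h0
      exact ⟨0, Submodule.zero_mem _, (map_zero _).trans h0.symm⟩
    | succ k ih =>
      intro n x hx hc h0
      have hd : (chains.obj (SPair.free.obj (sing Z 𝒰))).d (n + 1) n (singSdHomotopy 𝒰 n x) =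
          x - singSd 𝒰 n x := by
        cases n with
        | zero => exact d_singSdHomotopy_zero x
        | succ n =>
          rw [d_singSdHomotopy_succ]
          rw [isCycle_succ_iff] at hc
          exact (congr_arg _ ((congr_arg _ hc).trans (map_zero _))).trans (sub_zero _)
      let d : (SPair.free.obj (sing Z 𝒰)).obj (op ⦋n + 1⦌) →ₗ[ℚ]
          (SPair.free.obj (sing Z 𝒰)).obj (op ⦋n⦌) :=
        ((chains.obj (SPair.free.obj (sing Z 𝒰))).d (n + 1) n).hom
      have hx' : singSd 𝒰 n x = x - d (singSdHomotopy 𝒰 n x) :=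
        (sub_sub_cancel x (singSd 𝒰 n x)).symm.trans (congr_arg (x - ·) hd.symm)
      have hc' : IsCycle (chains.obj (SPair.free.obj (sing Z 𝒰))) n (singSd 𝒰 n x) := by
        intro m
        rw [hx']
        refine (map_sub _ _ _).trans ?_
        rw [hc m]
        exact (congr_arg _ (d_d_apply _ _ _ _ _)).trans (sub_zero _)
      obtain ⟨y, hy, e⟩ := ih n (singSd 𝒰 n x) (hS n x hx) hc' (by
        rw [pow_succ, Module.End.mul_apply] at h0
        exact h0)
      refine ⟨singSdHomotopy 𝒰 n x + y, Submodule.add_mem _ (hT n x hx) hy, ?_⟩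
      refine (map_add _ _ _).trans ?_
      rw [e, hd]
      exact sub_add_cancel _ _
  refine quasiIso_of_surjective _ hone fun n x hc hx => ?_
  obtain ⟨k, hk⟩ := hnil n x (hK n x hx)
  obtain ⟨y, hy, e⟩ := main k n x (hK n x hx) hc (hk k le_rfl)
  exact ⟨y, hK' _ _ hy, e⟩

end

/-! ### Excision -/

section

open Limits HomologicalComplex Opposite Simplicial TensorProduct

open TopCat

theorem PairType.freeMap_injective {P Q : PairType.{u}} (f : P ⟶ Q)
    (hf : Function.Injective (Hom.map f)) (h : ∀ x, Hom.map f x ∈ Q.sub → x ∈ P.sub) :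
    Function.Injective (freeMap f) := by
  rw [injective_iff_map_eq_zero]
  intro x hx
  have hx' := mem_span_of_freeMap_eq_zero f hf hx
  have : Submodule.span ℚ (P.cls '' (Hom.map f ⁻¹' Q.sub)) ≤ ⊥ := by
    rw [Submodule.span_le]
    rintro _ ⟨y, hy, rfl⟩
    exact P.cls_eq_zero (h y hy)
  exact this hx'

theorem PairType.freeMap_surjective {P Q : PairType.{u}} (f : P ⟶ Q)
    (hf : Function.Surjective (Hom.map f)) : Function.Surjective (freeMap f) := by
  rw [← LinearMap.range_eq_top, eq_top_iff]
  rintro y -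
  refine free_induction y (Submodule.zero_mem _) (fun _ _ => Submodule.add_mem _)
    fun a y => Submodule.smul_mem _ _ ?_
  obtain ⟨x, rfl⟩ := hf y
  exact ⟨P.cls x, freeMap_cls _ _⟩

/-- The short exact sequence of a triple of simplicial sets. -/
theorem SPair.isShortExact_triple {S T U : SPair.{u}} (f : S ⟶ T) (g : T ⟶ U)
    (hf : ∀ n, Function.Injective (PairType.Hom.map (f.app n)))
    (hfs : ∀ n x, PairType.Hom.map (f.app n) x ∈ (T.obj n).sub → x ∈ (S.obj n).sub)
    (hg : ∀ n, Function.Bijective (PairType.Hom.map (g.app n)))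
    (hfg : ∀ n y, PairType.Hom.map (g.app n) y ∈ (U.obj n).sub ↔
      y ∈ (T.obj n).sub ∨ ∃ x, PairType.Hom.map (f.app n) x = y) :
    SMod.IsShortExact (SPair.free.map f) (SPair.free.map g) where
  inj n := PairType.freeMap_injective _ (hf n) (hfs n)
  surj n := PairType.freeMap_surjective _ (hg n).2
  exact n := by
    change Function.Exact (PairType.freeMap (f.app n)) (PairType.freeMap (g.app n))
    intro y
    refine ⟨fun hy => ?_, ?_⟩
    · have : Submodule.span ℚ ((T.obj n).cls '' (PairType.Hom.map (g.app n) ⁻¹' (U.obj n).sub)) ≤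
          LinearMap.range (PairType.freeMap (f.app n)) := by
        rw [Submodule.span_le]
        rintro _ ⟨y, hy, rfl⟩
        obtain hy | ⟨x, rfl⟩ := (hfg n y).1 hy
        · rw [PairType.cls_eq_zero _ hy]
          exact Submodule.zero_mem _
        · exact ⟨_, PairType.freeMap_cls _ x⟩
      exact this (PairType.mem_span_of_freeMap_eq_zero (g.app n) (hg n).1 hy)
    · rintro ⟨x, rfl⟩
      suffices PairType.freeMap (g.app n) ∘ₗ PairType.freeMap (f.app n) = 0 from
        LinearMap.congr_fun this x
      refine PairType.free_hom_ext fun x => ?_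
      rw [LinearMap.comp_apply, PairType.freeMap_cls, PairType.freeMap_cls]
      exact PairType.cls_eq_zero _ ((hfg n _).2 (Or.inr ⟨x, rfl⟩))

/-- The chains of a simplicial pair `(P, P)` are acyclic. -/
theorem SPair.acyclic_of_sub_eq {S : SPair.{u}} (h : ∀ n (x : (S.obj n).carrier), x ∈ (S.obj n).sub) :
    RatChain.Acyclic (chains.obj (SPair.free.obj S)) := fun n x _ => by
  have : ∀ y : (S.obj (op ⦋n⦌)).Free, y = 0 := fun y =>
    PairType.free_induction (p := (· = 0)) y rfl (fun x y hx hy => by rw [hx, hy, add_zero])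
      fun a y => by rw [PairType.cls_eq_zero _ (h _ y), smul_zero]
  exact ⟨0, (map_zero _).trans (this x).symm⟩

theorem exists_simplex_lift {Z W : TopCat.{u}} {i : W ⟶ Z} (hi : Topology.IsEmbedding i)
    {n : SimplexCategoryᵒᵖ} (σ : (toSSet.obj Z).obj n) (h : ∀ p, simplexEval σ p ∈ Set.range i) :
    ∃ τ, (toSSet.map i).app n τ = σ := by
  choose w hw using h
  have hwc : Continuous w := hi.continuous_iff.2 ((continuous_simplexEval σ).congr
    fun p => (hw p).symm)
  refine ⟨simplexMk n ⟨w, hwc⟩, simplex_ext fun p => ?_⟩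
  refine (simplexEval_map i _ p).trans ?_
  rw [simplexEval_mk]
  exact hw p

/-- Excision: a closed subset of an open set can be removed. -/
theorem weakEquiv_excision {Z W : TopCat.{u}} (i : W ⟶ Z) (hi : Topology.IsEmbedding i)
    {S O : Set Z} (hr : Set.range i = Sᶜ) (hS : IsClosed S) (hO : IsOpen O) (hSO : S ⊆ O)
    {O' : Set W} (hO' : O' = i ⁻¹' O) (h : Subordinate {O'} {O} i) :
    SPair.WeakEquiv (singMap i h) := by
  have h1 : Subordinate {Sᶜ, O} {⋃₀ {Sᶜ, O}} (𝟙 Z) := fun U hU =>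
    ⟨_, rfl, fun z hz => ⟨U, hU, hz⟩⟩
  have h2 : Subordinate {O} {Sᶜ, O} (𝟙 Z) := fun U hU => ⟨U, Or.inr hU, fun z hz => hz⟩
  have hw := weakEquiv_sing_sUnion {Sᶜ, O} (by
    rintro _ (rfl | rfl)
    exacts [hS.isOpen_compl, hO]) h1
  have hac : RatChain.Acyclic (chains.obj (SPair.free.obj (sing Z {Sᶜ, O}))) := by
    refine RatChain.Acyclic.of_quasiIso _ hw (SPair.acyclic_of_sub_eq fun n σ => ⟨_, rfl, fun p => ?_⟩)
    by_cases hp : simplexEval σ p ∈ S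
    · exact ⟨O, Or.inr rfl, hSO hp⟩
    · exact ⟨Sᶜ, Or.inl rfl, hp⟩
  refine (SPair.isShortExact_triple (singMap i h) (singMap (𝟙 Z) h2) (fun n σ τ e => ?_) ?_
    (fun n => ⟨fun _ _ e => e, fun y => ⟨y, rfl⟩⟩) ?_).chains.quasiIso_left hac
  · refine simplex_ext fun p => hi.injective ?_
    exact congr_arg (fun ρ => simplexEval ρ p) e
  · rintro n σ ⟨_, rfl, hσ⟩
    exact ⟨_, rfl, fun p => by rw [hO']; exact hσ p⟩
  · intro n σ
    constructor
    · rintro ⟨_, rfl | rfl, hσ⟩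
      · exact Or.inr (exists_simplex_lift hi σ fun p => by rw [hr]; exact hσ p)
      · exact Or.inl ⟨_, rfl, hσ⟩
    · rintro (⟨_, rfl, hσ⟩ | ⟨σ, rfl⟩)
      · exact ⟨_, Or.inr rfl, hσ⟩
      · refine ⟨_, Or.inl rfl, fun p => ?_⟩
        have : i (simplexEval σ p) ∈ Set.range i := ⟨_, rfl⟩
        rw [hr] at this
        exact this

end

/-! ### Quotients by closed subsets -/

section

open Limits HomologicalComplex Opposite Simplicial TensorProduct

open TopCat

theorem Subordinate.of_forall_mem {Z W : Type*} {𝒰 : Set (Set Z)} {V : Set W} {f : Z → W}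
    (h : ∀ U ∈ 𝒰, Set.MapsTo f U V) : Subordinate 𝒰 {V} f := fun U hU => ⟨V, rfl, h U hU⟩

theorem weakEquiv_singMap_of_square {Z W : TopCat.{u}} {𝒰 𝒰' : Set (Set Z)} {𝒱 𝒱' : Set (Set W)}
    {f : Z ⟶ W} {hf : Subordinate 𝒰 𝒱 f} {hf' : Subordinate 𝒰' 𝒱' f}
    {h : Subordinate 𝒰 𝒰' (𝟙 Z)} {h' : Subordinate 𝒱 𝒱' (𝟙 W)}
    (hw : SPair.WeakEquiv (singMap (𝟙 Z) h)) (hw' : SPair.WeakEquiv (singMap (𝟙 W) h'))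
    (hfw : SPair.WeakEquiv (singMap f hf')) : SPair.WeakEquiv (singMap f hf) := by
  have e : singMap f hf ≫ singMap (𝟙 W) h' = singMap (𝟙 Z) h ≫ singMap f hf' := rfl
  refine SPair.WeakEquiv.of_comp_right hw' ?_
  rw [e]
  exact hw.comp hfw

/-- If a deformation of `Z` pushes a family `𝒱` of subsets into a smaller family `𝒰`, and preserves
both families, then `𝒰` and `𝒱` have the same relative homology. -/
theorem weakEquiv_singMap_of_deformation {Z : TopCat.{u}} {𝒰 𝒱 : Set (Set Z)}
    (h : Subordinate 𝒰 𝒱 (𝟙 Z)) (D : C(unitInterval × Z, Z)) (hD : ∀ z, D (0, z) = z)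
    (h𝒰 : ∀ U ∈ 𝒰, ∃ V ∈ 𝒰, ∀ t, Set.MapsTo (fun z => D (t, z)) U V)
    (h𝒱 : ∀ U ∈ 𝒱, ∃ V ∈ 𝒱, ∀ t, Set.MapsTo (fun z => D (t, z)) U V)
    (h1 : Subordinate 𝒱 𝒰 fun z => D (1, z)) : SPair.WeakEquiv (singMap (𝟙 Z) h) := by
  let d : Z ⟶ Z := TopCat.ofHom ⟨fun z => D (1, z), by fun_prop⟩
  let H : ContinuousMap.Homotopy (ContinuousMap.id Z) d.hom :=
    { toContinuousMap := D
      map_zero_left := hD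
      map_one_left := fun _ => rfl }
  have hH : ∀ 𝒲 : Set (Set Z), (∀ U ∈ 𝒲, ∃ V ∈ 𝒲, ∀ t, Set.MapsTo (fun z => D (t, z)) U V) →
      ∀ U ∈ 𝒲, ∃ V ∈ 𝒲, ∀ t, Set.MapsTo (fun z => H.symm (t, z)) U V := fun 𝒲 h𝒲 U hU => by
    obtain ⟨V, hV, h⟩ := h𝒲 U hU
    refine ⟨V, hV, fun t z hz => ?_⟩
    simp only [ContinuousMap.Homotopy.symm_apply]
    exact h _ hz
  exact weakEquiv_singMap (𝟙 Z) h d h1 H.symm H.symm (hH _ h𝒰) (hH _ h𝒱)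

/-- A closed subset with an open neighbourhood which can be deformed into it through a deformation
of the ambient space. -/
def GoodPair (Z : Type u) [TopologicalSpace Z] (S : Set Z) : Prop :=
  IsClosed S ∧ ∃ O : Set Z, IsOpen O ∧ S ⊆ O ∧ ∃ D : C(unitInterval × Z, Z), (∀ z, D (0, z) = z) ∧
    (∀ t, ∀ z ∈ S, D (t, z) ∈ S) ∧ (∀ t, ∀ z ∈ O, D (t, z) ∈ O) ∧ ∀ z ∈ O, D (1, z) ∈ S

/-- The points of `Z ^ A` with at least one coordinate in `S`. -/
def fat {Z : Type*} (S : Set Z) (A : Type) : Set (A → Z) := {z | ∃ a, z a ∈ S}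

/-- The subsets of `Z ^ A` on which one given coordinate lies in `S`. -/
def coordSets {Z : Type*} (S : Set Z) (A : Type) : Set (Set (A → Z)) :=
  Set.range fun a => (fun z => z a) ⁻¹' S

/-- If `S` is a neighbourhood deformation retract, it makes no difference whether chains on `Z ^ A` are
taken relative to the simplices with one coordinate entirely in `S` or to those all of whose points
have some coordinate in `S`: deform both to the analogous notions for the open set `O`, which are
compared by small simplices. -/
theorem weakEquiv_powers {Z : TopCat.{u}} {S : Set Z} (hS : GoodPair Z S) (A : Type) [Finite A]
    (h : Subordinate (coordSets S A) {fat S A}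
      (𝟙 (TopCat.of (A → Z)))) : SPair.WeakEquiv (singMap (𝟙 (TopCat.of (A → Z))) h) := by
  obtain ⟨-, O, hO, hSO, D, hD0, hDS, hDO, hD1⟩ := hS
  let E : C(unitInterval × (A → Z), A → Z) := ⟨fun x a => D (x.1, x.2 a), by fun_prop⟩
  have hE0 : ∀ z, E (0, z) = z := fun z => funext fun a => hD0 _
  have h1 : Subordinate (coordSets S A) (coordSets O A)
      (𝟙 (TopCat.of (A → Z))) := by
    rintro _ ⟨a, rfl⟩
    exact ⟨_, ⟨a, rfl⟩, fun z hz => hSO hz⟩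
  have h2 : Subordinate (coordSets O A)
      {⋃₀ coordSets O A} (𝟙 (TopCat.of (A → Z))) :=
    Subordinate.of_forall_mem fun U hU z hz => ⟨U, hU, hz⟩
  have h3 : Subordinate {fat S A}
      {⋃₀ coordSets O A} (𝟙 (TopCat.of (A → Z))) :=
    by
    rintro _ rfl
    refine ⟨_, rfl, ?_⟩
    rintro z ⟨a, hz⟩
    exact ⟨_, ⟨a, rfl⟩, hSO hz⟩
  have w1 : SPair.WeakEquiv (singMap (𝟙 (TopCat.of (A → Z))) h1) := by
    refine weakEquiv_singMap_of_deformation h1 E hE0 ?_ ?_ ?_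
    · rintro _ ⟨a, rfl⟩
      exact ⟨_, ⟨a, rfl⟩, fun t z hz => hDS t _ hz⟩
    · rintro _ ⟨a, rfl⟩
      exact ⟨_, ⟨a, rfl⟩, fun t z hz => hDO t _ hz⟩
    · rintro _ ⟨a, rfl⟩
      exact ⟨_, ⟨a, rfl⟩, fun z hz => hD1 _ hz⟩
  have w2 := weakEquiv_sing_sUnion (Z := TopCat.of (A → Z)) (coordSets O A) (by
    rintro _ ⟨a, rfl⟩
    exact hO.preimage (continuous_apply a)) h2
  have w3 : SPair.WeakEquiv (singMap (𝟙 (TopCat.of (A → Z))) h3) := by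
    refine weakEquiv_singMap_of_deformation h3 E hE0 ?_ ?_ ?_
    · rintro _ rfl
      exact ⟨_, rfl, fun t z ⟨a, hz⟩ => ⟨a, hDS t _ hz⟩⟩
    · rintro _ rfl
      refine ⟨_, rfl, ?_⟩
      rintro t z ⟨_, ⟨a, rfl⟩, hz⟩
      exact ⟨_, ⟨a, rfl⟩, hDO t _ hz⟩
    · refine Subordinate.singleton ?_
      rintro z ⟨_, ⟨a, rfl⟩, hz⟩
      exact ⟨a, hD1 _ hz⟩
  exact weakEquiv_singMap_of_square w1 w3 w2

namespace PtdTop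

variable {Z : Type u} [TopologicalSpace Z] {S : Set Z}

/-- The quotient map `Z → Z / S`. -/
def collapseProj (S : Set Z) : TopCat.of Z ⟶ (collapse Z S).space :=
  TopCat.ofHom ⟨fun z => Quot.mk _ (Sum.inl z), continuous_quot_mk.comp continuous_inl⟩

theorem collapseProj_eq_pt_iff {z : Z} : collapseProj S z = (collapse Z S).pt ↔ z ∈ S := by
  refine ⟨fun h => ?_, fun h => Quot.sound ⟨z, h, rfl, rfl⟩⟩
  let F : Quot (collapseRel S) → Prop := Quot.lift (Sum.elim (· ∈ S) fun _ => True) (by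
    rintro _ _ ⟨s, hs, rfl, rfl⟩
    exact eq_true hs)
  exact (congr_arg F h).mpr trivial

theorem collapseProj_injOn : Set.InjOn (collapseProj S) Sᶜ := by
  intro z hz w _ h
  let F : Quot (collapseRel S) → Prop := Quot.lift (Sum.elim (z = ·) fun _ => False) (by
    rintro _ _ ⟨s, hs, rfl, rfl⟩
    exact eq_false fun e => hz (e ▸ hs))
  exact (congr_arg F h).mp rfl

theorem collapse_cases {p : (collapse Z S).space → Prop} (h : ∀ z, p (collapseProj S z))
    (h' : p (collapse Z S).pt) (x : (collapse Z S).space) : p x := by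
  obtain ⟨(z | ⟨⟩), rfl⟩ := Quot.exists_rep x
  exacts [h z, h']

theorem isOpen_collapse_iff {U : Set (collapse Z S).space} :
    IsOpen U ↔ IsOpen (collapseProj S ⁻¹' U) :=
  isOpen_coinduced.trans (isOpen_sum_iff.trans (and_iff_left (isOpen_discrete _)))

theorem continuous_collapse_iff {W : Type*} [TopologicalSpace W]
    {f : (collapse Z S).space → W} : Continuous f ↔ Continuous fun z => f (collapseProj S z) := by
  simp only [continuous_def, isOpen_collapse_iff]
  rfl

/-- Homotopies of pairs descend to the quotients. -/
theorem exists_collapse_homotopy {W : Type u} [TopologicalSpace W] {T : Set W}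
    (f : C(unitInterval × Z, W)) (hf : ∀ t, ∀ z ∈ S, f (t, z) ∈ T) :
    ∃ F : C(unitInterval × (collapse Z S).space, (collapse W T).space),
      (∀ t z, F (t, collapseProj S z) = collapseProj T (f (t, z))) ∧
        ∀ t, F (t, (collapse Z S).pt) = (collapse W T).pt := by
  let g : C(Z × unitInterval, (collapse W T).space) :=
    (collapseProj T).hom.comp (f.comp ⟨fun x => (x.2, x.1), by fun_prop⟩)
  let c : (collapse Z S).space → C(unitInterval, (collapse W T).space) :=
    Quot.lift (Sum.elim g.curry fun _ => ContinuousMap.const _ (collapse W T).pt) (by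
      rintro _ _ ⟨s, hs, rfl, rfl⟩
      ext t
      exact collapseProj_eq_pt_iff.2 (hf t s hs))
  have hc : Continuous c := continuous_collapse_iff.2 g.curry.continuous
  refine ⟨⟨fun x => c x.2 x.1, ?_⟩, fun t z => rfl, fun t => rfl⟩
  exact ContinuousEval.continuous_eval.comp ((hc.comp continuous_snd).prodMk continuous_fst)

theorem isClosed_pt_collapse (hS : IsClosed S) : IsClosed {(collapse Z S).pt} := by
  rw [← isOpen_compl_iff, isOpen_collapse_iff]
  convert hS.isOpen_compl using 1
  ext z
  exact not_congr collapseProj_eq_pt_iff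

theorem isOpenEmbedding_collapseProj (hS : IsClosed S) :
    Topology.IsOpenEmbedding fun z : (Sᶜ : Set Z) => collapseProj S z.1 := by
  refine Topology.IsOpenEmbedding.of_continuous_injective_isOpenMap
    ((collapseProj S).hom.continuous.comp continuous_subtype_val)
    (fun z w h => Subtype.ext (collapseProj_injOn z.2 w.2 h)) fun U hU => ?_
  rw [isOpen_collapse_iff]
  convert hS.isOpen_compl.isOpenEmbedding_subtypeVal.isOpenMap U hU using 1
  ext z
  constructor
  · rintro ⟨w, hw, e⟩
    have hz : z ∉ S := fun hz =>
      w.2 (collapseProj_eq_pt_iff.1 (e.trans (collapseProj_eq_pt_iff.2 hz)))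
    exact ⟨w, hw, collapseProj_injOn w.2 hz e⟩
  · rintro ⟨w, hw, rfl⟩
    exact ⟨w, hw, rfl⟩

theorem subordinate_collapseProj (S : Set Z) :
    Subordinate {S} {{(collapse Z S).pt}} (collapseProj S) :=
  Subordinate.singleton fun _ hz => collapseProj_eq_pt_iff.2 hz

/-- The map `Z ⟶ Z / S` excises `S`. -/
theorem weakEquiv_collapseProj_of_open (hS : IsClosed S) {O : Set Z} (hO : IsOpen O) (hSO : S ⊆ O)
    {O' : Set (collapse Z S).space} (hOo : IsOpen O') (hpt : (collapse Z S).pt ∈ O')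
    (hO' : ∀ z, collapseProj S z ∈ O' ↔ z ∈ O)
    (h : Subordinate {O} {O'} (collapseProj S)) : SPair.WeakEquiv (singMap (collapseProj S) h) := by
  let i : TopCat.of (Sᶜ : Set Z) ⟶ TopCat.of Z := TopCat.ofHom ⟨Subtype.val, by fun_prop⟩
  let P : Set (TopCat.of (Sᶜ : Set Z)) := i ⁻¹' O
  have s1 : Subordinate {P} {O} i := Subordinate.singleton (Set.mapsTo_preimage _ _)
  have s2 : Subordinate {P} {O'} (i ≫ collapseProj S) :=
    Subordinate.singleton fun z hz => (hO' (i z)).2 hz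
  have w1 : SPair.WeakEquiv (singMap i s1) := weakEquiv_excision i Topology.IsEmbedding.subtypeVal
    (S := S) Subtype.range_coe hS hO hSO rfl _
  have hr : Set.range (i ≫ collapseProj S) = ({(collapse Z S).pt} : Set _)ᶜ := by
    refine Set.ext (collapse_cases (fun z => ?_) ?_)
    · rw [Set.mem_compl_iff, Set.mem_singleton_iff, collapseProj_eq_pt_iff]
      constructor
      · rintro ⟨w, hw⟩ hz
        exact w.2 (collapseProj_eq_pt_iff.1 (hw.trans (collapseProj_eq_pt_iff.2 hz)))
      · exact fun hz => ⟨⟨z, hz⟩, rfl⟩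
    · refine ⟨?_, fun h => absurd rfl h⟩
      rintro ⟨w, hw⟩
      exact absurd (collapseProj_eq_pt_iff.1 hw) w.2
  have hP : P = (i ≫ collapseProj S) ⁻¹' O' := Set.ext fun z => (hO' (i z)).symm
  have w2 : SPair.WeakEquiv (singMap (i ≫ collapseProj S) s2) :=
    weakEquiv_excision (i ≫ collapseProj S) (isOpenEmbedding_collapseProj hS).isEmbedding hr
      (isClosed_pt_collapse hS) hOo (Set.singleton_subset_iff.2 hpt) hP _
  exact SPair.WeakEquiv.of_comp_left w1 w2

/-- The quotient `Z / S` by a neighbourhood deformation retract has a good base point, and relative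
singular chains of `(Z, S)` compute the reduced chains of `Z / S`. Both follow by pushing the
deformation of the neighbourhood down to the quotient and excising inside the neighbourhood. -/
theorem goodPair_collapse_and_weakEquiv (h : GoodPair Z S) :
    GoodPair (collapse Z S).space {(collapse Z S).pt} ∧
      SPair.WeakEquiv (singMap (collapseProj S) (subordinate_collapseProj S)) := by
  obtain ⟨hS, O, hO, hSO, D, hD0, hDS, hDO, hD1⟩ := h
  obtain ⟨E, hE, hEpt⟩ := exists_collapse_homotopy D hDS
  let O' : Set (collapse Z S).space := {x | ∀ z, collapseProj S z = x → z ∈ O}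
  have hO' : ∀ z, collapseProj S z ∈ O' ↔ z ∈ O := fun z => by
    refine ⟨fun hz => hz z rfl, fun hz w e => ?_⟩
    by_cases hw : w ∈ S
    · exact hSO hw
    · have hz' : z ∉ S := fun hz' =>
        hw (collapseProj_eq_pt_iff.1 (e.trans (collapseProj_eq_pt_iff.2 hz')))
      rwa [collapseProj_injOn hw hz' e]
  have hptO : (collapse Z S).pt ∈ O' := fun z hz => hSO (collapseProj_eq_pt_iff.1 hz)
  have hOo : IsOpen O' := by
    rw [isOpen_collapse_iff]
    convert hO using 1
    exact Set.ext hO'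
  have hE0 : ∀ x, E (0, x) = x := collapse_cases (fun z => by rw [hE, hD0]) (hEpt 0)
  have hEO : ∀ t, ∀ x ∈ O', E (t, x) ∈ O' := fun t => collapse_cases (fun z hz => by
    rw [hE, hO']
    exact hDO t z ((hO' z).1 hz)) fun _ => by rwa [hEpt]
  have hE1 : ∀ x ∈ O', E (1, x) = (collapse Z S).pt := collapse_cases (fun z hz => by
    rw [hE, collapseProj_eq_pt_iff]
    exact hD1 z ((hO' z).1 hz)) fun _ => hEpt 1
  have hpt : ∀ t, ∀ x ∈ ({(collapse Z S).pt} : Set (collapse Z S).space),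
      E (t, x) ∈ ({(collapse Z S).pt} : Set (collapse Z S).space) := by
    rintro t _ rfl
    exact hEpt t
  refine ⟨⟨isClosed_pt_collapse hS, O', hOo, Set.singleton_subset_iff.2 hptO, E, hE0, hpt, hEO,
    hE1⟩, ?_⟩
  have s3 : Subordinate {O} {O'} (collapseProj S) :=
    Subordinate.singleton fun z hz => (hO' z).2 hz
  have s4 : Subordinate {S} {O} (𝟙 (TopCat.of Z)) := Subordinate.singleton fun z hz => hSO hz
  have s5 : Subordinate {{(collapse Z S).pt}} {O'} (𝟙 (collapse Z S).space) :=
    Subordinate.singleton (by rintro _ rfl; exact hptO)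
  have w3 : SPair.WeakEquiv (singMap (collapseProj S) s3) :=
    weakEquiv_collapseProj_of_open hS hO hSO hOo hptO hO' _
  have w4 : SPair.WeakEquiv (singMap (𝟙 (TopCat.of Z)) s4) := by
    refine weakEquiv_singMap_of_deformation s4 D hD0 ?_ ?_ (Subordinate.singleton hD1)
    · rintro _ rfl
      exact ⟨_, rfl, hDS⟩
    · rintro _ rfl
      exact ⟨_, rfl, hDO⟩
  have w5 : SPair.WeakEquiv (singMap (𝟙 (collapse Z S).space) s5) := by
    refine weakEquiv_singMap_of_deformation s5 E hE0 ?_ ?_ (Subordinate.singleton hE1)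
    · rintro _ rfl
      exact ⟨_, rfl, hpt⟩
    · rintro _ rfl
      exact ⟨_, rfl, hEO⟩
  exact weakEquiv_singMap_of_square w4 w5 w3

end PtdTop

end

/-! ### Reduced singular chains -/

section

open Limits HomologicalComplex Opposite Simplicial TensorProduct

open TopCat

namespace PtdTop

/-- The simplicial pair of the singular simplices of a pointed space and of the simplices at the
base point. -/
noncomputable def singPt : PtdTop.{u} ⥤ SPair.{u} where
  obj X := sing X.space {{X.pt}}
  map f := singMap f.map (Subordinate.singleton (by
    rintro _ rfl
    exact f.map_pt))

end PtdTop

namespace PairType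

/-- The coproduct of copies of `ℚ` indexed by a set. -/
noncomputable abbrev copower : Type u ⥤ ModuleCat.{u} ℚ :=
  sigmaConst.obj (ModuleCat.of ℚ (ULift.{u} ℚ))

/-- The projection from the coproduct of copies of `ℚ` indexed by `P` to `ℚ[P] / ℚ[F]`. -/
noncomputable def ofCopower (P : PairType.{u}) : copower.obj P.carrier ⟶ free.obj P :=
  Sigma.desc fun x => ModuleCat.ofHom
    ((LinearMap.toSpanSingleton ℚ P.Free (P.cls x)) ∘ₗ ULift.moduleEquiv.toLinearMap)

theorem ofCopower_ι (P : PairType.{u}) (x : P.carrier) (a : ULift.{u} ℚ) :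
    P.ofCopower (Sigma.ι (fun _ : P.carrier => ModuleCat.of ℚ (ULift.{u} ℚ)) x a) =
      a.down • P.cls x := by
  have := Sigma.ι_desc (fun x => ModuleCat.ofHom
    ((LinearMap.toSpanSingleton ℚ P.Free (P.cls x)) ∘ₗ ULift.moduleEquiv.toLinearMap)) x
  exact ConcreteCategory.congr_hom this a

theorem copower_hom_ext {P : Type u} {M : ModuleCat.{u} ℚ} {f g : copower.obj P ⟶ M}
    (h : ∀ x a, f (Sigma.ι (fun _ : P => ModuleCat.of ℚ (ULift.{u} ℚ)) x a) =
      g (Sigma.ι (fun _ : P => ModuleCat.of ℚ (ULift.{u} ℚ)) x a)) : f = g := by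
  refine Sigma.hom_ext _ _ fun x => ?_
  ext a
  exact h x a

theorem copower_map_ι {P Q : Type u} (f : P ⟶ Q) (x : P) (a : ULift.{u} ℚ) :
    copower.map f (Sigma.ι (fun _ : P => ModuleCat.of ℚ (ULift.{u} ℚ)) x a) =
      Sigma.ι (fun _ : Q => ModuleCat.of ℚ (ULift.{u} ℚ)) (f x) a := by
  have : Sigma.ι (fun _ : P => ModuleCat.of ℚ (ULift.{u} ℚ)) x ≫ copower.map f =
      Sigma.ι (fun _ : Q => ModuleCat.of ℚ (ULift.{u} ℚ)) (f x) := by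
    simp [copower]
  exact ConcreteCategory.congr_hom this a

theorem ofCopower_naturality {P Q : PairType.{u}} (f : P ⟶ Q) :
    copower.map (↾(Hom.map f)) ≫ Q.ofCopower = P.ofCopower ≫ free.map f := by
  refine copower_hom_ext fun x a => ?_
  rw [ModuleCat.comp_apply, copower_map_ι, ModuleCat.comp_apply]
  refine (ofCopower_ι Q _ a).trans (Eq.symm ?_)
  refine (congr_arg (freeMap f) (ofCopower_ι P x a)).trans ?_
  rw [map_smul, freeMap_cls]
  rfl

end PairType

namespace PtdTop

/-- The projection from singular chains to singular chains relative to the base point, for the two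
models of the singular chains. -/
noncomputable def singularProj (X : PtdTop.{u}) : singularChains.obj X.space ⟶
    chains.obj (SPair.free.obj (singPt.obj X)) :=
  chains.map (X := (toSSet.obj X.space) ⋙ PairType.copower)
    { app := fun n => PairType.ofCopower ((singPt.obj X).obj n)
      naturality := fun _ _ f => PairType.ofCopower_naturality ((singPt.obj X).map f) }

theorem singularProj_naturality {X Y : PtdTop.{u}} (f : X ⟶ Y) :
    singularChains.map f.map ≫ Y.singularProj =
      X.singularProj ≫ chains.map (SPair.free.map (singPt.map f)) := by
  ext1 n
  exact PairType.ofCopower_naturality ((singPt.map f).app (op ⦋n⦌))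

theorem incl_singularProj (X : PtdTop.{u}) : singularChains.map X.incl ≫ X.singularProj = 0 := by
  ext1 n
  refine PairType.copower_hom_ext (P := (toSSet.obj point.{u}).obj (op ⦋n⦌)) fun σ a => ?_
  refine (congr_arg (X.singularProj.f n) (PairType.copower_map_ι _ σ a)).trans ?_
  refine (PairType.ofCopower_ι _ _ a).trans ?_
  have h : (toSSet.map X.incl).app (op ⦋n⦌) σ ∈ ((singPt.obj X).obj (op ⦋n⦌)).sub :=
    ⟨_, rfl, fun _ => rfl⟩
  have h0 : a.down • ((singPt.obj X).obj (op ⦋n⦌)).cls ((toSSet.map X.incl).app (op ⦋n⦌) σ) = 0 := by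
    rw [PairType.cls_eq_zero _ h, smul_zero]
  exact h0

/-- Reduced singular chains, in the model `ℚ[Sing X] / ℚ[Sing pt]`. -/
noncomputable def reducedChainsComparison :
    reducedChains.{u} ⟶ singPt ⋙ SPair.free ⋙ chains where
  app X := cokernel.desc _ X.singularProj X.incl_singularProj
  naturality X Y f := by
    refine coequalizer.hom_ext ?_
    have h1 : cokernel.π (singularChains.map X.incl) ≫ reducedChains.map f =
        singularChains.map f.map ≫ cokernel.π (singularChains.map Y.incl) := cokernel.π_desc _ _ _
    refine (Category.assoc _ _ _).symm.trans ((congr_arg (· ≫ _) h1).trans ?_)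
    refine (Category.assoc _ _ _).trans ((congr_arg (_ ≫ ·) (cokernel.π_desc _ _ _)).trans ?_)
    refine (singularProj_naturality f).trans ?_
    refine Eq.trans ?_ (Category.assoc _ _ _)
    exact congr_arg (· ≫ _) (cokernel.π_desc _ _ _).symm

theorem quasiIso_reducedChainsComparison (X : PtdTop.{u}) :
    QuasiIso (reducedChainsComparison.app X) := by
  refine RatChain.quasiIso_of_bijective _ fun n => ?_
  let P := (singPt.obj X).obj (op ⦋n⦌)
  let π : PairType.copower.obj P.carrier ⟶ (reducedChains.obj X).X n :=
    (cokernel.π (singularChains.map X.incl)).f n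
  have hπ : Function.Surjective π := by
    rw [← ModuleCat.epi_iff_surjective]
    change Epi ((HomologicalComplex.eval _ _ n).map (cokernel.π (singularChains.map X.incl)))
    infer_instance
  have hd : ∀ y, (reducedChainsComparison.app X).f n (π y) = P.ofCopower y := fun y => by
    have := congr_arg (fun t => HomologicalComplex.Hom.f t n)
      (cokernel.π_desc (singularChains.map X.incl) X.singularProj X.incl_singularProj)
    exact ConcreteCategory.congr_hom this y
  let s : P.Free →ₗ[ℚ] (reducedChains.obj X).X n :=
    P.lift (fun x => π (Sigma.ι (fun _ : P.carrier => ModuleCat.of ℚ (ULift.{u} ℚ)) x ⟨1⟩)) (by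
      rintro σ ⟨_, rfl, hσ⟩
      let τ : (toSSet.obj point.{u}).obj (op ⦋n⦌) :=
        simplexMk (op ⦋n⦌) (ContinuousMap.const _ PUnit.unit)
      have e : (toSSet.map X.incl).app (op ⦋n⦌) τ = σ := simplex_ext fun p => (hσ p).symm
      have := congr_arg (fun t => HomologicalComplex.Hom.f t n)
        (cokernel.condition (singularChains.map X.incl))
      have h2 := ConcreteCategory.congr_hom this
        (Sigma.ι (fun _ : (toSSet.obj point.{u}).obj (op ⦋n⦌) => ModuleCat.of ℚ (ULift.{u} ℚ)) τ ⟨1⟩)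
      refine Eq.trans ?_ h2
      refine congr_arg π ?_
      refine Eq.trans ?_ (PairType.copower_map_ι _ τ ⟨1⟩).symm
      exact congr_arg (fun x => Sigma.ι (fun _ : P.carrier => ModuleCat.of ℚ (ULift.{u} ℚ)) x ⟨1⟩)
        e.symm)
  have hs : P.ofCopower ≫ ModuleCat.ofHom s = π := PairType.copower_hom_ext fun x a => by
    refine (congr_arg s (PairType.ofCopower_ι P x a)).trans ?_
    rw [map_smul, PairType.lift_cls, ← map_smul, ← map_smul]
    congr 2
    exact ULift.ext _ _ (mul_one _)
  constructor
  · intro x y h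
    obtain ⟨x, rfl⟩ := hπ x
    obtain ⟨y, rfl⟩ := hπ y
    rw [hd, hd] at h
    rw [← hs]
    exact congr_arg s h
  · intro y
    refine PairType.free_induction (p := fun y => ∃ a, (reducedChainsComparison.app X).f n a = y) y
      ⟨0, map_zero _⟩ ?_ ?_
    · rintro _ _ ⟨a, rfl⟩ ⟨b, rfl⟩
      exact ⟨a + b, map_add _ _ _⟩
    · intro a x
      refine ⟨π (Sigma.ι (fun _ : P.carrier => ModuleCat.of ℚ (ULift.{u} ℚ)) x ⟨a⟩), ?_⟩
      rw [hd]
      exact PairType.ofCopower_ι P x ⟨a⟩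

end PtdTop

end

/-! ### Smash powers -/

section

open Limits HomologicalComplex Opposite Simplicial TensorProduct

open TopCat

namespace SPair

/-- Formality of the right `Ω`-module of the smash powers of a simplicial pair. -/
def IsFormal (S : SPair.{u}) : Prop := RightOmegaModule.Formal (S.tensorPowers ⋙ chains)

theorem WeakEquiv.isFormal_iff {S T : SPair.{u}} {f : S ⟶ T} (hf : WeakEquiv f) :
    IsFormal S ↔ IsFormal T := by
  have h : RightOmegaModule.HasQuasiIso (S.tensorPowers ⋙ chains) (T.tensorPowers ⋙ chains) :=
    ⟨Functor.whiskerRight (SPair.tensorPowersMap f) chains, hf.tensorPowersMap⟩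
  exact ⟨fun hS => hS.of_hasQuasiIso h, fun hT => hT.of_hasQuasiIso' h⟩

end SPair

/-- The comparison between tuples of singular simplices of `Z` and singular simplices of `Z ^ A`. -/
noncomputable def singPow (Z : TopCat.{u}) (S : Set Z) (A : Type) :
    sing Z {S} ⋙ PairType.pow A ⟶ sing (TopCat.of (A → Z)) (coordSets S A) where
  app n := PairType.Hom.mk (P := (PairType.pow A).obj ((sing Z {S}).obj n))
    (Q := (sing (TopCat.of (A → Z)) (coordSets S A)).obj n)
    (fun σ => simplexMk (Z := TopCat.of (A → Z)) n
      ⟨fun p a => simplexEval (σ a) p, continuous_pi fun a => continuous_simplexEval (σ a)⟩) (by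
    rintro σ ⟨a, _, rfl, h⟩
    refine ⟨_, ⟨a, rfl⟩, fun p => ?_⟩
    rw [simplexEval_mk]
    exact h p)

theorem simplexEval_singPow {Z : TopCat.{u}} {S : Set Z} {A : Type} {n : SimplexCategoryᵒᵖ}
    (σ : A → (toSSet.obj Z).obj n) (p : stdSimplex ℝ (Fin (n.unop.len + 1))) :
    simplexEval (Z := TopCat.of (A → Z)) (PairType.Hom.map ((singPow Z S A).app n) σ) p =
      fun a => simplexEval (σ a) p := simplexEval_mk _ _

/-- A tuple of simplices of `Z` is the same as a simplex of `Z ^ A`, and it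
lies in the distinguished subset precisely if one of its coordinates has image in `S`. -/
theorem weakEquiv_singPow (Z : TopCat.{u}) (S : Set Z) (A : Type) :
    SPair.WeakEquiv (singPow Z S A) := by
  refine SPair.WeakEquiv.of_bijOn _ fun n => ⟨?_, ?_, ?_⟩
  · rintro σ hσ ⟨_, ⟨a, rfl⟩, h⟩
    refine hσ ⟨a, _, rfl, fun p => ?_⟩
    exact Set.mem_of_eq_of_mem (congr_fun (simplexEval_singPow σ p) a).symm (h p)
  · intro σ _ τ _ h
    refine funext fun a => simplex_ext fun p => ?_
    have := congr_arg (fun ρ => simplexEval (Z := TopCat.of (A → Z)) ρ p) h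
    exact congr_fun ((simplexEval_singPow σ p).symm.trans (this.trans (simplexEval_singPow τ p))) a
  · intro σ hσ
    let τ : A → (toSSet.obj Z).obj (op ⦋n⦌) := fun a => simplexMk (op ⦋n⦌)
      ⟨fun p => simplexEval (Z := TopCat.of (A → Z)) σ p a,
        (continuous_apply a).comp (continuous_simplexEval σ)⟩
    have hτ : PairType.Hom.map ((singPow Z S A).app (op ⦋n⦌)) τ = σ := by
      refine simplex_ext (Z := TopCat.of (A → Z)) fun p => ?_
      rw [simplexEval_singPow]
      exact funext fun a => simplexEval_mk _ _
    refine ⟨τ, ?_, hτ⟩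
    rintro ⟨a, _, rfl, h⟩
    refine hσ ⟨_, ⟨a, rfl⟩, fun p => ?_⟩
    have := h p
    rw [simplexEval_mk] at this
    exact this

theorem GoodPair.fat {Z : Type u} [TopologicalSpace Z] {S : Set Z} (hS : GoodPair Z S) (A : Type)
    [Finite A] : GoodPair (A → Z) (fat S A) := by
  obtain ⟨hc, O, hO, hSO, D, hD0, hDS, hDO, hD1⟩ := hS
  have hfat : ∀ T : Set Z, _root_.fat T A = ⋃ a, (fun z => z a) ⁻¹' T := fun T =>
    Set.ext fun z => (Set.mem_iUnion (s := fun a => (fun z : A → Z => z a) ⁻¹' T)).symm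
  refine ⟨?_, _root_.fat O A, ?_, fun z ⟨a, h⟩ => ⟨a, hSO h⟩,
    ⟨fun x a => D (x.1, x.2 a), by fun_prop⟩, fun z => funext fun a => hD0 _,
    fun t z ⟨a, h⟩ => ⟨a, hDS t _ h⟩, fun t z ⟨a, h⟩ => ⟨a, hDO t _ h⟩,
    fun z ⟨a, h⟩ => ⟨a, hD1 _ h⟩⟩
  · rw [hfat]
    exact isClosed_iUnion_of_finite fun a => hc.preimage (continuous_apply a)
  · rw [hfat]
    exact isOpen_iUnion fun a => hO.preimage (continuous_apply a)

theorem subordinate_coordSets {Z : Type u} (S : Set Z) (A : Type) :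
    Subordinate (coordSets S A) {fat S A} (id : (A → Z) → A → Z) := by
  rintro _ ⟨a, rfl⟩
  exact ⟨_, rfl, fun z hz => ⟨a, hz⟩⟩

/-- The map from `A`-tuples of singular simplices of `Z` to singular simplices of `Z ^ A / fat`. -/
noncomputable def singPowCollapse (Z : TopCat.{u}) (S : Set Z) (A : Type) :
    sing Z {S} ⋙ PairType.pow A ⟶ PtdTop.singPt.obj (PtdTop.collapse (A → Z) (fat S A)) :=
  singPow Z S A ≫ singMap (𝟙 (TopCat.of (A → Z))) (subordinate_coordSets S A) ≫
    singMap (PtdTop.collapseProj (fat S A)) (PtdTop.subordinate_collapseProj _)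

theorem simplexEval_singPowCollapse {Z : TopCat.{u}} {S : Set Z} {A : Type} {n : SimplexCategoryᵒᵖ}
    (σ : A → (toSSet.obj Z).obj n) (p : stdSimplex ℝ (Fin (n.unop.len + 1))) :
    simplexEval (Z := (PtdTop.collapse (A → Z) (fat S A)).space)
      (PairType.Hom.map ((singPowCollapse Z S A).app n) σ) p =
      PtdTop.collapseProj (fat S A) (fun a => simplexEval (σ a) p) :=
  congr_arg (PtdTop.collapseProj (fat S A)) (simplexEval_singPow (S := S) σ p)

/-- The simplicial power of the singular pair `(Z, S)` computes the reduced chains of `Z ^ A / fat`. -/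
theorem weakEquiv_singPowCollapse {Z : TopCat.{u}} {S : Set Z} (hS : GoodPair Z S) (A : Type)
    [Finite A] : SPair.WeakEquiv (singPowCollapse Z S A) :=
  (weakEquiv_singPow Z S A).comp ((weakEquiv_powers hS A _).comp
    (PtdTop.goodPair_collapse_and_weakEquiv (hS.fat A)).2)

namespace PtdTop

/-- For a well-behaved base point, the chains on the smash powers of `X` are the smash powers of the
singular simplicial set of `X`. -/
noncomputable def tensorPowersComparison (X : PtdTop.{u}) :
    (singPt.obj X).tensorPowers ⟶ X.smashPowers ⋙ singPt ⋙ SPair.free where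
  app A := SPair.free.map (singPowCollapse X.space {X.pt} A.unop.carrier)
  naturality A B g := by
    refine NatTrans.ext (funext fun n => ?_)
    refine (PairType.free.map_comp _ _).symm.trans (Eq.trans ?_ (PairType.free.map_comp _ _))
    refine congr_arg PairType.free.map (PairType.hom_ext fun σ => ?_)
    refine simplex_ext (Z := (collapse (B.unop.carrier → X.space) (fat {X.pt} _)).space) fun p => ?_
    refine (simplexEval_singPowCollapse _ p).trans (Eq.symm ?_)
    exact congr_arg (Hom.map (X.smashPowers.map g)) (simplexEval_singPowCollapse (S := {X.pt}) σ p)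

theorem hasQuasiIso_smashChains (X : PtdTop.{u}) :
    RightOmegaModule.HasQuasiIso X.smashChains (X.smashPowers ⋙ singPt ⋙ SPair.free ⋙ chains) :=
  ⟨Functor.whiskerLeft X.smashPowers reducedChainsComparison,
    fun _ => quasiIso_reducedChainsComparison _⟩

/-- For a good base point, formality of the chains on the smash powers of `X` can be tested on the
powers of the simplicial pair `(Sing X, Sing pt)`, where no quotient space occurs. -/
theorem formal_smashChains_iff {X : PtdTop.{u}} (hX : GoodPair X.space {X.pt}) :
    RightOmegaModule.Formal X.smashChains ↔ SPair.IsFormal (singPt.obj X) := by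
  have h : RightOmegaModule.HasQuasiIso ((singPt.obj X).tensorPowers ⋙ chains)
      (X.smashPowers ⋙ singPt ⋙ SPair.free ⋙ chains) :=
    ⟨Functor.whiskerRight X.tensorPowersComparison chains, fun A =>
      haveI := A.unop.finite
      weakEquiv_singPowCollapse hX A.unop.carrier⟩
  exact ⟨fun hf => (hf.of_hasQuasiIso X.hasQuasiIso_smashChains).of_hasQuasiIso' h,
    fun hf => RightOmegaModule.Formal.of_hasQuasiIso' (hf.of_hasQuasiIso h)
      X.hasQuasiIso_smashChains⟩

theorem isFormal_collapse_iff {Z : TopCat.{u}} {S : Set Z} (hS : GoodPair Z S) :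
    RightOmegaModule.Formal (collapse Z S).smashChains ↔ SPair.IsFormal (sing Z {S}) := by
  obtain ⟨h1, h2⟩ := goodPair_collapse_and_weakEquiv hS
  exact (formal_smashChains_iff h1).trans h2.isFormal_iff.symm

end PtdTop

end

/-! ### Homotopy invariance of the smash powers -/

section

open Limits HomologicalComplex Opposite Simplicial TensorProduct

open TopCat

/-- A map of pairs which is a homotopy equivalence through maps of pairs. -/
def PairHomotopyEquiv {Z W : Type*} [TopologicalSpace Z] [TopologicalSpace W] (S : Set Z)
    (T : Set W) (f : C(Z, W)) : Prop :=
  Set.MapsTo f S T ∧ ∃ g : C(W, Z), Set.MapsTo g T S ∧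
    (∃ H : C(unitInterval × Z, Z), (∀ z, H (0, z) = g (f z)) ∧ (∀ z, H (1, z) = z) ∧
      ∀ t, ∀ z ∈ S, H (t, z) ∈ S) ∧
    ∃ H : C(unitInterval × W, W), (∀ w, H (0, w) = f (g w)) ∧ (∀ w, H (1, w) = w) ∧
      ∀ t, ∀ w ∈ T, H (t, w) ∈ T

namespace PairHomotopyEquiv

section

variable {Z W : Type*} [TopologicalSpace Z] [TopologicalSpace W] {S : Set Z} {T : Set W}
  {f : C(Z, W)}

theorem pow (h : PairHomotopyEquiv S T f) (A : Type) :
    PairHomotopyEquiv (fat S A) (fat T A) ⟨fun z a => f (z a), by fun_prop⟩ := by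
  obtain ⟨hf, g, hg, ⟨H, h0, h1, hS⟩, H', h0', h1', hT⟩ := h
  exact ⟨fun z ⟨a, ha⟩ => ⟨a, hf ha⟩, ⟨fun z a => g (z a), by fun_prop⟩,
    fun z ⟨a, ha⟩ => ⟨a, hg ha⟩,
    ⟨⟨fun x a => H (x.1, x.2 a), by fun_prop⟩, fun z => funext fun a => h0 _,
      fun z => funext fun a => h1 _, fun t z ⟨a, ha⟩ => ⟨a, hS t _ ha⟩⟩,
    ⟨fun x a => H' (x.1, x.2 a), by fun_prop⟩, fun z => funext fun a => h0' _,
      fun z => funext fun a => h1' _, fun t z ⟨a, ha⟩ => ⟨a, hT t _ ha⟩⟩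

theorem sum {Z' W' : Type*} [TopologicalSpace Z'] [TopologicalSpace W'] {S' : Set Z'} {T' : Set W'}
    {f' : C(Z', W')} (h : PairHomotopyEquiv S T f) (h' : PairHomotopyEquiv S' T' f') :
    PairHomotopyEquiv (Sum.elim S S') (Sum.elim T T')
      ⟨Sum.map f f', f.continuous.sumMap f'.continuous⟩ := by
  obtain ⟨hf, g, hg, ⟨H, h0, h1, hS⟩, K, k0, k1, hT⟩ := h
  obtain ⟨hf', g', hg', ⟨H', h0', h1', hS'⟩, K', k0', k1', hT'⟩ := h'
  refine ⟨Sum.rec (fun _ h => hf h) (fun _ h => hf' h),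
    ⟨Sum.map g g', g.continuous.sumMap g'.continuous⟩, Sum.rec (fun _ h => hg h) (fun _ h => hg' h),
    ⟨⟨Sum.map H H' ∘ Homeomorph.prodSumDistrib, (H.continuous.sumMap H'.continuous).comp
      Homeomorph.prodSumDistrib.continuous⟩, ?_, ?_, ?_⟩,
    ⟨Sum.map K K' ∘ Homeomorph.prodSumDistrib, (K.continuous.sumMap K'.continuous).comp
      Homeomorph.prodSumDistrib.continuous⟩, ?_, ?_, ?_⟩
  · exact Sum.rec (fun z => congr_arg Sum.inl (h0 z)) (fun z => congr_arg Sum.inr (h0' z))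
  · exact Sum.rec (fun z => congr_arg Sum.inl (h1 z)) (fun z => congr_arg Sum.inr (h1' z))
  · exact fun t => Sum.rec (fun z hz => hS t z hz) (fun z hz => hS' t z hz)
  · exact Sum.rec (fun z => congr_arg Sum.inl (k0 z)) (fun z => congr_arg Sum.inr (k0' z))
  · exact Sum.rec (fun z => congr_arg Sum.inl (k1 z)) (fun z => congr_arg Sum.inr (k1' z))
  · exact fun t => Sum.rec (fun z hz => hT t z hz) (fun z hz => hT' t z hz)

end

variable {Z W : Type u} [TopologicalSpace Z] [TopologicalSpace W] {S : Set Z} {T : Set W}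
  {f : C(Z, W)}

theorem collapse (h : PairHomotopyEquiv S T f) :
    PairHomotopyEquiv {(PtdTop.collapse Z S).pt} {(PtdTop.collapse W T).pt}
      (PtdTop.collapseMap f h.1).map.hom := by
  obtain ⟨hf, g, hg, ⟨H, h0, h1, hS⟩, K, k0, k1, hT⟩ := h
  obtain ⟨H', e, ept⟩ := PtdTop.exists_collapse_homotopy H hS
  obtain ⟨K', l, lpt⟩ := PtdTop.exists_collapse_homotopy K hT
  refine ⟨by rintro _ rfl; rfl, (PtdTop.collapseMap g hg).map.hom, by rintro _ rfl; rfl,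
    ⟨H', ?_, ?_, ?_⟩, ⟨K', ?_, ?_, ?_⟩⟩
  · exact PtdTop.collapse_cases (fun z => (e 0 z).trans (congr_arg _ (h0 z))) (ept 0)
  · exact PtdTop.collapse_cases (fun z => (e 1 z).trans (congr_arg _ (h1 z))) (ept 1)
  · rintro t _ rfl
    exact ept t
  · exact PtdTop.collapse_cases (fun z => (l 0 z).trans (congr_arg _ (k0 z))) (lpt 0)
  · exact PtdTop.collapse_cases (fun z => (l 1 z).trans (congr_arg _ (k1 z))) (lpt 1)
  · rintro t _ rfl
    exact lpt t

end PairHomotopyEquiv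

theorem PairHomotopyEquiv.weakEquiv {Z W : TopCat.{u}} {S : Set Z} {T : Set W} {f : Z ⟶ W}
    (h : PairHomotopyEquiv S T f.hom) (hf : Subordinate {S} {T} f) :
    SPair.WeakEquiv (singMap f hf) := by
  obtain ⟨-, g, hg, ⟨H, h0, h1, hS⟩, K, k0, k1, hT⟩ := h
  refine weakEquiv_singMap f hf (TopCat.ofHom g) (Subordinate.singleton hg)
    { toContinuousMap := H, map_zero_left := h0, map_one_left := h1 }
    { toContinuousMap := K, map_zero_left := k0, map_one_left := k1 } ?_ ?_
  · rintro _ rfl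
    exact ⟨_, rfl, hS⟩
  · rintro _ rfl
    exact ⟨_, rfl, hT⟩

namespace PtdTop

/-- Functoriality of the smash powers. -/
noncomputable def smashPowersMap {X Y : PtdTop.{u}} (f : X ⟶ Y) :
    X.smashPowers ⟶ Y.smashPowers where
  app A := collapseMap (Z := A.unop.carrier → X.space) (Z' := A.unop.carrier → Y.space)
    ⟨fun z a => f.map (z a), by fun_prop⟩ (fun z ⟨a, ha⟩ => ⟨a, by
      change f.map (z a) = _
      rw [ha, f.map_pt]⟩)
  naturality A B g := by
    ext x
    obtain ⟨(x | x), rfl⟩ := Quot.exists_rep x <;> rfl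

/-- Pointed homotopy equivalences preserve formality of the chains on the smash powers, without any
assumption on the base points: the smash powers of the map are homotopy equivalences themselves. -/
theorem formal_iff_of_pairHomotopyEquiv {X Y : PtdTop.{u}} (f : X ⟶ Y)
    (hf : PairHomotopyEquiv {X.pt} {Y.pt} f.map.hom) :
    RightOmegaModule.Formal X.smashChains ↔ RightOmegaModule.Formal Y.smashChains := by
  have h : RightOmegaModule.HasQuasiIso (X.smashPowers ⋙ singPt ⋙ SPair.free ⋙ chains)
      (Y.smashPowers ⋙ singPt ⋙ SPair.free ⋙ chains) :=
    ⟨Functor.whiskerRight (smashPowersMap f) _, fun A =>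
      (hf.pow A.unop.carrier).collapse.weakEquiv
        (Subordinate.singleton (hf.pow A.unop.carrier).collapse.1)⟩
  exact ⟨fun hX => ((hX.of_hasQuasiIso X.hasQuasiIso_smashChains).of_hasQuasiIso h).of_hasQuasiIso'
    Y.hasQuasiIso_smashChains, fun hY => ((hY.of_hasQuasiIso
      Y.hasQuasiIso_smashChains).of_hasQuasiIso' h).of_hasQuasiIso' X.hasQuasiIso_smashChains⟩

end PtdTop

end

/-! ### Wedges of well-pointed spaces -/

section

open Limits HomologicalComplex Opposite Simplicial TensorProduct

open TopCat

/-- The singular simplices of a space with two complementary open subspaces. -/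
noncomputable def singCoprod {X Y Z : TopCat.{u}} (i : X ⟶ Z) (j : Y ⟶ Z) (S : Set Z) :
    SPair.coprod (sing X {i ⁻¹' S}) (sing Y {j ⁻¹' S}) ⟶ sing Z {S} where
  app n := PairType.Hom.mk
    (P := (SPair.coprod (sing X {i ⁻¹' S}) (sing Y {j ⁻¹' S})).obj n) (Q := (sing Z {S}).obj n)
    (Sum.elim ((toSSet.map i).app n) ((toSSet.map j).app n)) (by
      rintro (σ | σ) ⟨_, rfl, h⟩
      · exact ⟨_, rfl, h⟩
      · exact ⟨_, rfl, h⟩)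
  naturality n m g := by
    ext (σ | σ) <;> rfl

/-- Simplices are connected, so the singular simplices of a space which is the union of two disjoint
open subspaces are those of the two subspaces. -/
theorem weakEquiv_singCoprod {X Y Z : TopCat.{u}} {i : X ⟶ Z} {j : Y ⟶ Z}
    (hi : Topology.IsOpenEmbedding i) (hj : Topology.IsOpenEmbedding j)
    (hij : IsCompl (Set.range i) (Set.range j)) (S : Set Z) :
    SPair.WeakEquiv (singCoprod i j S) := by
  refine SPair.WeakEquiv.of_bijOn _ fun n => ⟨?_, ?_, ?_⟩
  · rintro (σ | σ) hσ ⟨_, rfl, h⟩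
    · exact hσ ⟨_, rfl, h⟩
    · exact hσ ⟨_, rfl, h⟩
  · have p : stdSimplex ℝ (Fin (n + 1)) := stdSimplex.vertex 0
    rintro (σ | σ) - (τ | τ) - h <;> have h' := fun p => congr_arg (fun ρ => simplexEval ρ p) h
    · exact congr_arg Sum.inl (simplex_ext fun p => hi.injective (h' p))
    · exact absurd ⟨simplexEval τ p, (h' p).symm⟩
        (Set.disjoint_left.1 hij.disjoint ⟨simplexEval σ p, rfl⟩)
    · exact absurd ⟨simplexEval σ p, h' p⟩
        (Set.disjoint_left.1 hij.disjoint ⟨simplexEval τ p, rfl⟩)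
    · exact congr_arg Sum.inr (simplex_ext fun p => hj.injective (h' p))
  · intro σ hσ
    let U : Set (stdSimplex ℝ (Fin (n + 1))) := simplexEval σ ⁻¹' Set.range i
    have hU : IsClopen U := by
      refine ⟨?_, hi.isOpen_range.preimage (continuous_simplexEval σ)⟩
      rw [← isOpen_compl_iff]
      have : Uᶜ = simplexEval σ ⁻¹' Set.range j := by rw [← hij.compl_eq]; rfl
      rw [this]
      exact hj.isOpen_range.preimage (continuous_simplexEval σ)
    have : PreconnectedSpace (stdSimplex ℝ (Fin (n + 1))) :=
      Subtype.preconnectedSpace (convex_stdSimplex ℝ _).isPreconnected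
    obtain hU | hU := isClopen_iff.1 hU
    · obtain ⟨τ, rfl⟩ := exists_simplex_lift hj.isEmbedding σ fun p => by
        have : p ∉ U := by rw [hU]; exact Set.notMem_empty p
        rw [← hij.compl_eq]
        exact this
      exact ⟨Sum.inr τ, fun ⟨_, e, h⟩ => hσ ⟨_, rfl, fun p => by subst e; exact h p⟩, rfl⟩
    · obtain ⟨τ, rfl⟩ := exists_simplex_lift hi.isEmbedding σ fun p => by
        have : p ∈ U := by rw [hU]; exact Set.mem_univ p
        exact this
      exact ⟨Sum.inl τ, fun ⟨_, e, h⟩ => hσ ⟨_, rfl, fun p => by subst e; exact h p⟩, rfl⟩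

/-- Formality passes from two disjoint open pieces to the whole space. -/
theorem SPair.isFormal_of_isCompl {X Y Z : TopCat.{u}} {i : X ⟶ Z} {j : Y ⟶ Z}
    (hi : Topology.IsOpenEmbedding i) (hj : Topology.IsOpenEmbedding j)
    (hij : IsCompl (Set.range i) (Set.range j)) {S : Set Z} {S₁ : Set X} {S₂ : Set Y}
    (h₁ : i ⁻¹' S = S₁) (h₂ : j ⁻¹' S = S₂) (hX : IsFormal (sing X {S₁}))
    (hY : IsFormal (sing Y {S₂})) : IsFormal (sing Z {S}) := by
  subst h₁ h₂
  exact (weakEquiv_singCoprod hi hj hij S).isFormal_iff.1 (formal_coprod hX hY)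

theorem GoodPair.sum {Z W : Type u} [TopologicalSpace Z] [TopologicalSpace W] {S : Set Z}
    {T : Set W} (hS : GoodPair Z S) (hT : GoodPair W T) : GoodPair (Z ⊕ W) (Sum.elim S T) := by
  obtain ⟨hc, O, hO, hSO, D, hD0, hDS, hDO, hD1⟩ := hS
  obtain ⟨hc', O', hO', hSO', D', hD0', hDS', hDO', hD1'⟩ := hT
  refine ⟨isClosed_sum_iff.2 ⟨hc, hc'⟩, Sum.elim O O', isOpen_sum_iff.2 ⟨hO, hO'⟩,
    Sum.rec hSO hSO',
    ⟨Sum.map D D' ∘ Homeomorph.prodSumDistrib, (D.continuous.sumMap D'.continuous).comp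
      Homeomorph.prodSumDistrib.continuous⟩, ?_, fun t => ?_, fun t => ?_, ?_⟩
  · exact Sum.rec (fun z => congr_arg Sum.inl (hD0 z)) (fun z => congr_arg Sum.inr (hD0' z))
  · exact Sum.rec (fun z hz => hDS t z hz) (fun z hz => hDS' t z hz)
  · exact Sum.rec (fun z hz => hDO t z hz) (fun z hz => hDO' t z hz)
  · exact Sum.rec (fun z hz => hD1 z hz) (fun z hz => hD1' z hz)

namespace PtdTop

theorem wedge_eq (X Y : PtdTop.{u}) :
    wedge X Y = collapse (X.space ⊕ Y.space) (Sum.elim ({X.pt} : Set X.space) ({Y.pt} : Set Y.space)) := by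
  have : ({Sum.inl X.pt, Sum.inr Y.pt} : Set (X.space ⊕ Y.space)) =
      Sum.elim ({X.pt} : Set X.space) ({Y.pt} : Set Y.space) := by
    ext (x | y)
    · exact (or_iff_left (by rintro ⟨⟩)).trans Sum.inl_injective.eq_iff
    · exact (or_iff_right (by rintro ⟨⟩)).trans Sum.inr_injective.eq_iff
  rw [wedge, this]

/-- For good base points, the wedge is the quotient of the disjoint union by a neighbourhood deformation
retract, so that formality can be tested before passing to the quotient. -/
theorem formal_wedge_of_goodPair {X Y : PtdTop.{u}} (hX : GoodPair X.space {X.pt})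
    (hY : GoodPair Y.space {Y.pt}) (fX : RightOmegaModule.Formal X.smashChains)
    (fY : RightOmegaModule.Formal Y.smashChains) :
    RightOmegaModule.Formal (wedge X Y).smashChains := by
  rw [wedge_eq, isFormal_collapse_iff (Z := TopCat.of (X.space ⊕ Y.space)) (hX.sum hY)]
  exact SPair.isFormal_of_isCompl (Z := TopCat.of (X.space ⊕ Y.space))
    (i := TopCat.ofHom ⟨Sum.inl, continuous_inl⟩) (j := TopCat.ofHom ⟨Sum.inr, continuous_inr⟩)
    Topology.IsOpenEmbedding.inl Topology.IsOpenEmbedding.inr Set.isCompl_range_inl_range_inr rfl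
    rfl ((formal_smashChains_iff hX).1 fX) ((formal_smashChains_iff hY).1 fY)

/-- The space obtained from `X` by attaching a whisker at the base point. -/
abbrev Whisker (X : PtdTop.{u}) : Type u :=
  {q : X.space × unitInterval // q.2 = 0 ∨ q.1 = X.pt}

/-- The space `X` with a whisker, with the free end of the whisker as base point. -/
def whisker (X : PtdTop.{u}) : PtdTop.{u} where
  space := TopCat.of X.Whisker
  pt := ⟨(X.pt, 1), Or.inr rfl⟩

theorem Whisker.eq_pt_iff {X : PtdTop.{u}} (q : X.Whisker) : q = X.whisker.pt ↔ q.1.2 = 1 := by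
  obtain ⟨⟨x, s⟩, h⟩ := q
  refine ⟨fun e => congr_arg (fun q : X.Whisker => q.1.2) e, fun e => ?_⟩
  obtain h | h := h
  · exact absurd (h.symm.trans e) zero_ne_one
  · exact Subtype.ext (Prod.ext h e)

theorem goodPair_whisker (X : PtdTop.{u}) : GoodPair X.whisker.space {X.whisker.pt} := by
  -- the deformation stretches the whisker by the factor `1 + t` and cuts it off at its end
  let c : unitInterval × unitInterval → unitInterval := fun x =>
    Set.projIcc 0 1 zero_le_one (x.2.1 * (1 + x.1.1))
  have hc : Continuous c := continuous_projIcc.comp (by fun_prop)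
  have hle : ∀ t s, s ≤ c (t, s) := fun t s => by
    change s.1 ≤ max 0 (min 1 (s.1 * (1 + t.1)))
    refine le_max_of_le_right (le_min s.2.2 ?_)
    nlinarith [s.2.1, t.2.1]
  have h0 : ∀ s, c (0, s) = s := fun s => by
    change Set.projIcc 0 1 zero_le_one (s.1 * (1 + 0)) = s
    rw [add_zero, mul_one, Set.projIcc_val]
  have hD : ∀ x : unitInterval × X.Whisker, c (x.1, x.2.1.2) = 0 ∨ x.2.1.1 = X.pt := fun x => by
    refine x.2.2.imp (fun h => ?_) id
    rw [h]
    change Set.projIcc 0 1 zero_le_one (0 * (1 + x.1.1)) = 0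
    rw [zero_mul]
    exact Set.projIcc_of_le_left (zero_le_one' ℝ) le_rfl
  let D : C(unitInterval × X.Whisker, X.Whisker) :=
    ⟨fun x => ⟨(x.2.1.1, c (x.1, x.2.1.2)), hD x⟩,
      Continuous.subtype_mk (Continuous.prodMk (by fun_prop) (hc.comp (by fun_prop))) hD⟩
  refine ⟨?_, (fun q : X.Whisker => (q.1.2 : ℝ)) ⁻¹' Set.Ioi (1 / 2),
    isOpen_Ioi.preimage (by fun_prop), ?_, D, fun q => Subtype.ext (Prod.ext rfl (h0 _)), ?_,
    fun t q hq => lt_of_lt_of_le (b := (q.1.2 : ℝ)) hq (hle t q.1.2), ?_⟩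
  · have : ({X.whisker.pt} : Set X.whisker.space) = (fun q : X.Whisker => q.1.2) ⁻¹' {1} :=
      Set.ext Whisker.eq_pt_iff
    rw [this]
    exact isClosed_singleton.preimage (by fun_prop)
  · rintro _ rfl
    change (1 / 2 : ℝ) < 1
    norm_num
  · rintro t _ rfl
    refine (Whisker.eq_pt_iff _).2 ?_
    exact le_antisymm unitInterval.le_one' (hle t 1)
  · intro q hq
    refine (Whisker.eq_pt_iff _).2 ?_
    change (1 / 2 : ℝ) < (q.1.2 : ℝ) at hq
    change Set.projIcc 0 1 zero_le_one (q.1.2.1 * (1 + 1)) = 1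
    exact Set.projIcc_of_right_le _ (by linarith)

/-- The projection which contracts the whisker. -/
def whiskerProj (X : PtdTop.{u}) : X.whisker ⟶ X :=
  Hom.mk (X := X.whisker) (Y := X) (TopCat.ofHom ⟨fun q : X.Whisker => q.1.1, by fun_prop⟩) rfl

/-- For a well-pointed space `X`, the retraction of `X × I` to the union of `X` and the whisker
provides a homotopy inverse of the projection. -/
theorem WellPointed.pairHomotopyEquiv_whiskerProj {X : PtdTop.{u}} (hX : X.WellPointed) :
    PairHomotopyEquiv {X.whisker.pt} {X.pt} X.whiskerProj.map.hom := by
  obtain ⟨r, hr0, hrpt⟩ := hX X.Whisker ⟨fun x => ⟨(x, 0), Or.inl rfl⟩, by fun_prop⟩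
    ⟨fun t => ⟨(X.pt, t), Or.inr rfl⟩, by fun_prop⟩ rfl
  let ρ : unitInterval × X.Whisker → X.Whisker := fun x => r (x.2.1.1, unitInterval.symm x.1)
  have hρ : Continuous ρ := by fun_prop
  have hH : ∀ x : unitInterval × X.Whisker, x.2.1.2 ⊔ (ρ x).1.2 = 0 ∨ (ρ x).1.1 = X.pt := fun x => by
    obtain h | h := x.2.2
    · refine (ρ x).2.imp (fun h' => ?_) id
      rw [h, h', sup_idem]
    · right
      change (r (x.2.1.1, unitInterval.symm x.1)).1.1 = X.pt
      rw [h, hrpt]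
      rfl
  let H : C(unitInterval × X.Whisker, X.Whisker) :=
    ⟨fun x => ⟨((ρ x).1.1, x.2.1.2 ⊔ (ρ x).1.2), hH x⟩,
      Continuous.subtype_mk (Continuous.prodMk (by fun_prop)
        (Continuous.sup (by fun_prop) (by fun_prop))) hH⟩
  refine ⟨by rintro _ rfl; rfl, ⟨fun x => r (x, 1), r.continuous.comp (by fun_prop)⟩, ?_, ⟨H, ?_, ?_, ?_⟩,
    ⟨⟨fun x => (r (x.2, unitInterval.symm x.1)).1.1, by fun_prop⟩, ?_, ?_, ?_⟩⟩
  · rintro _ rfl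
    exact hrpt 1
  · rintro ⟨⟨x, s⟩, h⟩
    refine Subtype.ext (Prod.ext ?_ ?_)
    · change (r (x, unitInterval.symm 0)).1.1 = (r (x, 1)).1.1
      rw [unitInterval.symm_zero]
    · change s ⊔ (r (x, unitInterval.symm 0)).1.2 = (r (x, 1)).1.2
      rw [unitInterval.symm_zero]
      obtain h | h := h
      · exact sup_eq_right.2 (le_trans h.le unitInterval.nonneg')
      · change x = X.pt at h
        rw [h, hrpt]
        exact sup_eq_right.2 unitInterval.le_one'
  · rintro ⟨⟨x, s⟩, h⟩
    refine Subtype.ext (Prod.ext ?_ ?_)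
    · change (r (x, unitInterval.symm 1)).1.1 = x
      rw [unitInterval.symm_one, hr0]
      rfl
    · change s ⊔ (r (x, unitInterval.symm 1)).1.2 = s
      rw [unitInterval.symm_one, hr0]
      exact sup_eq_left.2 unitInterval.nonneg'
  · rintro t _ rfl
    exact (Whisker.eq_pt_iff _).2 (sup_eq_left.2 unitInterval.le_one')
  · intro x
    change (r (x, unitInterval.symm 0)).1.1 = (r (x, 1)).1.1
    rw [unitInterval.symm_zero]
  · intro x
    change (r (x, unitInterval.symm 1)).1.1 = x
    rw [unitInterval.symm_one, hr0]
    rfl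
  · rintro t _ rfl
    change (r (X.pt, unitInterval.symm t)).1.1 = X.pt
    rw [hrpt]
    rfl

/-- Attaching whiskers does not change the pointed homotopy type of well-pointed spaces, nor that of
their wedge, and makes the base points good. -/
theorem formal_wedge {X Y : PtdTop.{u}} (hX : X.WellPointed) (hY : Y.WellPointed)
    (fX : RightOmegaModule.Formal X.smashChains) (fY : RightOmegaModule.Formal Y.smashChains) :
    RightOmegaModule.Formal (wedge X Y).smashChains := by
  have eX := hX.pairHomotopyEquiv_whiskerProj
  have eY := hY.pairHomotopyEquiv_whiskerProj
  have h := formal_wedge_of_goodPair X.goodPair_whisker Y.goodPair_whisker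
    ((formal_iff_of_pairHomotopyEquiv _ eX).2 fX) ((formal_iff_of_pairHomotopyEquiv _ eY).2 fY)
  rw [wedge_eq] at h ⊢
  exact (formal_iff_of_pairHomotopyEquiv _ (eX.sum eY).collapse).1 h

end PtdTop

end

/-! ### The singular simplices of the interval -/

section

open Limits HomologicalComplex Opposite Simplicial TensorProduct

open TopCat

namespace interval

theorem map_const {n m : ℕ} (c : Fin m) (p : stdSimplex ℝ (Fin (n + 1))) :
    stdSimplex.map (fun _ => c) p = stdSimplex.vertex c := by
  have h := stdSimplex.map_comp_apply (fun _ : Fin (n + 1) => (0 : Fin 1)) (fun _ : Fin 1 => c) p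
  rw [Subsingleton.elim (stdSimplex.map (fun _ : Fin (n + 1) => (0 : Fin 1)) p) (stdSimplex.vertex 0),
    stdSimplex.map_vertex] at h
  exact h.symm

/-- The affine simplex of the unit interval given by a simplex of `Δ[1]`. -/
noncomputable def edge {n : SimplexCategoryᵒᵖ} (θ : n.unop ⟶ ⦋1⦌) :
    (toSSet.obj (TopCat.of unitInterval)).obj n :=
  simplexMk n ⟨fun p => stdSimplexHomeomorphUnitInterval (stdSimplex.map θ.toOrderHom p),
    stdSimplexHomeomorphUnitInterval.continuous.comp (stdSimplex.continuous_map _)⟩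

theorem simplexEval_edge {n : SimplexCategoryᵒᵖ} (θ : n.unop ⟶ ⦋1⦌)
    (p : stdSimplex ℝ (Fin (n.unop.len + 1))) : simplexEval (edge θ) p =
      stdSimplexHomeomorphUnitInterval (stdSimplex.map θ.toOrderHom p) := simplexEval_mk _ _

theorem map_edge {n m : SimplexCategoryᵒᵖ} (f : n ⟶ m) (θ : n.unop ⟶ ⦋1⦌) :
    edge (f.unop ≫ θ) = (toSSet.obj (TopCat.of unitInterval)).map f (edge θ) := by
  refine simplex_ext fun p => ?_
  rw [simplexEval_edge, simplexEval_level, simplexEval_edge, stdSimplex.map_comp_apply]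
  rfl

/-- The ends of the unit interval. -/
noncomputable def endpoint (c : Fin 2) : unitInterval :=
  stdSimplexHomeomorphUnitInterval (stdSimplex.vertex c)

theorem endpoint_injective : Function.Injective endpoint := fun _ _ h =>
  stdSimplex.vertex_injective (S := ℝ) (stdSimplexHomeomorphUnitInterval.injective h)

theorem endpoint_mem (c : Fin 2) : endpoint c ∈ ({0, 1} : Set unitInterval) := by
  fin_cases c
  · exact Or.inl stdSimplexHomeomorphUnitInterval_zero
  · exact Or.inr stdSimplexHomeomorphUnitInterval_one

theorem simplexEval_edge_vertex {n : SimplexCategoryᵒᵖ} (θ : n.unop ⟶ ⦋1⦌)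
    (i : Fin (n.unop.len + 1)) :
    simplexEval (edge θ) (stdSimplex.vertex i) = endpoint (θ.toOrderHom i) := by
  rw [simplexEval_edge, stdSimplex.map_vertex]
  rfl

theorem edge_injective {n : SimplexCategoryᵒᵖ} :
    Function.Injective (edge : (n.unop ⟶ ⦋1⦌) → _) := fun θ θ' h => by
  ext i : 3
  refine endpoint_injective ?_
  rw [← simplexEval_edge_vertex, ← simplexEval_edge_vertex, h]

theorem simplexEval_edge_of_const {n : SimplexCategoryᵒᵖ} {θ : n.unop ⟶ ⦋1⦌} {c : Fin 2}
    (h : ∀ i, θ.toOrderHom i = c) (p : stdSimplex ℝ (Fin (n.unop.len + 1))) :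
    simplexEval (edge θ) p = endpoint c := by
  have : (θ.toOrderHom : Fin (n.unop.len + 1) → Fin 2) = fun _ => c := funext h
  rw [simplexEval_edge, endpoint]
  refine congr_arg _ ?_
  exact (congr_arg (fun f => stdSimplex.map f p) this).trans (map_const c p)

/-- A singular simplex in the boundary of the interval is constant. -/
theorem exists_eq_endpoint {n : SimplexCategoryᵒᵖ}
    (σ : (toSSet.obj (TopCat.of unitInterval)).obj n)
    (h : ∀ p, simplexEval σ p ∈ ({0, 1} : Set unitInterval)) :
    ∃ c, ∀ p, simplexEval σ p = endpoint c := by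
  by_cases h0 : ∀ p, simplexEval σ p = (0 : unitInterval)
  · exact ⟨0, h0⟩
  by_cases h1 : ∀ p, simplexEval σ p = (1 : unitInterval)
  · exact ⟨1, h1⟩
  push Not at h0 h1
  obtain ⟨p, hp⟩ := h0
  obtain ⟨q, hq⟩ := h1
  have : PreconnectedSpace (stdSimplex ℝ (Fin (n.unop.len + 1))) :=
    Subtype.preconnectedSpace (convex_stdSimplex ℝ _).isPreconnected
  let f : stdSimplex ℝ (Fin (n.unop.len + 1)) → ℝ := fun p => (simplexEval σ p : unitInterval)
  have hf : Continuous f := continuous_subtype_val.comp (continuous_simplexEval σ)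
  have hfp : f p = 1 := congr_arg Subtype.val ((h p).resolve_left hp)
  have hfq : f q = 0 := congr_arg Subtype.val ((h q).resolve_right hq)
  obtain ⟨r, hr⟩ := mem_range_of_exists_le_of_exists_ge (c := 1 / 2) hf
    ⟨q, by rw [hfq]; norm_num⟩ ⟨p, by rw [hfp]; norm_num⟩
  obtain e | e := h r
  · have : f r = 0 := congr_arg Subtype.val e
    rw [hr] at this
    norm_num at this
  · have : f r = 1 := congr_arg Subtype.val e
    rw [hr] at this
    norm_num at this

theorem exists_edge {n : SimplexCategoryᵒᵖ} (σ : (toSSet.obj (TopCat.of unitInterval)).obj n)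
    (h : ∀ p, simplexEval σ p ∈ ({0, 1} : Set unitInterval)) : ∃ θ, edge θ = σ := by
  obtain ⟨c, hc⟩ := exists_eq_endpoint σ h
  exact ⟨SimplexCategory.mkHom ⟨fun _ => c, fun _ _ _ => le_rfl⟩,
    simplex_ext fun p => (simplexEval_edge_of_const (fun _ => rfl) p).trans (hc p).symm⟩

/-- The singular simplices of the interval, relative to the affine simplices. -/
noncomputable def modEdges : SPair.{0} :=
  SPair.ofSubcomplex (toSSet.obj (TopCat.of unitInterval))
    { obj := fun n => {σ | ∃ θ : n.unop ⟶ ⦋1⦌, edge θ = σ}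
      map := by
        rintro n m f _ ⟨θ, rfl⟩
        exact ⟨f.unop ≫ θ, map_edge f θ⟩ }

/-- The inclusion of the affine simplices, relative to the boundary. -/
noncomputable def toSing : interval.{0} ⟶ sing (TopCat.of unitInterval) {{0, 1}} where
  app n := PairType.Hom.mk (P := interval.obj n)
    (Q := (sing (TopCat.of unitInterval) {{0, 1}}).obj n)
    (fun x => edge (SSet.stdSimplex.objEquiv x)) (fun x hx => ⟨_, rfl, fun p =>
      Set.mem_of_eq_of_mem (simplexEval_edge_of_const (c := _) (fun i => hx i 0) p)
        (endpoint_mem _)⟩)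
  naturality n m f := by
    ext x
    exact map_edge f (SSet.stdSimplex.objEquiv x)

/-- The inclusion of the affine simplices, relative to the initial vertex. -/
noncomputable def conesToSing : SPair.cones (fun _ : PUnit.{1} => 1) ⟶
    sing (TopCat.of unitInterval) {{0}} where
  app n := PairType.Hom.mk (P := (SPair.cones (fun _ : PUnit.{1} => 1)).obj n)
    (Q := (sing (TopCat.of unitInterval) {{0}}).obj n)
    (fun x => edge x.2) (fun x hx => ⟨_, rfl, fun p => simplexEval_edge_of_const hx p⟩)
  naturality n m f := by
    ext x
    exact map_edge f x.2

theorem acyclic_sing_zero : RatChain.Acyclic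
    (chains.obj (SPair.free.obj (sing (TopCat.of unitInterval) {{0}}))) := by
  have h : Subordinate {{0}} {Set.univ} (𝟙 (TopCat.of unitInterval)) :=
    Subordinate.singleton fun _ _ => trivial
  refine RatChain.Acyclic.of_quasiIso _ (weakEquiv_singMap_of_deformation h
    ⟨fun x => unitInterval.symm x.1 * x.2, by fun_prop⟩ (fun z => ?_) ?_ ?_ ?_)
    (SPair.acyclic_of_sub_eq fun n σ => ⟨_, rfl, fun p => trivial⟩)
  · change unitInterval.symm 0 * z = z
    rw [unitInterval.symm_zero, one_mul]
  · rintro _ rfl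
    refine ⟨_, rfl, ?_⟩
    rintro t _ rfl
    exact mul_zero (unitInterval.symm t)
  · rintro _ rfl
    exact ⟨_, rfl, fun _ _ _ => trivial⟩
  · refine Subordinate.singleton fun z _ => ?_
    change unitInterval.symm 1 * z = 0
    rw [unitInterval.symm_one, zero_mul]

/-- Edges modulo the vertex `0` and simplices modulo the vertex `0` are both acyclic, the former by
combinatorial contraction and the latter since the interval is contractible; hence so is the quotient. -/
theorem acyclic_modEdges : RatChain.Acyclic (chains.obj (SPair.free.obj modEdges)) := by
  let g : sing (TopCat.of unitInterval) {{0}} ⟶ modEdges :=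
    SPair.ofSubcomplexMap (𝟙 _) fun n σ ⟨_, e, h⟩ => exists_edge σ fun p => Or.inl (by
      subst e
      exact h p)
  have h := (SPair.isShortExact_triple conesToSing g ?_ ?_
    (fun n => ⟨fun _ _ e => e, fun y => ⟨y, rfl⟩⟩) ?_).chains
  · intro n
    cases n with
    | zero => exact h.acyclicAt_zero (acyclic_sing_zero 0)
    | succ n => exact h.acyclicAt_succ (acyclic_sing_zero _) (SMod.acyclic_cones _ n)
  · rintro n ⟨⟨⟩, x⟩ ⟨⟨⟩, y⟩ e
    exact congr_arg _ (edge_injective e)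
  · rintro n ⟨⟨⟩, x⟩ ⟨_, rfl, h⟩ i
    exact endpoint_injective ((simplexEval_edge_vertex x i).symm.trans (h _))
  · intro n σ
    constructor
    · rintro ⟨θ, rfl⟩
      exact Or.inr ⟨⟨PUnit.unit, θ⟩, rfl⟩
    · rintro (⟨_, rfl, h⟩ | ⟨x, rfl⟩)
      · exact exists_edge σ fun p => Or.inl (h p)
      · exact ⟨_, rfl⟩

/-- The affine simplices with vertices in `{0, 1}` compute the singular chains of the interval relative
to its endpoints, the quotient being acyclic. -/
theorem weakEquiv_toSing : SPair.WeakEquiv toSing := by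
  let g : sing (TopCat.of unitInterval) {{0, 1}} ⟶ modEdges :=
    SPair.ofSubcomplexMap (𝟙 _) fun n σ ⟨_, e, h⟩ => exists_edge σ fun p => by
      subst e
      exact h p
  refine (SPair.isShortExact_triple toSing g ?_ ?_
    (fun n => ⟨fun _ _ e => e, fun y => ⟨y, rfl⟩⟩) ?_).chains.quasiIso_left acyclic_modEdges
  · intro n x y e
    exact SSet.stdSimplex.objEquiv.injective (edge_injective e)
  · rintro n x ⟨_, rfl, h⟩ i j
    obtain ⟨c, hc⟩ := exists_eq_endpoint _ h
    refine endpoint_injective ?_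
    exact (simplexEval_edge_vertex _ i).symm.trans ((hc _).trans ((hc _).symm.trans
      (simplexEval_edge_vertex _ j)))
  · intro n σ
    constructor
    · rintro ⟨θ, rfl⟩
      exact Or.inr ⟨SSet.stdSimplex.objEquiv.symm θ,
        congr_arg edge (Equiv.apply_symm_apply _ _)⟩
    · rintro (⟨_, rfl, h⟩ | ⟨x, rfl⟩)
      · exact exists_edge σ h
      · exact ⟨_, rfl⟩

end interval

end

/-! ### Cubes and wedges of families -/

section

open Limits HomologicalComplex Opposite Simplicial TensorProduct

open TopCat

theorem goodPair_unitInterval : GoodPair unitInterval {0, 1} := by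
  -- the deformation stretches the interval by the factor `1 + t` about its midpoint
  let d : unitInterval × unitInterval → ℝ := fun x => 1 / 2 + (x.2 - 1 / 2) * (1 + x.1)
  have hd : Continuous d := by fun_prop
  let D : C(unitInterval × unitInterval, unitInterval) :=
    ⟨fun x => Set.projIcc 0 1 zero_le_one (d x), continuous_projIcc.comp hd⟩
  have hend : ∀ t, ∀ z ∈ ({0, 1} : Set unitInterval), D (t, z) = z := by
    rintro t z (rfl | rfl)
    · refine Set.projIcc_of_le_left (zero_le_one' ℝ) ?_
      change 1 / 2 + (0 - 1 / 2) * (1 + (t : ℝ)) ≤ 0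
      linarith [t.2.1]
    · refine Set.projIcc_of_right_le (zero_le_one' ℝ) ?_
      change 1 ≤ 1 / 2 + (1 - 1 / 2) * (1 + (t : ℝ))
      linarith [t.2.1]
  refine ⟨(Set.toFinite _).isClosed, (fun z : unitInterval => (z : ℝ)) ⁻¹' (Set.Iio (1 / 4) ∪
    Set.Ioi (3 / 4)), (isOpen_Iio.union isOpen_Ioi).preimage continuous_subtype_val, ?_, D, ?_,
    fun t z hz => (hend t z hz).symm ▸ hz, ?_, ?_⟩
  · rintro _ (rfl | rfl)
    · left
      change (0 : ℝ) < 1 / 4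
      norm_num
    · right
      change (3 / 4 : ℝ) < 1
      norm_num
  · intro z
    change Set.projIcc 0 1 zero_le_one (1 / 2 + ((z : ℝ) - 1 / 2) * (1 + 0)) = z
    convert Set.projIcc_val (zero_le_one' ℝ) z using 2
    ring
  · rintro t z (hz | hz)
    · left
      change (z : ℝ) < 1 / 4 at hz
      change max 0 (min 1 (1 / 2 + ((z : ℝ) - 1 / 2) * (1 + t))) < 1 / 4
      refine max_lt (by norm_num) (min_lt_of_right_lt ?_)
      nlinarith [t.2.1]
    · right
      change 3 / 4 < (z : ℝ) at hz
      change 3 / 4 < max 0 (min 1 (1 / 2 + ((z : ℝ) - 1 / 2) * (1 + t)))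
      refine lt_max_of_lt_right (lt_min (by norm_num) ?_)
      nlinarith [t.2.1]
  · rintro z (hz | hz)
    · left
      change (z : ℝ) < 1 / 4 at hz
      refine Set.projIcc_of_le_left (zero_le_one' ℝ) ?_
      change 1 / 2 + ((z : ℝ) - 1 / 2) * (1 + 1) ≤ 0
      linarith
    · right
      change 3 / 4 < (z : ℝ) at hz
      refine Set.projIcc_of_right_le (zero_le_one' ℝ) ?_
      change 1 ≤ 1 / 2 + ((z : ℝ) - 1 / 2) * (1 + 1)
      linarith

theorem GoodPair.of_homeomorph {Z W : Type u} [TopologicalSpace Z] [TopologicalSpace W] (e : Z ≃ₜ W)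
    {S : Set Z} {T : Set W} (h : ∀ z, e z ∈ T ↔ z ∈ S) (hS : GoodPair Z S) : GoodPair W T := by
  obtain ⟨hc, O, hO, hSO, D, hD0, hDS, hDO, hD1⟩ := hS
  have hT : ∀ w, w ∈ T ↔ e.symm w ∈ S := fun w => by rw [← h, e.apply_symm_apply]
  have hT' : T = e.symm ⁻¹' S := Set.ext hT
  refine ⟨hT' ▸ hc.preimage e.symm.continuous, e.symm ⁻¹' O, hO.preimage e.symm.continuous,
    fun w hw => hSO ((hT w).1 hw), ⟨fun x => e (D (x.1, e.symm x.2)), by fun_prop⟩, fun w => ?_,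
    fun t w hw => (h _).2 (hDS t _ ((hT w).1 hw)), fun t w hw => ?_,
    fun w hw => (h _).2 (hD1 _ hw)⟩
  · change e (D (0, e.symm w)) = w
    rw [hD0, e.apply_symm_apply]
  · change e.symm (e (D (t, e.symm w))) ∈ O
    rw [e.symm_apply_apply]
    exact hDO t _ hw

theorem GoodPair.sigma {ι : Type u} {Z : ι → Type u} [∀ i, TopologicalSpace (Z i)]
    {S : ∀ i, Set (Z i)} (hS : ∀ i, GoodPair (Z i) (S i)) :
    GoodPair (Σ i, Z i) {z | z.2 ∈ S z.1} := by
  choose hc O hO hSO D hD0 hDS hDO hD1 using hS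
  refine ⟨isClosed_sigma_iff.2 hc, {z | z.2 ∈ O z.1}, isOpen_sigma_iff.2 hO,
    fun z hz => hSO z.1 hz, ⟨fun x => ⟨x.2.1, D x.2.1 (x.1, x.2.2)⟩, ?_⟩,
    fun z => Sigma.ext rfl (heq_of_eq (hD0 _ _)), fun t z hz => hDS _ t _ hz,
    fun t z hz => hDO _ t _ hz, fun z hz => hD1 _ _ hz⟩
  have : Continuous fun x : (Σ i, Z i × unitInterval) =>
      (⟨x.1, D x.1 (x.2.2, x.2.1)⟩ : Σ i, Z i) :=
    continuous_sigma fun i => continuous_sigmaMk.comp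
      ((D i).continuous.comp continuous_swap)
  exact this.comp (Homeomorph.sigmaProdDistrib.continuous.comp continuous_swap)

theorem weakEquiv_singMap_of_homeomorph {Z W : TopCat.{u}} (e : Z ⟶ W) (he : IsHomeomorph e)
    {S : Set Z} {T : Set W} (h : ∀ z, e z ∈ T ↔ z ∈ S) (hs : Subordinate {S} {T} e) :
    SPair.WeakEquiv (singMap e hs) := by
  refine SPair.WeakEquiv.of_bijOn _ fun n => ⟨?_, ?_, ?_⟩
  · rintro σ hσ ⟨_, rfl, h'⟩
    exact hσ ⟨_, rfl, fun p => (h _).1 (h' p)⟩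
  · intro σ _ τ _ h'
    exact simplex_ext fun p => he.injective (congr_arg (fun ρ => simplexEval ρ p) h')
  · intro σ hσ
    obtain ⟨τ, rfl⟩ := exists_simplex_lift he.isEmbedding σ fun p => he.surjective _
    refine ⟨τ, ?_, rfl⟩
    rintro ⟨_, rfl, h'⟩
    exact hσ ⟨_, rfl, fun p => (h _).2 (h' p)⟩

namespace RightOmegaModule

theorem Formal.comp_functor {M : RightOmegaModule.{u}} (hM : Formal M) (F : FinSurj ⥤ FinSurj) :
    Formal (F.op ⋙ M) := by
  have : ∀ N P : RightOmegaModule.{u}, Relation.EqvGen HasQuasiIso N P →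
      Relation.EqvGen HasQuasiIso (F.op ⋙ N) (F.op ⋙ P) := fun N P h => by
    induction h with
    | rel _ _ h => exact .rel _ _ (h.comp_functor F)
    | refl => exact .refl _
    | symm _ _ _ ih => exact ih.symm
    | trans _ _ _ _ _ ih ih' => exact ih.trans _ _ _ ih'
  exact this _ _ hM

end RightOmegaModule

/-- The product of finite sets with a fixed finite set. -/
def FinSurj.prodRight (B : Type) [Finite B] : FinSurj ⥤ FinSurj where
  obj A := haveI := A.finite; ⟨A.carrier × B⟩
  map f := ⟨Prod.map f.1 id, f.2.prodMap Function.surjective_id⟩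

namespace SPair

/-- Currying, as a map from the powers of `S` to the powers of a power of `S`. -/
def curryPow (S : SPair.{u}) (A B : Type) :
    S ⋙ PairType.pow (A × B) ⟶ (S ⋙ PairType.pow B) ⋙ PairType.pow A where
  app n := PairType.Hom.mk (P := (PairType.pow (A × B)).obj (S.obj n))
    (Q := (PairType.pow A).obj ((PairType.pow B).obj (S.obj n)))
    (fun x a b => x (a, b)) (fun x ⟨⟨a, b⟩, h⟩ => ⟨a, b, h⟩)

theorem weakEquiv_curryPow (S : SPair.{u}) (A B : Type) : WeakEquiv (curryPow S A B) := by
  refine WeakEquiv.of_bijOn _ fun n => ⟨?_, ?_, ?_⟩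
  · rintro x hx ⟨a, b, h⟩
    exact hx ⟨(a, b), h⟩
  · intro x _ y _ h
    exact funext fun ⟨a, b⟩ => congr_fun (congr_fun h a) b
  · intro y hy
    exact ⟨fun ab => y ab.1 ab.2, fun ⟨⟨a, b⟩, h⟩ => hy ⟨a, b, h⟩, rfl⟩

/-- The `A`-th power of `S ^ B` is the `A × B`-th power of `S`, so that the powers of `S ^ B` are the
restriction of the powers of `S` along the functor `A ↦ A × B`, and restriction preserves formality. -/
theorem IsFormal.pow {S : SPair.{u}} (hS : IsFormal S) (B : Type) [Finite B] :
    IsFormal (S ⋙ PairType.pow B) := by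
  let f : (FinSurj.prodRight B).op ⋙ S.tensorPowers ⟶ SPair.tensorPowers (S ⋙ PairType.pow B) :=
    { app := fun A => SPair.free.map (curryPow S A.unop.carrier B)
      naturality := fun A A' g => by
        refine NatTrans.ext (funext fun n => ?_)
        refine (PairType.free.map_comp _ _).symm.trans (Eq.trans ?_ (PairType.free.map_comp _ _))
        rfl }
  exact RightOmegaModule.Formal.of_hasQuasiIso
    (RightOmegaModule.Formal.comp_functor hS (FinSurj.prodRight B))
    ⟨Functor.whiskerRight f chains, fun A => weakEquiv_curryPow S A.unop.carrier B⟩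

end SPair

namespace PtdTop

/-- The cube of dimension `m` modulo its boundary. -/
def cube (m : ℕ) : PtdTop.{0} := collapse (Fin m → unitInterval) (fat {0, 1} (Fin m))

/-- The cube modulo its boundary is the `m`-th smash power of the interval modulo its endpoints. -/
theorem isFormal_cube (m : ℕ) : SPair.IsFormal (singPt.obj (cube m)) := by
  have h : SPair.IsFormal (sing (TopCat.of unitInterval) {{0, 1}}) :=
    interval.weakEquiv_toSing.isFormal_iff.1 interval.formal
  exact (weakEquiv_singPowCollapse (Z := TopCat.of unitInterval) goodPair_unitInterval
    (Fin m)).isFormal_iff.1 (h.pow (Fin m))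

theorem goodPair_cube (m : ℕ) : GoodPair (cube m).space {(cube m).pt} :=
  (goodPair_collapse_and_weakEquiv (goodPair_unitInterval.fat (Fin m))).1

/-- Formality of finite disjoint unions, by splitting off the first summand. -/
theorem isFormal_sigma {r : ℕ} (X : Fin (r + 1) → PtdTop.{0})
    (h : ∀ i, SPair.IsFormal (singPt.obj (X i))) :
    SPair.IsFormal (sing (TopCat.of (Σ i, (X i).space)) {{z | z.2 = (X z.1).pt}}) := by
  induction r with
  | zero =>
    let e : (X 0).space ⟶ TopCat.of (Σ i, (X i).space) :=
      TopCat.ofHom (ContinuousMap.sigmaMk (X := fun i => (X i).space) 0)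
    refine (weakEquiv_singMap_of_homeomorph (S := {(X 0).pt}) e ?_ (fun z => Iff.rfl)
      (Subordinate.singleton fun z hz => hz)).isFormal_iff.1 (h 0)
    refine ⟨continuous_sigmaMk, isOpenMap_sigmaMk,
      sigma_mk_injective, ?_⟩
    rintro ⟨i, x⟩
    obtain rfl : i = 0 := Fin.ext (by lia)
    exact ⟨x, rfl⟩
  | succ r ih =>
    let e : (X 0).space ⟶ TopCat.of (Σ i, (X i).space) :=
      TopCat.ofHom (ContinuousMap.sigmaMk (X := fun i => (X i).space) 0)
    let e' : TopCat.of (Σ i : Fin (r + 1), (X i.succ).space) ⟶ TopCat.of (Σ i, (X i).space) :=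
      TopCat.ofHom ⟨fun z => ⟨z.1.succ, z.2⟩, continuous_sigma fun i =>
        (ContinuousMap.sigmaMk (X := fun i => (X i).space) i.succ).continuous⟩
    have he' : Topology.IsOpenEmbedding e' := by
      refine .of_continuous_injective_isOpenMap e'.hom.continuous ?_
        (isOpenMap_sigma.2 fun i => isOpenMap_sigmaMk (σ := fun i => (X i).space) (i := i.succ))
      rintro ⟨i, x⟩ ⟨j, y⟩ h
      obtain ⟨h1, h2⟩ := Sigma.mk.inj h
      obtain rfl := Fin.succ_injective _ h1
      obtain rfl := eq_of_heq h2
      rfl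
    have hc : Set.range e' = (Set.range e)ᶜ := by
      refine Set.ext fun ⟨k, x⟩ => ?_
      induction k using Fin.cases with
      | zero =>
        refine ⟨?_, fun h => absurd ⟨x, rfl⟩ h⟩
        rintro ⟨z, hz⟩
        exact absurd (Sigma.mk.inj hz).1 (Fin.succ_ne_zero _)
      | succ k =>
        refine ⟨?_, fun _ => ⟨⟨k, x⟩, rfl⟩⟩
        rintro - ⟨z, hz⟩
        exact absurd (Sigma.mk.inj hz).1.symm (Fin.succ_ne_zero _)
    exact SPair.isFormal_of_isCompl (i := e) (j := e') (S₁ := {(X 0).pt})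
      (S₂ := {z | z.2 = (X z.1.succ).pt}) Topology.IsOpenEmbedding.sigmaMk he'
      (hc ▸ isCompl_compl) rfl rfl (h 0) (ih (fun i => X i.succ) fun i => h i.succ)

theorem bigWedge_eq {ι : Type u} (X : ι → PtdTop.{u}) :
    bigWedge X = collapse (Σ i, (X i).space) {z | z.2 = (X z.1).pt} := by
  have : (Set.range fun i => (⟨i, (X i).pt⟩ : Σ i, (X i).space)) = {z | z.2 = (X z.1).pt} := by
    ext ⟨i, x⟩
    constructor
    · rintro ⟨j, h⟩
      obtain ⟨h1, h2⟩ := Sigma.mk.inj h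
      subst h1
      exact (eq_of_heq h2).symm
    · intro h
      exact ⟨i, Sigma.ext rfl (heq_of_eq h.symm)⟩
  rw [bigWedge, this]

theorem formal_bigWedge {r : ℕ} (X : Fin (r + 1) → PtdTop.{0})
    (hX : ∀ i, GoodPair (X i).space {(X i).pt}) (h : ∀ i, SPair.IsFormal (singPt.obj (X i))) :
    RightOmegaModule.Formal (bigWedge X).smashChains := by
  rw [bigWedge_eq]
  refine (isFormal_collapse_iff (Z := TopCat.of (Σ i, (X i).space)) ?_).2 (isFormal_sigma X h)
  exact GoodPair.sigma hX

end PtdTop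

end

/-! ### Spheres -/

section

open Limits HomologicalComplex Opposite Simplicial TensorProduct

open TopCat

namespace PtdTop

/-- The coordinates in `[-1, 1] ^ m` of a point of the unit cube. -/
def coords {m : ℕ} (z : Fin m → unitInterval) : Fin m → ℝ := fun i => 2 * (z i : ℝ) - 1

theorem continuous_coords {m : ℕ} : Continuous (coords : (Fin m → unitInterval) → _) := by
  unfold coords
  fun_prop

theorem norm_coords_le {m : ℕ} (z : Fin m → unitInterval) : ‖coords z‖ ≤ 1 :=
  (pi_norm_le_iff_of_nonneg zero_le_one).2 fun i => abs_le.2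
    ⟨by unfold coords; linarith [(z i).2.1], by unfold coords; linarith [(z i).2.2]⟩

theorem norm_coords_eq_one_iff {m : ℕ} (z : Fin m → unitInterval) :
    ‖coords z‖ = 1 ↔ z ∈ fat {0, 1} (Fin m) := by
  have key : ∀ i, |coords z i| = 1 ↔ z i ∈ ({0, 1} : Set unitInterval) := fun i => by
    rw [abs_eq zero_le_one, or_comm]
    refine or_congr ?_ ?_
    · refine Iff.trans ?_ (Subtype.ext_iff (a2 := (0 : unitInterval))).symm
      change 2 * (z i : ℝ) - 1 = -1 ↔ (z i : ℝ) = 0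
      constructor <;> intro h <;> linarith
    · refine Iff.trans ?_ (Subtype.ext_iff (a2 := (1 : unitInterval))).symm
      change 2 * (z i : ℝ) - 1 = 1 ↔ (z i : ℝ) = 1
      constructor <;> intro h <;> linarith
  constructor
  · intro h
    by_contra hz
    refine absurd h (ne_of_lt ((pi_norm_lt_iff zero_lt_one).2 fun i => ?_))
    exact lt_of_le_of_ne ((norm_le_pi_norm _ i).trans (norm_coords_le z)) fun e =>
      hz ⟨i, (key i).1 e⟩
  · rintro ⟨i, hi⟩
    exact le_antisymm (norm_coords_le z) (((key i).2 hi).symm.le.trans (norm_le_pi_norm (coords z) i))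

/-- The sum of the squares of the coordinates and of the distance to the boundary of the cube. -/
noncomputable def sqSum {m : ℕ} (z : Fin m → unitInterval) : ℝ :=
  ∑ i, coords z i ^ 2 + (1 - ‖coords z‖) ^ 2

theorem sqSum_pos {m : ℕ} (z : Fin m → unitInterval) : 0 < sqSum z := by
  have h : 0 ≤ ∑ i, coords z i ^ 2 := Finset.sum_nonneg fun i _ => sq_nonneg _
  unfold sqSum
  by_cases h1 : ‖coords z‖ = 1
  · refine add_pos_of_pos_of_nonneg (lt_of_le_of_ne h fun e => ?_) (sq_nonneg _)
    have h2 : coords z = 0 := funext fun i => by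
      have := (Finset.sum_eq_zero_iff_of_nonneg fun i _ => sq_nonneg _).1 e.symm i (Finset.mem_univ i)
      exact pow_eq_zero_iff two_ne_zero |>.1 this
    rw [h2, norm_zero] at h1
    exact zero_ne_one h1
  · exact add_pos_of_nonneg_of_pos h (pow_pos (lt_of_le_of_ne (sub_nonneg.2 (norm_coords_le z))
      fun e => h1 (by linarith)) 2)

/-- The map from the cube to the sphere which sends the boundary to the base point. It is the
composite of `x ↦ x / (1 - ‖x‖)` and of the inverse of the stereographic projection. -/
noncomputable def cubeToSphereFun {m : ℕ} (z : Fin m → unitInterval) : Fin (m + 1) → ℝ :=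
  Fin.cons (1 - 2 * (1 - ‖coords z‖) ^ 2 / sqSum z)
    fun i => 2 * (1 - ‖coords z‖) * coords z i / sqSum z

theorem cubeToSphereFun_mem {m : ℕ} (z : Fin m → unitInterval) :
    WithLp.toLp 2 (cubeToSphereFun z) ∈
      Metric.sphere (0 : EuclideanSpace ℝ (Fin (m + 1))) 1 := by
  have hN := (sqSum_pos z).ne'
  rw [mem_sphere_zero_iff_norm, EuclideanSpace.norm_eq, Real.sqrt_eq_one, Fin.sum_univ_succ]
  simp only [cubeToSphereFun, Fin.cons_zero, Fin.cons_succ, Real.norm_eq_abs, sq_abs]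
  have : ∑ i, (2 * (1 - ‖coords z‖) * coords z i / sqSum z) ^ 2 =
      (2 * (1 - ‖coords z‖) / sqSum z) ^ 2 * (sqSum z - (1 - ‖coords z‖) ^ 2) := by
    rw [sqSum, add_sub_cancel_right, Finset.mul_sum]
    exact Finset.sum_congr rfl fun i _ => by ring
  rw [this]
  field_simp
  ring

theorem continuous_cubeToSphereFun {m : ℕ} :
    Continuous (cubeToSphereFun : (Fin m → unitInterval) → _) := by
  have hc := continuous_coords (m := m)
  have hs : Continuous (sqSum : (Fin m → unitInterval) → ℝ) := by
    unfold sqSum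
    fun_prop
  refine continuous_pi fun i => ?_
  induction i using Fin.cases with
  | zero =>
    simp only [cubeToSphereFun, Fin.cons_zero]
    exact continuous_const.sub (Continuous.div (by fun_prop) hs fun z => (sqSum_pos z).ne')
  | succ i =>
    simp only [cubeToSphereFun, Fin.cons_succ]
    exact Continuous.div (by fun_prop) hs fun z => (sqSum_pos z).ne'

/-- The map from the cube to the sphere. -/
noncomputable def cubeToSphere (m : ℕ) : C(Fin m → unitInterval, (sphere m).space) :=
  ⟨fun z => ⟨WithLp.toLp 2 (cubeToSphereFun z), cubeToSphereFun_mem z⟩,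
    Continuous.subtype_mk ((PiLp.continuous_toLp 2 _).comp continuous_cubeToSphereFun) _⟩

theorem cubeToSphere_eq_iff {m : ℕ} (z : Fin m → unitInterval) (w : (sphere m).space) :
    cubeToSphere m z = w ↔ 1 - 2 * (1 - ‖coords z‖) ^ 2 / sqSum z = w.1 0 ∧
      ∀ i : Fin m, 2 * (1 - ‖coords z‖) * coords z i / sqSum z = w.1 i.succ := by
  constructor
  · rintro rfl
    exact ⟨rfl, fun _ => rfl⟩
  · rintro ⟨h0, h⟩
    refine Subtype.ext (PiLp.ext fun i => ?_)
    induction i using Fin.cases with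
    | zero => exact h0
    | succ i => exact h i

theorem cubeToSphere_eq_pt_iff {m : ℕ} (z : Fin m → unitInterval) :
    cubeToSphere m z = (sphere m).pt ↔ z ∈ fat {0, 1} (Fin m) := by
  have hN := (sqSum_pos z).ne'
  rw [cubeToSphere_eq_iff, ← norm_coords_eq_one_iff]
  have e0 : (sphere m).pt.1 0 = 1 := by simp [sphere]
  have e1 : ∀ i : Fin m, (sphere m).pt.1 i.succ = 0 := fun i => by simp [sphere]
  rw [e0]
  constructor
  · rintro ⟨h, -⟩
    have h2 : 2 * (1 - ‖coords z‖) ^ 2 / sqSum z = 0 := by linarith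
    rw [div_eq_zero_iff, or_iff_left hN] at h2
    have h3 : 1 - ‖coords z‖ = 0 := by
      have : (1 - ‖coords z‖) ^ 2 = 0 := by linarith
      exact pow_eq_zero_iff two_ne_zero |>.1 this
    linarith
  · intro h
    refine ⟨by rw [h]; norm_num, fun i => ?_⟩
    rw [e1, h]
    norm_num

theorem cubeToSphere_injOn (m : ℕ) : Set.InjOn (cubeToSphere m) (fat {0, 1} (Fin m))ᶜ := by
  intro z hz z' hz' h
  have pos : ∀ z : Fin m → unitInterval, z ∈ (fat {0, 1} (Fin m))ᶜ → 0 < 1 - ‖coords z‖ := fun z hz =>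
    sub_pos.2 (lt_of_le_of_ne (norm_coords_le z) fun e => hz ((norm_coords_eq_one_iff z).1 e))
  have p := pos z hz
  have p' := pos z' hz'
  have N := sqSum_pos z
  have N' := sqSum_pos z'
  obtain ⟨h0, h1⟩ := (cubeToSphere_eq_iff z _).1 h
  obtain ⟨h0', h1'⟩ := (cubeToSphere_eq_iff z' _).1 rfl
  rw [← h0'] at h0
  have e0 : (1 - ‖coords z‖) ^ 2 / sqSum z = (1 - ‖coords z'‖) ^ 2 / sqSum z' := by
    rw [mul_div_assoc, mul_div_assoc] at h0
    linarith
  -- both points have the same image under `x ↦ x / (1 - ‖x‖)`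
  have e1 : ∀ i, coords z i * (1 - ‖coords z'‖) = coords z' i * (1 - ‖coords z‖) := fun i => by
    have h2 := (h1 i).trans (h1' i).symm
    have e0' := e0
    rw [div_eq_div_iff N.ne' N'.ne'] at h2 e0'
    refine mul_left_cancel₀ (mul_pos p' N).ne' ?_
    linear_combination (1 - ‖coords z‖) / 2 * h2 - coords z i * e0'
  have e2 : ‖coords z‖ * (1 - ‖coords z'‖) = ‖coords z'‖ * (1 - ‖coords z‖) := by
    have : (1 - ‖coords z'‖) • coords z = (1 - ‖coords z‖) • coords z' := funext fun i => by
      simp only [Pi.smul_apply, smul_eq_mul]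
      linarith [e1 i]
    have h3 := congr_arg norm this
    rw [norm_smul, norm_smul, Real.norm_of_nonneg p.le, Real.norm_of_nonneg p'.le] at h3
    linarith
  have e3 : ‖coords z‖ = ‖coords z'‖ := by linarith
  funext i
  have e4 := e1 i
  rw [e3] at e4
  have e5 := mul_right_cancel₀ p'.ne' e4
  unfold coords at e5
  exact Subtype.ext (by linarith)

theorem exists_cubeToSphere_eq {m : ℕ} (w : (sphere m).space) (hw : w ≠ (sphere m).pt) :
    ∃ z, cubeToSphere m z = w := by
  have hn : w.1 0 ^ 2 + ∑ i : Fin m, w.1 i.succ ^ 2 = 1 := by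
    have := mem_sphere_zero_iff_norm.1 w.2
    rw [EuclideanSpace.norm_eq, Real.sqrt_eq_one, Fin.sum_univ_succ] at this
    simpa only [Real.norm_eq_abs, sq_abs] using this
  have hlt : w.1 0 < 1 := by
    have hs : 0 ≤ ∑ i : Fin m, w.1 i.succ ^ 2 := Finset.sum_nonneg fun i _ => sq_nonneg _
    refine lt_of_le_of_ne (by nlinarith) fun e => hw ?_
    rw [e] at hn
    have hz : ∀ i : Fin m, w.1 i.succ = 0 := fun i => by
      have := (Finset.sum_eq_zero_iff_of_nonneg fun i _ => sq_nonneg _).1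
        (by linarith : ∑ i : Fin m, w.1 i.succ ^ 2 = 0) i (Finset.mem_univ i)
      exact pow_eq_zero_iff two_ne_zero |>.1 this
    refine Subtype.ext (PiLp.ext fun i => ?_)
    induction i using Fin.cases with
    | zero => exact e.trans (by simp [sphere])
    | succ i => exact (hz i).trans (by simp [sphere])
  -- the stereographic projection of `w`
  let y : Fin m → ℝ := fun i => w.1 i.succ / (1 - w.1 0)
  have hd : 0 < 1 + ‖y‖ := by positivity
  let z : Fin m → unitInterval := fun i => ⟨(y i / (1 + ‖y‖) + 1) / 2, by
    have h1 := abs_le.1 (norm_le_pi_norm y i)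
    have h2 : y i / (1 + ‖y‖) ≤ 1 := (div_le_one hd).2 (by linarith)
    have h3 : -1 ≤ y i / (1 + ‖y‖) := by rw [le_div_iff₀ hd]; linarith
    constructor <;> linarith⟩
  have hz : coords z = (1 + ‖y‖)⁻¹ • y := funext fun i => by
    change 2 * ((y i / (1 + ‖y‖) + 1) / 2) - 1 = (1 + ‖y‖)⁻¹ * y i
    ring
  have hs : 1 - ‖coords z‖ = (1 + ‖y‖)⁻¹ := by
    rw [hz, norm_smul, Real.norm_of_nonneg (inv_nonneg.2 hd.le)]
    field_simp
    ring
  have hy : ∑ i, y i ^ 2 = (1 + w.1 0) / (1 - w.1 0) := by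
    have h1 : (1 - w.1 0) ≠ 0 := by linarith
    have : ∑ i, y i ^ 2 = (∑ i : Fin m, w.1 i.succ ^ 2) / (1 - w.1 0) ^ 2 := by
      rw [Finset.sum_div]
      exact Finset.sum_congr rfl fun i _ => div_pow _ _ _
    rw [this, eq_sub_of_add_eq' hn]
    field_simp
    ring
  have hq : sqSum z = (1 + ‖y‖)⁻¹ ^ 2 * (2 / (1 - w.1 0)) := by
    have h1 : (1 - w.1 0) ≠ 0 := by linarith
    have : ∑ i, coords z i ^ 2 = (1 + ‖y‖)⁻¹ ^ 2 * ∑ i, y i ^ 2 := by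
      rw [hz, Finset.mul_sum]
      exact Finset.sum_congr rfl fun i _ => by
        change ((1 + ‖y‖)⁻¹ * y i) ^ 2 = _
        ring
    rw [sqSum, this, hs, hy]
    field_simp
    ring
  refine ⟨z, (cubeToSphere_eq_iff z w).2 ⟨?_, fun i => ?_⟩⟩
  · have h1 : (1 - w.1 0) ≠ 0 := by linarith
    rw [hs, hq]
    field_simp
    ring
  · have h1 : (1 - w.1 0) ≠ 0 := by linarith
    have : coords z i = (1 + ‖y‖)⁻¹ * (w.1 i.succ / (1 - w.1 0)) := congr_fun hz i
    rw [hs, hq, this]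
    field_simp

/-- The cube modulo its boundary is homeomorphic to the sphere. -/
theorem exists_homeomorph_cube_sphere (m : ℕ) :
    ∃ e : (cube m).space ≃ₜ (sphere m).space, e (cube m).pt = (sphere m).pt := by
  let S : Set (Fin m → unitInterval) := fat {0, 1} (Fin m)
  let f : (cube m).space → (sphere m).space :=
    Quot.lift (Sum.elim (cubeToSphere m) fun _ => (sphere m).pt) (by
      rintro _ _ ⟨z, hz, rfl, rfl⟩
      exact (cubeToSphere_eq_pt_iff z).2 hz)
  have hf : Continuous f := continuous_collapse_iff.2 (cubeToSphere m).continuous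
  have hpt : ∀ z, cubeToSphere m z = (sphere m).pt → collapseProj S z = (cube m).pt := fun z h =>
    collapseProj_eq_pt_iff.2 ((cubeToSphere_eq_pt_iff z).1 h)
  have hinj : Function.Injective f := by
    refine collapse_cases (fun z => collapse_cases (fun z' h => ?_) fun h => hpt z h)
      (collapse_cases (fun z h => (hpt z h.symm).symm) fun _ => rfl)
    change cubeToSphere m z = cubeToSphere m z' at h
    by_cases hz : cubeToSphere m z = (sphere m).pt
    · exact (hpt z hz).trans (hpt z' (h ▸ hz)).symm
    · exact congr_arg _ (cubeToSphere_injOn m (fun h' => hz ((cubeToSphere_eq_pt_iff z).2 h'))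
        (fun h' => hz (h.trans ((cubeToSphere_eq_pt_iff z').2 h'))) h)
  have hsurj : Function.Surjective f := fun w => by
    by_cases hw : w = (sphere m).pt
    · exact ⟨(cube m).pt, hw.symm⟩
    · obtain ⟨z, rfl⟩ := exists_cubeToSphere_eq w hw
      exact ⟨collapseProj S z, rfl⟩
  have : CompactSpace (cube m).space :=
    inferInstanceAs (CompactSpace (Quot (collapseRel S)))
  have : T2Space (sphere m).space :=
    inferInstanceAs (T2Space (Metric.sphere (0 : EuclideanSpace ℝ (Fin (m + 1))) 1))
  exact ⟨Continuous.homeoOfEquivCompactToT2 (f := Equiv.ofBijective f ⟨hinj, hsurj⟩) hf, rfl⟩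

theorem goodPair_sphere_and_isFormal (m : ℕ) :
    GoodPair (sphere m).space {(sphere m).pt} ∧ SPair.IsFormal (singPt.obj (sphere m)) := by
  obtain ⟨e, he⟩ := exists_homeomorph_cube_sphere m
  have h : ∀ z, e z ∈ ({(sphere m).pt} : Set (sphere m).space) ↔ z ∈ ({(cube m).pt} : Set _) :=
    fun z => by rw [Set.mem_singleton_iff, Set.mem_singleton_iff, ← he, e.injective.eq_iff]
  refine ⟨(goodPair_cube m).of_homeomorph e h, ?_⟩
  exact (weakEquiv_singMap_of_homeomorph (TopCat.ofHom (e : C((cube m).space, (sphere m).space)))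
    e.isHomeomorph h (Subordinate.singleton fun z hz => (h z).2 hz)).isFormal_iff.1 (isFormal_cube m)

end PtdTop

end

theorem mainTheorem12 :
    (∀ X Y : PtdTop.{u}, X.WellPointed → Y.WellPointed →
      RightOmegaModule.Formal X.smashChains → RightOmegaModule.Formal Y.smashChains →
        RightOmegaModule.Formal (PtdTop.wedge X Y).smashChains) ∧
    (∀ (r : ℕ) (m : Fin r → ℕ), 1 ≤ r → (∀ i, 1 ≤ m i) →
      RightOmegaModule.Formal (PtdTop.bigWedge fun i => PtdTop.sphere (m i)).smashChains) := by
  refine ⟨fun X Y => PtdTop.formal_wedge, fun r m hr _ => ?_⟩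
  obtain ⟨r, rfl⟩ := Nat.exists_eq_add_of_le' hr
  exact PtdTop.formal_bigWedge _ (fun i => (PtdTop.goodPair_sphere_and_isFormal (m i)).1)
    fun i => (PtdTop.goodPair_sphere_and_isFormal (m i)).2
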